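/- Let $G,K:\mathbb R^n\to\mathbb R^n$ be $C^\infty$ vector fields and, for $\varepsilon>0$, let $F^\varepsilon=\frac1\varepsilon G+K$. Assume **(H)**: $G$ generates a flow $\Phi_\tau$ that is defined for all $\tau\in\mathbb R$ on all of $\mathbb R^n$ and is $2\pi$-periodic in $\tau$, regardless of the trajectory. Lie brackets are $[X,Y]=(\partial_yY)X-(\partial_yX)Y$. Series in $\varepsilon$ are formal power series with $C^\infty$ coefficients, and identities between them are understood coefficientwise. A *normal form splitting* of $F^\varepsilon$ is a pair of formal vector fields $G^\varepsilon=\sum_{r\ge0}\varepsilon^rG_r$ and $K^\varepsilon=\sum_{r\ge1}\varepsilon^{r-1}K^{[r]}$ such that $F^\varepsilon=\frac1\varepsilon G^\varepsilon+K^\varepsilon$, $[G^\varepsilon,K^\varepsilon]=0$, and the formal flow of $G^\varepsilon$ (the formal series $\Phi^\varepsilon_\tau$ with $\partial_\tau\Phi^\varepsilon_\tau=G^\varepsilon\circ\Phi^\varepsilon_\tau$, $\Phi^\varepsilon_0=\mathrm{id}$) is $2\pi$-periodic in $\tau$. There is exactly one such splitting, and it has the following properties. **(a) Transport equation.** Assume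 that the flow of $K^{[1]}$ is defined for all times on all of $\mathbb R^n$, and let $f_0:\mathbb R^n\to\mathbb R$ be $C^\infty$. Whenever $\varepsilon>0$ is such that the flow of $F^\varepsilon$ is defined for all times on all of $\mathbb R^n$, the equation $$\partial_tf+F^\varepsilon\cdot\nabla_yf=0,\qquad f(0,\cdot)=f_0,$$ has a unique $C^1$ solution $f$ on $\mathbb R\times\mathbb R^n$. The system $$\partial_\tau\tilde f+G^\varepsilon\cdot\nabla_y\tilde f=0,\qquad \partial_t\tilde f+K^\varepsilon\cdot\nabla_y\tilde f=0,\qquad \tilde f(0,0,\cdot)=f_0$$ has, among formal series with coefficients that are $C^1$ on $\mathbb R\times\mathbb R\times\mathbb R^n$, a unique solution $\tilde f(t,\tau,y)=\sum_{r\ge0}\varepsilon^r\tilde f_r(t,\tau,y)$. Its coefficients are $C^\infty$ and $2\pi$-periodic in $\tau$. The solution of the transport equation is the diagonal value $\tau=t/\varepsilon$ of $\tilde f$, in the following two senses. First, $\tilde f(t,t/\varepsilon,y)$ satisfies the transport equation and the initial condition formally, i.e. $\partial_t\tilde f+\frac1\varepsilon\partial_\tau\tilde f+F^\varepsilon\cdot\nabla_y\tilde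 f=0$. Second, if $f^\varepsilon$ is a $C^1$ solution on $\mathbb R\times\mathbb R^n$ of the transport equation with $f^\varepsilon(0,\cdot)=f_0$ for all sufficiently small $\varepsilon>0$, then for all $N\in\mathbb N$, $T\in\mathbb R$ and all compact $C\subset\mathbb R^n$ there is a constant $M$ such that, for all sufficiently small $\varepsilon>0$, $$\Big|f^\varepsilon(t,y)-\sum_{r=0}^N\varepsilon^r\tilde f_r(t,t/\varepsilon,y)\Big|\le M\varepsilon^{N+1}\qquad\text{for all } |t|\le T,\ y\in C.$$ **(b) Expansions.** Let $K_\tau(y)=(\partial_y\Phi_\tau(y))^{-1}K(\Phi_\tau(y))=\sum_{k\in\mathbb Z}e^{ik\tau}\hat K_k(y)$ (Fourier series in $\tau$). Then for all $r\ge1$, with (pointwise) convergence of the unordered sum, $$K^{[r]}=\frac1r\sum_{(i_1,\dots,i_r)\in\mathbb Z^r}\bar\beta_{i_1\cdots i_r}\,[\cdots[[\hat K_{i_1},\hat K_{i_2}],\hat K_{i_3}],\cdots,\hat K_{i_r}],\qquad G^\varepsilon=\varepsilon(F^\varepsilon-K^\varepsilon)=G+\varepsilon(K-K^\varepsilon),$$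 where the universal coefficients $\bar\beta$ are given recursively, for $j\in\mathbb Z\setminus\{0\}$, $r,s\ge1$ and $l_1,\dots,l_s\in\mathbb Z$, by $$\bar\beta_0=1,\quad \bar\beta_j=0,\quad \bar\beta_{0^{r+1}}=0,\quad \bar\beta_{0^rj}=\tfrac ij(\bar\beta_{0^{r-1}j}-\bar\beta_{0^r}),$$ $$\bar\beta_{jl_1\cdots l_s}=\tfrac ij(\bar\beta_{l_1\cdots l_s}-\bar\beta_{(j+l_1)l_2\cdots l_s}),\quad \bar\beta_{0^rjl_1\cdots l_s}=\tfrac ij(\bar\beta_{0^{r-1}jl_1\cdots l_s}-\bar\beta_{0^r(j+l_1)l_2\cdots l_s}).$$ **(c) Geometric properties.** If $G$ and $K$ are divergence-free, then so are all coefficients of $G^\varepsilon$ and $K^\varepsilon$. Let $J$ be an invertible skew-symmetric real $n\times n$ matrix, and suppose $G=J^{-1}\nabla H_G$ and $K=J^{-1}\nabla H_K$ with $C^\infty$ functions $H_G,H_K$. Then there are $C^\infty$ functions $H^{[r]}$, $r\ge1$, with $K^{[r]}=J^{-1}\nabla H^{[r]}$; they are given by the formula in (b) with $\hat K_k$ replaced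 by the Fourier coefficients $\hat H_k$ of $\tau\mapsto H_K(\Phi_\tau(y))$ and the Lie brackets by the Poisson brackets $\{A,B\}=-(\nabla A)^TJ^{-1}\nabla B$ (for which $J^{-1}\nabla\{A,B\}=[J^{-1}\nabla A,J^{-1}\nabla B]$). Moreover $G^\varepsilon=J^{-1}\nabla H_{G^\varepsilon}$ with $H_{G^\varepsilon}=H_G+\varepsilon\big(H_K-\sum_{r\ge1}\varepsilon^{r-1}H^{[r]}\big)$. -/

import Mathlib

open Filter Topology
open scoped ContDiff

/-- The phase space `ℝⁿ` with its Euclidean structure. -/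
abbrev Phase (n : ℕ) : Type := EuclideanSpace ℝ (Fin n)

/-! ### Flows -/

/-- `Φ` is the flow `(τ, y) ↦ Φ_τ(y)` of the vector field `G`; it is defined for all times and
`2π`-periodic, with the same period for all trajectories. -/
structure IsPeriodicFlow {n : ℕ} (G : Phase n → Phase n) (Φ : ℝ → Phase n → Phase n) : Prop where
  init : ∀ y, Φ 0 y = y
  ode : ∀ τ y, HasDerivAt (fun s => Φ s y) (G (Φ τ y)) τ
  periodic : ∀ τ y, Φ (τ + 2 * Real.pi) y = Φ τ y

/-- The flow of the vector field `F` is defined for all times and all initial values. -/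
def HasGlobalFlow {n : ℕ} (F : Phase n → Phase n) : Prop :=
  ∀ y, ∃ γ : ℝ → Phase n, γ 0 = y ∧ ∀ t, HasDerivAt γ (F (γ t)) t

/-! ### Formal series in `ε`

A formal series `∑ r, ε ^ r • X r` of vector fields is the sequence `X : ℕ → Phase n → Phase n` of
its coefficients, and similarly for formal series of functions. -/

/-- The coefficient of `ε ^ r` in the formal composition `X^ε (u^ε)` of the formal series of vector
fields `X^ε = ∑ s, ε ^ s • X s` with the formal series of points `u^ε = ∑ j, ε ^ j • u j`: only the
terms up to order `r` matter, and the coefficient is the Taylor coefficient at `ε = 0`. -/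
noncomputable def formalComp {n : ℕ} (X : ℕ → Phase n → Phase n) (u : ℕ → Phase n) (r : ℕ) :
    Phase n :=
  ((r.factorial : ℝ)⁻¹) • iteratedDeriv r
    (fun ε : ℝ => ∑ s ∈ Finset.range (r + 1),
      ε ^ s • X s (∑ j ∈ Finset.range (r + 1), ε ^ j • u j)) 0

/-- The formal series of maps `Φ^ε_τ = ∑ r, ε ^ r • Φ r τ` is the flow of the formal vector field
`X^ε = ∑ r, ε ^ r • X r`, that is `∂_τ Φ^ε_τ = X^ε (Φ^ε_τ)` and `Φ^ε_0 = id`, and it is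
`2π`-periodic. -/
structure IsFormalPeriodicFlow {n : ℕ} (X : ℕ → Phase n → Phase n)
    (Φ : ℕ → ℝ → Phase n → Phase n) : Prop where
  init_zero : ∀ y, Φ 0 0 y = y
  init_succ : ∀ r y, Φ (r + 1) 0 y = 0
  ode : ∀ r τ y, HasDerivAt (fun s => Φ r s y) (formalComp X (fun j => Φ j τ y) r) τ
  periodic : ∀ r τ y, Φ r (τ + 2 * Real.pi) y = Φ r τ y

/-- `G^ε = ∑ r, ε ^ r • Gs r` and `K^ε = ∑ r, ε ^ r • Ks r`, formal series of smooth vector fields,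
are a normal form splitting of `F^ε = (1/ε) G + K`: `F^ε = (1/ε) G^ε + K^ε`, the Lie bracket
`[G^ε, K^ε]` vanishes, and `G^ε` generates a `2π`-periodic flow. -/
structure IsNormalFormSplitting {n : ℕ} (G K : Phase n → Phase n)
    (Gs Ks : ℕ → Phase n → Phase n) : Prop where
  smooth_G : ∀ r, ContDiff ℝ ∞ (Gs r)
  smooth_K : ∀ r, ContDiff ℝ ∞ (Ks r)
  split_neg : Gs 0 = G
  split_zero : Gs 1 + Ks 0 = K
  split_pos : ∀ r, Gs (r + 2) + Ks (r + 1) = 0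
  commute : ∀ r y, ∑ p ∈ Finset.HasAntidiagonal.antidiagonal r, VectorField.lieBracket ℝ (Gs p.1) (Ks p.2) y = 0
  periodic : ∃ Φ : ℕ → ℝ → Phase n → Phase n, IsFormalPeriodicFlow Gs Φ

/-! ### The coefficients of the averaged vector field -/

/-- `betaBarAux r w` is the coefficient `β̄` of the word `0 ⋯ 0 w` that starts with `r` zeros
followed by the letters of `w`. -/
noncomputable def betaBarAux : ℕ → List ℤ → ℂ
  | r, [] => if r = 1 then 1 else 0
  | r, j :: l =>
    if j = 0 then betaBarAux (r + 1) l
    else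
      match r, l with
      | 0, [] => 0
      | r + 1, [] => Complex.I / (j : ℂ) * (betaBarAux r [j] - betaBarAux (r + 1) [])
      | 0, l₁ :: l => Complex.I / (j : ℂ) * (betaBarAux 0 (l₁ :: l) - betaBarAux 0 ((j + l₁) :: l))
      | r + 1, l₁ :: l =>
        Complex.I / (j : ℂ) * (betaBarAux r (j :: l₁ :: l) - betaBarAux (r + 1) ((j + l₁) :: l))
  termination_by r w => r + 2 * w.length

/-- The universal coefficients `β̄_{i₁ ⋯ i_r}` of the averaged vector field; the facts below are
their recursive definition. -/
noncomputable def betaBar (w : List ℤ) : ℂ := betaBarAux 0 w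

theorem betaBarAux_replicate (r s : ℕ) (w : List ℤ) :
    betaBarAux s (List.replicate r 0 ++ w) = betaBarAux (s + r) w := by
  induction r generalizing s with
  | zero => simp
  | succ r ih =>
    rw [List.replicate_succ, List.cons_append, betaBarAux.eq_def]
    simp only [if_true, ih]
    congr 1
    omega

theorem betaBar_replicate_append (r : ℕ) (w : List ℤ) :
    betaBar (List.replicate r 0 ++ w) = betaBarAux r w := by
  rw [betaBar, betaBarAux_replicate, Nat.zero_add]

theorem betaBar_zero : betaBar [0] = 1 := by
  simp [betaBar, betaBarAux]

theorem betaBar_single (j : ℤ) (hj : j ≠ 0) : betaBar [j] = 0 := by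
  simp [betaBar, betaBarAux, hj]

theorem betaBar_zeros (r : ℕ) (hr : 1 ≤ r) : betaBar (List.replicate (r + 1) 0) = 0 := by
  have h := betaBar_replicate_append (r + 1) []
  rw [List.append_nil] at h
  rw [h, betaBarAux, if_neg (by omega)]

theorem betaBar_zeros_single (r : ℕ) (hr : 1 ≤ r) (j : ℤ) (hj : j ≠ 0) :
    betaBar (List.replicate r 0 ++ [j]) = Complex.I / (j : ℂ) *
      (betaBar (List.replicate (r - 1) 0 ++ [j]) - betaBar (List.replicate r 0)) := by
  obtain ⟨r, rfl⟩ : ∃ k, r = k + 1 := ⟨r - 1, by omega⟩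
  have h := betaBar_replicate_append (r + 1) []
  rw [List.append_nil] at h
  rw [h, betaBar_replicate_append, betaBar_replicate_append, betaBarAux.eq_def (r + 1) [j]]
  simp [hj]

theorem betaBar_cons (j : ℤ) (hj : j ≠ 0) (l₁ : ℤ) (l : List ℤ) :
    betaBar (j :: l₁ :: l) = Complex.I / (j : ℂ) *
      (betaBar (l₁ :: l) - betaBar ((j + l₁) :: l)) := by
  rw [betaBar, betaBarAux.eq_def]
  simp [hj, betaBar]

theorem betaBar_zeros_cons (r : ℕ) (hr : 1 ≤ r) (j : ℤ) (hj : j ≠ 0) (l₁ : ℤ) (l : List ℤ) :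
    betaBar (List.replicate r 0 ++ j :: l₁ :: l) = Complex.I / (j : ℂ) *
      (betaBar (List.replicate (r - 1) 0 ++ j :: l₁ :: l)
        - betaBar (List.replicate r 0 ++ (j + l₁) :: l)) := by
  obtain ⟨r, rfl⟩ : ∃ k, r = k + 1 := ⟨r - 1, by omega⟩
  rw [betaBar_replicate_append, betaBar_replicate_append, betaBar_replicate_append,
    betaBarAux.eq_def (r + 1) (j :: l₁ :: l)]
  simp [hj]

/-! ### Fourier coefficients and brackets -/

/-- The `k`-th Fourier coefficient `(1/2π) ∫₀^{2π} e^{-ikτ} g(τ) dτ` of a `2π`-periodic real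
function. -/
noncomputable def fourierCoef (g : ℝ → ℝ) (k : ℤ) : ℂ :=
  (1 / (2 * Real.pi) : ℂ) *
    ∫ τ in (0 : ℝ)..(2 * Real.pi), Complex.exp (-(Complex.I * k * τ)) * (g τ : ℂ)

/-- Partial derivative `∂_{y_j}` of a complex-valued function on `ℝⁿ`. -/
noncomputable def partialDeriv {n : ℕ} (j : Fin n) (g : Phase n → ℂ) (y : Phase n) : ℂ :=
  fderiv ℝ g y (EuclideanSpace.single j 1)

/-- The Fourier coefficient `K̂_k` of `τ ↦ K_τ(y) = (∂_y Φ_τ(y))⁻¹ K(Φ_τ(y))`, a complex vector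
field. -/
noncomputable def fieldCoef {n : ℕ} (Φ : ℝ → Phase n → Phase n) (K : Phase n → Phase n) (k : ℤ) :
    Phase n → Fin n → ℂ :=
  fun y i => fourierCoef (fun τ => VectorField.pullback ℝ (Φ τ) K y i) k

/-- The Lie bracket `[X, Y] = (∂_y Y) X - (∂_y X) Y` of complex vector fields on `ℝⁿ`. -/
noncomputable def complexBracket {n : ℕ} (X Y : Phase n → Fin n → ℂ) : Phase n → Fin n → ℂ :=
  fun y i => ∑ j, (partialDeriv j (fun z => Y z i) y * X y j
    - partialDeriv j (fun z => X z i) y * Y y j)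

/-- The Fourier coefficient `Ĥ_k` of `τ ↦ H_τ(y) = H(Φ_τ(y))`. -/
noncomputable def hamiltonianCoef {n : ℕ} (Φ : ℝ → Phase n → Phase n) (H : Phase n → ℝ) (k : ℤ) :
    Phase n → ℂ :=
  fun y => fourierCoef (fun τ => H (Φ τ y)) k

/-- The Poisson bracket `{A, B} = -(∇A)ᵀ J⁻¹ ∇B`, normalized so that
`J⁻¹ ∇{A, B} = [J⁻¹ ∇A, J⁻¹ ∇B]`. -/
noncomputable def poissonBracket {n : ℕ} (J : Matrix (Fin n) (Fin n) ℝ) (A B : Phase n → ℂ) :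
    Phase n → ℂ :=
  fun y => -∑ i, ∑ j, partialDeriv i A y * ((J⁻¹ i j : ℝ) : ℂ) * partialDeriv j B y

/-- The left-nested bracket `[⋯[[X_{i₁}, X_{i₂}], X_{i₃}], ⋯, X_{i_r}]` of the word `i₁ ⋯ i_r`. -/
def nestedBracket {V : Type*} [Zero V] (br : V → V → V) (X : ℤ → V) : List ℤ → V
  | [] => 0
  | i :: l => l.foldl (fun A j => br A (X j)) (X i)

/-- The coefficients of `G + ε (K - K^ε)`, which is `ε (F^ε - K^ε)` for `F^ε = (1/ε) G + K`. -/
def companionSeries {V : Type*} [AddGroup V] (G K : V) (Ks : ℕ → V) : ℕ → V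
  | 0 => G
  | 1 => K - Ks 0
  | r + 2 => -Ks (r + 1)

/-! ### Geometric properties -/

/-- The vector field `F` is divergence-free. -/
def IsDivergenceFree {n : ℕ} (F : Phase n → Phase n) : Prop :=
  ∀ y, ∑ i, fderiv ℝ F y (EuclideanSpace.single i 1) i = 0

/-- The Hamiltonian vector field `J⁻¹ ∇H`. -/
noncomputable def hamiltonianField {n : ℕ} (J : Matrix (Fin n) (Fin n) ℝ) (H : Phase n → ℝ) :
    Phase n → Phase n :=
  fun y => Matrix.toEuclideanLin J⁻¹ (gradient H y)

/-! ### Transport equations -/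

/-- `f` is a classical solution of `∂_t f + F · ∇_y f = 0`, `f(0, ·) = f₀`. -/
structure IsTransportSolution {n : ℕ} (F : Phase n → Phase n) (f₀ : Phase n → ℝ)
    (f : ℝ → Phase n → ℝ) : Prop where
  contDiff : ContDiff ℝ 1 (fun p : ℝ × Phase n => f p.1 p.2)
  eq : ∀ t y, deriv (fun s => f s y) t + fderiv ℝ (f t) y (F y) = 0
  init : ∀ y, f 0 y = f₀ y

/-- The formal series `f̃ = ∑ r, ε ^ r * ft r t τ y` of `C¹` functions solves
`∂_τ f̃ + G^ε · ∇_y f̃ = 0`, `∂_t f̃ + K^ε · ∇_y f̃ = 0`, `f̃(0, 0, ·) = f₀`. -/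
structure IsTwoScaleSolution {n : ℕ} (Gs Ks : ℕ → Phase n → Phase n) (f₀ : Phase n → ℝ)
    (ft : ℕ → ℝ → ℝ → Phase n → ℝ) : Prop where
  contDiff : ∀ r, ContDiff ℝ 1 (fun p : ℝ × ℝ × Phase n => ft r p.1 p.2.1 p.2.2)
  eq_tau : ∀ r t τ y, deriv (fun s => ft r t s y) τ
    + ∑ p ∈ Finset.HasAntidiagonal.antidiagonal r, fderiv ℝ (ft p.2 t τ) y (Gs p.1 y) = 0
  eq_t : ∀ r t τ y, deriv (fun s => ft r s τ y) t
    + ∑ p ∈ Finset.HasAntidiagonal.antidiagonal r, fderiv ℝ (ft p.2 t τ) y (Ks p.1 y) = 0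
  init_zero : ∀ y, ft 0 0 0 y = f₀ y
  init_succ : ∀ r y, ft (r + 1) 0 0 y = 0

/-- The diagonal `f̃(t, t/ε, y)` of the formal series `f̃ = ∑ r, ε ^ r * ft r t τ y` solves
`∂_t f + ((1/ε) G + K) · ∇_y f = 0`, `f(0, ·) = f₀` as a formal series: the time derivative of the
diagonal is `∂_t f̃ + (1/ε) ∂_τ f̃`, and the coefficients of `ε ^ (-1)` and of `ε ^ r` vanish. -/
structure IsFormalDiagonalSolution {n : ℕ} (G K : Phase n → Phase n) (f₀ : Phase n → ℝ)
    (ft : ℕ → ℝ → ℝ → Phase n → ℝ) : Prop where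
  eq_neg : ∀ t τ y, deriv (fun s => ft 0 t s y) τ + fderiv ℝ (ft 0 t τ) y (G y) = 0
  eq : ∀ r t τ y, deriv (fun s => ft r s τ y) t + deriv (fun s => ft (r + 1) t s y) τ
    + fderiv ℝ (ft (r + 1) t τ) y (G y) + fderiv ℝ (ft r t τ) y (K y) = 0
  init_zero : ∀ y, ft 0 0 0 y = f₀ y
  init_succ : ∀ r y, ft (r + 1) 0 0 y = 0

/-! Put `K_τ = Φ_τ^* K`, a `2π`-periodic family with `∂_τ K_τ = [G, K_τ]` and `K_0 = K`. The
argument is algebra in the Lie algebra of smooth time-dependent vector fields, with formal series in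
`ε`.

A periodic series `L` with `L_0 = 0` generates a near-identity transport: `conj L x` is the series
`Y` with `Y_0 = x` and `ε dY/dε = -[L, Y]`. It respects brackets, and it moves functions by
composition with the transported identity map (`conj_ofSpace`). One looks for `L`, vanishing at `τ =
0`, and a series `B` independent of `τ` such that, with `C = conj L B` and `U = ε K_τ - C`, the
zero-curvature equation `∂_τ L = ε dU/dε + [L, U]` holds. Order by order the mean of the equation
determines `B` and the oscillating remainder determines `L` (`Averaging.exists_isAveraged`). By zero
curvature, the transport `Y` of a series independent of `τ` satisfies `∂_τ Y = -[U, Y]`; in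
particular `∂_τ C = [C, ε K_τ]`.

The derivation `∂_τ - [G, ·]` annihilates `K_τ`, and periodicity forces it to annihilate `C` as well
(`derivation_conjSer`). Comparing the two formulas for `∂_τ C` gives `[G + ε K_τ, C] = 0`, and at `τ
= 0` this reads `[G + ε K, B] = 0`. Hence `K^ε = B / ε` and `G^ε = G + ε K - B` commute. The
transport of `G^ε` is `G + U`, so the formal flow of `G^ε` is `Φ_τ` followed by the transported
identity at time `-τ`; both are periodic. For uniqueness, the first discrepancy `b` of two
candidates for `G^ε` commutes with `G`, and the corresponding flows differ at that order by `τ ·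
DΦ_τ b`, which is periodic only if `b = 0`.

(a) If `u` solves the formal equation `∂_t u + K^ε · ∇u = 0`, then `(conj L u)(t, τ, Φ_{-τ} y)`
solves the two-scale system. Along a trajectory of `F^ε` the derivative of a truncation telescopes
to a single term of top order. Applied to the solution with initial value the identity, this
confines the trajectories to a compact set independent of `ε`; applied to the given data, it yields
the error bound.

(b) The solution of `∂_τ Λ = ε K_τ + [Λ, ε K_τ]`, `Λ(0) = 0`, consists of iterated integrals of
left-nested brackets. It is also polynomial in `τ` with periodic coefficients, and its linear
coefficient at order `r` has the value `r B_r` at `τ = 0` (`exists_secular`). So `B_r` can be read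
off the values at `τ = 2πm` (`averaged_eq_secularCoef`). Inserting the Fourier series of `K_τ`
leaves scalar oscillatory integrals, whose linear coefficients obey the recursion of `β̄` through
integration by parts (`sum_linearWeight_iterOsc`).

(c) Brackets, primitives and evaluations preserve vanishing divergence, and `J⁻¹∇` intertwines them
with their Hamiltonian counterparts. The same iterated integrals therefore yield both geometric
statements. -/

/-! ### Ordinary differential equations -/

section ODE

open Set

variable {E : Type*} [NormedAddCommGroup E] [NormedSpace ℝ E]

/-- `ψ` is the flow of the vector field `F`, defined for all times. -/
structure IsGlobalFlow (F : E → E) (ψ : ℝ → E → E) : Prop where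
  init : ∀ y, ψ 0 y = y
  ode : ∀ t y, HasDerivAt (fun s => ψ s y) (F (ψ t y)) t

theorem exists_lipschitzOnWith_closedBall [ProperSpace E] {F : E → E} (hF : ContDiff ℝ 1 F)
    (R : ℝ) : ∃ K, LipschitzOnWith K F (Metric.closedBall 0 R) := by
  obtain ⟨K, hK⟩ := LocallyLipschitzOn.exists_lipschitzOnWith_of_compact
    (isCompact_closedBall (0 : E) R) (hF.locallyLipschitz.locallyLipschitzOn)
  exact ⟨K, hK⟩

/-- On a compact interval both curves stay in one ball, where a `C¹` field is Lipschitz; no global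
Lipschitz bound is needed. -/
theorem eqOn_of_hasDerivAt_Icc [ProperSpace E] {F : E → E} (hF : ContDiff ℝ 1 F) {a b t₀ : ℝ}
    (ht₀ : t₀ ∈ Ioo a b) {γ₁ γ₂ : ℝ → E} (h₁ : ∀ t ∈ Icc a b, HasDerivAt γ₁ (F (γ₁ t)) t)
    (h₂ : ∀ t ∈ Icc a b, HasDerivAt γ₂ (F (γ₂ t)) t) (h : γ₁ t₀ = γ₂ t₀) :
    EqOn γ₁ γ₂ (Icc a b) := by
  have c₁ : ContinuousOn γ₁ (Icc a b) := fun t ht => (h₁ t ht).continuousAt.continuousWithinAt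
  have c₂ : ContinuousOn γ₂ (Icc a b) := fun t ht => (h₂ t ht).continuousAt.continuousWithinAt
  obtain ⟨R₁, hR₁⟩ := isCompact_Icc.exists_bound_of_continuousOn c₁
  obtain ⟨R₂, hR₂⟩ := isCompact_Icc.exists_bound_of_continuousOn c₂
  obtain ⟨K, hK⟩ := exists_lipschitzOnWith_closedBall hF (max R₁ R₂)
  refine ODE_solution_unique_of_mem_Icc (v := fun _ => F)
    (s := fun _ => Metric.closedBall 0 (max R₁ R₂)) (fun t _ => hK) ht₀ c₁
    (fun t ht => h₁ t (Ioo_subset_Icc_self ht)) (fun t ht => ?_) c₂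
    (fun t ht => h₂ t (Ioo_subset_Icc_self ht)) (fun t ht => ?_) h
  · simpa using Or.inl (hR₁ t (Ioo_subset_Icc_self ht))
  · simpa using Or.inr (hR₂ t (Ioo_subset_Icc_self ht))

theorem eq_of_hasDerivAt [ProperSpace E] {F : E → E} (hF : ContDiff ℝ 1 F) {t₀ : ℝ}
    {γ₁ γ₂ : ℝ → E} (h₁ : ∀ t, HasDerivAt γ₁ (F (γ₁ t)) t)
    (h₂ : ∀ t, HasDerivAt γ₂ (F (γ₂ t)) t) (h : γ₁ t₀ = γ₂ t₀) : γ₁ = γ₂ := by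
  ext t
  refine eqOn_of_hasDerivAt_Icc hF (a := min t t₀ - 1) (b := max t t₀ + 1) (t₀ := t₀)
    ⟨?_, ?_⟩ (fun t _ => h₁ t) (fun t _ => h₂ t) h ⟨?_, ?_⟩
  · linarith [min_le_right t t₀]
  · linarith [le_max_right t t₀]
  · linarith [min_le_left t t₀]
  · linarith [le_max_left t t₀]

/-- Grönwall's inequality forward in time, applied to the curve and to its time reversal. -/
theorem norm_le_gronwallBound_abs {f f' : ℝ → E} {K ε T : ℝ}
    (hf : ∀ t, |t| ≤ T → HasDerivAt f (f' t) t)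
    (hb : ∀ t, |t| ≤ T → ‖f' t‖ ≤ K * ‖f t‖ + ε) {t : ℝ} (ht : |t| ≤ T) :
    ‖f t‖ ≤ gronwallBound ‖f 0‖ K ε |t| := by
  have key : ∀ g g' : ℝ → E, (∀ t, |t| ≤ T → HasDerivAt g (g' t) t) →
      (∀ t, |t| ≤ T → ‖g' t‖ ≤ K * ‖g t‖ + ε) → ∀ t, 0 ≤ t → t ≤ T →
      ‖g t‖ ≤ gronwallBound ‖g 0‖ K ε t := by
    intro g g' hg hb t h0 hT
    have hs : ∀ x ∈ Icc 0 t, |x| ≤ T := fun x hx => by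
      rw [abs_of_nonneg hx.1]; exact hx.2.trans hT
    have := norm_le_gronwallBound_of_norm_deriv_right_le (f := g) (f' := g') (a := 0) (b := t)
      (δ := ‖g 0‖) (K := K) (ε := ε)
      (fun x hx => (hg x (hs x hx)).continuousAt.continuousWithinAt)
      (fun x hx => (hg x (hs x (Ico_subset_Icc_self hx))).hasDerivWithinAt) le_rfl
      (fun x hx => hb x (hs x (Ico_subset_Icc_self hx))) t ⟨h0, le_rfl⟩
    simpa using this
  rcases le_total 0 t with h | h
  · rw [abs_of_nonneg h] at ht ⊢
    exact key f f' hf hb t h ht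
  · rw [abs_of_nonpos h] at ht ⊢
    have := key (fun s => f (-s)) (fun s => -f' (-s)) (fun s hs => ?_) (fun s hs => ?_) (-t)
      (by linarith) ht
    · simpa using this
    · simpa [Function.comp_def] using
        (hf (-s) (by simpa using hs)).scomp s (hasDerivAt_neg s)
    · simpa using hb (-s) (by simpa using hs)

/-- For a bounded field the Picard–Lindelöf theorem applies on every interval `[-T, T]`; by
uniqueness the solutions on different intervals glue. -/
theorem exists_solution_of_lipschitzWith [CompleteSpace E] {F : E → E} {K : NNReal}
    (hF : LipschitzWith K F) {M : NNReal} (hM : ∀ y, ‖F y‖ ≤ M) (y : E) :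
    ∃ γ : ℝ → E, γ 0 = y ∧ ∀ t, HasDerivAt γ (F (γ t)) t := by
  have step : ∀ T : NNReal, ∃ α : ℝ → E, α 0 = y ∧
      ∀ t ∈ Ioo (-T : ℝ) T, HasDerivAt α (F (α t)) t := by
    intro T
    have h0 : (0 : ℝ) ∈ Icc (-T : ℝ) T := by constructor <;> simp
    have hp : IsPicardLindelof (fun _ => F) (⟨0, h0⟩ : Icc (-T : ℝ) T) y (M * T) 0 M K :=
      ⟨fun _ _ => hF.lipschitzOnWith, fun _ _ => continuousOn_const, fun _ _ x _ => hM x, by simp⟩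
    obtain ⟨α, hα, hα'⟩ := hp.exists_eq_forall_mem_Icc_hasDerivWithinAt₀
    exact ⟨α, hα, fun t ht => (hα' t (Ioo_subset_Icc_self ht)).hasDerivAt (Icc_mem_nhds ht.1 ht.2)⟩
  choose α hα0 hα using step
  have uniq : ∀ S T : NNReal, 0 < S → S ≤ T → EqOn (α S) (α T) (Ioo (-S : ℝ) S) := by
    intro S T hS hST
    have hST' : (S : ℝ) ≤ T := by exact_mod_cast hST
    refine ODE_solution_unique_of_mem_Ioo (v := fun _ => F) (s := fun _ => univ) (t₀ := 0)
      (fun t _ => hF.lipschitzOnWith) ⟨by simpa using hS, by simpa using hS⟩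
      (fun t ht => ⟨hα S t ht, trivial⟩)
      (fun t ht => ⟨hα T t ⟨by linarith [ht.1], by linarith [ht.2]⟩, trivial⟩) (by rw [hα0, hα0])
  -- The value at `t` is taken from the solution on a slightly larger interval; near `t` all these
  -- choices agree with the single solution on `|s| < |t| + 2`.
  refine ⟨fun t => α (Real.nnabs t + 1) t, hα0 _, fun t => ?_⟩
  set T : NNReal := Real.nnabs t + 2 with hT
  have hTt : (T : ℝ) = |t| + 2 := by simp [hT]
  have hev : (fun s => α (Real.nnabs s + 1) s) =ᶠ[𝓝 t] α T := by
    have : ∀ᶠ s in 𝓝 t, |s| < |t| + 1 :=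
      continuous_abs.continuousAt.eventually (gt_mem_nhds (by simp))
    filter_upwards [this] with s hs
    refine uniq _ T (by positivity) ?_ ?_
    · rw [← NNReal.coe_le_coe, hTt]
      simp only [NNReal.coe_add, Real.coe_nnabs, NNReal.coe_one]
      linarith
    · simp only [NNReal.coe_add, Real.coe_nnabs, NNReal.coe_one, mem_Ioo]
      rw [← abs_lt]; linarith
  have h1 := hα T t (by rw [mem_Ioo, ← abs_lt, hTt]; linarith)
  have h2 := h1.congr_of_eventuallyEq hev
  rwa [← hev.self_of_nhds] at h2

theorem exists_isGlobalFlow_of_lipschitzWith [CompleteSpace E] {F : E → E} {K : NNReal}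
    (hF : LipschitzWith K F) {M : NNReal} (hM : ∀ y, ‖F y‖ ≤ M) : ∃ ψ, IsGlobalFlow F ψ := by
  choose ψ h0 h using exists_solution_of_lipschitzWith hF hM
  exact ⟨fun t y => ψ y t, ⟨h0, fun t y => h y t⟩⟩

theorem exists_bound_of_hasCompactSupport {X G : Type*} [TopologicalSpace X]
    [NormedAddCommGroup G] {F : X → G} (hF : Continuous F) (hs : HasCompactSupport F) : ∃ M : NNReal, ∀ y, ‖F y‖ ≤ M := by
  obtain ⟨M, hM⟩ := hs.exists_bound_of_continuous hF
  exact ⟨⟨max M 0, le_max_right _ _⟩, fun y => (hM y).trans (le_max_left _ _)⟩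

theorem exists_isGlobalFlow_of_hasCompactSupport [CompleteSpace E] {F : E → E}
    (hF : ContDiff ℝ ∞ F) (hs : HasCompactSupport F) : ∃ ψ, IsGlobalFlow F ψ := by
  obtain ⟨K, hK⟩ := hF.lipschitzWith_of_hasCompactSupport hs (by simp)
  obtain ⟨M, hM⟩ := exists_bound_of_hasCompactSupport hF.continuous hs
  exact exists_isGlobalFlow_of_lipschitzWith hK hM

theorem exists_contDiff_hasCompactSupport_eqOn [FiniteDimensional ℝ E] {F : E → E}
    (hF : ContDiff ℝ ∞ F) {R : ℝ} (hR : 0 < R) : ∃ F' : E → E, ContDiff ℝ ∞ F' ∧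
      HasCompactSupport F' ∧ EqOn F' F (Metric.closedBall 0 R) := by
  let χ : ContDiffBump (0 : E) := ⟨R, R + 1, hR, by linarith⟩
  refine ⟨fun y => χ y • F y, χ.contDiff.smul hF, χ.hasCompactSupport.smul_right, fun y hy => ?_⟩
  simp only
  rw [χ.one_of_mem_closedBall hy, one_smul]

theorem IsGlobalFlow.norm_sub_le {F : E → E} {ψ : ℝ → E → E} (h : IsGlobalFlow F ψ) {K : NNReal}
    (hF : LipschitzWith K F) (t : ℝ) (y y' : E) :
    ‖ψ t y - ψ t y'‖ ≤ ‖y - y'‖ * Real.exp (K * |t|) := by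
  have := norm_le_gronwallBound_abs (f := fun t => ψ t y - ψ t y')
    (f' := fun t => F (ψ t y) - F (ψ t y')) (K := K) (ε := 0) (T := |t|)
    (fun t _ => (h.ode t y).sub (h.ode t y'))
    (fun t _ => by simpa using hF.norm_sub_le (ψ t y) (ψ t y')) le_rfl
  simpa [gronwallBound_ε0, h.init] using this

/-- For small initial perturbations, a global flow agrees on a compact time interval with the flow
of a compactly supported vector field. -/
theorem IsGlobalFlow.exists_hasCompactSupport [FiniteDimensional ℝ E] {F : E → E} {ψ : ℝ → E → E}
    (h : IsGlobalFlow F ψ) (hF : ContDiff ℝ ∞ F) (T : ℝ) (y₀ : E) :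
    ∃ (F' : E → E) (ψ' : ℝ → E → E) (δ : ℝ), ContDiff ℝ ∞ F' ∧ HasCompactSupport F' ∧
      IsGlobalFlow F' ψ' ∧ 0 < δ ∧
      ∀ y ∈ Metric.ball y₀ δ, ∀ t, |t| ≤ T → ψ t y = ψ' t y ∧ F' =ᶠ[𝓝 (ψ' t y)] F := by
  have : CompleteSpace E := FiniteDimensional.complete ℝ E
  have : ProperSpace E := FiniteDimensional.proper ℝ E
  have hc : Continuous fun t => ψ t y₀ :=
    continuous_iff_continuousAt.2 fun t => (h.ode t y₀).continuousAt
  obtain ⟨R, hR⟩ := (isCompact_Icc (a := -(|T| + 1)) (b := |T| + 1)).exists_bound_of_continuousOn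
    hc.continuousOn
  obtain ⟨F', hF', hs, heq⟩ := exists_contDiff_hasCompactSupport_eqOn hF
    (R := max R 0 + 1) (by positivity)
  obtain ⟨ψ', hψ'⟩ := exists_isGlobalFlow_of_hasCompactSupport hF' hs
  obtain ⟨K, hK⟩ := hF'.lipschitzWith_of_hasCompactSupport hs (by simp)
  -- The window is enlarged to `|T| + 1` so that time zero is interior for every real `T`.
  have hmem : (0 : ℝ) ∈ Ioo (-(|T| + 1)) (|T| + 1) := by
    constructor <;> nlinarith [abs_nonneg T]
  have h0 : ∀ t ∈ Icc (-(|T| + 1)) (|T| + 1), ψ t y₀ = ψ' t y₀ := by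
    refine eqOn_of_hasDerivAt_Icc (hF'.of_le (by simp)) hmem (fun t ht => ?_)
      (fun t ht => hψ'.ode t y₀) (by rw [h.init, hψ'.init])
    rw [heq]
    · exact h.ode t y₀
    · have := hR t ht
      simp only [Metric.mem_closedBall, dist_zero_right]
      linarith [le_max_left R 0]
  -- By Grönwall a perturbation grows at most by the factor `exp (K (|T| + 1))`. This `δ` keeps
  -- perturbed trajectories within distance `1` of the reference one, hence where `F' = F`.
  refine ⟨F', ψ', Real.exp (-(K * (|T| + 1))), hF', hs, hψ', Real.exp_pos _,
    fun y hy => ?_⟩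
  have hin : ∀ t ∈ Icc (-(|T| + 1)) (|T| + 1), ‖ψ' t y‖ < max R 0 + 1 := by
    intro t ht
    have h1 := hψ'.norm_sub_le hK t y y₀
    have h2 := hR t ht
    rw [h0 t ht] at h2
    have h3 : ‖y - y₀‖ * Real.exp (K * |t|) < 1 := by
      rw [Metric.mem_ball, dist_eq_norm] at hy
      calc ‖y - y₀‖ * Real.exp (K * |t|) < Real.exp (-(K * (|T| + 1))) * Real.exp (K * |t|) := by
            gcongr
        _ = Real.exp (-(K * (|T| + 1)) + K * |t|) := (Real.exp_add _ _).symm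
        _ ≤ 1 := by
            rw [Real.exp_le_one_iff]
            have : |t| ≤ |T| + 1 := abs_le.2 ht
            nlinarith [K.2, mul_le_mul_of_nonneg_left this K.2]
    have h4 := norm_add_le (ψ' t y - ψ' t y₀) (ψ' t y₀)
    rw [sub_add_cancel] at h4
    linarith [le_max_left R 0]
  have h1 : ∀ t ∈ Icc (-(|T| + 1)) (|T| + 1), ψ t y = ψ' t y := by
    refine eqOn_of_hasDerivAt_Icc (hF.of_le (by simp)) hmem
      (fun t ht => h.ode t y) (fun t ht => ?_) (by rw [h.init, hψ'.init])
    rw [← heq]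
    · exact hψ'.ode t y
    · simpa using (hin t ht).le
  intro t ht
  have ht' : t ∈ Icc (-(|T| + 1)) (|T| + 1) := abs_le.1 (by linarith [le_abs_self T])
  refine ⟨h1 t ht', ?_⟩
  have : Metric.ball (0 : E) (max R 0 + 1) ∈ 𝓝 (ψ' t y) :=
    Metric.isOpen_ball.mem_nhds (by simpa using hin t ht')
  filter_upwards [this] with z hz
  exact heq (Metric.ball_subset_closedBall hz)

/-- Locally the flow is that of a compactly supported field. It is then Lipschitz in `y`, locally
uniformly in time, and a single trajectory is continuous in time. -/
theorem IsGlobalFlow.continuous [FiniteDimensional ℝ E] {F : E → E} {ψ : ℝ → E → E}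
    (h : IsGlobalFlow F ψ) (hF : ContDiff ℝ ∞ F) : Continuous fun p : ℝ × E => ψ p.1 p.2 := by
  rw [continuous_iff_continuousAt]
  rintro ⟨t₀, y₀⟩
  obtain ⟨F', ψ', δ, hF', hs, hψ', hδ, heq⟩ := h.exists_hasCompactSupport hF (|t₀| + 1) y₀
  obtain ⟨K, hK⟩ := hF'.lipschitzWith_of_hasCompactSupport hs (by simp)
  have hev : (fun p : ℝ × E => ψ p.1 p.2) =ᶠ[𝓝 (t₀, y₀)] fun p => ψ' p.1 p.2 := by
    have h1 : ∀ᶠ p : ℝ × E in 𝓝 (t₀, y₀), |p.1| < |t₀| + 1 :=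
      (continuous_abs.comp continuous_fst).continuousAt.eventually (gt_mem_nhds (by simp))
    have h2 : ∀ᶠ p : ℝ × E in 𝓝 (t₀, y₀), p.2 ∈ Metric.ball y₀ δ :=
      continuous_snd.continuousAt.eventually (Metric.ball_mem_nhds _ hδ)
    filter_upwards [h1, h2] with p hp1 hp2 using (heq p.2 hp2 p.1 hp1.le).1
  refine ContinuousAt.congr ?_ hev.symm
  have hc : ContinuousAt (fun p : ℝ × E => ‖p.2 - y₀‖ * Real.exp (K * |p.1|) +
      ‖ψ' p.1 y₀ - ψ' t₀ y₀‖) (t₀, y₀) := by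
    have h3 : ContinuousAt (fun p : ℝ × E => ψ' p.1 y₀) (t₀, y₀) :=
      ContinuousAt.comp (f := Prod.fst) (g := fun t => ψ' t y₀) (hψ'.ode t₀ y₀).continuousAt
        continuousAt_fst
    have h4 : Continuous fun p : ℝ × E => ‖p.2 - y₀‖ * Real.exp (K * |p.1|) := by fun_prop
    exact h4.continuousAt.add (h3.sub continuousAt_const).norm
  rw [ContinuousAt, tendsto_iff_norm_sub_tendsto_zero]
  refine squeeze_zero (fun _ => norm_nonneg _) (fun p => ?_) (by simpa [ContinuousAt] using hc)
  have h5 := hψ'.norm_sub_le hK p.1 p.2 y₀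
  have h6 := norm_add_le (ψ' p.1 p.2 - ψ' p.1 y₀) (ψ' p.1 y₀ - ψ' t₀ y₀)
  rw [sub_add_sub_cancel] at h6
  linarith

end ODE

/-! ### Smooth dependence of flows on the initial value -/

section SmoothFlow

theorem HasDerivAt.clm_apply_right {E F : Type*} [NormedAddCommGroup E] [NormedSpace ℝ E]
    [NormedAddCommGroup F] [NormedSpace ℝ F] {X : ℝ → E →L[ℝ] F} {X' : E →L[ℝ] F} {t : ℝ}
    (h : HasDerivAt X X' t) (v : E) : HasDerivAt (fun s => X s v) (X' v) t :=
  (ContinuousLinearMap.apply ℝ F v).hasFDerivAt.comp_hasDerivAt t h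

open Set

variable {E : Type*} [NormedAddCommGroup E] [NormedSpace ℝ E]

theorem norm_sub_sub_fderiv_le {F : E → E} (hF : ContDiff ℝ ∞ F) {K : NNReal}
    (hK : LipschitzWith K (fderiv ℝ F)) (a b : E) :
    ‖F b - F a - fderiv ℝ F a (b - a)‖ ≤ K * ‖b - a‖ ^ 2 := by
  have h := (convex_segment (𝕜 := ℝ) a b).norm_image_sub_le_of_norm_hasFDerivWithin_le
    (f := fun z => F z - fderiv ℝ F a z) (f' := fun z => fderiv ℝ F z - fderiv ℝ F a)
    (C := K * ‖b - a‖) (fun z _ => (((hF.differentiable (by simp)) z).hasFDerivAt.sub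
      (fderiv ℝ F a).hasFDerivAt).hasFDerivWithinAt) (fun z hz => ?_)
    (left_mem_segment ℝ a b) (right_mem_segment ℝ a b)
  · rw [map_sub, pow_two, ← mul_assoc]
    convert h using 2
    abel
  · refine (hK.norm_sub_le z a).trans ?_
    gcongr
    obtain ⟨s, hs, rfl⟩ := (segment_eq_image' ℝ a b ▸ hz)
    rw [add_sub_cancel_left, norm_smul, Real.norm_of_nonneg hs.1]
    exact mul_le_of_le_one_left (norm_nonneg _) hs.2

variable [FiniteDimensional ℝ E]

/-- The derivative in `y` is the solution `X` of the variational equation: the error of the linear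
approximation satisfies the same linear equation up to a source quadratic in the increment. -/
theorem IsGlobalFlow.exists_hasFDerivAt_of_hasCompactSupport {F : E → E} {ψ : ℝ → E → E}
    (h : IsGlobalFlow F ψ) (hF : ContDiff ℝ ∞ F) (hs : HasCompactSupport F) (T : ℝ) (y : E) :
    ∃ X : ℝ → E →L[ℝ] E, X 0 = ContinuousLinearMap.id ℝ E ∧ ∀ t, |t| ≤ T →
      HasDerivAt X (fderiv ℝ F (ψ t y) ∘L X t) t ∧ HasFDerivAt (ψ t) (X t) y := by
  have : CompleteSpace E := FiniteDimensional.complete ℝ E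
  have : ProperSpace E := FiniteDimensional.proper ℝ E
  have hDF : ContDiff ℝ ∞ (fderiv ℝ F) := hF.fderiv_right (by simp)
  have hsD : HasCompactSupport (fderiv ℝ F) := hs.fderiv ℝ
  obtain ⟨K, hK⟩ := hF.lipschitzWith_of_hasCompactSupport hs (by simp)
  obtain ⟨K₂, hK₂⟩ := hDF.lipschitzWith_of_hasCompactSupport hsD (by simp)
  have hK₁ : ∀ z, ‖fderiv ℝ F z‖ ≤ K := fun z => norm_fderiv_le_of_lipschitz ℝ hK
  -- The variational field is unbounded in `X`, so it is cut off. `R` exceeds the Grönwall bound for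
  -- `X` on the window, so the cutoff is `1` along the solution.
  let R : ℝ := ‖ContinuousLinearMap.id ℝ E‖ * Real.exp (K * |T|) + 1
  have hR : 0 < R := by positivity
  let χ : ContDiffBump (0 : E →L[ℝ] E) := ⟨R, R + 1, hR, by linarith⟩
  let V : E × (E →L[ℝ] E) → E →L[ℝ] E := fun p => χ p.2 • (fderiv ℝ F p.1 ∘L p.2)
  have hV : ContDiff ℝ ∞ V :=
    (χ.contDiff.comp contDiff_snd).smul ((hDF.comp contDiff_fst).clm_comp contDiff_snd)
  have hsV : HasCompactSupport V := by
    refine HasCompactSupport.intro (hsD.isCompact.prod χ.hasCompactSupport.isCompact) ?_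
    rintro ⟨a, b⟩ hab
    rw [mem_prod, not_and_or] at hab
    rcases hab with hab | hab
    · simp [V, image_eq_zero_of_notMem_tsupport hab]
    · simp [V, image_eq_zero_of_notMem_tsupport hab]
  obtain ⟨KV, hKV⟩ := hV.lipschitzWith_of_hasCompactSupport hsV (by simp)
  obtain ⟨M₁, hM₁⟩ := exists_bound_of_hasCompactSupport hF.continuous hs
  obtain ⟨M₂, hM₂⟩ := exists_bound_of_hasCompactSupport hV.continuous hsV
  obtain ⟨γ, hγ0, hγ⟩ := exists_solution_of_lipschitzWith
    (F := fun p : E × (E →L[ℝ] E) => (F p.1, V p))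
    ((hK.comp LipschitzWith.prod_fst).prodMk hKV) (M := max M₁ M₂)
    (fun p => by
      rw [Prod.norm_mk, NNReal.coe_max]
      exact max_le_max (hM₁ _) (hM₂ _)) (y, ContinuousLinearMap.id ℝ E)
  have h1 : ∀ t, HasDerivAt (fun t => (γ t).1) (F (γ t).1) t := fun t => (hγ t).fst
  have h2 : ∀ t, HasDerivAt (fun t => (γ t).2) (V (γ t)) t := fun t => (hγ t).snd
  have h3 : (fun t => (γ t).1) = fun t => ψ t y :=
    eq_of_hasDerivAt (hF.of_le (by simp)) (t₀ := 0) h1 (fun t => h.ode t y) (by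
      simp [hγ0, h.init])
  have h4 : ∀ t, |t| ≤ |T| → ‖(γ t).2‖ ≤ R := by
    intro t ht
    have := norm_le_gronwallBound_abs (f := fun t => (γ t).2) (K := K) (ε := 0) (T := |T|)
      (fun t _ => h2 t) (fun t _ => ?_) ht
    · rw [gronwallBound_ε0, hγ0] at this
      refine this.trans ?_
      simp only [R]
      have : Real.exp (K * |t|) ≤ Real.exp (K * |T|) := by gcongr
      nlinarith [norm_nonneg (ContinuousLinearMap.id ℝ E)]
    · simp only [V, add_zero]
      rw [norm_smul, Real.norm_of_nonneg χ.nonneg]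
      refine (mul_le_of_le_one_left (norm_nonneg _) χ.le_one).trans ?_
      exact (ContinuousLinearMap.opNorm_comp_le _ _).trans (by gcongr; exact hK₁ _)
  have h5 : ∀ t, |t| ≤ |T| → V (γ t) = fderiv ℝ F (ψ t y) ∘L (γ t).2 := by
    intro t ht
    simp only [V]
    rw [χ.one_of_mem_closedBall (by simpa using h4 t ht), one_smul]
    have : (γ t).1 = ψ t y := congrFun h3 t
    rw [this]
  refine ⟨fun t => (γ t).2, by simp [hγ0], fun t ht => ⟨?_, ?_⟩⟩
  · rw [← h5 t (ht.trans (le_abs_self T))]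
    exact h2 t
  · rw [hasFDerivAt_iff_isLittleO_nhds_zero]
    -- Grönwall with constant `K + 1` rather than `K`, so that the constant is nonzero and the
    -- explicit form of the bound applies.
    have key : ∀ z : E, ‖ψ t (y + z) - ψ t y - (γ t).2 z‖ ≤
        (K₂ * Real.exp (K * |T|) ^ 2 * ((Real.exp ((K + 1) * |T|)) / (K + 1))) * ‖z‖ ^ 2 := by
      intro z
      have := norm_le_gronwallBound_abs (f := fun t => ψ t (y + z) - ψ t y - (γ t).2 z)
        (f' := fun t => F (ψ t (y + z)) - F (ψ t y) - V (γ t) z) (K := K + 1)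
        (ε := K₂ * (‖z‖ * Real.exp (K * |T|)) ^ 2) (T := |T|)
        (fun t _ => ((h.ode t _).sub (h.ode t y)).sub ((h2 t).clm_apply_right z))
        (fun t ht => ?_) (ht.trans (le_abs_self T))
      · rw [h.init, h.init, hγ0] at this
        simp only [add_sub_cancel_left, ContinuousLinearMap.id_apply, sub_self, norm_zero] at this
        refine this.trans ?_
        rw [gronwallBound_of_K_ne_0 (by positivity)]
        have h6 : Real.exp ((K + 1) * |t|) ≤ Real.exp ((K + 1) * |T|) := by
          have := ht.trans (le_abs_self T)
          gcongr
        have h7 : 0 ≤ (K₂ * (‖z‖ * Real.exp (K * |T|)) ^ 2 / (K + 1) : ℝ) := by positivity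
        calc _ ≤ K₂ * (‖z‖ * Real.exp (K * |T|)) ^ 2 / (K + 1) * Real.exp ((K + 1) * |T|) := by
              simp only [zero_mul, zero_add]
              refine mul_le_mul_of_nonneg_left ?_ h7
              linarith
          _ = _ := by ring
      · rw [h5 t ht]
        have e : F (ψ t (y + z)) - F (ψ t y) - (fderiv ℝ F (ψ t y) ∘L (γ t).2) z =
            (F (ψ t (y + z)) - F (ψ t y) - fderiv ℝ F (ψ t y) (ψ t (y + z) - ψ t y)) +
            fderiv ℝ F (ψ t y) (ψ t (y + z) - ψ t y - (γ t).2 z) := by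
          simp only [map_sub, ContinuousLinearMap.comp_apply]; abel
        rw [e]
        refine (norm_add_le _ _).trans ?_
        have e1 := norm_sub_sub_fderiv_le hF hK₂ (ψ t y) (ψ t (y + z))
        have e2 := (fderiv ℝ F (ψ t y)).le_of_opNorm_le (hK₁ _) (ψ t (y + z) - ψ t y - (γ t).2 z)
        have e3 := h.norm_sub_le hK t (y + z) y
        rw [add_sub_cancel_left] at e3
        have e4 : ‖ψ t (y + z) - ψ t y‖ ≤ ‖z‖ * Real.exp (K * |T|) := e3.trans (by gcongr)
        have e5 : (K₂ : ℝ) * ‖ψ t (y + z) - ψ t y‖ ^ 2 ≤ K₂ * (‖z‖ * Real.exp (K * |T|)) ^ 2 := by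
          gcongr
        nlinarith [norm_nonneg (ψ t (y + z) - ψ t y - (γ t).2 z)]
    exact (Asymptotics.IsBigO.of_bound _ (Eventually.of_forall fun z => by
      simpa using key z)).trans_isLittleO (Asymptotics.isLittleO_norm_pow_id one_lt_two)

theorem IsGlobalFlow.hasFDerivAt {F : E → E} {ψ : ℝ → E → E} (h : IsGlobalFlow F ψ)
    (hF : ContDiff ℝ ∞ F) (t : ℝ) (y : E) :
    DifferentiableAt ℝ (ψ t) y ∧
      HasDerivAt (fun s => fderiv ℝ (ψ s) y) (fderiv ℝ F (ψ t y) ∘L fderiv ℝ (ψ t) y) t := by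
  obtain ⟨F', ψ', δ, hF', hs, hψ', hδ, heq⟩ := h.exists_hasCompactSupport hF (|t| + 1) y
  obtain ⟨X, hX0, hX⟩ := hψ'.exists_hasFDerivAt_of_hasCompactSupport hF' hs (|t| + 1) y
  have h1 : ∀ s, |s| ≤ |t| + 1 → HasFDerivAt (ψ s) (X s) y := by
    intro s hs
    refine (hX s hs).2.congr_of_eventuallyEq ?_
    filter_upwards [Metric.ball_mem_nhds y hδ] with z hz using (heq z hz s hs).1
  have ht : |t| ≤ |t| + 1 := by linarith
  have h2 : (fun s => fderiv ℝ (ψ s) y) =ᶠ[𝓝 t] X := by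
    have : ∀ᶠ s in 𝓝 t, |s| < |t| + 1 :=
      continuous_abs.continuousAt.eventually (gt_mem_nhds (by simp))
    filter_upwards [this] with s hs using (h1 s hs.le).fderiv
  refine ⟨(h1 t ht).differentiableAt, ?_⟩
  have h3 := (hX t ht).1.congr_of_eventuallyEq h2
  rw [← (h1 t ht).fderiv] at h3
  obtain ⟨h4, h5⟩ := heq y (Metric.mem_ball_self hδ) t ht
  rwa [h4, ← h5.fderiv_eq]

/-- The flow together with its derivative is again a flow, on `E × E`. This is what makes an
induction on the order of smoothness possible. -/
theorem IsGlobalFlow.tangent {F : E → E} {ψ : ℝ → E → E} (h : IsGlobalFlow F ψ)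
    (hF : ContDiff ℝ ∞ F) : IsGlobalFlow (fun p : E × E => (F p.1, fderiv ℝ F p.1 p.2))
      (fun t p => (ψ t p.1, fderiv ℝ (ψ t) p.1 p.2)) := by
  refine ⟨fun p => ?_, fun t p => ?_⟩
  · have : ψ 0 = id := funext h.init
    simp [this]
  · exact (h.ode t p.1).prodMk ((h.hasFDerivAt hF t p.1).2.clm_apply_right p.2)

/-- Induction on the order, over all spaces at once: `∂_y ψ` is a component of the flow of the
tangent field, hence `C^k` by the induction hypothesis, and `∂_t ψ = F ∘ ψ`. So `ψ` is `C^(k+1)`. -/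
theorem IsGlobalFlow.contDiff {F : E → E} {ψ : ℝ → E → E} (h : IsGlobalFlow F ψ)
    (hF : ContDiff ℝ ∞ F) : ContDiff ℝ ∞ fun p : ℝ × E => ψ p.1 p.2 := by
  rw [contDiff_infty]
  intro k
  induction k generalizing E with
  | zero => simpa using h.continuous hF
  | succ k ih =>
    have hDF : ContDiff ℝ ∞ (fderiv ℝ F) := hF.fderiv_right (by simp)
    have h1 := ih (h.tangent hF)
      ((hF.comp contDiff_fst).prodMk ((hDF.comp contDiff_fst).clm_apply contDiff_snd))
    have h2 : ContDiff ℝ k fun p : ℝ × E => ψ p.1 p.2 := ih h hF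
    have h3 : ContDiff ℝ k fun p : ℝ × E => fderiv ℝ (ψ p.1) p.2 := by
      rw [contDiff_clm_apply_iff]
      intro v
      exact h1.snd.comp (contDiff_fst.prodMk (contDiff_snd.prodMk contDiff_const))
    have h4' : ContDiff ℝ k fun p : ℝ × E => F (ψ p.1 p.2) :=
      (hF.of_le (by exact_mod_cast le_top)).comp h2
    have h4 : ContDiff ℝ k fun p : ℝ × E => ContinuousLinearMap.toSpanSingleton ℝ (F (ψ p.1 p.2)) :=
      (ContinuousLinearMap.toSpanSingletonCLE (𝕜 := ℝ) (E := E)).contDiff.comp h4'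
    have h5 : ∀ u : ℝ × E, HasFDerivAt (fun p : ℝ × E => ψ p.1 p.2)
        ((ContinuousLinearMap.toSpanSingleton ℝ (F (ψ u.1 u.2))).coprod
          (fderiv ℝ (ψ u.1) u.2)) u := fun u =>
      (hasStrictFDerivAt_uncurry_coprod (f := ψ)
        (f₁ := fun t y => ContinuousLinearMap.toSpanSingleton ℝ (F (ψ t y)))
        (f₂ := fun t y => fderiv ℝ (ψ t) y)
        (Eventually.of_forall fun v => (h.ode v.1 v.2).hasFDerivAt)
        (Eventually.of_forall fun v => (h.hasFDerivAt hF v.1 v.2).1.hasFDerivAt)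
        h4.continuous.continuousAt h3.continuous.continuousAt).hasFDerivAt
    rw [Nat.cast_add, Nat.cast_one, contDiff_succ_iff_hasFDerivAt]
    refine ⟨_, ?_, h5⟩
    rw [contDiff_clm_apply_iff]
    intro v
    simp only [ContinuousLinearMap.coprod_apply, ContinuousLinearMap.toSpanSingleton_apply]
    exact (contDiff_const.smul h4').add (h3.clm_apply contDiff_const)

end SmoothFlow

/-! ### Linear uniqueness, primitives, and pullbacks along flows -/

section FlowCalculus

open Set

variable {E V : Type*} [NormedAddCommGroup E] [NormedSpace ℝ E]
  [NormedAddCommGroup V] [NormedSpace ℝ V]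

theorem eq_zero_of_hasDerivAt_clm {M : ℝ → V →L[ℝ] V} (hM : Continuous M) {f : ℝ → V}
    (hf : ∀ t, HasDerivAt f (M t (f t)) t) (h0 : f 0 = 0) (t : ℝ) : f t = 0 := by
  obtain ⟨K, hK⟩ := (isCompact_Icc (a := -|t|) (b := |t|)).exists_bound_of_continuousOn
    hM.continuousOn
  have := norm_le_gronwallBound_abs (f := f) (K := K) (ε := 0) (T := |t|) (fun s _ => hf s)
    (fun s hs => by
      rw [add_zero]
      exact (M s).le_of_opNorm_le (hK s (abs_le.1 hs)) _) le_rfl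
  rw [h0, norm_zero, gronwallBound_ε0, zero_mul] at this
  exact norm_le_zero_iff.1 this

theorem eq_of_hasDerivAt_eq {f g f' : ℝ → V} (hf : ∀ t, HasDerivAt f (f' t) t)
    (hg : ∀ t, HasDerivAt g (f' t) t) (h0 : f 0 = g 0) (t : ℝ) : f t = g t := by
  have := eq_zero_of_hasDerivAt_clm (M := fun _ => 0) continuous_const
    (f := fun t => f t - g t) (fun t => by simpa using (hf t).fun_sub (hg t)) (by simp [h0]) t
  exact sub_eq_zero.1 this

theorem hasDerivAt_slice {X : ℝ × E → V} (hX : ContDiff ℝ ∞ X) (t : ℝ) (y : E) :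
    HasDerivAt (fun s => X (s, y)) (fderiv ℝ X (t, y) (1, 0)) t :=
  HasFDerivAt.comp_hasDerivAt (f := fun s => (s, y)) t
    ((hX.differentiable (by simp) _).hasFDerivAt)
    ((hasDerivAt_id t).prodMk (hasDerivAt_const t y))

theorem hasFDerivAt_slice {Q : Type*} [NormedAddCommGroup Q] [NormedSpace ℝ Q] {X : Q × E → V}
    (hX : ContDiff ℝ ∞ X) (q : Q) (y : E) :
    HasFDerivAt (fun z => X (q, z)) (fderiv ℝ X (q, y) ∘L ContinuousLinearMap.inr ℝ Q E) y :=
  ((hX.differentiable (by simp) _).hasFDerivAt).comp y (hasFDerivAt_prodMk_right q y)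

theorem hasDerivAt_comp_curve {X : ℝ × E → V} (hX : ContDiff ℝ ∞ X) {γ : ℝ → E} {γ' : E} {t : ℝ}
    (hγ : HasDerivAt γ γ' t) :
    HasDerivAt (fun s => X (s, γ s))
      (fderiv ℝ X (t, γ t) (1, 0) + fderiv ℝ X (t, γ t) (0, γ')) t := by
  rw [← map_add, Prod.mk_add_mk, add_zero, zero_add]
  exact HasFDerivAt.comp_hasDerivAt (f := fun s => (s, γ s)) t
    ((hX.differentiable (by simp) _).hasFDerivAt) ((hasDerivAt_id t).prodMk hγ)

variable [FiniteDimensional ℝ E]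

/-- Primitives of smooth families are smooth. -/
theorem contDiff_primitive [FiniteDimensional ℝ V] {f : ℝ × E → V} (hf : ContDiff ℝ ∞ f) :
    ContDiff ℝ ∞ fun p : ℝ × E => ∫ s in (0 : ℝ)..p.1, f (s, p.2) := by
  have : CompleteSpace V := FiniteDimensional.complete ℝ V
  have hc : ∀ y, Continuous fun s => f (s, y) := fun y => hf.continuous.comp (by fun_prop)
  -- The primitive is a component of the flow of an autonomous system in time, parameter and value,
  -- so smoothness of flows applies.
  have hflow : IsGlobalFlow (fun p : ℝ × E × V => ((1 : ℝ), (0 : E), f (p.1, p.2.1)))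
      (fun t p => (p.1 + t, p.2.1, p.2.2 + ∫ s in p.1..(p.1 + t), f (s, p.2.1))) := by
    refine ⟨fun p => by simp, fun t p => ?_⟩
    refine ((hasDerivAt_id t).const_add p.1).prodMk
      ((hasDerivAt_const t p.2.1).prodMk (HasDerivAt.const_add _ ?_))
    have h1 := intervalIntegral.integral_hasDerivAt_right ((hc p.2.1).intervalIntegrable p.1 (p.1 + t))
      ((hc p.2.1).stronglyMeasurableAtFilter _ _) (hc p.2.1).continuousAt
    have h2 := h1.scomp t ((hasDerivAt_id t).const_add p.1)
    rw [one_smul] at h2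
    exact h2
  have h1 := hflow.contDiff (contDiff_const.prodMk (contDiff_const.prodMk
    (hf.comp (contDiff_fst.prodMk (contDiff_fst.comp contDiff_snd)))))
  have h2 : ContDiff ℝ ∞ fun p : ℝ × E => (p.1, ((0 : ℝ), p.2, (0 : V))) :=
    contDiff_fst.prodMk (contDiff_const.prodMk (contDiff_snd.prodMk contDiff_const))
  have h3 := (h1.comp h2).snd.snd
  convert h3 using 2 with p
  simp

theorem hasDerivAt_primitive [CompleteSpace V] {f : ℝ → V} (hf : Continuous f) (t : ℝ) :
    HasDerivAt (fun t => ∫ s in (0 : ℝ)..t, f s) (f t) t :=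
  intervalIntegral.integral_hasDerivAt_right (hf.intervalIntegrable 0 t)
    (hf.stronglyMeasurableAtFilter _ _) hf.continuousAt

namespace IsGlobalFlow

variable {F : E → E} {ψ : ℝ → E → E}

omit [FiniteDimensional ℝ E] in
theorem hasDerivAt_neg (h : IsGlobalFlow F ψ) (t : ℝ) (y : E) :
    HasDerivAt (fun s => ψ (-s) y) (-F (ψ (-t) y)) t := by
  simpa [Function.comp_def] using (h.ode (-t) y).scomp t (_root_.hasDerivAt_neg t)

theorem add (h : IsGlobalFlow F ψ) (hF : ContDiff ℝ ∞ F) (s t : ℝ) (y : E) :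
    ψ (s + t) y = ψ s (ψ t y) := by
  have : ProperSpace E := FiniteDimensional.proper ℝ E
  have := eq_of_hasDerivAt (hF.of_le (by simp)) (t₀ := 0) (γ₁ := fun s => ψ (s + t) y)
    (γ₂ := fun s => ψ s (ψ t y)) (fun s => (h.ode (s + t) y).comp_add_const s t)
    (fun s => h.ode s _) (by simp [h.init])
  exact congrFun this s

theorem neg_apply (h : IsGlobalFlow F ψ) (hF : ContDiff ℝ ∞ F) (t : ℝ) (y : E) :
    ψ (-t) (ψ t y) = y := by rw [← h.add hF, neg_add_cancel, h.init]

theorem apply_neg (h : IsGlobalFlow F ψ) (hF : ContDiff ℝ ∞ F) (t : ℝ) (y : E) :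
    ψ t (ψ (-t) y) = y := by rw [← h.add hF, add_neg_cancel, h.init]

theorem differentiableAt (h : IsGlobalFlow F ψ) (hF : ContDiff ℝ ∞ F) (t : ℝ) (y : E) :
    DifferentiableAt ℝ (ψ t) y := (h.hasFDerivAt hF t y).1

theorem contDiff_fderiv (h : IsGlobalFlow F ψ) (hF : ContDiff ℝ ∞ F) :
    ContDiff ℝ ∞ fun p : ℝ × E => fderiv ℝ (ψ p.1) p.2 := by
  have h1 := (h.tangent hF).contDiff ((hF.comp contDiff_fst).prodMk
    (((hF.fderiv_right (m := ∞) (by simp)).comp contDiff_fst).clm_apply contDiff_snd))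
  rw [contDiff_clm_apply_iff]
  intro v
  exact h1.snd.comp (contDiff_fst.prodMk (contDiff_snd.prodMk contDiff_const))

theorem fderiv_neg_comp (h : IsGlobalFlow F ψ) (hF : ContDiff ℝ ∞ F) (t : ℝ) (y : E) :
    fderiv ℝ (ψ (-t)) (ψ t y) ∘L fderiv ℝ (ψ t) y = ContinuousLinearMap.id ℝ E := by
  rw [← fderiv_comp y (h.differentiableAt hF _ _) (h.differentiableAt hF _ _)]
  have : ψ (-t) ∘ ψ t = id := funext fun y => h.neg_apply hF t y
  rw [this, fderiv_id]

theorem fderiv_comp_neg (h : IsGlobalFlow F ψ) (hF : ContDiff ℝ ∞ F) (t : ℝ) (y : E) :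
    fderiv ℝ (ψ t) y ∘L fderiv ℝ (ψ (-t)) (ψ t y) = ContinuousLinearMap.id ℝ E := by
  have := h.fderiv_neg_comp hF (-t) (ψ t y)
  rwa [neg_neg, h.neg_apply hF] at this

theorem fderiv_apply_self (h : IsGlobalFlow F ψ) (hF : ContDiff ℝ ∞ F) (t : ℝ) (y : E) :
    fderiv ℝ (ψ t) y (F y) = F (ψ t y) := by
  have h1 : HasDerivAt (fun s => ψ t (ψ s y)) (fderiv ℝ (ψ t) y (F y)) 0 := by
    have h2 := h.ode 0 y
    have h3 : HasFDerivAt (ψ t) (fderiv ℝ (ψ t) (ψ 0 y)) (ψ 0 y) :=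
      (h.differentiableAt hF t _).hasFDerivAt
    have h4 := h3.comp_hasDerivAt 0 h2
    rwa [h.init] at h4
  have h5 : HasDerivAt (fun s => ψ t (ψ s y)) (F (ψ t y)) 0 := by
    have : (fun s => ψ t (ψ s y)) = fun s => ψ (s + t) y := by
      ext s; rw [← h.add hF, add_comm]
    rw [this]
    have := (h.ode (0 + t) y).comp_add_const 0 t
    rwa [zero_add] at this
  exact h1.unique h5

/-- The pullback `(∂_y ψ_t(y))⁻¹ X(ψ_t(y))`. -/
theorem pullback_eq (h : IsGlobalFlow F ψ) (hF : ContDiff ℝ ∞ F) (t : ℝ) (X : E → E) (y : E) :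
    VectorField.pullback ℝ (ψ t) X y = fderiv ℝ (ψ (-t)) (ψ t y) (X (ψ t y)) := by
  let M : E ≃L[ℝ] E := ContinuousLinearEquiv.equivOfInverse (fderiv ℝ (ψ t) y)
    (fderiv ℝ (ψ (-t)) (ψ t y))
    (fun v => by simpa using congrArg (fun T : E →L[ℝ] E => T v) (h.fderiv_neg_comp hF t y))
    (fun v => by simpa using congrArg (fun T : E →L[ℝ] E => T v) (h.fderiv_comp_neg hF t y))
  have hM : (M : E →L[ℝ] E) = fderiv ℝ (ψ t) y := by ext v; rfl
  rw [VectorField.pullback_eq_of_fderiv_eq hM]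
  rfl

theorem contDiff_pullback (h : IsGlobalFlow F ψ) (hF : ContDiff ℝ ∞ F) {X : E → E}
    (hX : ContDiff ℝ ∞ X) :
    ContDiff ℝ ∞ fun p : ℝ × E => VectorField.pullback ℝ (ψ p.1) X p.2 := by
  simp only [h.pullback_eq hF]
  have h1 := h.contDiff hF
  exact ((h.contDiff_fderiv hF).comp (contDiff_fst.neg.prodMk h1)).clm_apply (hX.comp h1)

/-- `∂_τ (Φ_τ^* X) = [F, Φ_τ^* X]` for the flow `Φ` of `F`. -/
theorem deriv_pullback (h : IsGlobalFlow F ψ) (hF : ContDiff ℝ ∞ F) {X : E → E}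
    (hX : ContDiff ℝ ∞ X) (t : ℝ) (y : E) :
    deriv (fun s => VectorField.pullback ℝ (ψ s) X y) t =
      VectorField.lieBracket ℝ F (VectorField.pullback ℝ (ψ t) X) y := by
  set A : ℝ × E → E := fun p => VectorField.pullback ℝ (ψ p.1) X p.2 with hA
  have hAs := h.contDiff_pullback hF hX
  have h1 := hasDerivAt_slice hAs t y
  have h2 := hasFDerivAt_slice hAs t y
  set z := ψ t y with hz
  have hy : ψ (-t) z = y := h.neg_apply hF t y
  have h3 := hasDerivAt_comp_curve hAs (h.hasDerivAt_neg t z)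
  rw [hy] at h3
  -- Along the backward trajectory the pulled-back field is just `Dψ_{-s}(z)` applied to a fixed
  -- vector. Differentiating this in two ways gives the formula.
  have h6 : (fun s => A (s, ψ (-s) z)) = fun s => fderiv ℝ (ψ (-s)) z (X z) := by
    ext s
    simp only [hA]
    rw [h.pullback_eq hF, h.apply_neg hF]
  have h7 : HasDerivAt (fun s => fderiv ℝ (ψ (-s)) z (X z)) (-(fderiv ℝ F y (A (t, y)))) t := by
    have h8 := (h.hasFDerivAt hF (-t) z).2.clm_apply_right (X z)
    have h9 := h8.scomp t (_root_.hasDerivAt_neg t)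
    rw [hy] at h9
    simpa [Function.comp_def, hA, h.pullback_eq hF, ← hz] using h9
  rw [h6] at h3
  have h10 := h3.unique h7
  rw [VectorField.lieBracket, h1.deriv, h2.fderiv]
  simp only [ContinuousLinearMap.comp_apply, ContinuousLinearMap.inr_apply]
  have h12 : fderiv ℝ A (t, y) (0, -F y) = -fderiv ℝ A (t, y) (0, F y) := by
    rw [← map_neg]; simp
  rw [h12, ← sub_eq_add_neg, sub_eq_iff_eq_add] at h10
  rw [h10]
  simp only [hA]
  abel

/-- A solution of `∂_τ X = [F, X]` is the pullback of its value at `τ = 0`. -/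
theorem fderiv_apply_of_deriv_eq (h : IsGlobalFlow F ψ) (hF : ContDiff ℝ ∞ F) {X : ℝ × E → E}
    (hX : ContDiff ℝ ∞ X) (hd : ∀ t y, deriv (fun s => X (s, y)) t =
      VectorField.lieBracket ℝ F (fun z => X (t, z)) y) (t : ℝ) (y : E) :
    fderiv ℝ (ψ t) y (X (t, y)) = X (0, ψ t y) := by
  -- Along a backward trajectory both terms solve the same linear equation with the same initial
  -- value.
  have key : ∀ z t, X (t, ψ (-t) z) - fderiv ℝ (ψ (-t)) z (X (0, z)) = 0 := by
    intro z
    have hDF : ContDiff ℝ ∞ (fderiv ℝ F) := hF.fderiv_right (by simp)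
    refine eq_zero_of_hasDerivAt_clm (M := fun t => -fderiv ℝ F (ψ (-t) z)) ?_ (fun t => ?_) ?_
    · exact (hDF.continuous.comp ((h.continuous hF).comp
        (continuous_neg.prodMk continuous_const))).neg
    · set w := ψ (-t) z with hw
      have h1 := hasDerivAt_slice hX t w
      have h2 := hasFDerivAt_slice hX t w
      have h3 := hasDerivAt_comp_curve hX (h.hasDerivAt_neg t z)
      have h8 := (h.hasFDerivAt hF (-t) z).2.clm_apply_right (X (0, z))
      have h9 := h8.scomp t (_root_.hasDerivAt_neg t)
      have h10 := h3.fun_sub h9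
      have h11 := hd t w
      rw [VectorField.lieBracket, h1.deriv, h2.fderiv] at h11
      have h12 : fderiv ℝ X (t, w) (0, -F w) = -fderiv ℝ X (t, w) (0, F w) := by
        rw [← map_neg]; simp
      rw [← hw, h12, h11] at h10
      refine HasDerivAt.congr_deriv h10 ?_
      simp only [ContinuousLinearMap.comp_apply, ContinuousLinearMap.inr_apply,
        _root_.neg_apply, map_sub, neg_smul, one_smul]
      abel
    · have : ψ 0 = id := funext h.init
      simp [this]
  have h1 := key (ψ t y) t
  rw [h.neg_apply hF, sub_eq_zero] at h1
  rw [h1]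
  simpa using congrArg (fun T : E →L[ℝ] E => T (X (0, ψ t y))) (h.fderiv_comp_neg hF t y)

end IsGlobalFlow

end FlowCalculus

/-! ### Formal series with coefficients in a Lie algebra -/

/-- Recursive construction of series: the coefficient of order `r` is a function of the sequence
truncated to orders below `r`, with zeros from `r` on. -/
theorem exists_seq_eq {V : Type*} [Zero V] (Θ : ℕ → (ℕ → V) → V) :
    ∃ x : ℕ → V, ∀ r, x r = Θ r (fun s => if s < r then x s else 0) := by
  let x : ℕ → V := fun r => Nat.strongRec (motive := fun _ => V)
    (fun r ih => Θ r (fun s => if h : s < r then ih s h else 0)) r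
  refine ⟨x, fun r => ?_⟩
  simp only [x]
  rw [Nat.strongRec_eq]
  rfl

/-- Formal series `∑ r, ε ^ r • X r` with coefficients in `V`. -/
def Ser (V : Type*) : Type _ := ℕ → V

namespace Ser

@[ext] theorem ext {V : Type*} {X Y : Ser V} (h : ∀ r, X r = Y r) : X = Y := funext h

/-- The formal series with given coefficients. -/
def mk {V : Type*} (f : ℕ → V) : Ser V := f

@[simp] theorem mk_apply {V : Type*} (f : ℕ → V) (r : ℕ) : mk f r = f r := rfl

section Basic

variable {V W : Type*} [AddCommGroup V] [Module ℝ V] [AddCommGroup W] [Module ℝ W]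

instance : AddCommGroup (Ser V) := inferInstanceAs (AddCommGroup (ℕ → V))
instance : Module ℝ (Ser V) := inferInstanceAs (Module ℝ (ℕ → V))

omit [Module ℝ V] in
@[simp] theorem coeff_add (X Y : Ser V) (r : ℕ) : (X + Y) r = X r + Y r := rfl
omit [Module ℝ V] in
@[simp] theorem coeff_sub (X Y : Ser V) (r : ℕ) : (X - Y) r = X r - Y r := rfl
omit [Module ℝ V] in
@[simp] theorem coeff_neg (X : Ser V) (r : ℕ) : (-X) r = -X r := rfl
omit [Module ℝ V] in
@[simp] theorem coeff_zero (r : ℕ) : (0 : Ser V) r = 0 := rfl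
@[simp] theorem coeff_smul (c : ℝ) (X : Ser V) (r : ℕ) : (c • X) r = c • X r := rfl

/-- The Euler derivation `ε d/dε`. -/
def euler : Ser V →ₗ[ℝ] Ser V where
  toFun X := mk fun r => (r : ℝ) • X r
  map_add' X Y := by ext r; simp
  map_smul' c X := by ext r; exact smul_comm _ _ _

@[simp] theorem euler_apply (X : Ser V) (r : ℕ) : euler X r = (r : ℝ) • X r := rfl

/-- Coefficientwise application of a linear map. -/
def map (f : V →ₗ[ℝ] W) : Ser V →ₗ[ℝ] Ser W where
  toFun X := mk fun r => f (X r)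
  map_add' X Y := by ext r; simp
  map_smul' c X := by ext r; simp

@[simp] theorem map_apply (f : V →ₗ[ℝ] W) (X : Ser V) (r : ℕ) : map f X r = f (X r) := rfl

theorem map_euler (f : V →ₗ[ℝ] W) (X : Ser V) : map f (euler X) = euler (map f X) := by
  ext r; simp

/-- The monomial `ε • x`. -/
def monomialOne (x : V) : Ser V := fun r => if r = 1 then x else 0

omit [Module ℝ V] in
@[simp] theorem monomialOne_zero (x : V) : monomialOne x 0 = 0 := rfl

@[simp] theorem monomialOne_one (x : V) : monomialOne x 1 = x := rfl

theorem euler_monomialOne (x : V) : euler (monomialOne x) = monomialOne x := by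
  ext r
  by_cases h : r = 1 <;> simp [monomialOne, h]

theorem map_monomialOne (f : V →ₗ[ℝ] W) (x : V) :
    map f (monomialOne x) = monomialOne (f x) := by
  ext r
  by_cases h : r = 1 <;> simp [monomialOne, h]

end Basic

section Lie

open Finset.HasAntidiagonal

variable {𝔏 M : Type*} [LieRing 𝔏] [AddCommGroup M] [LieRingModule 𝔏 M]

instance : Bracket (Ser 𝔏) (Ser M) :=
  ⟨fun X m r => ∑ p ∈ antidiagonal r, ⁅X p.1, m p.2⁆⟩

theorem lie_apply (X : Ser 𝔏) (m : Ser M) (r : ℕ) :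
    ⁅X, m⁆ r = ∑ p ∈ antidiagonal r, ⁅X p.1, m p.2⁆ := rfl

theorem sum_antidiagonal_assoc {V : Type*} [AddCommMonoid V] (f : ℕ → ℕ → ℕ → V) (r : ℕ) :
    ∑ p ∈ antidiagonal r, ∑ q ∈ antidiagonal p.2, f p.1 q.1 q.2 =
      ∑ p ∈ antidiagonal r, ∑ q ∈ antidiagonal p.1, f q.1 q.2 p.2 := by
  simp only [Finset.sum_sigma']
  refine Finset.sum_nbij' (fun x => ⟨(x.1.1 + x.2.1, x.2.2), (x.1.1, x.2.1)⟩)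
    (fun x => ⟨(x.2.1, x.2.2 + x.1.2), (x.2.2, x.1.2)⟩) ?_ ?_ ?_ ?_ ?_
  · rintro ⟨⟨a, b⟩, c, d⟩ h; simp at h ⊢; omega
  · rintro ⟨⟨a, b⟩, c, d⟩ h; simp at h ⊢; omega
  · rintro ⟨⟨a, b⟩, c, d⟩ h; simp at h ⊢; omega
  · rintro ⟨⟨a, b⟩, c, d⟩ h; simp at h ⊢; omega
  · rintro ⟨⟨a, b⟩, c, d⟩ h; simp

theorem sum_antidiagonal_left_comm {V : Type*} [AddCommMonoid V] (f : ℕ → ℕ → ℕ → V) (r : ℕ) :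
    ∑ p ∈ antidiagonal r, ∑ q ∈ antidiagonal p.2, f p.1 q.1 q.2 =
      ∑ p ∈ antidiagonal r, ∑ q ∈ antidiagonal p.2, f q.1 p.1 q.2 := by
  rw [sum_antidiagonal_assoc, sum_antidiagonal_assoc (fun a b c => f b a c)]
  refine Finset.sum_congr rfl fun p _ => ?_
  exact Finset.sum_nbij' Prod.swap Prod.swap (by simp [add_comm]) (by simp [add_comm])
    (by simp) (by simp) (by simp)

/-- The bracket of `X` and `Y` is spelled out so that one computation supplies both the Jacobi
identity of series and their action on a module. -/
theorem leibniz_aux (X Y : Ser 𝔏) (m : Ser M) : ⁅X, ⁅Y, m⁆⁆ =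
    mk (fun r => ∑ p ∈ antidiagonal r, ⁅(∑ q ∈ antidiagonal p.1, ⁅X q.1, Y q.2⁆), m p.2⁆)
      + ⁅Y, ⁅X, m⁆⁆ := by
  ext r
  simp only [coeff_add, mk_apply, lie_apply, lie_sum, sum_lie]
  rw [← sum_antidiagonal_assoc (fun a b c => ⁅⁅X a, Y b⁆, m c⁆),
    sum_antidiagonal_left_comm (fun a b c => ⁅Y a, ⁅X b, m c⁆⁆), ← Finset.sum_add_distrib]
  refine Finset.sum_congr rfl fun p _ => ?_
  rw [← Finset.sum_add_distrib]
  exact Finset.sum_congr rfl fun q _ => leibniz_lie _ _ _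

instance : LieRing (Ser 𝔏) where
  add_lie X Y Z := by ext r; simp [lie_apply, Finset.sum_add_distrib]
  lie_add X Y Z := by ext r; simp [lie_apply, Finset.sum_add_distrib]
  lie_self X := by
    ext r
    rw [lie_apply]
    refine Finset.sum_involution (fun p _ => p.swap) (fun p _ => ?_) (fun p _ h h' => h ?_)
      (fun p hp => by simpa [add_comm] using hp) (fun p _ => by simp)
    · rw [Prod.fst_swap, Prod.snd_swap, ← lie_skew (X p.1) (X p.2)]; exact neg_add_cancel _
    · have : p.2 = p.1 := congrArg Prod.fst h'
      rw [this, lie_self]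
  leibniz_lie X Y Z := leibniz_aux X Y Z

instance : LieRingModule (Ser 𝔏) (Ser M) where
  add_lie X Y Z := by ext r; simp [lie_apply, Finset.sum_add_distrib]
  lie_add X Y Z := by ext r; simp [lie_apply, Finset.sum_add_distrib]
  leibniz_lie X Y m := leibniz_aux X Y m

/-- As the acting series has no constant term, order `r` of the bracket sees the other factor only
below order `r`. All inductions on the order rest on this. -/
theorem lie_apply_congr {X X' : Ser 𝔏} {m m' : Ser M} {r : ℕ} (hX : X 0 = 0) (hX' : X' 0 = 0)
    (h : ∀ s ≤ r, X s = X' s) (hm : ∀ s < r, m s = m' s) : ⁅X, m⁆ r = ⁅X', m'⁆ r := by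
  rw [lie_apply, lie_apply]
  refine Finset.sum_congr rfl fun p hp => ?_
  rw [mem_antidiagonal] at hp
  rcases Nat.eq_zero_or_pos p.1 with h0 | h0
  · rw [h0, hX, hX', zero_lie, zero_lie]
  · rw [h _ (by omega), hm _ (by omega)]

theorem lie_apply_eq_zero {X : Ser 𝔏} {m : Ser M} {r : ℕ} (hX : X 0 = 0)
    (hm : ∀ s < r, m s = 0) : ⁅X, m⁆ r = 0 := by
  rw [lie_apply_congr hX hX (fun _ _ => rfl) (m' := 0) (by simpa using hm), lie_zero, coeff_zero]

theorem lie_apply_eq_zero' {X : Ser 𝔏} {m : Ser M} {r : ℕ} (hX : ∀ s < r, X s = 0)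
    (hm : m 0 = 0) : ⁅X, m⁆ r = 0 := by
  rw [lie_apply]
  refine Finset.sum_eq_zero fun p hp => ?_
  rw [mem_antidiagonal] at hp
  rcases Nat.eq_zero_or_pos p.2 with h0 | h0
  · rw [h0, hm, lie_zero]
  · rw [hX _ (by omega), zero_lie]

theorem map_lie [LieAlgebra ℝ 𝔏] [Module ℝ M] {d : 𝔏 →ₗ[ℝ] 𝔏} {dM : M →ₗ[ℝ] M}
    (hd : ∀ x m, dM ⁅x, m⁆ = ⁅d x, m⁆ + ⁅x, dM m⁆) (X : Ser 𝔏) (m : Ser M) :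
    map dM ⁅X, m⁆ = ⁅map d X, m⁆ + ⁅X, map dM m⁆ := by
  ext r
  simp [lie_apply, hd, Finset.sum_add_distrib]

theorem map_lie_of_hom [LieAlgebra ℝ 𝔏] [Module ℝ M] {S : 𝔏 →ₗ[ℝ] 𝔏} {SM : M →ₗ[ℝ] M}
    (hS : ∀ x m, SM ⁅x, m⁆ = ⁅S x, SM m⁆) (X : Ser 𝔏) (m : Ser M) :
    map SM ⁅X, m⁆ = ⁅map S X, map SM m⁆ := by
  ext r
  simp [lie_apply, hS]

variable [LieAlgebra ℝ 𝔏] [Module ℝ M] [LieModule ℝ 𝔏 M]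

theorem euler_lie (X : Ser 𝔏) (m : Ser M) : euler ⁅X, m⁆ = ⁅euler X, m⁆ + ⁅X, euler m⁆ := by
  ext r
  simp only [euler_apply, lie_apply, coeff_add, Finset.smul_sum, ← Finset.sum_add_distrib]
  refine Finset.sum_congr rfl fun p hp => ?_
  rw [smul_lie, lie_smul, ← add_smul, ← Nat.cast_add, mem_antidiagonal.1 hp]

instance : LieAlgebra ℝ (Ser 𝔏) where
  lie_smul c X Y := by ext r; simp [lie_apply, Finset.smul_sum]

instance : LieModule ℝ (Ser 𝔏) (Ser M) where
  smul_lie c X Y := by ext r; simp [lie_apply, Finset.smul_sum]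
  lie_smul c X Y := by ext r; simp [lie_apply, Finset.smul_sum]

omit [LieAlgebra ℝ 𝔏] [LieModule ℝ 𝔏 M] in
-- At order `r > 0` the right side involves lower coefficients only, while the left side is `r Z_r`.
-- This is the uniqueness principle for transport: two expressions agree if they have the same
-- constant term and satisfy the same equation in `ε`.
theorem eq_zero_of_euler_eq {L : Ser 𝔏} (hL : L 0 = 0) {Z : Ser M} (hZ : euler Z = -⁅L, Z⁆)
    (h0 : Z 0 = 0) : Z = 0 := by
  ext r
  induction r using Nat.strong_induction_on with
  | _ r ih =>
    rcases Nat.eq_zero_or_pos r with h | h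
    · rw [h, h0]; rfl
    · have := congrFun hZ r
      rw [coeff_neg, lie_apply_eq_zero hL ih, neg_zero, euler_apply] at this
      exact (smul_eq_zero.1 this).resolve_left (by positivity)

omit [LieAlgebra ℝ 𝔏] [LieModule ℝ 𝔏 M] in
-- The coefficient of order `r` is found by dividing the equation by `r`; order zero is the initial
-- value.
theorem exists_conj (L : Ser 𝔏) (x : M) : ∃ Y : Ser M,
    ∀ r, Y r = if r = 0 then x else -(r : ℝ)⁻¹ • ⁅L, mk (fun s => if s < r then Y s else 0)⁆ r :=
  exists_seq_eq (fun r z => if r = 0 then x else -(r : ℝ)⁻¹ • ⁅L, mk z⁆ r)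

/-- The formal series `Y` with `Y 0 = x` and `ε dY/dε = -⁅L, Y⁆`. -/
noncomputable def conj (L : Ser 𝔏) (x : M) : Ser M := (exists_conj L x).choose

omit [LieAlgebra ℝ 𝔏] [LieModule ℝ 𝔏 M] in
theorem conj_zero (L : Ser 𝔏) (x : M) : conj L x 0 = x := by
  rw [conj, (exists_conj L x).choose_spec]; simp

omit [LieAlgebra ℝ 𝔏] [LieModule ℝ 𝔏 M] in
theorem euler_conj {L : Ser 𝔏} (hL : L 0 = 0) (x : M) : euler (conj L x) = -⁅L, conj L x⁆ := by
  ext r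
  rcases Nat.eq_zero_or_pos r with h | h
  · rw [h]
    simp [lie_apply, hL]
  · rw [euler_apply]
    nth_rw 1 [conj]
    rw [(exists_conj L x).choose_spec, if_neg h.ne', smul_smul, coeff_neg, mul_neg,
      mul_inv_cancel₀ (by positivity), neg_smul, one_smul]
    congr 1
    exact lie_apply_congr hL hL (fun _ _ => rfl) (fun s hs => if_pos hs)

omit [LieAlgebra ℝ 𝔏] [LieModule ℝ 𝔏 M] in
theorem conj_apply {L : Ser 𝔏} (hL : L 0 = 0) (x : M) {r : ℕ} (hr : r ≠ 0) :
    conj L x r = -(r : ℝ)⁻¹ • ⁅L, conj L x⁆ r := by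
  have := congrFun (euler_conj hL x) r
  rw [euler_apply, coeff_neg] at this
  have hr' : (r : ℝ) ≠ 0 := by exact_mod_cast hr
  rw [neg_smul, ← smul_neg, ← this, smul_smul, inv_mul_cancel₀ hr', one_smul]

omit [LieAlgebra ℝ 𝔏] [LieModule ℝ 𝔏 M] in
theorem conj_apply_zero {L : Ser 𝔏} (hL : L 0 = 0) : conj L (0 : M) = 0 :=
  eq_zero_of_euler_eq hL (euler_conj hL 0) (conj_zero L 0)

omit [LieAlgebra ℝ 𝔏] [LieModule ℝ 𝔏 M] in
theorem conj_congr {L L' : Ser 𝔏} (hL : L 0 = 0) (hL' : L' 0 = 0) (x : M) {r : ℕ}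
    (h : ∀ s ≤ r, L s = L' s) : conj L x r = conj L' x r := by
  induction r using Nat.strong_induction_on with
  | _ r ih =>
    rcases Nat.eq_zero_or_pos r with h0 | h0
    · rw [h0, conj_zero, conj_zero]
    · rw [conj_apply hL x h0.ne', conj_apply hL' x h0.ne',
        lie_apply_congr hL hL' h (fun s hs => ih s hs fun k hk => h k (by omega))]

omit [LieModule ℝ 𝔏 M] in
theorem map_conj_of_hom {L : Ser 𝔏} (hL : L 0 = 0) {S : 𝔏 →ₗ[ℝ] 𝔏} {SM : M →ₗ[ℝ] M}
    (hS : ∀ x m, SM ⁅x, m⁆ = ⁅S x, SM m⁆) (hSL : map S L = L) {x : M} (hx : SM x = x) :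
    map SM (conj L x) = conj L x := by
  rw [← sub_eq_zero]
  refine eq_zero_of_euler_eq hL ?_ (by simp [conj_zero, hx])
  rw [map_sub, ← map_euler, euler_conj hL, map_neg, map_lie_of_hom hS, hSL, lie_sub]
  abel

omit [LieAlgebra ℝ 𝔏] [LieModule ℝ 𝔏 M] in
-- A functional that vanishes on brackets with the generator sees only the constant term of a
-- transport. It is applied to evaluation at time zero, where `L` vanishes.
theorem map_conj_of_lie_eq_zero {V : Type*} [AddCommGroup V] [Module ℝ V] {L : Ser 𝔏}
    (hL : L 0 = 0) {e : M →ₗ[ℝ] V} (he : ∀ s m, e ⁅L s, m⁆ = 0) (x : M) {r : ℕ} (hr : r ≠ 0) :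
    e (conj L x r) = 0 := by
  rw [conj_apply hL x hr, map_smul, lie_apply, map_sum, Finset.sum_eq_zero (fun p _ => he _ _),
    smul_zero]

/-- If `∂L = ε dU/dε + ⁅L, U⁆`, then `∂ (conj L x) = -⁅U, conj L x⁆` for constant `x`. -/
theorem map_conj {L U : Ser 𝔏} (hL : L 0 = 0) (hU : U 0 = 0) {d : 𝔏 →ₗ[ℝ] 𝔏} {dM : M →ₗ[ℝ] M}
    (hd : ∀ x m, dM ⁅x, m⁆ = ⁅d x, m⁆ + ⁅x, dM m⁆) (hdL : map d L = euler U + ⁅L, U⁆) {x : M}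
    (hx : dM x = 0) : map dM (conj L x) = -⁅U, conj L x⁆ := by
  rw [← sub_eq_zero, sub_neg_eq_add]
  -- The defect solves the homogeneous equation in `ε`. The hypothesis on `d L` is the
  -- zero-curvature condition making the `τ`- and `ε`-equations compatible.
  refine eq_zero_of_euler_eq hL ?_ ?_
  · rw [map_add, ← map_euler, euler_lie, euler_conj hL, map_neg, map_lie hd, hdL, add_lie, lie_neg,
      lie_add L, leibniz_lie L U]
    abel
  · rw [coeff_add, map_apply, conj_zero, hx, lie_apply]
    simp [hU]

/-- The extension of `conj L` to formal series. -/
noncomputable def conjSer (L : Ser 𝔏) (Y : Ser M) : Ser M :=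
  fun r => ∑ p ∈ antidiagonal r, conj L (Y p.2) p.1

omit [LieAlgebra ℝ 𝔏] [LieModule ℝ 𝔏 M] in
theorem conjSer_apply (L : Ser 𝔏) (Y : Ser M) (r : ℕ) :
    conjSer L Y r = ∑ p ∈ antidiagonal r, conj L (Y p.2) p.1 := rfl

theorem map_conjSer {L U : Ser 𝔏} (hL : L 0 = 0) (hU : U 0 = 0) {d : 𝔏 →ₗ[ℝ] 𝔏}
    {dM : M →ₗ[ℝ] M} (hd : ∀ x m, dM ⁅x, m⁆ = ⁅d x, m⁆ + ⁅x, dM m⁆)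
    (hdL : map d L = euler U + ⁅L, U⁆) {Y : Ser M} (hY : ∀ r, dM (Y r) = 0) :
    map dM (conjSer L Y) = -⁅U, conjSer L Y⁆ := by
  ext r
  rw [map_apply, conjSer_apply, map_sum, coeff_neg, lie_apply]
  simp only [conjSer_apply, lie_sum]
  rw [sum_antidiagonal_assoc (fun a b c => ⁅U a, conj L (Y c) b⁆), ← Finset.sum_neg_distrib]
  refine Finset.sum_congr rfl fun p _ => ?_
  exact congrFun (map_conj hL hU hd hdL (hY p.2)) p.1

omit [LieModule ℝ 𝔏 M] in
theorem map_conjSer_of_hom {L : Ser 𝔏} (hL : L 0 = 0) {S : 𝔏 →ₗ[ℝ] 𝔏} {SM : M →ₗ[ℝ] M}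
    (hS : ∀ x m, SM ⁅x, m⁆ = ⁅S x, SM m⁆) (hSL : map S L = L) {Y : Ser M}
    (hY : ∀ r, SM (Y r) = Y r) : map SM (conjSer L Y) = conjSer L Y := by
  ext r
  rw [map_apply, conjSer_apply, map_sum]
  exact Finset.sum_congr rfl fun p _ => congrFun (map_conj_of_hom hL hS hSL (hY p.2)) p.1

omit [LieAlgebra ℝ 𝔏] [LieModule ℝ 𝔏 M] in
theorem map_conjSer_of_lie_eq_zero {V : Type*} [AddCommGroup V] [Module ℝ V] {L : Ser 𝔏}
    (hL : L 0 = 0) {e : M →ₗ[ℝ] V} (he : ∀ s m, e ⁅L s, m⁆ = 0) (Y : Ser M) (r : ℕ) :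
    e (conjSer L Y r) = e (Y r) := by
  rw [conjSer_apply, map_sum, Finset.sum_eq_single_of_mem (0, r) (by simp), conj_zero]
  rintro ⟨a, b⟩ hp hne
  refine map_conj_of_lie_eq_zero hL he _ fun h => hne ?_
  simp only [mem_antidiagonal] at hp h
  rw [h] at hp ⊢
  simpa using hp

omit [LieAlgebra ℝ 𝔏] [LieModule ℝ 𝔏 M] in
theorem conjSer_zero (L : Ser 𝔏) (Y : Ser M) : conjSer L Y 0 = Y 0 := by
  simp [conjSer_apply, conj_zero]

end Lie

end Ser

/-! ### Averaging in a Lie algebra of time-dependent vector fields -/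

/-- The operations on a Lie algebra of time-dependent vector fields that averaging uses: the time
derivative `d`, the shift `S` by one period, the value `ev` at time `0` (a constant field), the
primitive `J` that vanishes at time `0`, and the mean `μ` over one period. -/
structure Averaging (𝔏 : Type*) [LieRing 𝔏] [LieAlgebra ℝ 𝔏] where
  d : 𝔏 →ₗ[ℝ] 𝔏
  S : 𝔏 →ₗ[ℝ] 𝔏
  ev : 𝔏 →ₗ[ℝ] 𝔏
  J : 𝔏 →ₗ[ℝ] 𝔏
  μ : 𝔏 →ₗ[ℝ] 𝔏
  d_lie : ∀ x y, d ⁅x, y⁆ = ⁅d x, y⁆ + ⁅x, d y⁆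
  S_lie : ∀ x y, S ⁅x, y⁆ = ⁅S x, S y⁆
  S_d : ∀ x, S (d x) = d (S x)
  ev_lie : ∀ x y, ev ⁅x, y⁆ = ⁅ev x, ev y⁆
  d_J : ∀ x, d (J x) = x
  ev_J : ∀ x, ev (J x) = 0
  d_ev : ∀ x, d (ev x) = 0
  ev_of_d : ∀ x, d x = 0 → ev x = x
  S_of_d : ∀ x, d x = 0 → S x = x
  d_μ : ∀ x, d (μ x) = 0
  μ_of_d : ∀ x, d x = 0 → μ x = x
  μ_d : ∀ x, S x = x → μ (d x) = 0
  S_J : ∀ x, S x = x → μ x = 0 → S (J x) = J x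

namespace Averaging

open Ser Finset.HasAntidiagonal

variable {𝔏 : Type*} [LieRing 𝔏] [LieAlgebra ℝ 𝔏] (a : Averaging 𝔏)

/-- `B` is the averaged series of the periodic element `A`, and `L` generates the near-identity
change of variables. -/
structure IsAveraged (A : 𝔏) (L B : Ser 𝔏) : Prop where
  L_zero : L 0 = 0
  B_zero : B 0 = 0
  ev_L : ∀ r, a.ev (L r) = 0
  S_L : ∀ r, a.S (L r) = L r
  d_B : ∀ r, a.d (B r) = 0
  d_L : map a.d L = euler (monomialOne A - conjSer L B) + ⁅L, monomialOne A - conjSer L B⁆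

/-- At order `r` the equation reads `∂L_r + r B_r = R_r` with `R_r` built from lower orders. Take `r
B_r` to be the mean of `R_r` and `L_r` the primitive of the rest, which is periodic because its
integrand has mean zero. -/
theorem exists_isAveraged {A : 𝔏} (hA : a.S A = A) : ∃ L B : Ser 𝔏, a.IsAveraged A L B := by
  let R : ℕ → Ser 𝔏 → Ser 𝔏 → 𝔏 := fun r L B =>
    (monomialOne A + ⁅L, monomialOne A - conjSer L B⁆ - euler (conjSer L B)) r
  -- Both series are constructed in one recursion, as a sequence of pairs.
  obtain ⟨x, hx⟩ := exists_seq_eq (V := 𝔏 × 𝔏) (fun r z =>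
    (a.J (R r (Ser.mk fun s => (z s).1) (Ser.mk fun s => (z s).2) -
        a.μ (R r (Ser.mk fun s => (z s).1) (Ser.mk fun s => (z s).2))),
      (r : ℝ)⁻¹ • a.μ (R r (Ser.mk fun s => (z s).1) (Ser.mk fun s => (z s).2))))
  let L : Ser 𝔏 := Ser.mk fun r => (x r).1
  let B : Ser 𝔏 := Ser.mk fun r => (x r).2
  let tr : ℕ → Ser 𝔏 → Ser 𝔏 := fun r X => Ser.mk fun s => if s < r then X s else 0
  have htr : ∀ r X s, s < r → tr r X s = X s := fun r X s hs => by simp [tr, hs]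
  have hx1 : ∀ r, L r = a.J (R r (tr r L) (tr r B) - a.μ (R r (tr r L) (tr r B))) := by
    intro r
    simp only [L, Ser.mk_apply]
    rw [hx]
    simp only [tr, B, Ser.mk_apply, apply_ite Prod.fst, apply_ite Prod.snd, Prod.fst_zero,
      Prod.snd_zero]
  have hx2 : ∀ r, B r = (r : ℝ)⁻¹ • a.μ (R r (tr r L) (tr r B)) := by
    intro r
    simp only [B, Ser.mk_apply]
    rw [hx]
    simp only [tr, L, Ser.mk_apply, apply_ite Prod.fst, apply_ite Prod.snd, Prod.fst_zero,
      Prod.snd_zero]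
  have hdB : ∀ r, a.d (B r) = 0 := fun r => by rw [hx2, map_smul, a.d_μ, smul_zero]
  have hB0 : B 0 = 0 := by rw [hx2]; simp
  have hL0 : L 0 = 0 := by
    rw [hx1]
    have : R 0 (tr 0 L) (tr 0 B) = 0 := by
      simp [R, lie_apply, tr]
    rw [this]; simp
  have htL0 : ∀ r, tr r L 0 = 0 := fun r => by simp [tr, hL0]
  have hSL : ∀ r, a.S (L r) = L r := by
    intro r
    induction r using Nat.strong_induction_on with
    | _ r ih =>
      have h1 : map a.S (tr r L) = tr r L := by
        ext s
        simp only [map_apply, tr, Ser.mk_apply]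
        split_ifs with h
        · exact ih s h
        · simp
      have h2 : ∀ s, a.S (tr r B s) = tr r B s := by
        intro s
        simp only [tr, Ser.mk_apply]
        split_ifs with h
        · exact a.S_of_d _ (hdB s)
        · simp
      have h3 := map_conjSer_of_hom (htL0 r) a.S_lie h1 h2
      have h4 : a.S (R r (tr r L) (tr r B)) = R r (tr r L) (tr r B) := by
        simp only [R]
        rw [← map_apply, map_sub, map_add, map_lie_of_hom a.S_lie, map_euler, map_sub, h1, h3,
          map_monomialOne, hA]
      rw [hx1]
      refine a.S_J _ ?_ ?_
      · rw [map_sub, h4, a.S_of_d _ (a.d_μ _)]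
      · rw [map_sub, a.μ_of_d _ (a.d_μ _), sub_self]
  have hC : ∀ r s, s < r → conjSer L B s = conjSer (tr r L) (tr r B) s := by
    intro r s hs
    rw [conjSer_apply, conjSer_apply]
    refine Finset.sum_congr rfl fun p hp => ?_
    rw [mem_antidiagonal] at hp
    rw [htr r B _ (by omega)]
    exact conj_congr hL0 (htL0 r) _ fun k hk => (htr r L k (by omega)).symm
  -- The unknown `B_r` enters order `r` of the transported series only untransported, as the term
  -- `(0, r)`. The unknown `L_r` could enter only through the transport of `B_0 = 0`.
  have hCr : ∀ r, r ≠ 0 → conjSer L B r = conjSer (tr r L) (tr r B) r + B r := by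
    intro r hr
    rw [conjSer_apply, conjSer_apply, Finset.sum_eq_add_sum_sdiff_singleton_of_mem
      (i := ((0, r) : ℕ × ℕ)) (by simp), Finset.sum_eq_add_sum_sdiff_singleton_of_mem
      (i := ((0, r) : ℕ × ℕ)) (s := antidiagonal r) (f := fun p => conj (tr r L) (tr r B p.2) p.1)
      (by simp), conj_zero, conj_zero]
    have h0 : tr r B r = 0 := by simp [tr]
    rw [h0, zero_add, add_comm]
    congr 1
    refine Finset.sum_congr rfl fun p hp => ?_
    rw [Finset.mem_sdiff, mem_antidiagonal, Finset.mem_singleton] at hp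
    have hp1 : p.1 ≠ 0 := fun h => hp.2 (Prod.ext h (by have := hp.1; simp only; omega))
    rw [htr r B _ (by omega)]
    rcases Nat.eq_zero_or_pos p.2 with h | h
    · rw [h, hB0, conj_apply_zero hL0, conj_apply_zero (htL0 r)]
    · exact conj_congr hL0 (htL0 r) _ fun k hk => (htr r L k (by omega)).symm
  refine ⟨L, B, hL0, hB0, fun r => by rw [hx1, a.ev_J], hSL, hdB, ?_⟩
  ext r
  rcases Nat.eq_zero_or_pos r with h | h
  · rw [h, map_apply, hL0]
    simp [lie_apply, hL0]
  · have hr : (r : ℝ) ≠ 0 := by positivity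
    -- Neither factor has a constant term, so only orders strictly below `r` occur and truncation is
    -- harmless.
    have h5 : ⁅tr r L, monomialOne A - conjSer (tr r L) (tr r B)⁆ r =
        ⁅L, monomialOne A - conjSer L B⁆ r := by
      simp only [lie_apply]
      refine Finset.sum_congr rfl fun p hp => ?_
      rw [mem_antidiagonal] at hp
      rcases Nat.eq_zero_or_pos p.1 with h1 | h1
      · rw [h1, hL0, htL0, zero_lie, zero_lie]
      rcases Nat.eq_zero_or_pos p.2 with h2 | h2
      · rw [h2, coeff_sub, coeff_sub, conjSer_zero, conjSer_zero, hB0]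
        simp [tr, hB0]
      · rw [htr r L _ (by omega), coeff_sub, coeff_sub, hC r p.2 (by omega)]
    have h6 : (r : ℝ) • B r = a.μ (R r (tr r L) (tr r B)) := by
      rw [hx2, smul_smul, mul_inv_cancel₀ hr, one_smul]
    rw [map_apply, hx1, a.d_J, ← h6]
    simp only [R, coeff_add, coeff_sub, euler_apply, map_sub]
    rw [h5, hCr r h.ne', ← euler_apply (monomialOne A) r, euler_monomialOne, smul_add]
    abel

variable {a} {A : 𝔏} {L B : Ser 𝔏}

namespace IsAveraged

theorem conjSer_zero (h : a.IsAveraged A L B) : conjSer L B 0 = 0 := by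
  rw [Ser.conjSer_zero, h.B_zero]

theorem sub_conjSer_zero (h : a.IsAveraged A L B) : (monomialOne A - conjSer L B) 0 = 0 := by
  rw [coeff_sub, h.conjSer_zero]; simp

theorem map_S_L (h : a.IsAveraged A L B) : map a.S L = L := Ser.ext h.S_L

/-- Since `L` vanishes at time zero, the transport is the identity there. -/
theorem map_ev (h : a.IsAveraged A L B) : map a.ev (conjSer L B) = B := by
  ext r
  rw [map_apply, map_conjSer_of_lie_eq_zero h.L_zero (fun s m => by
    rw [a.ev_lie, h.ev_L, zero_lie]), a.ev_of_d _ (h.d_B r)]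

theorem map_S (h : a.IsAveraged A L B) : map a.S (conjSer L B) = conjSer L B :=
  map_conjSer_of_hom h.L_zero a.S_lie h.map_S_L fun r => a.S_of_d _ (h.d_B r)

/-- This is `∂C = -[U, C]` for `U = ε A - C`, and `[C, C] = 0`. -/
theorem map_d (h : a.IsAveraged A L B) :
    map a.d (conjSer L B) = ⁅conjSer L B, monomialOne A⁆ := by
  rw [map_conjSer h.L_zero h.sub_conjSer_zero a.d_lie h.d_L h.d_B, lie_skew, lie_sub, lie_self,
    sub_zero]

/-- If a derivation `D` that commutes with the time derivative annihilates `A`, then it annihilates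
the transported averaged series. -/
theorem derivation_conjSer (h : a.IsAveraged A L B) {D : 𝔏 →ₗ[ℝ] 𝔏}
    (hD : ∀ x y, D ⁅x, y⁆ = ⁅D x, y⁆ + ⁅x, D y⁆) (hDd : ∀ x, D (a.d x) = a.d (D x))
    (hDS : ∀ x, a.S x = x → a.S (D x) = D x) (hA : D A = 0) : map D (conjSer L B) = 0 := by
  set C := conjSer L B with hC
  set U := monomialOne A - C with hU
  have hmapd : ∀ X : Ser 𝔏, map D (map a.d X) = map a.d (map D X) := fun X => by
    ext r; exact hDd _
  have hDA : map D (monomialOne A) = 0 := by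
    rw [map_monomialOne, hA]; ext r; simp [monomialOne]
  have hc : map a.d (map D C) = ⁅map D C, monomialOne A⁆ := by
    rw [← hmapd, h.map_d, map_lie hD, hDA, lie_zero, add_zero]
  set l := map D L with hl
  have hl' : map a.d l = -euler (map D C) + ⁅l, U⁆ - ⁅L, map D C⁆ := by
    have e : map D U = -map D C := by rw [hU, map_sub, hDA, zero_sub]
    rw [hl, ← hmapd, h.d_L, map_add, map_euler, map_lie hD, e, lie_neg, map_neg]
    abel
  -- `P` solves the homogeneous equation with the initial value of `l = D L`; subtracting it makes
  -- the remainder vanish at time zero.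
  set P := conjSer L (map a.ev l) with hP
  have hP' : map a.d P = ⁅P, U⁆ := by
    rw [hP, map_conjSer (Y := map a.ev l) h.L_zero h.sub_conjSer_zero a.d_lie h.d_L
      (fun r => a.d_ev _), lie_skew]
  have hm' : map a.d (l - P) = -euler (map D C) + ⁅l - P, U⁆ - ⁅L, map D C⁆ := by
    rw [map_sub, hl', hP', sub_lie]; abel
  have hev : ∀ r, a.ev ((l - P) r) = 0 := fun r => by
    rw [coeff_sub, map_sub, hP, map_conjSer_of_lie_eq_zero h.L_zero (fun s m => by
      rw [a.ev_lie, h.ev_L, zero_lie]), map_apply, a.ev_of_d _ (a.d_ev _), sub_self]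
  have hSl : ∀ r, a.S ((l - P) r) = (l - P) r := fun r => by
    have h1 : a.S (P r) = P r := congrFun (map_conjSer_of_hom h.L_zero a.S_lie h.map_S_L
      fun r => a.S_of_d _ (a.d_ev _)) r
    rw [coeff_sub, map_sub, h1, hl, map_apply, hDS _ (h.S_L r)]
  -- If all lower orders vanish, `(D C)_r` is constant in time and `∂(l - P)_r = -r (D C)_r`. As `l
  -- - P` is periodic, the mean of its derivative is zero, so `r (D C)_r = 0`. Then `(l - P)_r` is
  -- constant, hence equal to its initial value `0`.
  have key : ∀ r, map D C r = 0 ∧ (l - P) r = 0 := by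
    intro r
    induction r using Nat.strong_induction_on with
    | _ r ih =>
      have h1 : a.d (map D C r) = 0 := by
        have := congrFun hc r
        rwa [lie_apply_eq_zero' (fun s hs => (ih s hs).1) (monomialOne_zero A)] at this
      have h2 : a.d ((l - P) r) = -((r : ℝ) • map D C r) := by
        have := congrFun hm' r
        rwa [coeff_sub, coeff_add, lie_apply_eq_zero' (fun s hs => (ih s hs).2)
          h.sub_conjSer_zero, lie_apply_eq_zero h.L_zero (fun s hs => (ih s hs).1), add_zero,
          sub_zero] at this
      have h3 : (r : ℝ) • map D C r = 0 := by
        have := a.μ_d _ (hSl r)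
        rwa [h2, map_neg, neg_eq_zero, map_smul, a.μ_of_d _ h1] at this
      have h4 : (l - P) r = 0 := by
        rw [h3, neg_zero] at h2
        rw [← a.ev_of_d _ h2, hev]
      refine ⟨?_, h4⟩
      rcases Nat.eq_zero_or_pos r with h0 | h0
      · rw [h0, map_apply, hC, h.conjSer_zero, map_zero]
      · exact (smul_eq_zero.1 h3).resolve_left (by positivity)
  ext r
  exact (key r).1

end IsAveraged

end Averaging

/-! ### The secular solution, polynomial in time -/

namespace Averaging

open Ser Finset.HasAntidiagonal

variable {𝔏 : Type*} [LieRing 𝔏] [LieAlgebra ℝ 𝔏] {a : Averaging 𝔏} {A : 𝔏} {L B : Ser 𝔏}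

omit [LieAlgebra ℝ 𝔏] in
theorem lie_monomialOne_succ (X : Ser 𝔏) (s : ℕ) : ⁅X, monomialOne A⁆ (s + 1) = ⁅X s, A⁆ := by
  rw [lie_apply, Finset.sum_eq_single_of_mem (s, 1) (by simp)]
  · simp
  · rintro ⟨p, q⟩ hp hne
    have : q ≠ 1 := fun h => hne (by simp only [mem_antidiagonal] at hp; ext <;> simp <;> omega)
    simp [monomialOne, this]

/-- Multiplication by time. -/
structure IsTimeMul (a : Averaging 𝔏) (θ : 𝔏 →ₗ[ℝ] 𝔏) : Prop where
  d_θ : ∀ x : 𝔏, a.d (θ x) = x + θ (a.d x)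
  lie_θ : ∀ x y : 𝔏, ⁅x, θ y⁆ = θ ⁅x, y⁆
  ev_θ : ∀ x : 𝔏, a.ev (θ x) = 0

namespace IsTimeMul

variable {θ : 𝔏 →ₗ[ℝ] 𝔏}

theorem d_pow (h : a.IsTimeMul θ) (k : ℕ) (x : 𝔏) :
    a.d ((θ ^ (k + 1)) x) = (k + 1 : ℝ) • (θ ^ k) x + (θ ^ (k + 1)) (a.d x) := by
  induction k with
  | zero => simp [h.d_θ]
  | succ k ih =>
    rw [pow_succ', Module.End.mul_apply, h.d_θ, ih, map_add, map_smul, ← Module.End.mul_apply,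
      ← Module.End.mul_apply, ← pow_succ', ← pow_succ', Nat.cast_succ]
    module

theorem lie_pow (h : a.IsTimeMul θ) (k : ℕ) (x y : 𝔏) :
    ⁅x, (θ ^ k) y⁆ = (θ ^ k) ⁅x, y⁆ := by
  induction k with
  | zero => simp
  | succ k ih => rw [pow_succ', Module.End.mul_apply, h.lie_θ, ih, Module.End.mul_apply]

theorem lie_map_pow (h : a.IsTimeMul θ) (k : ℕ) (X Y : Ser 𝔏) :
    ⁅X, map (θ ^ k) Y⁆ = map (θ ^ k) ⁅X, Y⁆ := by
  ext r
  simp [lie_apply, h.lie_pow]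

end IsTimeMul

namespace IsAveraged

/-- The iterated brackets of the transported averaged series with the transport of its Euler
derivative. -/
noncomputable def iter (L B : Ser 𝔏) : ℕ → Ser 𝔏
  | 0 => euler (conjSer L B) + ⁅L, conjSer L B⁆
  | k + 1 => ⁅conjSer L B, iter L B k⁆

/-- The iterates are transports of the time-independent series `(ad B)^k (ε dB/dε)`, which is why
they obey this law. The computation uses zero curvature for `k = 0` and then the Leibniz rule. -/
theorem map_d_iter (h : a.IsAveraged A L B) (k : ℕ) :
    map a.d (iter L B k) = ⁅iter L B k, monomialOne A - conjSer L B⁆ := by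
  have hC := h.map_d
  have hL := h.d_L
  set C := conjSer L B with hCdef
  set A₁ := monomialOne A with hA₁
  induction k with
  | zero =>
    rw [iter, ← hCdef, map_add, map_euler, map_lie a.d_lie, hC, hL, euler_lie, map_sub, hA₁,
      euler_monomialOne, ← hA₁]
    simp only [add_lie, sub_lie, lie_sub, leibniz_lie L C A₁]
    rw [← lie_skew A₁ C, ← lie_skew C ⁅L, A₁⁆]
    abel
  | succ k ih =>
    rw [iter, ← hCdef, map_lie a.d_lie, hC, ih, leibniz_lie C (iter L B k), lie_sub C,
      lie_self, sub_zero, ← lie_skew _ ⁅C, A₁⁆]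
    abel

theorem map_S_iter (h : a.IsAveraged A L B) (k : ℕ) :
    map a.S (iter L B k) = iter L B k := by
  induction k with
  | zero => rw [iter, map_add, map_euler, map_lie_of_hom a.S_lie, h.map_S, h.map_S_L]
  | succ k ih => rw [iter, map_lie_of_hom a.S_lie, h.map_S, ih]

/-- Every bracket with `C` raises the order by at least one. Hence only finitely many powers of time
occur at each order. -/
theorem iter_eq_zero (h : a.IsAveraged A L B) {k r : ℕ} (hr : r ≤ k) : iter L B k r = 0 := by
  induction k generalizing r with
  | zero =>
    rw [Nat.le_zero.1 hr, iter, coeff_add, lie_apply_eq_zero h.L_zero (by simp)]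
    simp
  | succ k ih =>
    rw [iter]
    exact lie_apply_eq_zero h.conjSer_zero fun s hs => ih (by omega)

theorem ev_iter_zero (h : a.IsAveraged A L B) (r : ℕ) : a.ev (iter L B 0 r) = (r : ℝ) • B r := by
  have h1 : a.ev (conjSer L B r) = B r := congrFun h.map_ev r
  rw [iter, coeff_add, map_add, euler_apply, map_smul, h1, lie_apply, map_sum,
    Finset.sum_eq_zero (fun p _ => by rw [a.ev_lie, h.ev_L, zero_lie]), add_zero]

/-- The solution of `∂Λ = ε A + ⁅Λ, ε A⁆`, `Λ(0) = 0`, as a polynomial in time with periodic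
coefficients. -/
theorem exists_secular (h : a.IsAveraged A L B) {θ : 𝔏 →ₗ[ℝ] 𝔏} (hθ : a.IsTimeMul θ) (R : ℕ) :
    ∃ (Λ : ℕ → 𝔏) (Z : ℕ → ℕ → 𝔏),
      (∀ r, Λ r = L r + ∑ k ∈ Finset.range R, (θ ^ (k + 1)) (Z k r)) ∧
      (∀ k r, a.S (Z k r) = Z k r) ∧ (∀ r, a.ev (Z 0 r) = (r : ℝ) • B r) ∧
      (∀ r, a.ev (Λ r) = 0) ∧ (1 ≤ R → a.d (Λ 1) = A) ∧
      ∀ s, 1 ≤ s → s < R → a.d (Λ (s + 1)) = ⁅Λ s, A⁆ := by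
  set C := conjSer L B with hC
  set A₁ := monomialOne A with hA₁
  set X := iter L B with hX
  -- These are the coefficients of `(1 - e^{-θz})/z` in powers of `θ`, with `z = ad C` acting on the
  -- iterate of index `0`.
  let c : ℕ → ℝ := fun k => (-1) ^ k / (k + 1).factorial
  let Y : ℕ → Ser 𝔏 := fun R => ∑ k ∈ Finset.range R, c k • map (θ ^ (k + 1)) (X k)
  -- Truncating this exponential series leaves one defect term, `θ^R` times the `R`-th iterate,
  -- which vanishes at all orders up to `R`.
  have hY : ∀ R, map a.d (Y R) = X 0 - ⁅C, Y R⁆ + ⁅Y R, A₁ - C⁆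
      - ((-1) ^ R / R.factorial : ℝ) • map (θ ^ R) (X R) := by
    intro R
    induction R with
    | zero =>
      ext r
      simp [Y]
    | succ R ih =>
      have hYs : Y (R + 1) = Y R + c R • map (θ ^ (R + 1)) (X R) := Finset.sum_range_succ _ _
      have h1 : map a.d (map (θ ^ (R + 1)) (X R)) = (R + 1 : ℝ) • map (θ ^ R) (X R) +
          ⁅map (θ ^ (R + 1)) (X R), A₁ - C⁆ := by
        rw [← lie_skew, hθ.lie_map_pow, ← map_neg, lie_skew, ← h.map_d_iter]
        ext r
        simp only [map_apply, hθ.d_pow, coeff_add, coeff_smul]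
        rfl
      have h2 : ⁅C, map (θ ^ (R + 1)) (X R)⁆ = map (θ ^ (R + 1)) (X (R + 1)) := by
        rw [hθ.lie_map_pow]; rfl
      have h3 : c R * (R + 1) = (-1) ^ R / R.factorial := by
        simp only [c, Nat.factorial_succ, Nat.cast_mul, Nat.cast_succ]
        field_simp
      have h4 : ((-1) ^ (R + 1) / (R + 1).factorial : ℝ) = -c R := by
        simp only [c]; ring
      rw [hYs, map_add, ih, map_smul, h1, lie_add, add_lie, lie_smul, smul_lie, h2, smul_add,
        smul_smul, h3, h4, neg_smul]
      abel
  have hS : ∀ k r, a.S (X k r) = X k r := fun k r => congrFun (h.map_S_iter k) r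
  have hYr : ∀ r, Y R r = ∑ k ∈ Finset.range R, (θ ^ (k + 1)) (c k • X k r) := by
    intro r
    have : ∀ R, Y R r = ∑ k ∈ Finset.range R, (θ ^ (k + 1)) (c k • X k r) := by
      intro R
      induction R with
      | zero => simp [Y]
      | succ R ih =>
        have hYs : Y (R + 1) = Y R + c R • map (θ ^ (R + 1)) (X R) := Finset.sum_range_succ _ _
        rw [hYs, coeff_add, ih, Finset.sum_range_succ]
        simp
    exact this R
  have hd : ∀ r ≤ R, a.d ((L + Y R) r) = A₁ r + ⁅L + Y R, A₁⁆ r := by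
    intro r hr
    have h1 : map a.d (L + Y R) = A₁ + ⁅L + Y R, A₁⁆
        - ((-1) ^ R / R.factorial : ℝ) • map (θ ^ R) (X R) := by
      have h2 : X 0 = euler C + ⁅L, C⁆ := rfl
      rw [map_add, h.d_L, hY, h2, ← hC, ← hA₁, map_sub, hA₁, euler_monomialOne, ← hA₁, add_lie,
        lie_sub, lie_sub, ← lie_skew C (Y R)]
      abel
    have h3 := congrFun h1 r
    rw [map_apply] at h3
    rw [h3]
    simp [hX, h.iter_eq_zero hr]
  have hev : ∀ r, a.ev ((L + Y R) r) = 0 := by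
    intro r
    rw [coeff_add, map_add, h.ev_L, hYr, map_sum, zero_add]
    refine Finset.sum_eq_zero fun k _ => ?_
    rw [pow_succ', Module.End.mul_apply, hθ.ev_θ]
  refine ⟨L + Y R, fun k r => c k • X k r, fun r => ?_, fun k r => ?_, fun r => ?_, hev,
    fun hR => ?_, fun s hs hsR => ?_⟩
  · rw [coeff_add, hYr]
  · rw [map_smul, hS]
  · rw [map_smul, hX, h.ev_iter_zero]; simp [c]
  · rw [hd 1 hR, lie_monomialOne_succ (s := 0)]
    have : (L + Y R) 0 = 0 := by
      rw [coeff_add, h.L_zero, hYr, zero_add]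
      exact Finset.sum_eq_zero fun k _ => by rw [hX, h.iter_eq_zero (Nat.zero_le k)]; simp
    rw [this]; simp [hA₁]
  · rw [hd _ (by omega), lie_monomialOne_succ]
    have : A₁ (s + 1) = 0 := by
      rw [hA₁]; simp only [monomialOne]; rw [if_neg (by omega)]
    rw [this, zero_add]

end IsAveraged

end Averaging

/-! ### Smooth maps and time-dependent vector fields -/

section SmoothMaps

/-- The submodule of smooth maps. -/
def smoothMaps (P V : Type*) [NormedAddCommGroup P] [NormedSpace ℝ P] [NormedAddCommGroup V]
    [NormedSpace ℝ V] : Submodule ℝ (P → V) where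
  carrier := {f | ContDiff ℝ ∞ f}
  add_mem' {f g} (hf : ContDiff ℝ ∞ f) (hg : ContDiff ℝ ∞ g) := hf.add hg
  zero_mem' := show ContDiff ℝ ∞ fun _ : P => (0 : V) from contDiff_const
  smul_mem' _ {f} (hf : ContDiff ℝ ∞ f) := contDiff_const.smul hf

/-- Smooth maps. -/
def SmoothMap (P V : Type*) [NormedAddCommGroup P] [NormedSpace ℝ P] [NormedAddCommGroup V]
    [NormedSpace ℝ V] : Type _ :=
  ↥(smoothMaps P V)

variable {P V W : Type*} [NormedAddCommGroup P] [NormedSpace ℝ P] [NormedAddCommGroup V]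
  [NormedSpace ℝ V] [NormedAddCommGroup W] [NormedSpace ℝ W]

namespace SmoothMap

instance : AddCommGroup (SmoothMap P V) := inferInstanceAs (AddCommGroup (smoothMaps P V))
noncomputable instance : Module ℝ (SmoothMap P V) := inferInstanceAs (Module ℝ (smoothMaps P V))

/-- The smooth map with given values. -/
noncomputable def mk (f : P → V) (hf : ContDiff ℝ ∞ f) : SmoothMap P V := ⟨f, hf⟩

@[simp] theorem mk_val (f : P → V) (hf : ContDiff ℝ ∞ f) (p : P) : (mk f hf).1 p = f p := rfl

theorem contDiff (f : SmoothMap P V) : ContDiff ℝ ∞ f.1 := f.2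

theorem differentiableAt (f : SmoothMap P V) (p : P) : DifferentiableAt ℝ f.1 p :=
  (f.contDiff.differentiable (by simp)) p

theorem ext_apply {f g : SmoothMap P V} (h : ∀ p, f.1 p = g.1 p) : f = g :=
  Subtype.ext (funext h)

@[simp] theorem add_val (f g : SmoothMap P V) (p : P) : (f + g).1 p = f.1 p + g.1 p := rfl
@[simp] theorem sub_val (f g : SmoothMap P V) (p : P) : (f - g).1 p = f.1 p - g.1 p := rfl
@[simp] theorem neg_val (f : SmoothMap P V) (p : P) : (-f).1 p = -f.1 p := rfl
@[simp] theorem smul_val (c : ℝ) (f : SmoothMap P V) (p : P) : (c • f).1 p = c • f.1 p := rfl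
@[simp] theorem zero_val (p : P) : (0 : SmoothMap P V).1 p = 0 := rfl
@[simp] theorem sum_val {ι : Type*} (s : Finset ι) (f : ι → SmoothMap P V) (p : P) :
    (∑ i ∈ s, f i).1 p = ∑ i ∈ s, (f i).1 p := by
  induction s using Finset.cons_induction with
  | empty => rfl
  | cons a s ha ih => rw [Finset.sum_cons, Finset.sum_cons, add_val, ih]

theorem fderiv_add (f g : SmoothMap P V) (p : P) :
    fderiv ℝ (f + g).1 p = fderiv ℝ f.1 p + fderiv ℝ g.1 p :=
  _root_.fderiv_add (f.differentiableAt p) (g.differentiableAt p)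

theorem fderiv_smul (c : ℝ) (f : SmoothMap P V) (p : P) :
    fderiv ℝ (c • f).1 p = c • fderiv ℝ f.1 p :=
  fderiv_const_smul (f.differentiableAt p) c

/-- The derivative `X · g` of `g` in the direction of the vector field `X`. -/
noncomputable def lieDeriv (X : SmoothMap P P) : SmoothMap P V →ₗ[ℝ] SmoothMap P V where
  toFun g := mk (fun p => fderiv ℝ g.1 p (X.1 p))
    ((g.contDiff.fderiv_right (m := ∞) (by simp)).clm_apply X.contDiff)
  map_add' f g := ext_apply fun p => by simp [fderiv_add]
  map_smul' c g := ext_apply fun p => by simp [fderiv_smul]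

theorem lieDeriv_apply (X : SmoothMap P P) (g : SmoothMap P V) (p : P) :
    (lieDeriv X g).1 p = fderiv ℝ g.1 p (X.1 p) := rfl

theorem lieDeriv_add_left (X Y : SmoothMap P P) (g : SmoothMap P V) :
    lieDeriv (X + Y) g = lieDeriv X g + lieDeriv Y g :=
  ext_apply fun p => by simp [lieDeriv_apply]

theorem lieDeriv_smul_left (c : ℝ) (X : SmoothMap P P) (g : SmoothMap P V) :
    lieDeriv (c • X) g = c • lieDeriv X g :=
  ext_apply fun p => by simp [lieDeriv_apply]

theorem lieDeriv_zero_left (g : SmoothMap P V) : lieDeriv 0 g = 0 :=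
  ext_apply fun p => by simp [lieDeriv_apply]

theorem lieDeriv_lieDeriv_apply (X Y : SmoothMap P P) (g : SmoothMap P V) (p : P) :
    (lieDeriv X (lieDeriv Y g)).1 p = fderiv ℝ (fderiv ℝ g.1) p (X.1 p) (Y.1 p) +
      fderiv ℝ g.1 p (fderiv ℝ Y.1 p (X.1 p)) := by
  have h1 : DifferentiableAt ℝ (fderiv ℝ g.1) p :=
    (g.contDiff.fderiv_right (m := ∞) (by simp)).differentiable (by simp) p
  have h2 := h1.hasFDerivAt.clm_apply (Y.differentiableAt p).hasFDerivAt
  rw [lieDeriv_apply]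
  have h3 : fderiv ℝ (lieDeriv Y g).1 p = _ := h2.fderiv
  rw [h3]
  simp [add_comm]

/-- The commutator of two directional derivatives. -/
theorem lieDeriv_comm (X Y : SmoothMap P P) (g : SmoothMap P V) :
    lieDeriv X (lieDeriv Y g) =
      lieDeriv Y (lieDeriv X g) + lieDeriv (lieDeriv X Y - lieDeriv Y X) g := by
  refine ext_apply fun p => ?_
  have hs : IsSymmSndFDerivAt ℝ g.1 p :=
    (g.contDiff.contDiffAt).isSymmSndFDerivAt
      (by simpa using WithTop.coe_le_coe.2 (le_top (a := (2 : ℕ∞))))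
  rw [add_val, lieDeriv_lieDeriv_apply, lieDeriv_lieDeriv_apply, lieDeriv_apply, sub_val,
    lieDeriv_apply, lieDeriv_apply, map_sub, hs.eq (X.1 p) (Y.1 p)]
  abel

/-- Postcomposition with a continuous linear map. -/
noncomputable def postcomp (ℓ : V →L[ℝ] W) : SmoothMap P V →ₗ[ℝ] SmoothMap P W where
  toFun g := mk (fun p => ℓ (g.1 p)) (ℓ.contDiff.comp g.contDiff)
  map_add' f g := ext_apply fun p => by simp
  map_smul' c g := ext_apply fun p => by simp

theorem postcomp_apply (ℓ : V →L[ℝ] W) (g : SmoothMap P V) (p : P) :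
    (postcomp ℓ g).1 p = ℓ (g.1 p) := rfl

theorem lieDeriv_postcomp (X : SmoothMap P P) (ℓ : V →L[ℝ] W) (g : SmoothMap P V) :
    lieDeriv X (postcomp ℓ g) = postcomp ℓ (lieDeriv X g) := by
  refine ext_apply fun p => ?_
  rw [postcomp_apply, lieDeriv_apply, lieDeriv_apply]
  have h : fderiv ℝ (postcomp ℓ g).1 p = _ :=
    (ℓ.hasFDerivAt.comp p (g.differentiableAt p).hasFDerivAt).fderiv
  rw [h]; rfl

/-- Precomposition with a smooth map. -/
noncomputable def precomp (σ : SmoothMap W P) : SmoothMap P V →ₗ[ℝ] SmoothMap W V where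
  toFun g := mk (fun q => g.1 (σ.1 q)) (g.contDiff.comp σ.contDiff)
  map_add' _ _ := rfl
  map_smul' _ _ := rfl

theorem precomp_apply (σ : SmoothMap W P) (g : SmoothMap P V) (q : W) :
    (precomp σ g).1 q = g.1 (σ.1 q) := rfl

theorem fderiv_precomp (σ : SmoothMap W P) (g : SmoothMap P V) (q v : W) :
    fderiv ℝ (precomp σ g).1 q v = fderiv ℝ g.1 (σ.1 q) (fderiv ℝ σ.1 q v) := by
  have h : fderiv ℝ (precomp σ g).1 q = _ :=
    ((g.differentiableAt (σ.1 q)).hasFDerivAt.comp q (σ.differentiableAt q).hasFDerivAt).fderiv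
  rw [h]; rfl

/-- The constant map. -/
noncomputable def const (v : V) : SmoothMap P V := mk (fun _ => v) contDiff_const

@[simp] theorem const_val (v : V) (p : P) : (const v : SmoothMap P V).1 p = v := rfl

@[simp] theorem lieDeriv_const (X : SmoothMap P P) (v : V) : lieDeriv X (const v) = 0 :=
  ext_apply fun p => by
    have : (const v : SmoothMap P V).1 = fun _ => v := rfl
    simp [lieDeriv_apply, this]

end SmoothMap

end SmoothMaps

/-! ### The Lie algebra of time-dependent vector fields -/

section TimeField

open SmoothMap

variable {E V : Type*} [NormedAddCommGroup E] [NormedSpace ℝ E] [NormedAddCommGroup V]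
  [NormedSpace ℝ V]

/-- Smooth time-dependent vector fields `(τ, y) ↦ X(τ, y)`. -/
abbrev TimeField (E : Type*) [NormedAddCommGroup E] [NormedSpace ℝ E] : Type _ :=
  SmoothMap (ℝ × E) E

/-- Smooth functions of `(t, τ, y)`. -/
abbrev TwoTimeMap (E V : Type*) [NormedAddCommGroup E] [NormedSpace ℝ E] [NormedAddCommGroup V]
    [NormedSpace ℝ V] : Type _ :=
  SmoothMap (ℝ × ℝ × E) V

namespace TimeField

/-- The vector field `(0, X)` on space-time. -/
noncomputable def lift : TimeField E →ₗ[ℝ] SmoothMap (ℝ × E) (ℝ × E) :=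
  postcomp (ContinuousLinearMap.inr ℝ ℝ E)

@[simp] theorem lift_val (X : TimeField E) (p : ℝ × E) : (lift X).1 p = (0, X.1 p) := rfl

/-- The vector field `(0, 0, X)` on `(t, τ, y)`-space. -/
noncomputable def liftTwo : TimeField E →ₗ[ℝ] SmoothMap (ℝ × ℝ × E) (ℝ × ℝ × E) :=
  (postcomp (ContinuousLinearMap.inr ℝ ℝ (ℝ × E))).comp
    ((precomp (.mk Prod.snd contDiff_snd)).comp lift)

noncomputable instance : Bracket (TimeField E) (TimeField E) :=
  ⟨fun X Y => lieDeriv (lift X) Y - lieDeriv (lift Y) X⟩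

theorem lie_def (X Y : TimeField E) : ⁅X, Y⁆ = lieDeriv (lift X) Y - lieDeriv (lift Y) X := rfl

theorem lie_val (X Y : TimeField E) (p : ℝ × E) :
    (⁅X, Y⁆ : TimeField E).1 p = fderiv ℝ Y.1 p (0, X.1 p) - fderiv ℝ X.1 p (0, Y.1 p) := rfl

theorem lift_lie (X Y : TimeField E) :
    lift ⁅X, Y⁆ = lieDeriv (lift X) (lift Y) - lieDeriv (lift Y) (lift X) := by
  rw [lie_def, map_sub, lift, ← lieDeriv_postcomp, ← lieDeriv_postcomp]

theorem lieDeriv_lift_comm (X Y : TimeField E) (g : SmoothMap (ℝ × E) V) :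
    lieDeriv (lift X) (lieDeriv (lift Y) g) =
      lieDeriv (lift Y) (lieDeriv (lift X) g) + lieDeriv (lift ⁅X, Y⁆) g := by
  rw [lieDeriv_comm, lift_lie]

noncomputable instance : LieRing (TimeField E) where
  add_lie X Y Z := by
    simp only [lie_def, map_add, lieDeriv_add_left]; abel
  lie_add X Y Z := by
    simp only [lie_def, map_add, lieDeriv_add_left]; abel
  lie_self X := by simp [lie_def]
  leibniz_lie X Y Z := by
    have h1 := lieDeriv_lift_comm X Y Z
    have h2 := lieDeriv_lift_comm Y Z X
    have h3 := lieDeriv_lift_comm X Z Y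
    rw [lie_def X ⁅Y, Z⁆, lie_def ⁅X, Y⁆ Z, lie_def Y ⁅X, Z⁆, ← sub_eq_iff_eq_add'.2 h1,
      ← sub_eq_iff_eq_add'.2 h2, ← sub_eq_iff_eq_add'.2 h3]
    simp only [lie_def, map_sub]
    abel

noncomputable instance : LieAlgebra ℝ (TimeField E) where
  lie_smul c X Y := by
    simp only [lie_def, map_smul, lieDeriv_smul_left, smul_sub]

noncomputable instance : Bracket (TimeField E) (TwoTimeMap E V) :=
  ⟨fun X g => lieDeriv (liftTwo X) g⟩

theorem act_def (X : TimeField E) (g : TwoTimeMap E V) : ⁅X, g⁆ = lieDeriv (liftTwo X) g := rfl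

theorem act_val (X : TimeField E) (g : TwoTimeMap E V) (p : ℝ × ℝ × E) :
    (⁅X, g⁆ : TwoTimeMap E V).1 p = fderiv ℝ g.1 p (0, 0, X.1 p.2) := rfl

theorem liftTwo_lie (X Y : TimeField E) :
    liftTwo ⁅X, Y⁆ = lieDeriv (liftTwo X) (liftTwo Y) - lieDeriv (liftTwo Y) (liftTwo X) := by
  have h : ∀ X Y : TimeField E, lieDeriv (liftTwo X) (liftTwo Y) =
      postcomp (ContinuousLinearMap.inr ℝ ℝ (ℝ × E)) (precomp (.mk Prod.snd contDiff_snd)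
        (lieDeriv (lift X) (lift Y))) := by
    intro X Y
    rw [show liftTwo Y = postcomp (ContinuousLinearMap.inr ℝ ℝ (ℝ × E))
      (precomp (.mk Prod.snd contDiff_snd) (lift Y)) from rfl, lieDeriv_postcomp]
    congr 1
    refine ext_apply fun p => ?_
    rw [lieDeriv_apply, fderiv_precomp, precomp_apply, lieDeriv_apply]
    congr 1
    change fderiv ℝ Prod.snd p _ = _
    rw [fderiv_snd]; rfl
  rw [h, h, ← map_sub, ← map_sub, ← lift_lie]; rfl

noncomputable instance : LieRingModule (TimeField E) (TwoTimeMap E V) where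
  add_lie X Y g := by simp only [act_def, map_add, lieDeriv_add_left]
  lie_add X f g := by simp only [act_def, map_add]
  leibniz_lie X Y g := by
    simp only [act_def]
    rw [lieDeriv_comm, ← liftTwo_lie, add_comm]

noncomputable instance : LieModule ℝ (TimeField E) (TwoTimeMap E V) where
  smul_lie c X g := by simp only [act_def, map_smul, lieDeriv_smul_left]
  lie_smul c X g := by simp only [act_def, map_smul]

/-- The time derivative. -/
noncomputable def ddt : SmoothMap (ℝ × E) V →ₗ[ℝ] SmoothMap (ℝ × E) V :=
  lieDeriv (const (1, 0))

theorem hasDerivAt (X : SmoothMap (ℝ × E) V) (τ : ℝ) (y : E) :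
    HasDerivAt (fun s => X.1 (s, y)) ((ddt X).1 (τ, y)) τ :=
  hasDerivAt_slice X.contDiff τ y

theorem eq_ddt {X Y : SmoothMap (ℝ × E) V}
    (h : ∀ τ y, HasDerivAt (fun s => X.1 (s, y)) (Y.1 (τ, y)) τ) : ddt X = Y :=
  ext_apply fun p => (hasDerivAt X p.1 p.2).unique (h p.1 p.2)

theorem ddt_lie (X Y : TimeField E) : ddt ⁅X, Y⁆ = ⁅ddt X, Y⁆ + ⁅X, ddt Y⁆ := by
  have h : ∀ X Y : TimeField E, ddt (lieDeriv (lift X) Y) =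
      lieDeriv (lift X) (ddt Y) + lieDeriv (lift (ddt X)) Y := by
    intro X Y
    rw [ddt, lieDeriv_comm, lieDeriv_const, sub_zero, lift, lieDeriv_postcomp]
  rw [lie_def, map_sub, h, h, lie_def, lie_def]
  abel

/-- The affine reparametrization of time `τ ↦ c τ + b`. -/
noncomputable def affineTime (E : Type*) [NormedAddCommGroup E] [NormedSpace ℝ E] (c b : ℝ) :
    SmoothMap (ℝ × E) (ℝ × E) :=
  mk (fun p => (c * p.1 + b, p.2))
    (((contDiff_const.mul contDiff_fst).add contDiff_const).prodMk contDiff_snd)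

@[simp] theorem affineTime_val (c b : ℝ) (p : ℝ × E) :
    (affineTime E c b).1 p = (c * p.1 + b, p.2) := rfl

/-- Affine reparametrization of time in a time-dependent map. -/
noncomputable def affine (c b : ℝ) : SmoothMap (ℝ × E) V →ₗ[ℝ] SmoothMap (ℝ × E) V :=
  precomp (affineTime E c b)

@[simp] theorem affine_val (c b : ℝ) (X : SmoothMap (ℝ × E) V) (p : ℝ × E) :
    (affine c b X).1 p = X.1 (c * p.1 + b, p.2) := rfl

theorem fderiv_affineTime (c b : ℝ) (p v : ℝ × E) :
    fderiv ℝ (affineTime E c b).1 p v = (c * v.1, v.2) := by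
  have h1 : HasFDerivAt (fun p : ℝ × E => (c * p.1 + b, p.2))
      ((c • ContinuousLinearMap.fst ℝ ℝ E).prod (ContinuousLinearMap.snd ℝ ℝ E)) p :=
    ((hasFDerivAt_fst.const_mul c).add_const b).prodMk hasFDerivAt_snd
  have h2 : fderiv ℝ (affineTime E c b).1 p = _ := h1.fderiv
  rw [h2]; rfl

theorem affine_lieDeriv (c b : ℝ) (X : TimeField E) (Y : SmoothMap (ℝ × E) V) :
    affine c b (lieDeriv (lift X) Y) = lieDeriv (lift (affine c b X)) (affine c b Y) := by
  refine ext_apply fun p => ?_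
  rw [lieDeriv_apply, affine, fderiv_precomp, fderiv_affineTime]
  simp [precomp_apply, lieDeriv_apply]

theorem affine_lie (c b : ℝ) (X Y : TimeField E) :
    affine c b ⁅X, Y⁆ = ⁅affine c b X, affine c b Y⁆ := by
  rw [lie_def, map_sub, affine_lieDeriv, affine_lieDeriv, lie_def]

theorem ddt_affine (c b : ℝ) (X : SmoothMap (ℝ × E) V) :
    ddt (affine c b X) = c • affine c b (ddt X) := by
  refine ext_apply fun p => ?_
  rw [ddt, lieDeriv_apply, affine, fderiv_precomp, fderiv_affineTime, smul_val, precomp_apply,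
    lieDeriv_apply, ← map_smul]
  simp

/-- With `c = 1` this says that constants are periodic, with `c = 0` that they equal their value at
any fixed time. -/
theorem affine_of_ddt_eq_zero (c b : ℝ) {X : SmoothMap (ℝ × E) V} (hX : ddt X = 0) :
    affine c b X = X := by
  refine ext_apply fun p => ?_
  have h : ∀ τ, HasDerivAt (fun s => X.1 (s, p.2)) 0 τ := fun τ => by
    have h1 := hasDerivAt X τ p.2
    rwa [hX] at h1
  exact is_const_of_deriv_eq_zero (fun τ => (h τ).differentiableAt) (fun τ => (h τ).deriv) _ _

/-- Multiplication by time. -/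
noncomputable def timeMul : SmoothMap (ℝ × E) V →ₗ[ℝ] SmoothMap (ℝ × E) V where
  toFun X := mk (fun p => p.1 • X.1 p) (contDiff_fst.smul X.contDiff)
  map_add' X Y := ext_apply fun p => by simp
  map_smul' c X := ext_apply fun p => smul_comm _ _ _

@[simp] theorem timeMul_val (X : SmoothMap (ℝ × E) V) (p : ℝ × E) :
    (timeMul X).1 p = p.1 • X.1 p := rfl

theorem fderiv_timeMul (X : SmoothMap (ℝ × E) V) (p v : ℝ × E) :
    fderiv ℝ (timeMul X).1 p v = p.1 • fderiv ℝ X.1 p v + v.1 • X.1 p := by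
  have h : fderiv ℝ (timeMul X).1 p = _ :=
    (hasFDerivAt_fst.smul (X.differentiableAt p).hasFDerivAt).fderiv
  rw [h]; simp

variable [FiniteDimensional ℝ E] [FiniteDimensional ℝ V]

/-- The primitive that vanishes at time zero. -/
noncomputable def primitive : SmoothMap (ℝ × E) V →ₗ[ℝ] SmoothMap (ℝ × E) V where
  toFun X := mk (fun p => ∫ s in (0 : ℝ)..p.1, X.1 (s, p.2)) (contDiff_primitive X.contDiff)
  map_add' X Y := ext_apply fun p => by
    have h : ∀ Z : SmoothMap (ℝ × E) V, Continuous fun s => Z.1 (s, p.2) := fun Z =>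
      Z.contDiff.continuous.comp (by fun_prop)
    exact intervalIntegral.integral_add ((h X).intervalIntegrable _ _)
      ((h Y).intervalIntegrable _ _)
  map_smul' c X := ext_apply fun p => intervalIntegral.integral_smul _ _

theorem primitive_val (X : SmoothMap (ℝ × E) V) (p : ℝ × E) :
    (primitive X).1 p = ∫ s in (0 : ℝ)..p.1, X.1 (s, p.2) := rfl

@[simp] theorem primitive_zero_val (X : SmoothMap (ℝ × E) V) (y : E) :
    (primitive X).1 (0, y) = 0 := by simp [primitive_val]

theorem ddt_primitive (X : SmoothMap (ℝ × E) V) : ddt (primitive X) = X := by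
  have : CompleteSpace V := FiniteDimensional.complete ℝ V
  exact eq_ddt fun τ y => hasDerivAt_primitive (f := fun s => X.1 (s, y))
    (X.contDiff.continuous.comp (by fun_prop)) τ

omit [FiniteDimensional ℝ E] [FiniteDimensional ℝ V] in
theorem eq_of_ddt_eq {X Y : SmoothMap (ℝ × E) V} (h : ddt X = ddt Y)
    (h0 : ∀ y, X.1 (0, y) = Y.1 (0, y)) : X = Y := by
  have h1 : ddt (X - Y) = 0 := by rw [map_sub, h, sub_self]
  have h2 := affine_of_ddt_eq_zero 0 0 h1
  rw [← sub_eq_zero, ← h2]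
  exact ext_apply fun p => by simp [h0]

/-- Averaging of smooth time-dependent vector fields over the period `2π`. -/
noncomputable def averaging (E : Type*) [NormedAddCommGroup E] [NormedSpace ℝ E]
    [FiniteDimensional ℝ E] : Averaging (TimeField E) where
  d := ddt
  S := affine 1 (2 * Real.pi)
  ev := affine 0 0
  J := primitive
  -- The mean is the primitive evaluated at one period, divided by the period.
  μ := (2 * Real.pi)⁻¹ • (affine 0 (2 * Real.pi)).comp primitive
  d_lie := ddt_lie
  S_lie := affine_lie _ _
  S_d X := by rw [ddt_affine, one_smul]
  ev_lie := affine_lie _ _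
  d_J := ddt_primitive
  ev_J X := ext_apply fun p => by simp
  d_ev X := by rw [ddt_affine, zero_smul]
  ev_of_d X hX := affine_of_ddt_eq_zero _ _ hX
  S_of_d X hX := affine_of_ddt_eq_zero _ _ hX
  d_μ X := by simp [ddt_affine]
  μ_of_d X hX := by
    -- For a time-independent field the primitive is multiplication by time, so dividing its value
    -- at `2π` by `2π` recovers the field.
    have h : primitive X = timeMul X := by
      refine eq_of_ddt_eq ?_ fun y => by simp
      refine (ddt_primitive X).trans (ext_apply fun p => ?_)
      rw [ddt, lieDeriv_apply, fderiv_timeMul]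
      have := congrArg (fun Z : TimeField E => Z.1 p) hX
      rw [ddt] at this
      simp only [lieDeriv_apply, const_val, zero_val] at this
      simp [this]
    refine ext_apply fun p => ?_
    have h2 := congrArg (fun Z : TimeField E => Z.1 p) (affine_of_ddt_eq_zero 0 (2 * Real.pi) hX)
    simp only [affine_val, zero_mul, zero_add] at h2
    have h3 : (2 * Real.pi)⁻¹ * (2 * Real.pi) = 1 := inv_mul_cancel₀ (by positivity)
    change (2 * Real.pi)⁻¹ • (affine 0 (2 * Real.pi) (primitive X)).1 p = _
    rw [h, affine_val, timeMul_val]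
    simp only [zero_mul, zero_add]
    rw [h2, smul_smul, h3, one_smul]
  μ_d X hX := by
    have h : primitive (ddt X) = X - affine 0 0 X := by
      refine eq_of_ddt_eq ?_ fun y => by simp
      rw [ddt_primitive, map_sub, ddt_affine, zero_smul, sub_zero]
    refine ext_apply fun p => ?_
    have h2 := congrArg (fun Z : TimeField E => Z.1 (0, p.2)) hX
    simp only [affine_val] at h2
    simp only [mul_zero, zero_add] at h2
    simp [h, h2]
  S_J X hX hμ := by
    refine eq_of_ddt_eq ?_ fun y => ?_
    · rw [ddt_affine, ddt_primitive, one_smul, hX]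
    · have h2 := congrArg (fun Z : TimeField E => Z.1 (0, y)) hμ
      simpa [Real.pi_ne_zero] using h2

theorem isTimeMul : (averaging E).IsTimeMul timeMul where
  d_θ X := by
    refine ext_apply fun p => ?_
    change (ddt _).1 p = X.1 p + p.1 • (ddt X).1 p
    rw [ddt, lieDeriv_apply, fderiv_timeMul, lieDeriv_apply]
    simp [add_comm]
  lie_θ X Y := by
    refine ext_apply fun p => ?_
    rw [timeMul_val, lie_val, lie_val, fderiv_timeMul]
    have : ((0 : ℝ), (timeMul Y).1 p) = p.1 • ((0 : ℝ), Y.1 p) := by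
      rw [timeMul_val, Prod.smul_mk, smul_zero]
    rw [this, map_smul, zero_smul, add_zero, smul_sub]
  ev_θ X := ext_apply fun p => by
    change (affine 0 0 (timeMul X)).1 p = 0
    simp

end TimeField

end TimeField

/-! ### Transport of series as a Lie morphism -/

namespace Ser

open Finset.HasAntidiagonal

theorem sum_antidiagonal_exchange {V : Type*} [AddCommMonoid V] (f : ℕ → ℕ → ℕ → ℕ → V) (r : ℕ) :
    ∑ p ∈ antidiagonal r, ∑ q ∈ antidiagonal p.2, ∑ s ∈ antidiagonal p.1, f s.1 q.1 s.2 q.2 =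
      ∑ p ∈ antidiagonal r, ∑ q ∈ antidiagonal p.1, ∑ s ∈ antidiagonal p.2,
        f q.1 q.2 s.1 s.2 := by
  simp only [Finset.sum_sigma']
  refine Finset.sum_nbij'
    (fun x => ⟨(x.2.2.1 + x.2.1.1, x.2.2.2 + x.2.1.2), (x.2.2.1, x.2.1.1), (x.2.2.2, x.2.1.2)⟩)
    (fun x => ⟨(x.2.1.1 + x.2.2.1, x.2.1.2 + x.2.2.2), (x.2.1.2, x.2.2.2), (x.2.1.1, x.2.2.1)⟩)
    ?_ ?_ ?_ ?_ ?_
  · rintro ⟨⟨a, b⟩, ⟨c, d⟩, e, f⟩ h; simp at h ⊢; omega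
  · rintro ⟨⟨a, b⟩, ⟨c, d⟩, e, f⟩ h; simp at h ⊢; omega
  · rintro ⟨⟨a, b⟩, ⟨c, d⟩, e, f⟩ h
    simp only [Finset.mem_sigma, mem_antidiagonal] at h ⊢
    obtain ⟨h1, h2, h3⟩ := h
    subst h2 h3; rfl
  · rintro ⟨⟨a, b⟩, ⟨c, d⟩, e, f⟩ h
    simp only [Finset.mem_sigma, mem_antidiagonal] at h ⊢
    obtain ⟨h1, h2, h3⟩ := h
    subst h2 h3; rfl
  · rintro ⟨⟨a, b⟩, ⟨c, d⟩, e, f⟩ h; rfl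

section

variable {𝔏 M : Type*} [LieRing 𝔏] [AddCommGroup M] [LieRingModule 𝔏 M] [LieAlgebra ℝ 𝔏]
  [Module ℝ M] [LieModule ℝ 𝔏 M] {L : Ser 𝔏}

omit [LieAlgebra ℝ 𝔏] [LieModule ℝ 𝔏 M] in
theorem eq_conj (hL : L 0 = 0) {Y : Ser M} (hY : euler Y = -⁅L, Y⁆) : Y = conj L (Y 0) := by
  rw [← sub_eq_zero]
  refine eq_zero_of_euler_eq hL ?_ (by simp [conj_zero])
  rw [map_sub, euler_conj hL, hY, lie_sub]
  abel

omit [LieAlgebra ℝ 𝔏] [LieModule ℝ 𝔏 M] in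
theorem conj_add (hL : L 0 = 0) (x y : M) : conj L (x + y) = conj L x + conj L y := by
  symm
  convert eq_conj hL (Y := conj L x + conj L y) _ using 2
  · simp [conj_zero]
  · rw [map_add, euler_conj hL, euler_conj hL, lie_add]; abel

omit [LieAlgebra ℝ 𝔏] [LieModule ℝ 𝔏 M] in
theorem conj_sum (hL : L 0 = 0) {ι : Type*} (s : Finset ι) (x : ι → M) (r : ℕ) :
    conj L (∑ i ∈ s, x i) r = ∑ i ∈ s, conj L (x i) r := by
  induction s using Finset.cons_induction with
  | empty => simp [conj_apply_zero hL]
  | cons a s ha ih => rw [Finset.sum_cons, Finset.sum_cons, conj_add hL, coeff_add, ih]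

/-- By the Leibniz rules for `ε d/dε` and for `[L, ·]`, the bracket of two transports satisfies the
equation that characterizes the transport of the bracket. -/
theorem conj_lie (hL : L 0 = 0) (x : 𝔏) (m : M) : conj L ⁅x, m⁆ = ⁅conj L x, conj L m⁆ := by
  symm
  convert eq_conj hL (Y := ⁅conj L x, conj L m⁆) _ using 2
  · simp [lie_apply, conj_zero]
  · rw [euler_lie, euler_conj hL, euler_conj hL, leibniz_lie L, neg_lie, lie_neg]; abel

theorem conjSer_lie (hL : L 0 = 0) (X : Ser 𝔏) (Y : Ser M) :
    conjSer L ⁅X, Y⁆ = ⁅conjSer L X, conjSer L Y⁆ := by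
  ext r
  simp only [conjSer_apply, lie_apply, conj_sum hL, conj_lie hL, lie_sum, sum_lie]
  rw [sum_antidiagonal_exchange (fun c a d b => ⁅conj L (X a) c, conj L (Y b) d⁆)]
  exact Finset.sum_congr rfl fun p _ => Finset.sum_comm

omit [LieAlgebra ℝ 𝔏] [LieModule ℝ 𝔏 M] in
/-- A linear map that commutes with the action of the coefficients of `L` commutes with
`conj L`. -/
theorem map_conj_of_comm {M' : Type*} [AddCommGroup M'] [LieRingModule 𝔏 M'] [Module ℝ M']
    (hL : L 0 = 0) {T : M →ₗ[ℝ] M'} (hT : ∀ r m, T ⁅L r, m⁆ = ⁅L r, T m⁆) (x : M) :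
    map T (conj L x) = conj L (T x) := by
  convert eq_conj hL (Y := map T (conj L x)) _ using 2
  · simp [conj_zero]
  · rw [← map_euler, euler_conj hL, map_neg]
    congr 1
    ext r
    simp [lie_apply, hT]

omit [LieAlgebra ℝ 𝔏] [LieModule ℝ 𝔏 M] in
theorem map_conjSer_of_comm {M' : Type*} [AddCommGroup M'] [LieRingModule 𝔏 M'] [Module ℝ M']
    (hL : L 0 = 0) {T : M →ₗ[ℝ] M'} (hT : ∀ r m, T ⁅L r, m⁆ = ⁅L r, T m⁆) (Y : Ser M) :
    map T (conjSer L Y) = conjSer L (map T Y) := by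
  ext r
  rw [map_apply, conjSer_apply, map_sum, conjSer_apply]
  exact Finset.sum_congr rfl fun p _ => congrFun (map_conj_of_comm hL hT (Y p.2)) p.1

omit [LieAlgebra ℝ 𝔏] [LieModule ℝ 𝔏 M] in
theorem conjSer_neg (hL : L 0 = 0) (Y : Ser M) : conjSer L (-Y) = -conjSer L Y := by
  have := map_conjSer_of_comm (M := M) (M' := M) hL (T := -LinearMap.id) (fun r m => by simp) Y
  exact (this.trans (by rfl)).symm

end

/-- The constant series `x`. -/
def monomialZero {V : Type*} [Zero V] (x : V) : Ser V := fun r => if r = 0 then x else 0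

@[simp] theorem monomialZero_zero {V : Type*} [Zero V] (x : V) : monomialZero x 0 = x := rfl

@[simp] theorem monomialZero_succ {V : Type*} [Zero V] (x : V) (r : ℕ) :
    monomialZero x (r + 1) = 0 := rfl

theorem lie_monomialZero {𝔏 M : Type*} [LieRing 𝔏] [AddCommGroup M] [LieRingModule 𝔏 M] (g : 𝔏)
    (Y : Ser M) (r : ℕ) : ⁅monomialZero g, Y⁆ r = ⁅g, Y r⁆ := by
  rw [lie_apply, Finset.sum_eq_single_of_mem (0, r) (by simp)]
  · simp
  · rintro ⟨p, q⟩ hp hne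
    have : p ≠ 0 := fun h => hne (by simp only [mem_antidiagonal] at hp; ext <;> simp <;> omega)
    simp [monomialZero, this]

theorem lie_monomialZero_right {𝔏 M : Type*} [LieRing 𝔏] [AddCommGroup M] [LieRingModule 𝔏 M]
    (X : Ser 𝔏) (m : M) (r : ℕ) : ⁅X, monomialZero m⁆ r = ⁅X r, m⁆ := by
  rw [lie_apply, Finset.sum_eq_single_of_mem (r, 0) (by simp)]
  · simp
  · rintro ⟨p, q⟩ hp hne
    have : q ≠ 0 := fun h => hne (by simp only [mem_antidiagonal] at hp; ext <;> simp <;> omega)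
    simp [monomialZero, this]

end Ser

/-! ### Commutation of the averaged series with its companion -/

namespace Averaging.IsAveraged

open Ser Finset.HasAntidiagonal

variable {𝔏 : Type*} [LieRing 𝔏] [LieAlgebra ℝ 𝔏] {a : Averaging 𝔏} {A : 𝔏} {L B : Ser 𝔏}

/-- The derivation `∂ - [g, ·]` annihilates `A`, hence the transported averaged series. This gives a
second formula for `∂C`, besides `∂C = [C, ε A]`. -/
theorem d_conjSer (h : a.IsAveraged A L B) {g : 𝔏} (hg : a.d g = 0) (hA : a.d A = ⁅g, A⁆) (r : ℕ) :
    a.d (conjSer L B r) = ⁅g, conjSer L B r⁆ := by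
  let D : 𝔏 →ₗ[ℝ] 𝔏 := a.d - (LieAlgebra.ad ℝ 𝔏 g : 𝔏 →ₗ[ℝ] 𝔏)
  have hD : ∀ x, D x = a.d x - ⁅g, x⁆ := fun x => rfl
  have h1 : Ser.map D (conjSer L B) = 0 := by
    refine h.derivation_conjSer (fun x y => ?_) (fun x => ?_) (fun x hx => ?_) ?_
    · rw [hD, hD, hD, a.d_lie, leibniz_lie g x y, sub_lie, lie_sub]; abel
    · rw [hD, hD, map_sub, a.d_lie, hg, zero_lie, zero_add]
    · rw [hD, map_sub, a.S_lie, a.S_of_d g hg, hx]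
      rw [a.S_d, hx]
    · rw [hD, hA, sub_self]
  have h2 := congrFun h1 r
  rw [map_apply, hD] at h2
  exact sub_eq_zero.1 h2

/-- The averaged series commutes with `g + ε A(0) - B`. -/
theorem lie_companion (h : a.IsAveraged A L B) {g : 𝔏} (hg : a.d g = 0) (hA : a.d A = ⁅g, A⁆) :
    ⁅monomialZero g + monomialOne (a.ev A) - B, B⁆ = 0 := by
  set C := conjSer L B with hC
  -- Comparison of the two formulas for the time derivative of `C`.
  have h1 : ⁅monomialZero g + monomialOne A, C⁆ = 0 := by
    rw [add_lie, ← lie_skew (monomialOne A) C, ← h.map_d, ← sub_eq_add_neg, sub_eq_zero]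
    ext r
    rw [lie_monomialZero, map_apply, h.d_conjSer hg hA]
  -- At time zero `C` becomes `B` and `A` becomes its initial value.
  have h2 := congrArg (Ser.map a.ev) h1
  rw [map_lie_of_hom a.ev_lie, map_zero, h.map_ev, map_add, map_monomialOne] at h2
  have h3 : Ser.map a.ev (monomialZero g) = monomialZero g := by
    ext r
    rcases r with _ | r
    · exact a.ev_of_d g hg
    · simp
  rw [h3] at h2
  rw [sub_lie, lie_self, sub_zero, h2]

/-- The transport of the companion series `g + ε A(0) - B`. -/
theorem conjSer_companion (h : a.IsAveraged A L B) {g : 𝔏} (hg : a.d g = 0)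
    (hA : a.d A = ⁅g, A⁆) :
    conjSer L (monomialZero g + monomialOne (a.ev A) - B) =
      monomialZero g + monomialOne A - conjSer L B := by
  set C := conjSer L B with hC
  set U := monomialOne A - C with hU
  have hdg : ∀ r, a.d (monomialZero g r) = 0 := fun r => by rcases r with _ | r <;> simp [hg]
  have hd1 : ∀ r, a.d (monomialOne (a.ev A) r) = 0 := fun r => by
    by_cases hr : r = 1 <;> simp [monomialOne, hr, a.d_ev]
  have hd : ∀ r, a.d ((monomialZero g + monomialOne (a.ev A) - B) r) = 0 := fun r => by
    rw [coeff_sub, coeff_add, map_sub, map_add, hdg, hd1, h.d_B]; simp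
  set P := conjSer L (monomialZero g + monomialOne (a.ev A) - B) with hP
  have h1 : Ser.map a.d P = -⁅U, P⁆ := map_conjSer h.L_zero h.sub_conjSer_zero a.d_lie h.d_L hd
  have hW : monomialZero g + monomialOne A - C = monomialZero g + U := by rw [hU]; abel
  -- The claimed right side satisfies the law `∂Y = -[U, Y]` of a transport; it remains to compare
  -- the values at time zero and to argue by induction on the order.
  have h2 : Ser.map a.d (monomialZero g + U) = -⁅U, monomialZero g + U⁆ := by
    rw [lie_add, lie_self, add_zero, lie_skew]
    ext r
    rw [lie_monomialZero, map_apply, coeff_add, map_add, hdg, zero_add, hU, coeff_sub, map_sub,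
      h.d_conjSer hg hA, lie_sub]
    congr 1
    by_cases hr : r = 1 <;> simp [monomialOne, hr, hA]
  have hev : ∀ r, a.ev ((P - (monomialZero g + U)) r) = 0 := fun r => by
    rw [coeff_sub, map_sub, hP, map_conjSer_of_lie_eq_zero h.L_zero (fun s m => by
      rw [a.ev_lie, h.ev_L, zero_lie]), hU]
    have h3 : a.ev (C r) = B r := congrFun h.map_ev r
    simp only [coeff_sub, coeff_add, map_sub, map_add, h3]
    rw [a.ev_of_d _ (hdg r), a.ev_of_d _ (hd1 r), a.ev_of_d _ (h.d_B r)]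
    have h4 : a.ev (monomialOne A r) = monomialOne (a.ev A) r :=
      congrFun (map_monomialOne a.ev A) r
    rw [h4]; abel
  rw [hW, ← sub_eq_zero]
  have h3 : Ser.map a.d (P - (monomialZero g + U)) = ⁅P - (monomialZero g + U), U⁆ := by
    rw [map_sub, h1, h2, ← lie_skew U P, ← lie_skew U (_ + _), neg_neg, neg_neg, ← sub_lie]
  ext r
  induction r using Nat.strong_induction_on with
  | _ r ih =>
    have h4 := congrFun h3 r
    rw [lie_apply_eq_zero' (fun s hs => by rw [ih s hs]; rfl) h.sub_conjSer_zero, map_apply] at h4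
    rw [← a.ev_of_d _ h4, hev]; rfl

end Averaging.IsAveraged

/-! ### Averaging along a periodic flow -/

section FlowAveraging

open SmoothMap Finset.HasAntidiagonal Ser

variable {E V W : Type*} [NormedAddCommGroup E] [NormedSpace ℝ E] [NormedAddCommGroup V]
  [NormedSpace ℝ V] [NormedAddCommGroup W] [NormedSpace ℝ W]

namespace TwoTimeMap

/-- The derivative in the slow time `t`. -/
noncomputable def dt : TwoTimeMap E V →ₗ[ℝ] TwoTimeMap E V := lieDeriv (const (1, 0, 0))

/-- The derivative in the fast time `τ`. -/
noncomputable def dτ : TwoTimeMap E V →ₗ[ℝ] TwoTimeMap E V := lieDeriv (const (0, 1, 0))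

theorem dt_lie (X : TimeField E) (g : TwoTimeMap E V) : dt ⁅X, g⁆ = ⁅X, dt g⁆ := by
  have h : lieDeriv (const (1, 0, 0)) (TimeField.liftTwo X) = 0 := by
    refine ext_apply fun p => ?_
    rw [show TimeField.liftTwo X = postcomp (ContinuousLinearMap.inr ℝ ℝ (ℝ × E))
      (precomp (.mk Prod.snd contDiff_snd) (TimeField.lift X)) from rfl, lieDeriv_postcomp,
      postcomp_apply, lieDeriv_apply, fderiv_precomp]
    change _ = (0 : ℝ × ℝ × E)
    have : fderiv ℝ (SmoothMap.mk (Prod.snd : ℝ × ℝ × E → ℝ × E) contDiff_snd).1 p =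
      ContinuousLinearMap.snd ℝ ℝ (ℝ × E) := fderiv_snd
    rw [this, const_val]
    simp only [ContinuousLinearMap.coe_snd', Prod.mk_zero_zero, map_zero]
  rw [TimeField.act_def, dt, lieDeriv_comm, h, lieDeriv_const, sub_zero, lieDeriv_zero_left,
    add_zero, TimeField.act_def]

theorem dτ_lie (X : TimeField E) (g : TwoTimeMap E V) :
    dτ ⁅X, g⁆ = ⁅TimeField.ddt X, g⁆ + ⁅X, dτ g⁆ := by
  have h : lieDeriv (const (0, 1, 0)) (TimeField.liftTwo X) =
      TimeField.liftTwo (TimeField.ddt X) := by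
    refine ext_apply fun p => ?_
    have h1 : (TimeField.liftTwo (TimeField.ddt X)).1 p =
      ContinuousLinearMap.inr ℝ ℝ (ℝ × E) ((TimeField.lift (TimeField.ddt X)).1 p.2) := rfl
    have h2 : TimeField.lift (TimeField.ddt X) = lieDeriv (const (1, 0)) (TimeField.lift X) :=
      (lieDeriv_postcomp _ _ X).symm
    rw [h1, h2, show TimeField.liftTwo X = postcomp (ContinuousLinearMap.inr ℝ ℝ (ℝ × E))
      (precomp (.mk Prod.snd contDiff_snd) (TimeField.lift X)) from rfl,
      lieDeriv_postcomp, postcomp_apply, lieDeriv_apply, fderiv_precomp]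
    have : fderiv ℝ (SmoothMap.mk (Prod.snd : ℝ × ℝ × E → ℝ × E) contDiff_snd).1 p =
      ContinuousLinearMap.snd ℝ ℝ (ℝ × E) := fderiv_snd
    rw [this]; rfl
  rw [TimeField.act_def, dτ, lieDeriv_comm, h, lieDeriv_const, sub_zero, TimeField.act_def,
    TimeField.act_def, add_comm]

theorem hasDerivAt_dt (g : TwoTimeMap E V) (t τ : ℝ) (y : E) :
    HasDerivAt (fun s => g.1 (s, τ, y)) ((dt g).1 (t, τ, y)) t :=
  hasDerivAt_slice g.contDiff t (τ, y)

theorem eq_of_dτ_eq_zero {g : TwoTimeMap E V} (hg : dτ g = 0) (t τ τ' : ℝ) (y : E) :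
    g.1 (t, τ, y) = g.1 (t, τ', y) := by
  have h : ∀ s, HasDerivAt (fun s => g.1 (t, s, y)) 0 s := fun s => by
    have h1 := HasFDerivAt.comp_hasDerivAt (f := fun s => (t, s, y)) s
      (g.differentiableAt _).hasFDerivAt
      ((hasDerivAt_const s t).prodMk ((hasDerivAt_id s).prodMk (hasDerivAt_const s y)))
    have h2 := congrArg (fun f : TwoTimeMap E V => f.1 (t, s, y)) hg
    exact h1.congr_deriv h2
  exact is_const_of_deriv_eq_zero (fun s => (h s).differentiableAt) (fun s => (h s).deriv) τ τ'

/-- The shift of the fast time. -/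
noncomputable def shift (b : ℝ) : TwoTimeMap E V →ₗ[ℝ] TwoTimeMap E V :=
  precomp (.mk (fun p => (p.1, p.2.1 + b, p.2.2)) (contDiff_fst.prodMk
    ((contDiff_snd.fst.add contDiff_const).prodMk contDiff_snd.snd)))

@[simp] theorem shift_val (b : ℝ) (g : TwoTimeMap E V) (p : ℝ × ℝ × E) :
    (shift b g).1 p = g.1 (p.1, p.2.1 + b, p.2.2) := rfl

theorem shift_lie (b : ℝ) (X : TimeField E) (g : TwoTimeMap E V) :
    shift b ⁅X, g⁆ = ⁅TimeField.affine 1 b X, shift b g⁆ := by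
  refine ext_apply fun p => ?_
  have h1 : HasFDerivAt (fun p : ℝ × ℝ × E => (p.1, p.2.1 + b, p.2.2))
      (ContinuousLinearMap.id ℝ (ℝ × ℝ × E)) p := by
    have h2 : (fun p : ℝ × ℝ × E => (p.1, p.2.1 + b, p.2.2)) =
        fun p => id p + ((0 : ℝ), b, (0 : E)) := by
      funext q; simp [Prod.ext_iff]
    rw [h2]
    exact (hasFDerivAt_id p).add_const _
  rw [TimeField.act_val, shift, fderiv_precomp]
  have h2 : fderiv ℝ (SmoothMap.mk (fun p : ℝ × ℝ × E => (p.1, p.2.1 + b, p.2.2))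
    (contDiff_fst.prodMk ((contDiff_snd.fst.add contDiff_const).prodMk contDiff_snd.snd))).1 p =
      ContinuousLinearMap.id ℝ (ℝ × ℝ × E) := h1.fderiv
  rw [h2, precomp_apply, TimeField.act_val]
  simp

end TwoTimeMap

namespace TimeField

/-- An autonomous vector field. -/
noncomputable def autonomous (X : E → E) (hX : ContDiff ℝ ∞ X) : TimeField E :=
  .mk (fun p => X p.2) (hX.comp contDiff_snd)

@[simp] theorem autonomous_val (X : E → E) (hX : ContDiff ℝ ∞ X) (p : ℝ × E) :
    (autonomous X hX).1 p = X p.2 := rfl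

theorem ddt_autonomous (X : E → E) (hX : ContDiff ℝ ∞ X) : ddt (autonomous X hX) = 0 :=
  eq_ddt fun τ y => hasDerivAt_const τ (X y)

theorem lie_val_eq_lieBracket (X Y : TimeField E) (τ : ℝ) (y : E) :
    (⁅X, Y⁆ : TimeField E).1 (τ, y) =
      VectorField.lieBracket ℝ (fun z => X.1 (τ, z)) (fun z => Y.1 (τ, z)) y := by
  rw [lie_val, VectorField.lieBracket, (hasFDerivAt_slice X.contDiff τ y).fderiv,
    (hasFDerivAt_slice Y.contDiff τ y).fderiv]
  rfl

theorem contDiff_slice (X : SmoothMap (ℝ × E) V) (τ : ℝ) : ContDiff ℝ ∞ fun y => X.1 (τ, y) :=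
  X.contDiff.comp (contDiff_const.prodMk contDiff_id)

end TimeField

namespace IsGlobalFlow

variable [FiniteDimensional ℝ E] {G : E → E} {Φ : ℝ → E → E}

/-- The family `Φ_τ^* K` of pullbacks along a flow. -/
noncomputable def flowField (h : IsGlobalFlow G Φ) (hG : ContDiff ℝ ∞ G) {K : E → E}
    (hK : ContDiff ℝ ∞ K) : TimeField E :=
  .mk (fun p => VectorField.pullback ℝ (Φ p.1) K p.2) (h.contDiff_pullback hG hK)

variable (h : IsGlobalFlow G Φ) (hG : ContDiff ℝ ∞ G) {K : E → E} (hK : ContDiff ℝ ∞ K)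

theorem flowField_val (p : ℝ × E) :
    (h.flowField hG hK).1 p = VectorField.pullback ℝ (Φ p.1) K p.2 := rfl

theorem ddt_flowField : TimeField.ddt (h.flowField hG hK) =
    ⁅TimeField.autonomous G hG, h.flowField hG hK⁆ := by
  refine ext_apply fun p => ?_
  obtain ⟨τ, y⟩ := p
  rw [TimeField.lie_val_eq_lieBracket]
  exact (TimeField.hasDerivAt (h.flowField hG hK) τ y).deriv.symm.trans
    (h.deriv_pullback hG hK τ y)

theorem affine_flowField (hper : ∀ τ y, Φ (τ + 2 * Real.pi) y = Φ τ y) :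
    TimeField.affine 1 (2 * Real.pi) (h.flowField hG hK) = h.flowField hG hK := by
  refine ext_apply fun p => ?_
  have : Φ (p.1 + 2 * Real.pi) = Φ p.1 := funext (hper p.1)
  simp [flowField_val, this]

theorem flowField_zero (y : E) : (h.flowField hG hK).1 (0, y) = K y := by
  have h0 : Φ (-0) = id := funext fun y => by simp [h.init]
  rw [flowField_val, h.pullback_eq hG, h0]
  simp [h.init]

include h in
/-- A solution of `∂_τ X = [G, X]` is transported by the flow. -/
theorem fderiv_neg_apply_of_ddt_eq {X : TimeField E}
    (hX : TimeField.ddt X = ⁅TimeField.autonomous G hG, X⁆) (τ : ℝ) (y : E) :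
    fderiv ℝ (Φ (-τ)) y (X.1 (0, y)) = X.1 (τ, Φ (-τ) y) := by
  have h1 := h.fderiv_apply_of_deriv_eq hG X.contDiff (fun t z => by
    rw [(TimeField.hasDerivAt X t z).deriv, hX, TimeField.lie_val_eq_lieBracket]; rfl) τ (Φ (-τ) y)
  rw [h.apply_neg hG] at h1
  rw [← h1]
  have h2 := congrArg (fun T : E →L[ℝ] E => T (X.1 (τ, Φ (-τ) y)))
    (h.fderiv_neg_comp hG τ (Φ (-τ) y))
  rw [h.apply_neg hG] at h2
  exact h2

end IsGlobalFlow

/-- The companion `G + ε K - B` of the averaged series. -/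
noncomputable def companionSer {G K : E → E} (hG : ContDiff ℝ ∞ G) (hK : ContDiff ℝ ∞ K)
    (B : Ser (TimeField E)) : Ser (TimeField E) :=
  monomialZero (TimeField.autonomous G hG) + monomialOne (TimeField.autonomous K hK) - B

/-- The transported series `(t, τ, y) ↦ (conj L h)(t, τ, Φ_{-τ}(y))`. -/
noncomputable def twoScale (Φ : ℝ → E → E) (L : Ser (TimeField E)) (h : Ser (TwoTimeMap E V))
    (r : ℕ) (t τ : ℝ) (y : E) : V :=
  (conjSer L h r).1 (t, τ, Φ (-τ) y)

end FlowAveraging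

/-! ### Transported series in two time scales -/

section AveragedFlow

open SmoothMap Finset.HasAntidiagonal Ser TwoTimeMap

variable {E V W : Type*} [NormedAddCommGroup E] [NormedSpace ℝ E] [FiniteDimensional ℝ E]
  [NormedAddCommGroup V] [NormedSpace ℝ V]
  {G : E → E} {Φ : ℝ → E → E} {hΦ : IsGlobalFlow G Φ} {hG : ContDiff ℝ ∞ G} {K : E → E}
  {hK : ContDiff ℝ ∞ K} {L B : Ser (TimeField E)}

include hΦ hG in
theorem contDiff_twoScale (h : Ser (TwoTimeMap E V)) (r : ℕ) :
    ContDiff ℝ ∞ fun p : ℝ × ℝ × E => twoScale Φ L h r p.1 p.2.1 p.2.2 :=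
  (conjSer L h r).contDiff.comp (contDiff_fst.prodMk (contDiff_snd.fst.prodMk
    ((hΦ.contDiff hG).comp (contDiff_snd.fst.neg.prodMk contDiff_snd.snd))))

include hΦ hG in
theorem fderiv_twoScale (h : Ser (TwoTimeMap E V)) (r : ℕ) (t τ : ℝ) (y v : E) :
    fderiv ℝ (fun z => twoScale Φ L h r t τ z) y v =
      fderiv ℝ (conjSer L h r).1 (t, τ, Φ (-τ) y) (0, 0, fderiv ℝ (Φ (-τ)) y v) := by
  have h1 : HasFDerivAt (fun z => (t, τ, Φ (-τ) z))
      ((0 : E →L[ℝ] ℝ).prod ((0 : E →L[ℝ] ℝ).prod (fderiv ℝ (Φ (-τ)) y))) y :=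
    (hasFDerivAt_const t y).prodMk ((hasFDerivAt_const τ y).prodMk
      (hΦ.differentiableAt hG (-τ) y).hasFDerivAt)
  have h2 : HasFDerivAt (fun z => twoScale Φ L h r t τ z) _ y :=
    ((conjSer L h r).differentiableAt (t, τ, Φ (-τ) y)).hasFDerivAt.comp y h1
  rw [h2.fderiv]
  rfl

omit [FiniteDimensional ℝ E] in
theorem hasDerivAt_twoScale_slow (hL : L 0 = 0) (h : Ser (TwoTimeMap E V)) (r : ℕ) (t τ : ℝ)
    (y : E) : HasDerivAt (fun s => twoScale Φ L h r s τ y)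
      (twoScale Φ L (Ser.map dt h) r t τ y) t := by
  have h1 := hasDerivAt_dt (conjSer L h r) t τ (Φ (-τ) y)
  have h2 := congrFun (map_conjSer_of_comm hL (T := dt) (fun s m => dt_lie (V := V) (L s) m) h) r
  rw [map_apply] at h2
  rw [h2] at h1
  exact h1

/-- At `τ = 0` the generator vanishes and `Φ_0` is the identity, so nothing is transported. -/
theorem twoScale_zero_fast (hΦ : IsGlobalFlow G Φ)
    (h : (TimeField.averaging E).IsAveraged (hΦ.flowField hG hK) L B)
    (m : Ser (TwoTimeMap E V)) (r : ℕ) (t : ℝ) (y : E) :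
    twoScale Φ L m r t 0 y = (m r).1 (t, 0, y) := by
  let e : TwoTimeMap E V →ₗ[ℝ] V :=
    { toFun := fun m => m.1 (t, 0, y), map_add' := fun _ _ => rfl, map_smul' := fun _ _ => rfl }
  have h1 := map_conjSer_of_lie_eq_zero h.L_zero (e := e) (fun s m => by
    have h2 := congrArg (fun X : TimeField E => X.1 (0, y)) (h.ev_L s)
    have h3 : (L s).1 (0, y) = 0 := by
      have h4 : (TimeField.affine 0 0 (L s)).1 (0, y) = 0 := h2
      simpa using h4
    change (⁅L s, m⁆ : TwoTimeMap E V).1 (t, 0, y) = 0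
    rw [TimeField.act_val, h3]
    exact map_zero _) m r
  rw [twoScale, neg_zero, hΦ.init]
  exact h1

/-- Shifting `τ` by a period fixes `L`, the `τ`-independent data and the flow `Φ`. -/
theorem twoScale_periodic (hper : ∀ τ y, Φ (τ + 2 * Real.pi) y = Φ τ y)
    (h : (TimeField.averaging E).IsAveraged (hΦ.flowField hG hK) L B)
    {m : Ser (TwoTimeMap E V)} (hm : ∀ r, dτ (m r) = 0) (r : ℕ) (t τ : ℝ) (y : E) :
    twoScale Φ L m r t (τ + 2 * Real.pi) y = twoScale Φ L m r t τ y := by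
  have h1 := congrFun (map_conjSer_of_hom h.L_zero (SM := shift (V := V) (2 * Real.pi))
    (shift_lie (2 * Real.pi)) h.map_S_L (Y := m) fun r => ext_apply fun p => by
      rw [shift_val]; exact eq_of_dτ_eq_zero (hm r) _ _ _ _) r
  rw [map_apply] at h1
  have h2 := congrArg (fun X : TwoTimeMap E V => X.1 (t, τ, Φ (-τ) y)) h1
  have h3 : Φ (-(τ + 2 * Real.pi)) y = Φ (-τ) y := by
    rw [← hper (-(τ + 2 * Real.pi))]; congr 1; ring
  rw [twoScale, h3]
  exact h2

theorem ddt_conjSer (h : (TimeField.averaging E).IsAveraged (hΦ.flowField hG hK) L B) (r : ℕ) :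
    TimeField.ddt (conjSer L B r) = ⁅TimeField.autonomous G hG, conjSer L B r⁆ :=
  h.d_conjSer (TimeField.ddt_autonomous G hG) (hΦ.ddt_flowField hG hK) r

theorem ev_flowField : (TimeField.averaging E).ev (hΦ.flowField hG hK) =
    TimeField.autonomous K hK := by
  refine ext_apply fun p => ?_
  change (TimeField.affine 0 0 (hΦ.flowField hG hK)).1 p = _
  rw [TimeField.affine_val, zero_mul, zero_add, hΦ.flowField_zero]
  rfl

theorem conjSer_companionSer
    (h : (TimeField.averaging E).IsAveraged (hΦ.flowField hG hK) L B) :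
    conjSer L (companionSer hG hK B) = monomialZero (TimeField.autonomous G hG) +
      monomialOne (hΦ.flowField hG hK) - conjSer L B := by
  have h1 := h.conjSer_companion (TimeField.ddt_autonomous G hG) (hΦ.ddt_flowField hG hK)
  rwa [ev_flowField] at h1

theorem lie_companionSer
    (h : (TimeField.averaging E).IsAveraged (hΦ.flowField hG hK) L B) :
    ⁅companionSer hG hK B, B⁆ = 0 := by
  have h1 := h.lie_companion (TimeField.ddt_autonomous G hG) (hΦ.ddt_flowField hG hK)
  rwa [ev_flowField] at h1

theorem ddt_conjSer_companionSer
    (h : (TimeField.averaging E).IsAveraged (hΦ.flowField hG hK) L B) (r : ℕ) :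
    TimeField.ddt (conjSer L (companionSer hG hK B) r) =
      ⁅TimeField.autonomous G hG, conjSer L (companionSer hG hK B) r⁆ := by
  rw [conjSer_companionSer h, coeff_sub, coeff_add, map_sub, map_add, ddt_conjSer h, lie_sub,
    lie_add]
  congr 2
  · rcases r with _ | r
    · simp [TimeField.ddt_autonomous]
    · simp
  · by_cases hr : r = 1 <;> simp [monomialOne, hr, hΦ.ddt_flowField hG hK]

/-- The action on a transported series of a series of vector fields that the flow transports. -/
theorem sum_fderiv_twoScale (hΦ : IsGlobalFlow G Φ) (hL : L 0 = 0) {X : Ser (TimeField E)}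
    (hX : ∀ r, TimeField.ddt (conjSer L X r) = ⁅TimeField.autonomous G hG, conjSer L X r⁆)
    (hX0 : ∀ r y, (conjSer L X r).1 (0, y) = (X r).1 (0, y))
    (m : Ser (TwoTimeMap E V)) (r : ℕ) (t τ : ℝ) (y : E) :
    ∑ p ∈ antidiagonal r, fderiv ℝ (fun z => twoScale Φ L m p.2 t τ z) y ((X p.1).1 (0, y)) =
      twoScale Φ L ⁅X, m⁆ r t τ y := by
  rw [twoScale, conjSer_lie hL, lie_apply, sum_val]
  refine Finset.sum_congr rfl fun p _ => ?_
  -- `DΦ_{-τ}` carries the field at `y` to the transported field at time `τ` and point `Φ_{-τ} y`.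
  -- The sum is then a bracket of transports, that is, the transport of the bracket.
  rw [fderiv_twoScale (hΦ := hΦ) (hG := hG), ← hX0, hΦ.fderiv_neg_apply_of_ddt_eq hG (hX p.1)]
  rfl

theorem conjSer_val_zero (h : (TimeField.averaging E).IsAveraged (hΦ.flowField hG hK) L B)
    (X : Ser (TimeField E)) (r : ℕ) (y : E) : (conjSer L X r).1 (0, y) = (X r).1 (0, y) := by
  have h1 := map_conjSer_of_lie_eq_zero h.L_zero (e := (TimeField.averaging E).ev) (fun s m => by
    rw [Averaging.ev_lie, h.ev_L, zero_lie]) X r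
  have h2 := congrArg (fun X : TimeField E => X.1 (0, y)) h1
  have h3 : (TimeField.affine 0 0 (conjSer L X r)).1 (0, y) = (TimeField.affine 0 0 (X r)).1 (0, y) := h2
  simpa using h3

/-- The explicit time dependence contributes `-[U, ·]` and the motion of `Φ_{-τ} y` contributes
`-[G, ·]`. Their sum is minus the action of `G + U`, the transport of the companion series. -/
theorem hasDerivAt_twoScale_fast
    (h : (TimeField.averaging E).IsAveraged (hΦ.flowField hG hK) L B)
    {m : Ser (TwoTimeMap E V)} (hm : ∀ r, dτ (m r) = 0) (r : ℕ) (t τ : ℝ) (y : E) :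
    HasDerivAt (fun s => twoScale Φ L m r t s y)
      (-twoScale Φ L ⁅companionSer hG hK B, m⁆ r t τ y) τ := by
  have h1 : HasDerivAt (fun s => (t, s, Φ (-s) y)) (0, 1, -G (Φ (-τ) y)) τ :=
    (hasDerivAt_const τ t).prodMk ((hasDerivAt_id τ).prodMk (hΦ.hasDerivAt_neg τ y))
  have h2 : HasDerivAt (fun s => twoScale Φ L m r t s y) _ τ :=
    HasFDerivAt.comp_hasDerivAt τ
      ((conjSer L m r).differentiableAt (t, τ, Φ (-τ) y)).hasFDerivAt h1
  refine h2.congr_deriv ?_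
  have h3 : Ser.map dτ (conjSer L m) = _ :=
    map_conjSer h.L_zero h.sub_conjSer_zero (dM := dτ (V := V)) dτ_lie h.d_L hm
  have h4 : ⁅conjSer L (companionSer hG hK B), conjSer L m⁆ =
      ⁅monomialZero (TimeField.autonomous G hG), conjSer L m⁆ - Ser.map dτ (conjSer L m) := by
    rw [h3, conjSer_companionSer h, sub_neg_eq_add, ← add_lie, add_sub_assoc]
  rw [twoScale, conjSer_lie h.L_zero, h4, coeff_sub, lie_monomialZero, map_apply, sub_val, neg_sub,
    TimeField.act_val, dτ, lieDeriv_apply, ← map_sub]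
  simp

end AveragedFlow

/-! ### Taylor coefficients in a parameter -/

section TaylorCoef

open SmoothMap

variable {P V W : Type*} [NormedAddCommGroup P] [NormedSpace ℝ P] [NormedAddCommGroup V]
  [NormedSpace ℝ V] [NormedAddCommGroup W] [NormedSpace ℝ W]

/-- The Taylor coefficient at `0`. -/
noncomputable def taylorCoef (r : ℕ) (f : ℝ → V) : V := ((r.factorial : ℝ)⁻¹) • iteratedDeriv r f 0

theorem contDiff_id_smul {f : ℝ → V} (hf : ContDiff ℝ ∞ f) : ContDiff ℝ ∞ fun ε => ε • f ε :=
  contDiff_id.smul hf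

theorem contDiff_pow_smul {f : ℝ → V} (hf : ContDiff ℝ ∞ f) (s : ℕ) :
    ContDiff ℝ ∞ fun ε => ε ^ s • f ε :=
  (contDiff_id.pow s).smul hf

theorem contDiff_infty_deriv {f : ℝ → V} (hf : ContDiff ℝ ∞ f) : ContDiff ℝ ∞ (deriv f) :=
  (contDiff_infty_iff_deriv.1 hf).2

theorem taylorCoef_zero (f : ℝ → V) : taylorCoef 0 f = f 0 := by simp [taylorCoef]

theorem taylorCoef_add {f g : ℝ → V} (hf : ContDiff ℝ ∞ f) (hg : ContDiff ℝ ∞ g) (r : ℕ) :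
    taylorCoef r (fun ε => f ε + g ε) = taylorCoef r f + taylorCoef r g := by
  rw [taylorCoef, iteratedDeriv_fun_add (hf.contDiffAt.of_le (by exact_mod_cast le_top))
    (hg.contDiffAt.of_le (by exact_mod_cast le_top)), smul_add]; rfl

theorem taylorCoef_const_smul {f : ℝ → V} (c : ℝ) (hf : ContDiff ℝ ∞ f) (r : ℕ) :
    taylorCoef r (fun ε => c • f ε) = c • taylorCoef r f := by
  rw [taylorCoef, show (fun ε => c • f ε) = c • f from rfl,
    iteratedDeriv_const_smul (hf.contDiffAt.of_le (by exact_mod_cast le_top)), smul_comm]; rfl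

theorem taylorCoef_fun_zero (r : ℕ) : taylorCoef r (fun _ => (0 : V)) = 0 := by
  simpa using taylorCoef_const_smul (V := V) (f := fun _ => 0) 0 contDiff_const r

theorem taylorCoef_sum {ι : Type*} (s : Finset ι) {f : ι → ℝ → V}
    (hf : ∀ i ∈ s, ContDiff ℝ ∞ (f i)) (r : ℕ) :
    taylorCoef r (fun ε => ∑ i ∈ s, f i ε) = ∑ i ∈ s, taylorCoef r (f i) := by
  induction s using Finset.cons_induction with
  | empty => simpa using taylorCoef_fun_zero r
  | cons a s ha ih =>
    simp only [Finset.sum_cons]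
    rw [taylorCoef_add (hf a (by simp)) (ContDiff.sum fun i hi => hf i (by simp [hi])),
      ih fun i hi => hf i (by simp [hi])]

theorem taylorCoef_deriv (f : ℝ → V) (r : ℕ) :
    taylorCoef r (deriv f) = (r + 1 : ℝ) • taylorCoef (r + 1) f := by
  rw [taylorCoef, taylorCoef, iteratedDeriv_succ', smul_smul, Nat.factorial_succ]
  congr 1
  push_cast
  have : (r.factorial : ℝ) ≠ 0 := by positivity
  field_simp

theorem taylorCoef_id_smul {f : ℝ → V} (hf : ContDiff ℝ ∞ f) (r : ℕ) :
    taylorCoef (r + 1) (fun ε => ε • f ε) = taylorCoef r f := by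
  have hd2 : ∀ g : ℝ → V, ContDiff ℝ ∞ g → deriv (fun ε => ε • g ε) =
      fun ε => g ε + ε • deriv g ε := fun g hg => by
    funext ε
    have : HasDerivAt (fun ε => ε • g ε) _ ε := (hasDerivAt_id ε).fun_smul ((hg.differentiable (by simp)) ε).hasDerivAt
    rw [HasDerivAt.deriv this, add_comm]; simp
  induction r generalizing f with
  | zero =>
    have h1 := taylorCoef_deriv (fun ε => ε • f ε) 0
    rw [hd2 f hf, taylorCoef_zero] at h1
    simpa [taylorCoef_zero] using h1.symm
  | succ r ih =>
    have h1 := taylorCoef_deriv (fun ε => ε • f ε) (r + 1)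
    rw [hd2 f hf, taylorCoef_add hf (contDiff_id_smul (contDiff_infty_deriv hf)), ih (contDiff_infty_deriv hf), taylorCoef_deriv,
      ← one_smul ℝ (taylorCoef (r + 1) f), smul_smul, ← add_smul] at h1
    have h2 : ((r + 1 : ℕ) + 1 : ℝ) ≠ 0 := by positivity
    have h3 : (1 + (r + 1 : ℝ) * 1) = ((r + 1 : ℕ) + 1 : ℝ) := by push_cast; ring
    rw [h3] at h1
    exact (smul_right_injective V h2 h1).symm

theorem taylorCoef_pow_smul {f : ℝ → V} (hf : ContDiff ℝ ∞ f) (s r : ℕ) :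
    taylorCoef (s + r) (fun ε => ε ^ s • f ε) = taylorCoef r f := by
  induction s generalizing f r with
  | zero => simp
  | succ s ih =>
    have h1 : (fun ε : ℝ => ε ^ (s + 1) • f ε) = fun ε => ε ^ s • (ε • f ε) := by
      funext ε; rw [smul_smul, pow_succ]
    rw [h1, add_right_comm, add_assoc, ih (contDiff_id_smul hf), taylorCoef_id_smul hf]

theorem taylorCoef_pow_smul_of_lt {f : ℝ → V} (hf : ContDiff ℝ ∞ f) {s r : ℕ} (h : r < s) :
    taylorCoef r (fun ε => ε ^ s • f ε) = 0 := by
  obtain ⟨k, rfl⟩ : ∃ k, s = r + (k + 1) := ⟨s - r - 1, by omega⟩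
  have h1 : (fun ε : ℝ => ε ^ (r + (k + 1)) • f ε) = fun ε => ε ^ r • (ε ^ (k + 1) • f ε) := by
    funext ε; rw [smul_smul, pow_add]
  rw [h1, ← add_zero r, add_zero r]
  have := taylorCoef_pow_smul (f := fun ε => ε ^ (k + 1) • f ε)
    (contDiff_pow_smul hf _) r 0
  rw [add_zero] at this
  rw [this, taylorCoef_zero]
  simp

theorem taylorCoef_euler (f : ℝ → V) (hf : ContDiff ℝ ∞ f) (r : ℕ) :
    taylorCoef r (fun ε => ε • deriv f ε) = (r : ℝ) • taylorCoef r f := by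
  rcases r with _ | r
  · simp [taylorCoef_zero]
  · rw [taylorCoef_id_smul (contDiff_infty_deriv hf), taylorCoef_deriv]
    simp

theorem iterate_ddt_val (F : SmoothMap (ℝ × P) V) (r : ℕ) (ε : ℝ) (p : P) :
    ((TimeField.ddt ^ r) F).1 (ε, p) = iteratedDeriv r (fun ε => F.1 (ε, p)) ε := by
  induction r generalizing ε with
  | zero => simp
  | succ r ih =>
    rw [iteratedDeriv_succ, pow_succ', Module.End.mul_apply]
    have h1 := (TimeField.hasDerivAt ((TimeField.ddt ^ r) F) ε p).deriv
    rw [← h1]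
    congr 1
    exact funext fun s => ih s

/-- The Taylor coefficient with respect to the first variable. -/
noncomputable def SmoothMap.taylor (r : ℕ) : SmoothMap (ℝ × P) V →ₗ[ℝ] SmoothMap P V :=
  ((r.factorial : ℝ)⁻¹) • (precomp (.mk (fun p => ((0 : ℝ), p))
    (contDiff_const.prodMk contDiff_id))).comp (TimeField.ddt ^ r)

theorem SmoothMap.taylor_val (r : ℕ) (F : SmoothMap (ℝ × P) V) (p : P) :
    (taylor r F).1 p = taylorCoef r (fun ε => F.1 (ε, p)) := by
  rw [taylorCoef, ← iterate_ddt_val]; rfl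

theorem SmoothMap.fderiv_taylor (r : ℕ) (F : SmoothMap (ℝ × P) V) (p v : P) :
    fderiv ℝ (taylor r F).1 p v = taylorCoef r (fun ε => fderiv ℝ F.1 (ε, p) (0, v)) := by
  have h1 : ∀ H : SmoothMap (ℝ × P) V, TimeField.ddt (lieDeriv (const (0, v)) H) =
      lieDeriv (const (0, v)) (TimeField.ddt H) := fun H => by
    rw [TimeField.ddt, lieDeriv_comm, lieDeriv_const, lieDeriv_const, sub_zero,
      lieDeriv_zero_left, add_zero]
  have h2 : ∀ r, (TimeField.ddt ^ r) (lieDeriv (const (0, v)) F) =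
      lieDeriv (const (0, v)) ((TimeField.ddt ^ r) F) := fun r => by
    induction r with
    | zero => simp
    | succ r ih => rw [pow_succ', Module.End.mul_apply, ih, h1, Module.End.mul_apply]
  have h3 := taylor_val r (lieDeriv (const (0, v)) F) p
  have h4 : (fun ε => (lieDeriv (const (0, v)) F).1 (ε, p)) =
    fun ε => fderiv ℝ F.1 (ε, p) (0, v) := rfl
  rw [h4] at h3
  rw [← h3, taylor, LinearMap.smul_apply, LinearMap.smul_apply, LinearMap.comp_apply,
    LinearMap.comp_apply, h2, SmoothMap.fderiv_smul, smul_val, precomp_apply, lieDeriv_apply,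
    _root_.smul_apply, fderiv_precomp]
  congr 2
  change fderiv ℝ (fun p : P => ((0 : ℝ), p)) p v = _
  rw [(hasFDerivAt_prodMk_right (0 : ℝ) p).fderiv]
  rfl

theorem contDiff_sum_pow_smul (u : ℕ → V) (R : ℕ) :
    ContDiff ℝ ∞ fun ε : ℝ => ∑ j ∈ Finset.range R, ε ^ j • u j :=
  ContDiff.sum fun j _ => (contDiff_id.pow j).smul contDiff_const

/-- The factorization of an increment. -/
theorem exists_contDiff_increment [FiniteDimensional ℝ P] [FiniteDimensional ℝ V] {f : P → V}
    (hf : ContDiff ℝ ∞ f) : ∃ h : ℝ × P × P → V, ContDiff ℝ ∞ h ∧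
      (∀ δ a b, f (a + δ • b) = f a + δ • h (δ, a, b)) ∧ ∀ a b, h (0, a, b) = fderiv ℝ f a b := by
  have : CompleteSpace V := FiniteDimensional.complete ℝ V
  let D : ℝ × ℝ × P × P → V := fun p => fderiv ℝ f (p.2.2.1 + (p.1 * p.2.1) • p.2.2.2) p.2.2.2
  have hD : ContDiff ℝ ∞ D := by
    have h1 : ContDiff ℝ ∞ fun p : ℝ × ℝ × P × P => p.2.2.1 + (p.1 * p.2.1) • p.2.2.2 :=
      contDiff_snd.snd.fst.add ((contDiff_fst.mul contDiff_snd.fst).smul contDiff_snd.snd.snd)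
    exact ((hf.fderiv_right (m := ∞) (by simp)).comp h1).clm_apply contDiff_snd.snd.snd
  refine ⟨fun q => ∫ s in (0 : ℝ)..1, D (s, q), ?_, fun δ a b => ?_, fun a b => ?_⟩
  · exact (contDiff_primitive hD).comp (contDiff_const.prodMk contDiff_id)
  · have h1 : ∀ s ∈ Set.uIcc (0 : ℝ) 1,
        HasDerivAt (fun s => f (a + (s * δ) • b)) (δ • D (s, δ, a, b)) s := fun s _ => by
      have h2 : HasDerivAt (fun s : ℝ => a + (s * δ) • b) (δ • b) s := by
        simpa using (((hasDerivAt_id s).mul_const δ).smul_const b).const_add a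
      have h3 := HasFDerivAt.comp_hasDerivAt s
        (hf.differentiable (by simp) (a + (s * δ) • b)).hasFDerivAt h2
      rw [map_smul] at h3
      exact h3
    have h4 := intervalIntegral.integral_eq_sub_of_hasDerivAt h1
      ((continuous_const.smul (hD.continuous.comp (by fun_prop))).intervalIntegrable _ _)
    rw [intervalIntegral.integral_smul] at h4
    simp only [one_mul, zero_mul, zero_smul, add_zero] at h4
    rw [h4]; abel
  · simp [D]

/-- Taylor coefficients of a composition depend on the coefficients of low order only. -/
theorem taylorCoef_comp_congr [FiniteDimensional ℝ P] [FiniteDimensional ℝ V] {f : P → V}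
    (hf : ContDiff ℝ ∞ f) {a b : ℝ → P} (ha : ContDiff ℝ ∞ a) (hb : ContDiff ℝ ∞ b) {r s : ℕ}
    (h : r < s) : taylorCoef r (fun ε => f (a ε + ε ^ s • b ε)) = taylorCoef r (fun ε => f (a ε)) := by
  obtain ⟨k, hk, hk1, -⟩ := exists_contDiff_increment hf
  have h1 : ContDiff ℝ ∞ fun ε : ℝ => k (ε ^ s, a ε, b ε) :=
    hk.comp ((contDiff_id.pow s).prodMk (ha.prodMk hb))
  simp only [hk1]
  rw [taylorCoef_add (f := fun ε => f (a ε)) (hf.comp ha) (contDiff_pow_smul h1 s), taylorCoef_pow_smul_of_lt h1 h,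
    add_zero]

theorem taylorCoef_comp_add_pow [FiniteDimensional ℝ P] [FiniteDimensional ℝ V] {f : P → V}
    (hf : ContDiff ℝ ∞ f) {a b : ℝ → P} (ha : ContDiff ℝ ∞ a) (hb : ContDiff ℝ ∞ b) {r : ℕ}
    (hr : r ≠ 0) : taylorCoef r (fun ε => f (a ε + ε ^ r • b ε)) =
      taylorCoef r (fun ε => f (a ε)) + fderiv ℝ f (a 0) (b 0) := by
  obtain ⟨k, hk, hk1, hk2⟩ := exists_contDiff_increment hf
  have h1 : ContDiff ℝ ∞ fun ε : ℝ => k (ε ^ r, a ε, b ε) :=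
    hk.comp ((contDiff_id.pow r).prodMk (ha.prodMk hb))
  simp only [hk1]
  have h2 := taylorCoef_pow_smul h1 r 0
  rw [add_zero] at h2
  rw [taylorCoef_add (f := fun ε => f (a ε)) (hf.comp ha) (contDiff_pow_smul h1 r), h2, taylorCoef_zero]
  simp [hr, hk2]

end TaylorCoef

/-! ### The transport of functions is composition with the transported identity -/

section Composition

open SmoothMap Finset.HasAntidiagonal Ser

variable {E V : Type*} [NormedAddCommGroup E] [NormedSpace ℝ E]
  [NormedAddCommGroup V] [NormedSpace ℝ V]

/-- A function of `y`, as a function of `(t, τ, y)`. -/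
noncomputable def TwoTimeMap.ofSpace (f : E → V) (hf : ContDiff ℝ ∞ f) : TwoTimeMap E V :=
  .mk (fun p => f p.2.2) (hf.comp contDiff_snd.snd)

theorem TwoTimeMap.ofSpace_val (f : E → V) (hf : ContDiff ℝ ∞ f) (p : ℝ × ℝ × E) :
    (ofSpace f hf).1 p = f p.2.2 := rfl

theorem sum_range_antidiagonal {M : Type*} [AddCommMonoid M] (a : ℕ × ℕ → M) (R : ℕ) :
    ∑ j ∈ Finset.range (R + 1), ∑ p ∈ antidiagonal j, a p =
      ∑ p ∈ (Finset.range (R + 1) ×ˢ Finset.range (R + 1)).filter (fun p => p.1 + p.2 ≤ R),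
        a p := by
  rw [← Finset.sum_fiberwise_of_maps_to (g := fun p : ℕ × ℕ => p.1 + p.2) (t := Finset.range (R + 1))
    (fun p hp => by simp at hp ⊢; omega)]
  refine Finset.sum_congr rfl fun j hj => Finset.sum_congr ?_ fun _ _ => rfl
  ext p
  simp at hj ⊢
  omega

/-- By the chain rule the Taylor coefficients of `f(κ^ε)`, with `κ^ε` the transported identity, obey
the recursion `r F_r = -[L, F]_r` that determines the transport of `f`. Truncating `κ^ε` at order
`R` does not affect coefficients up to `R`. -/
theorem conj_ofSpace {L : Ser (TimeField E)} (hL : L 0 = 0) {f : E → V} (hf : ContDiff ℝ ∞ f)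
    {r R : ℕ} (hr : r ≤ R) (q : ℝ × ℝ × E) :
    (conj L (TwoTimeMap.ofSpace f hf) r).1 q = taylorCoef r (fun ε => f (∑ j ∈ Finset.range (R + 1),
      ε ^ j • (conj L (TwoTimeMap.ofSpace (id : E → E) contDiff_id) j).1 q)) := by
  set κ := conj L (TwoTimeMap.ofSpace (id : E → E) contDiff_id) with hκ
  let u : SmoothMap (ℝ × ℝ × ℝ × E) E := .mk
    (fun p => ∑ j ∈ Finset.range (R + 1), p.1 ^ j • (κ j).1 p.2)
    (ContDiff.sum fun j _ => (contDiff_fst.pow j).smul ((κ j).contDiff.comp contDiff_snd))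
  let F : SmoothMap (ℝ × ℝ × ℝ × E) V := .mk (fun p => f (u.1 p)) (hf.comp u.contDiff)
  suffices H : ∀ r ≤ R, conj L (TwoTimeMap.ofSpace f hf) r = taylor r F by
    rw [H r hr, taylor_val]; rfl
  intro r
  induction r using Nat.strong_induction_on with
  | _ r ih =>
  intro hrR
  rcases Nat.eq_zero_or_pos r with h0 | h0
  · subst h0
    refine ext_apply fun q => ?_
    rw [conj_zero, taylor_val, taylorCoef_zero]
    change f q.2.2 = f (∑ j ∈ Finset.range (R + 1), (0 : ℝ) ^ j • (κ j).1 q)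
    rw [Finset.sum_eq_single_of_mem 0 (by simp) (fun j _ hj => by simp [hj])]
    rw [hκ, conj_zero]
    simp [TwoTimeMap.ofSpace_val]
  have hr0 : (r : ℝ) ≠ 0 := by positivity
  refine smul_right_injective _ hr0 ?_
  refine ext_apply fun q => ?_
  -- the derivatives of `F`
  have hFq : ∀ ε v, fderiv ℝ F.1 (ε, q) (0, v) = fderiv ℝ f (u.1 (ε, q))
      (∑ k ∈ Finset.range (R + 1), ε ^ k • fderiv ℝ (κ k).1 q v) := by
    intro ε v
    have h1 : HasFDerivAt (fun q => u.1 (ε, q))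
        (∑ k ∈ Finset.range (R + 1), ε ^ k • fderiv ℝ (κ k).1 q) q :=
      HasFDerivAt.fun_sum (u := Finset.range (R + 1)) (A := fun k q => ε ^ k • (κ k).1 q) fun k _ =>
        ((κ k).differentiableAt q).hasFDerivAt.const_smul (ε ^ k)
    have h2 := (hf.differentiable (by simp) (u.1 (ε, q))).hasFDerivAt.comp q h1
    have h3 := (hasFDerivAt_slice F.contDiff ε q).unique h2
    have h4 := congrArg (fun T => T v) h3
    simpa [sum_apply] using h4
  have hFε : ∀ ε, ε • deriv (fun ε => F.1 (ε, q)) ε = fderiv ℝ f (u.1 (ε, q))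
      (∑ j ∈ Finset.range (R + 1), ε ^ j • ((j : ℝ) • (κ j).1 q)) := by
    intro ε
    have h1 : HasDerivAt (fun ε => u.1 (ε, q))
        (∑ j ∈ Finset.range (R + 1), (j * ε ^ (j - 1)) • (κ j).1 q) ε :=
      HasDerivAt.fun_sum (u := Finset.range (R + 1)) (A := fun j ε => ε ^ j • (κ j).1 q) fun j _ =>
        (hasDerivAt_pow j ε).smul_const _
    have h2 : HasDerivAt (fun ε => F.1 (ε, q)) _ ε := HasFDerivAt.comp_hasDerivAt (l := f) ε
      (hf.differentiable (by simp) (u.1 (ε, q))).hasFDerivAt h1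
    rw [h2.deriv, ← map_smul, Finset.smul_sum]
    congr 1
    refine Finset.sum_congr rfl fun j _ => ?_
    rw [smul_smul, smul_smul]
    congr 1
    rcases j with _ | j
    · simp
    · rw [Nat.add_sub_cancel, pow_succ]; ring
  let S := Finset.range (R + 1) ×ˢ Finset.range (R + 1)
  let a : ℕ × ℕ → E := fun p => fderiv ℝ (κ p.2).1 q (0, 0, (L p.1).1 q.2)
  have hEuler : ∀ j : ℕ, (j : ℝ) • (κ j).1 q = -∑ p ∈ antidiagonal j, a p := by
    intro j
    have h1 := congrArg (fun X : TwoTimeMap E E => X.1 q)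
      (congrFun (euler_conj hL (TwoTimeMap.ofSpace (id : E → E) contDiff_id)) j)
    have h2 : (euler κ j).1 q = (j : ℝ) • (κ j).1 q := rfl
    rw [← h2]
    refine h1.trans ?_
    rw [coeff_neg, neg_val, lie_apply, sum_val]
    rfl
  have hsm : ∀ p : ℕ × ℕ, ContDiff ℝ ∞ fun ε => fderiv ℝ f (u.1 (ε, q)) (a p) := fun p =>
    (((hf.fderiv_right (m := ∞) (by simp)).comp
      (u.contDiff.comp (contDiff_id.prodMk contDiff_const))).clm_apply contDiff_const)
  have hF : ContDiff ℝ ∞ fun ε => F.1 (ε, q) :=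
    F.contDiff.comp (contDiff_id.prodMk contDiff_const)
  -- The Euler derivative in `ε`: it acts on `κ^ε` through the transport equation of the identity,
  -- where truncation keeps only pairs of total order at most `R`.
  have key1 : (r : ℝ) • taylorCoef r (fun ε => F.1 (ε, q)) =
      -∑ p ∈ S.filter (fun p => p.1 + p.2 ≤ R),
        taylorCoef r (fun ε => ε ^ (p.1 + p.2) • fderiv ℝ f (u.1 (ε, q)) (a p)) := by
    rw [← taylorCoef_euler _ hF]
    simp only [hFε, hEuler]
    have h1 : ∀ ε : ℝ, fderiv ℝ f (u.1 (ε, q))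
        (∑ j ∈ Finset.range (R + 1), ε ^ j • -∑ p ∈ antidiagonal j, a p) =
        (-1 : ℝ) • ∑ p ∈ S.filter (fun p => p.1 + p.2 ≤ R),
          ε ^ (p.1 + p.2) • fderiv ℝ f (u.1 (ε, q)) (a p) := by
      intro ε
      have h2 : ∑ j ∈ Finset.range (R + 1), ε ^ j • -∑ p ∈ antidiagonal j, a p =
          -∑ p ∈ S.filter (fun p => p.1 + p.2 ≤ R), ε ^ (p.1 + p.2) • a p := by
        rw [← sum_range_antidiagonal, ← Finset.sum_neg_distrib]
        refine Finset.sum_congr rfl fun j _ => ?_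
        rw [smul_neg, Finset.smul_sum]
        congr 1
        exact Finset.sum_congr rfl fun p hp => by rw [mem_antidiagonal.1 hp]
      rw [h2, map_neg, map_sum, neg_one_smul]
      simp only [map_smul]
    simp only [h1]
    have h3 : ∀ p ∈ S.filter (fun p => p.1 + p.2 ≤ R),
        ContDiff ℝ ∞ fun ε : ℝ => ε ^ (p.1 + p.2) • fderiv ℝ f (u.1 (ε, q)) (a p) :=
      fun p _ => (contDiff_id.pow _).smul (hsm p)
    rw [taylorCoef_const_smul (-1) (ContDiff.sum h3), taylorCoef_sum _ h3, neg_one_smul]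
  have key2 : ⁅L, conj L (TwoTimeMap.ofSpace f hf)⁆ r = ⁅L, Ser.mk fun r => taylor r F⁆ r :=
    lie_apply_congr hL hL (fun _ _ => rfl) fun s hs => ih s hs (by omega)
  -- The bracket with `L` unfolds to the same terms, but over the full square of pairs.
  have key3 : (⁅L, Ser.mk fun r => taylor r F⁆ r).1 q = ∑ p ∈ S,
      taylorCoef r (fun ε => ε ^ (p.1 + p.2) • fderiv ℝ f (u.1 (ε, q)) (a p)) := by
    have h1 : ∀ s v, s ≤ r → fderiv ℝ (taylor (r - s) F).1 q v = taylorCoef r (fun ε =>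
        ε ^ s • fderiv ℝ F.1 (ε, q) (0, v)) := by
      intro s v hs
      have h2 : ContDiff ℝ ∞ fun ε => fderiv ℝ F.1 (ε, q) (0, v) :=
        ((F.contDiff.fderiv_right (m := ∞) (by simp)).comp
          (contDiff_id.prodMk contDiff_const)).clm_apply contDiff_const
      have h3 := taylorCoef_pow_smul h2 s (r - s)
      rw [Nat.add_sub_cancel' hs] at h3
      rw [h3, fderiv_taylor]
    have hsm2 : ∀ s k, ContDiff ℝ ∞ fun ε : ℝ =>
        ε ^ (s + k) • fderiv ℝ f (u.1 (ε, q)) (a (s, k)) :=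
      fun s k => (contDiff_id.pow _).smul (hsm (s, k))
    have h4 : ∀ s, taylorCoef r (fun ε => ε ^ s • fderiv ℝ F.1 (ε, q) (0, 0, 0, (L s).1 q.2)) =
        ∑ k ∈ Finset.range (R + 1),
          taylorCoef r (fun ε => ε ^ (s + k) • fderiv ℝ f (u.1 (ε, q)) (a (s, k))) := by
      intro s
      simp only [hFq]
      rw [← taylorCoef_sum _ fun k _ => hsm2 s k]
      congr 1
      funext ε
      rw [map_sum, Finset.smul_sum]
      refine Finset.sum_congr rfl fun k _ => ?_
      rw [map_smul, smul_smul, pow_add]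
    have h5 : ∀ s, r < s → ∀ k,
        taylorCoef r (fun ε => ε ^ (s + k) • fderiv ℝ f (u.1 (ε, q)) (a (s, k))) = 0 :=
      fun s hs k => taylorCoef_pow_smul_of_lt (hsm (s, k)) (by omega)
    rw [Finset.sum_product, lie_apply, sum_val,
      ← Finset.sum_subset (Finset.range_subset_range.2 (by omega : r + 1 ≤ R + 1))
        (fun s _ hs => Finset.sum_eq_zero fun k _ => h5 s (by simpa using hs) k)]
    rw [Finset.Nat.sum_antidiagonal_eq_sum_range_succ_mk]
    refine Finset.sum_congr rfl fun s hs => ?_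
    rw [← h4]
    exact h1 s _ (by simp at hs; omega)
  -- The extra pairs carry a power of `ε` beyond `R ≥ r` and contribute nothing to order `r`.
  have key4 : ∑ p ∈ S, taylorCoef r (fun ε => ε ^ (p.1 + p.2) • fderiv ℝ f (u.1 (ε, q)) (a p)) =
      ∑ p ∈ S.filter (fun p => p.1 + p.2 ≤ R),
        taylorCoef r (fun ε => ε ^ (p.1 + p.2) • fderiv ℝ f (u.1 (ε, q)) (a p)) := by
    refine (Finset.sum_filter_of_ne fun p _ hp => ?_).symm
    by_contra hlt
    exact hp (taylorCoef_pow_smul_of_lt (hsm p) (by omega))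
  have key5 : (r : ℝ) • conj L (TwoTimeMap.ofSpace f hf) r = -⁅L, conj L (TwoTimeMap.ofSpace f hf)⁆ r :=
    congrFun (euler_conj hL (TwoTimeMap.ofSpace f hf)) r
  change ((r : ℝ) • conj L (TwoTimeMap.ofSpace f hf) r).1 q = ((r : ℝ) • taylor r F).1 q
  rw [key5, key2, neg_val, key3, key4, smul_val, taylor_val, key1]

end Composition

/-! ### The normal form splitting -/

section Splitting

open SmoothMap Finset.HasAntidiagonal Ser TwoTimeMap

theorem conjSer_monomialZero {𝔏 M : Type*} [LieRing 𝔏] [AddCommGroup M] [LieRingModule 𝔏 M]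
    [Module ℝ M] {L : Ser 𝔏} (hL : L 0 = 0) (x : M) :
    conjSer L (monomialZero x) = conj L x := by
  ext r
  rw [conjSer_apply, Finset.sum_eq_single_of_mem (r, 0) (by simp)]
  · rfl
  · rintro ⟨p, q⟩ hp hne
    have : q ≠ 0 := fun h => hne (by simp only [mem_antidiagonal] at hp; ext <;> simp <;> omega)
    simp [monomialZero, this, conj_apply_zero hL]

theorem fderiv_snd_snd {E : Type*} [NormedAddCommGroup E] [NormedSpace ℝ E] (p v : ℝ × ℝ × E) :
    fderiv ℝ (fun p : ℝ × ℝ × E => p.2.2) p v = v.2.2 := by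
  have h := ((ContinuousLinearMap.snd ℝ ℝ E).comp
    (ContinuousLinearMap.snd ℝ ℝ (ℝ × E))).hasFDerivAt (x := p)
  exact congrArg (fun T => T v) h.fderiv

theorem formalComp_eq_taylorCoef {n : ℕ} (X : ℕ → Phase n → Phase n) (u : ℕ → Phase n) (r : ℕ) :
    formalComp X u r = taylorCoef r (fun ε => ∑ s ∈ Finset.range (r + 1),
      ε ^ s • X s (∑ j ∈ Finset.range (r + 1), ε ^ j • u j)) := rfl

/-- Transport of a whole series of fields, read componentwise as functions, is formal composition
with the transported identity. This identifies the right side of the formal flow equation. -/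
theorem conjSer_ofSpace {n : ℕ} {L : Ser (TimeField (Phase n))} (hL : L 0 = 0)
    {X : ℕ → Phase n → Phase n} (hX : ∀ r, ContDiff ℝ ∞ (X r)) (r : ℕ) (q : ℝ × ℝ × Phase n) :
    (conjSer L (Ser.mk fun r => ofSpace (X r) (hX r)) r).1 q =
      formalComp X (fun j => (conj L (ofSpace (id : Phase n → Phase n) contDiff_id) j).1 q) r := by
  set κ := fun j => (conj L (ofSpace (id : Phase n → Phase n) contDiff_id) j).1 q
  have hs : ∀ s, ContDiff ℝ ∞ fun ε : ℝ => X s (∑ j ∈ Finset.range (r + 1), ε ^ j • κ j) :=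
    fun s => (hX s).comp (contDiff_sum_pow_smul κ (r + 1))
  rw [formalComp_eq_taylorCoef, taylorCoef_sum _ fun s _ => contDiff_pow_smul (hs s) s,
    conjSer_apply, sum_val, ← Finset.Nat.sum_antidiagonal_swap,
    Finset.Nat.sum_antidiagonal_eq_sum_range_succ_mk]
  refine Finset.sum_congr rfl fun s hs' => ?_
  have hsr : s ≤ r := by simp at hs'; omega
  have h1 := taylorCoef_pow_smul (hs s) s (r - s)
  rw [Nat.add_sub_cancel' hsr] at h1
  rw [h1]
  exact conj_ofSpace hL (hX s) (show r - s ≤ r by omega) q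

variable {n : ℕ} {G K : Phase n → Phase n} {Φ : ℝ → Phase n → Phase n}

theorem IsPeriodicFlow.isGlobalFlow (h : IsPeriodicFlow G Φ) : IsGlobalFlow G Φ := ⟨h.init, h.ode⟩

/-- The coefficients of `K^ε`. -/
def averagedField (B : Ser (TimeField (Phase n))) (r : ℕ) (y : Phase n) : Phase n :=
  (B (r + 1)).1 (0, y)

/-- The coefficients of `G^ε`. -/
noncomputable def companionField (hG : ContDiff ℝ ∞ G) (hK : ContDiff ℝ ∞ K)
    (B : Ser (TimeField (Phase n))) (r : ℕ) (y : Phase n) : Phase n :=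
  (companionSer hG hK B r).1 (0, y)

variable {hΦ : IsPeriodicFlow G Φ} {hG : ContDiff ℝ ∞ G} {hK : ContDiff ℝ ∞ K}
  {L B : Ser (TimeField (Phase n))}

theorem contDiff_averagedField (r : ℕ) : ContDiff ℝ ∞ (averagedField B r) :=
  TimeField.contDiff_slice _ _

theorem contDiff_companionField (r : ℕ) : ContDiff ℝ ∞ (companionField hG hK B r) :=
  TimeField.contDiff_slice _ _

theorem ddt_companionSer (hB : ∀ r, TimeField.ddt (B r) = 0) (r : ℕ) :
    TimeField.ddt (companionSer hG hK B r) = 0 := by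
  rw [companionSer, coeff_sub, coeff_add, map_sub, map_add, hB, sub_zero]
  have h1 : TimeField.ddt (monomialZero (TimeField.autonomous G hG) r) = 0 := by
    rcases r with _ | r <;> simp [TimeField.ddt_autonomous]
  rw [h1, zero_add]
  by_cases hr : r = 1 <;> simp [monomialOne, hr, TimeField.ddt_autonomous]

theorem val_of_ddt_eq_zero {X : TimeField (Phase n)} (hX : TimeField.ddt X = 0) (τ : ℝ)
    (y : Phase n) : X.1 (τ, y) = X.1 (0, y) := by
  have h1 := congrArg (fun X : TimeField (Phase n) => X.1 (τ, y))
    (TimeField.affine_of_ddt_eq_zero 0 0 hX)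
  simpa using h1.symm

theorem companionField_eq (hB : B 0 = 0) :
    companionField hG hK B = companionSeries G K (averagedField B) := by
  funext r y
  rcases r with _ | _ | r
  · simp [companionField, companionSer, companionSeries, hB]
  · simp [companionField, companionSer, companionSeries, averagedField]
  · simp [companionField, companionSer, companionSeries, averagedField, monomialOne]

/-- The formal flow of the companion series. -/
theorem isFormalPeriodicFlow_companionField
    (h : (TimeField.averaging (Phase n)).IsAveraged (hΦ.isGlobalFlow.flowField hG hK) L B) :
    IsFormalPeriodicFlow (companionField hG hK B) (fun r τ y =>
      twoScale Φ L (monomialZero (ofSpace (id : Phase n → Phase n) contDiff_id)) r 0 (-τ) y) := by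
  set m : Ser (TwoTimeMap (Phase n) (Phase n)) := monomialZero (ofSpace id contDiff_id) with hm
  have hdB : ∀ r, TimeField.ddt (B r) = 0 := h.d_B
  have hdm : ∀ r, dτ (m r) = 0 := by
    intro r
    rcases r with _ | r
    · refine ext_apply fun p => ?_
      change fderiv ℝ (fun p : ℝ × ℝ × Phase n => p.2.2) p (0, 1, 0) = 0
      rw [fderiv_snd_snd]
    · simp [hm]
  refine ⟨fun y => ?_, fun r y => ?_, fun r τ y => ?_, fun r τ y => ?_⟩
  · simp only [neg_zero]; rw [twoScale_zero_fast hΦ.isGlobalFlow h]; rfl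
  · simp only [neg_zero]; rw [twoScale_zero_fast hΦ.isGlobalFlow h]; rfl
  -- The transported identity moves with velocity minus the companion field, so the flow uses
  -- reversed fast time.
  · have h1 := (hasDerivAt_twoScale_fast h hdm r 0 (-τ) y).scomp τ (hasDerivAt_neg τ)
    refine h1.congr_deriv ?_
    -- A vector field differentiating the identity map returns the field itself.
    have h2 : ⁅companionSer hG hK B, m⁆ = Ser.mk fun r =>
        ofSpace (companionField hG hK B r) (contDiff_companionField r) := by
      ext r
      rw [hm, lie_monomialZero_right]
      refine ext_apply fun p => ?_
      rw [TimeField.act_val, mk_apply, ofSpace_val]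
      change fderiv ℝ (fun p : ℝ × ℝ × Phase n => p.2.2) p _ = _
      rw [fderiv_snd_snd]
      exact val_of_ddt_eq_zero (ddt_companionSer hdB r) p.2.1 p.2.2
    rw [h2, twoScale, conjSer_ofSpace h.L_zero contDiff_companionField]
    simp only [neg_smul, one_smul, neg_neg, twoScale, hm, conjSer_monomialZero h.L_zero]
  · have h1 := twoScale_periodic hΦ.periodic h hdm r 0 (-(τ + 2 * Real.pi)) y
    rw [← h1]
    congr 1; ring

/-- Averaging produces a normal form splitting. -/
theorem isNormalFormSplitting
    (h : (TimeField.averaging (Phase n)).IsAveraged (hΦ.isGlobalFlow.flowField hG hK) L B) :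
    IsNormalFormSplitting G K (companionField hG hK B) (averagedField B) where
  smooth_G := contDiff_companionField
  smooth_K := contDiff_averagedField
  split_neg := by rw [companionField_eq h.B_zero]; rfl
  split_zero := by rw [companionField_eq h.B_zero]; simp [companionSeries]
  split_pos r := by rw [companionField_eq h.B_zero]; simp [companionSeries]
  commute r y := by
    -- `B` represents `ε K^ε`, so order `r` of the commutation is read at order `r + 1`, where the
    -- term with `B_0` drops out.
    have h1 := congrArg (fun X : TimeField (Phase n) => X.1 (0, y))
      (congrFun (lie_companionSer h) (r + 1))
    rw [lie_apply, Finset.Nat.sum_antidiagonal_succ', h.B_zero, lie_zero, zero_add] at h1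
    simp only [sum_val, TimeField.lie_val_eq_lieBracket] at h1
    exact h1
  periodic := ⟨_, isFormalPeriodicFlow_companionField (hΦ := hΦ) h⟩

theorem formalComp_zero (X : ℕ → Phase n → Phase n) (u : ℕ → Phase n) :
    formalComp X u 0 = X 0 (u 0) := by
  simp [formalComp_eq_taylorCoef, taylorCoef_zero]

/-- The leading dependence of the coefficients of a formal composition. -/
theorem formalComp_eq {X : ℕ → Phase n → Phase n} (hX : ∀ r, ContDiff ℝ ∞ (X r))
    (u : ℕ → Phase n) {r : ℕ} (hr : r ≠ 0) :
    formalComp X u r = ∑ s ∈ Finset.range r,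
      taylorCoef (r - s) (fun ε => X s (∑ j ∈ Finset.range r, ε ^ j • u j)) +
      (X r (u 0) + fderiv ℝ (X 0) (u 0) (u r)) := by
  have ha := contDiff_sum_pow_smul u r
  have ha0 : ∑ j ∈ Finset.range r, (0 : ℝ) ^ j • u j = u 0 := by
    rw [Finset.sum_eq_single_of_mem 0 (by simp; omega) (fun j _ hj => by simp [hj])]
    simp
  have hs : ∀ s, ContDiff ℝ ∞ fun ε : ℝ => X s (∑ j ∈ Finset.range r, ε ^ j • u j + ε ^ r • u r) :=
    fun s => (hX s).comp (ha.add (contDiff_pow_smul contDiff_const r))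
  simp only [formalComp_eq_taylorCoef, Finset.sum_range_succ _ r]
  have h1 : ∀ s ∈ Finset.range r, ContDiff ℝ ∞ fun ε : ℝ => ε ^ s •
      X s (∑ j ∈ Finset.range r, ε ^ j • u j + ε ^ r • u r) := fun s _ => contDiff_pow_smul (hs s) s
  rw [taylorCoef_add (ContDiff.sum h1) (contDiff_pow_smul (hs r) r), taylorCoef_sum _ h1]
  have h2 : ∀ s ≤ r, taylorCoef r (fun ε : ℝ => ε ^ s •
      X s (∑ j ∈ Finset.range r, ε ^ j • u j + ε ^ r • u r)) = taylorCoef (r - s)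
      (fun ε : ℝ => X s (∑ j ∈ Finset.range r, ε ^ j • u j + ε ^ r • u r)) := fun s hsr => by
    have := taylorCoef_pow_smul (hs s) s (r - s)
    rwa [Nat.add_sub_cancel' hsr] at this
  rw [h2 r le_rfl, Nat.sub_self, taylorCoef_zero, ha0, zero_pow hr, zero_smul, add_zero,
    Finset.sum_congr rfl fun s hsr => h2 s (Finset.mem_range.1 hsr).le]
  -- For `s ≥ 1` a Taylor coefficient of order below `r` is taken, which does not see `ε^r u_r`.
  -- Only `X_0` sees it, and linearly.
  have h3 : ∀ s, s ≠ 0 → taylorCoef (r - s)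
      (fun ε : ℝ => X s (∑ j ∈ Finset.range r, ε ^ j • u j + ε ^ r • u r)) = taylorCoef (r - s)
      (fun ε : ℝ => X s (∑ j ∈ Finset.range r, ε ^ j • u j)) := fun s hs0 =>
    taylorCoef_comp_congr (b := fun _ => u r) (hX s) ha contDiff_const (by omega)
  have h4 := taylorCoef_comp_add_pow (b := fun _ => u r) (hX 0) ha contDiff_const hr
  simp only [ha0] at h4
  obtain ⟨k, rfl⟩ := Nat.exists_eq_succ_of_ne_zero hr
  rw [Finset.sum_range_succ', Finset.sum_range_succ', Finset.sum_congr rfl fun s _ =>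
    h3 (s + 1) (by omega), Nat.sub_zero]
  rw [Nat.succ_eq_add_one] at *
  rw [h4]
  abel

/-- The coefficients of order less than `r` of the formal flow depend only on the coefficients
of order less than `r` of the vector field; at order `r` the flows differ by the solution of a
linear equation. -/
theorem IsFormalPeriodicFlow.sub_hasDerivAt {X X' : ℕ → Phase n → Phase n}
    {Ψ Ψ' : ℕ → ℝ → Phase n → Phase n} (hX : ∀ r, ContDiff ℝ ∞ (X r))
    (hX' : ∀ r, ContDiff ℝ ∞ (X' r)) (h : IsFormalPeriodicFlow X Ψ)
    (h' : IsFormalPeriodicFlow X' Ψ') {r : ℕ} (hr : r ≠ 0) (heq : ∀ s < r, X s = X' s)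
    (hΨ : ∀ s < r, Ψ s = Ψ' s) (τ : ℝ) (y : Phase n) :
    HasDerivAt (fun s => Ψ r s y - Ψ' r s y) (fderiv ℝ (X 0) (Ψ 0 τ y) (Ψ r τ y - Ψ' r τ y) +
      (X r (Ψ 0 τ y) - X' r (Ψ 0 τ y))) τ := by
  refine ((h.ode r τ y).fun_sub (h'.ode r τ y)).congr_deriv ?_
  rw [formalComp_eq hX _ hr, formalComp_eq hX' _ hr, ← hΨ 0 (by omega), ← heq 0 (by omega)]
  have h1 : ∀ s ∈ Finset.range r, taylorCoef (r - s)
      (fun ε => X' s (∑ j ∈ Finset.range r, ε ^ j • Ψ' j τ y)) = taylorCoef (r - s)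
      (fun ε => X s (∑ j ∈ Finset.range r, ε ^ j • Ψ j τ y)) := fun s hs => by
    rw [heq s (Finset.mem_range.1 hs)]
    congr 1
    funext ε
    congr 1
    exact Finset.sum_congr rfl fun j hj => by rw [hΨ j (Finset.mem_range.1 hj)]
  rw [Finset.sum_congr rfl h1, map_sub]
  abel

/-- Order zero is uniqueness for a nonlinear equation. At each later order the difference solves a
homogeneous linear equation with initial value zero. -/
theorem IsFormalPeriodicFlow.eq_of_lt {X X' : ℕ → Phase n → Phase n}
    {Ψ Ψ' : ℕ → ℝ → Phase n → Phase n} (hX : ∀ r, ContDiff ℝ ∞ (X r))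
    (hX' : ∀ r, ContDiff ℝ ∞ (X' r)) (h : IsFormalPeriodicFlow X Ψ)
    (h' : IsFormalPeriodicFlow X' Ψ') {r : ℕ} (heq : ∀ s < r, X s = X' s) (s : ℕ) (hs : s < r) :
    Ψ s = Ψ' s := by
  induction s using Nat.strong_induction_on with
  | _ s ih =>
  funext τ y
  rcases Nat.eq_zero_or_pos s with h0 | h0
  · subst h0
    have h1 := eq_of_hasDerivAt ((hX 0).of_le (by simp)) (t₀ := 0) (γ₁ := fun s => Ψ 0 s y)
      (γ₂ := fun s => Ψ' 0 s y)
      (fun t => by simpa [formalComp_zero] using h.ode 0 t y)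
      (fun t => by rw [heq 0 hs]; simpa [formalComp_zero] using h'.ode 0 t y)
      (by simp [h.init_zero, h'.init_zero])
    exact congrFun h1 τ
  · have hc : Continuous fun t => Ψ 0 t y :=
      continuous_iff_continuousAt.2 fun t => (h.ode 0 t y).continuousAt
    obtain ⟨k, rfl⟩ : ∃ k, s = k + 1 := ⟨s - 1, by omega⟩
    have h1 := eq_zero_of_hasDerivAt_clm (M := fun t => fderiv ℝ (X 0) (Ψ 0 t y))
      (((hX 0).continuous_fderiv (by simp)).comp hc) (f := fun t => Ψ (k + 1) t y - Ψ' (k + 1) t y)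
      (fun t => by
        have h2 := h.sub_hasDerivAt hX hX' h' (by omega : k + 1 ≠ 0)
          (fun s hs' => heq s (by omega)) (fun s hs' => ih s hs' (by omega)) t y
        rw [heq (k + 1) hs] at h2
        simpa using h2)
      (by simp [h.init_succ, h'.init_succ]) τ
    exact sub_eq_zero.1 h1

/-- The normal form splitting is unique. -/
theorem IsNormalFormSplitting.eq {Gs Ks Gs' Ks' : ℕ → Phase n → Phase n} (hΦ : IsPeriodicFlow G Φ)
    (hG : ContDiff ℝ ∞ G) (h : IsNormalFormSplitting G K Gs Ks)
    (h' : IsNormalFormSplitting G K Gs' Ks') : Gs' = Gs ∧ Ks' = Ks := by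
  -- The sum of the two series is prescribed, so a discrepancy of `G^ε` at order `c + 1` appears
  -- with opposite sign in `K^ε` at order `c`.
  have hKs : ∀ c, Ks' c = Ks c + (Gs (c + 1) - Gs' (c + 1)) := by
    intro c
    rcases c with _ | c
    · have h1 := h.split_zero.trans h'.split_zero.symm
      rw [eq_comm, ← eq_sub_iff_add_eq'] at h1
      rw [h1]; abel
    · have h1 := (h.split_pos c).trans (h'.split_pos c).symm
      rw [eq_comm, ← eq_sub_iff_add_eq'] at h1
      rw [h1]; abel
  suffices H : ∀ r, Gs r = Gs' r by
    refine ⟨funext fun r => (H r).symm, funext fun r => ?_⟩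
    rw [hKs r, H, sub_self, add_zero]
  intro r
  induction r using Nat.strong_induction_on with
  | _ r ih =>
  rcases Nat.eq_zero_or_pos r with h0 | h0
  · rw [h0, h.split_neg, h'.split_neg]
  obtain ⟨k, rfl⟩ : ∃ k, r = k + 1 := ⟨r - 1, by omega⟩
  set b : Phase n → Phase n := Gs (k + 1) - Gs' (k + 1) with hb
  have hbs : ContDiff ℝ ∞ b := (h.smooth_G _).sub (h'.smooth_G _)
  -- At order `k` of the commutation relation the two splittings differ only in the term `[G, K_k]`.
  have hcomm : ∀ y, VectorField.lieBracket ℝ G b y = 0 := by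
    intro y
    have h1 := (h.commute k y).trans (h'.commute k y).symm
    rw [Finset.Nat.sum_antidiagonal_eq_sum_range_succ_mk,
      Finset.Nat.sum_antidiagonal_eq_sum_range_succ_mk, Finset.sum_range_succ',
      Finset.sum_range_succ'] at h1
    simp only [Nat.sub_zero] at h1
    rw [h.split_neg, h'.split_neg, hKs k,
      VectorField.lieBracket_add_right ((h.smooth_K k).differentiable (by simp) y)
        (hbs.differentiable (by simp) y)] at h1
    have h2 : ∀ a ∈ Finset.range k,
        VectorField.lieBracket ℝ (Gs' (a + 1)) (Ks' (k - (a + 1))) y =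
          VectorField.lieBracket ℝ (Gs (a + 1)) (Ks (k - (a + 1))) y := fun a ha => by
      have ha' := Finset.mem_range.1 ha
      rw [hKs, ih (k - (a + 1) + 1) (by omega), sub_self, add_zero, ih (a + 1) (by omega)]
    rw [Finset.sum_congr rfl h2] at h1
    simpa using h1
  obtain ⟨Ψ, hΨ⟩ := h.periodic
  obtain ⟨Ψ', hΨ'⟩ := h'.periodic
  have hlt := hΨ.eq_of_lt h.smooth_G h'.smooth_G hΨ' (r := k + 1) ih
  have h00 : ∀ τ y, Ψ 0 τ y = Φ τ y := fun τ y => by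
    have h1 := eq_of_hasDerivAt (hG.of_le (by simp)) (t₀ := 0) (γ₁ := fun s => Ψ 0 s y)
      (γ₂ := fun s => Φ s y)
      (fun t => by simpa [formalComp_zero, h.split_neg] using hΨ.ode 0 t y)
      (fun t => hΦ.ode t y) (by simp [hΨ.init_zero, hΦ.init])
    exact congrFun h1 τ
  have hflow := hΦ.isGlobalFlow
  -- As `[G, b] = 0`, the field `b` is invariant under the flow of `G`.
  have hinv : ∀ τ y, fderiv ℝ (Φ τ) y (b y) = b (Φ τ y) := fun τ y =>
    hflow.fderiv_apply_of_deriv_eq hG (X := fun p => b p.2) (hbs.comp contDiff_snd)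
      (fun t z => by rw [hcomm]; simp) τ y
  rw [← sub_eq_zero, ← hb]
  funext y
  have hc : Continuous fun t => Φ t y :=
    continuous_iff_continuousAt.2 fun t => (hΦ.ode t y).continuousAt
  -- The difference of the flows at order `k + 1` solves the variational equation with source `b(Φ_t
  -- y) = DΦ_t b(y)`. Hence it equals `t · DΦ_t b(y)`; at `t = 2π` periodicity gives `2π b(y) = 0`.
  have h1 := eq_zero_of_hasDerivAt_clm (M := fun t => fderiv ℝ G (Φ t y))
    ((hG.continuous_fderiv (by simp)).comp hc)
    (f := fun t => (Ψ (k + 1) t y - Ψ' (k + 1) t y) - t • fderiv ℝ (Φ t) y (b y))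
    (fun t => by
      have h2 := hΨ.sub_hasDerivAt h.smooth_G h'.smooth_G hΨ' (by omega : k + 1 ≠ 0) ih hlt t y
      have h3 : HasDerivAt (fun t => fderiv ℝ (Φ t) y (b y)) _ t :=
        ((hflow.hasFDerivAt hG t y).2).clm_apply (hasDerivAt_const t (b y))
      have h4 : HasDerivAt (fun t : ℝ => t • fderiv ℝ (Φ t) y (b y)) _ t :=
        (hasDerivAt_id t).fun_smul h3
      refine (h2.fun_sub h4).congr_deriv ?_
      have h5 : Gs (k + 1) (Φ t y) - Gs' (k + 1) (Φ t y) = fderiv ℝ (Φ t) y (b y) := by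
        rw [hinv]; rfl
      rw [h.split_neg, h00, h5, map_sub, map_sub, map_smul]
      simp)
    (by simp [hΨ.init_succ, hΨ'.init_succ]) (2 * Real.pi)
  have h2 : Ψ (k + 1) (2 * Real.pi) y = 0 := by
    rw [← zero_add (2 * Real.pi), hΨ.periodic, hΨ.init_succ]
  have h3 : Ψ' (k + 1) (2 * Real.pi) y = 0 := by
    rw [← zero_add (2 * Real.pi), hΨ'.periodic, hΨ'.init_succ]
  have h4 : Φ (2 * Real.pi) y = y := by rw [← zero_add (2 * Real.pi), hΦ.periodic, hΦ.init]
  rw [h2, h3, hinv, h4] at h1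
  simpa [Real.pi_ne_zero] using h1

end Splitting

/-! ### Transport along a global flow -/

section Transport

open SmoothMap Finset.HasAntidiagonal Ser TwoTimeMap

variable {E V : Type*} [NormedAddCommGroup E] [NormedSpace ℝ E] [NormedAddCommGroup V]
  [NormedSpace ℝ V]

theorem hasDerivAt_along {f : ℝ → E → V} (hf : ContDiff ℝ 1 fun p : ℝ × E => f p.1 p.2)
    {γ : ℝ → E} {v : E} {t : ℝ} (hγ : HasDerivAt γ v t) :
    HasDerivAt (fun s => f s (γ s)) (deriv (fun s => f s (γ t)) t + fderiv ℝ (f t) (γ t) v) t := by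
  have h1 := (hf.differentiable (by simp) (t, γ t)).hasFDerivAt
  have h2 : HasDerivAt (fun s => f s (γ t)) _ t :=
    HasFDerivAt.comp_hasDerivAt (f := fun s => (s, γ t)) t h1
      ((hasDerivAt_id t).prodMk (hasDerivAt_const t (γ t)))
  have h3 : HasFDerivAt (fun z => f t z) _ (γ t) := h1.comp (γ t) (hasFDerivAt_prodMk_right t (γ t))
  have h4 : HasDerivAt (fun s => f s (γ s)) _ t :=
    HasFDerivAt.comp_hasDerivAt (f := fun s => (s, γ s)) t h1 ((hasDerivAt_id t).prodMk hγ)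
  refine h4.congr_deriv ?_
  rw [h2.deriv, h3.fderiv]
  simp [← map_add]

theorem eq_of_transport {f : ℝ → E → V} (hf : ContDiff ℝ 1 fun p : ℝ × E => f p.1 p.2)
    {F : E → E} {ψ : ℝ → E → E} (hψ : IsGlobalFlow F ψ)
    (heq : ∀ t y, deriv (fun s => f s y) t + fderiv ℝ (f t) y (F y) = 0) (t : ℝ) (y : E) :
    f t (ψ t y) = f 0 y := by
  have h1 : ∀ t, HasDerivAt (fun s => f s (ψ s y)) 0 t := fun t =>
    (hasDerivAt_along hf (hψ.ode t y)).congr_deriv (heq t _)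
  have h2 := is_const_of_deriv_eq_zero (fun t => (h1 t).differentiableAt) (fun t => (h1 t).deriv) t 0
  simpa [hψ.init] using h2

theorem exists_isGlobalFlow_of_hasGlobalFlow {n : ℕ} {F : Phase n → Phase n}
    (h : HasGlobalFlow F) : ∃ ψ, IsGlobalFlow F ψ := by
  choose γ h0 h1 using h
  exact ⟨fun t y => γ y t, h0, fun t y => h1 y t⟩

/-- The transport equation of a complete vector field is uniquely solvable. -/
theorem existsUnique_isTransportSolution {n : ℕ} {F : Phase n → Phase n} (hF : ContDiff ℝ ∞ F)
    (h : HasGlobalFlow F) {f₀ : Phase n → ℝ} (hf₀ : ContDiff ℝ ∞ f₀) :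
    ∃! f : ℝ → Phase n → ℝ, IsTransportSolution F f₀ f := by
  obtain ⟨ψ, hψ⟩ := exists_isGlobalFlow_of_hasGlobalFlow h
  refine ⟨fun t y => f₀ (ψ (-t) y), ⟨?_, fun t y => ?_, fun y => by simp [hψ.init]⟩, ?_⟩
  · exact ((hf₀.comp ((hψ.contDiff hF).comp (contDiff_fst.neg.prodMk contDiff_snd))).of_le
      (by simp))
  · have hd := hf₀.differentiable (by simp) (ψ (-t) y)
    have h1 : HasDerivAt (fun s => f₀ (ψ (-s) y)) _ t :=
      HasFDerivAt.comp_hasDerivAt (l := f₀) t hd.hasFDerivAt (hψ.hasDerivAt_neg t y)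
    have h2 : HasFDerivAt (fun z => f₀ (ψ (-t) z)) _ y :=
      hd.hasFDerivAt.comp y (hψ.differentiableAt hF (-t) y).hasFDerivAt
    rw [h1.deriv, h2.fderiv, ContinuousLinearMap.comp_apply, hψ.fderiv_apply_self hF]
    simp
  · intro f hf
    funext t y
    have h1 := eq_of_transport hf.contDiff hψ hf.eq t (ψ (-t) y)
    rw [hψ.apply_neg hF] at h1
    rw [h1, hf.init]

variable [FiniteDimensional ℝ E] [FiniteDimensional ℝ V]

/-- Solvability of the transport equation with a source. -/
theorem exists_transport_source {X : E → E} {ψ : ℝ → E → E} (hX : ContDiff ℝ ∞ X)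
    (hψ : IsGlobalFlow X ψ) (S : SmoothMap (ℝ × E) V) {f₀ : E → V} (hf₀ : ContDiff ℝ ∞ f₀) :
    ∃ u : SmoothMap (ℝ × E) V,
      TimeField.ddt u + lieDeriv (TimeField.lift (TimeField.autonomous X hX)) u = S ∧
        ∀ y, u.1 (0, y) = f₀ y := by
  have hψs := hψ.contDiff hX
  -- Method of characteristics: `σ` straightens the field `(1, X)` to `(1, 0)`, and `v` is the
  -- solution in the straightened coordinates, obtained by integrating the source in time.
  let σ : SmoothMap (ℝ × E) (ℝ × E) := .mk (fun p => (p.1, ψ (-p.1) p.2))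
    (contDiff_fst.prodMk (hψs.comp (contDiff_fst.neg.prodMk contDiff_snd)))
  let v : SmoothMap (ℝ × E) V := .mk (fun p => f₀ p.2) (hf₀.comp contDiff_snd) +
    TimeField.primitive (precomp (.mk (fun p => (p.1, ψ p.1 p.2)) (contDiff_fst.prodMk hψs)) S)
  have hv : ∀ p, fderiv ℝ v.1 p (1, 0) = S.1 (p.1, ψ p.1 p.2) := by
    intro p
    have h1 : TimeField.ddt v = precomp
        (.mk (fun p => (p.1, ψ p.1 p.2)) (contDiff_fst.prodMk hψs)) S := by
      rw [map_add, TimeField.ddt_primitive, add_eq_right]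
      exact TimeField.eq_ddt fun τ y => hasDerivAt_const τ (f₀ y)
    exact congrArg (fun Z : SmoothMap (ℝ × E) V => Z.1 p) h1
  have hσ : ∀ t y, fderiv ℝ σ.1 (t, y) (1, X y) = (1, 0) := by
    intro t y
    have h1 : HasDerivAt (fun s => σ.1 (s, y)) (1, -X (ψ (-t) y)) t :=
      (hasDerivAt_id t).prodMk (hψ.hasDerivAt_neg t y)
    have h2 : HasFDerivAt (fun z => σ.1 (t, z)) ((0 : E →L[ℝ] ℝ).prod (fderiv ℝ (ψ (-t)) y)) y :=
      (hasFDerivAt_const t y).prodMk (hψ.differentiableAt hX (-t) y).hasFDerivAt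
    have h3 := (hasDerivAt_slice σ.contDiff t y).unique h1
    have h4 := congrArg (fun T => T (X y)) ((hasFDerivAt_slice σ.contDiff t y).unique h2)
    have h5 : ((1 : ℝ), X y) = (1, 0) + (0, X y) := by simp
    rw [h5, map_add, h3]
    refine (congrArg ((1, -X (ψ (-t) y)) + ·) h4).trans ?_
    simp [hψ.fderiv_apply_self hX]
  refine ⟨precomp σ v, ?_, fun y => ?_⟩
  · refine ext_apply fun p => ?_
    obtain ⟨t, y⟩ := p
    rw [add_val, TimeField.ddt, lieDeriv_apply, lieDeriv_apply, ← map_add]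
    have h5 : (const ((1 : ℝ), (0 : E)) : SmoothMap (ℝ × E) (ℝ × E)).1 (t, y) +
        (TimeField.lift (TimeField.autonomous X hX)).1 (t, y) = (1, X y) := by simp
    rw [h5, fderiv_precomp, hσ, hv]
    change S.1 (t, ψ t (ψ (-t) y)) = _
    rw [hψ.apply_neg hX]
  · rw [precomp_apply, add_val, mk_val]
    change f₀ (ψ (-0) y) + (TimeField.primitive _).1 (0, ψ (-0) y) = _
    rw [TimeField.primitive_zero_val]
    simp [hψ.init]

/-- The formal transport equation of a series of vector fields with complete leading term. -/
theorem exists_formal_transport {X : ℕ → E → E} (hX : ∀ r, ContDiff ℝ ∞ (X r)) {ψ : ℝ → E → E}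
    (hψ : IsGlobalFlow (X 0) ψ) {f₀ : E → V} (hf₀ : ContDiff ℝ ∞ f₀) :
    ∃ u : ℕ → SmoothMap (ℝ × E) V,
      (∀ r, TimeField.ddt (u r) + ∑ p ∈ antidiagonal r,
        lieDeriv (TimeField.lift (TimeField.autonomous (X p.1) (hX p.1))) (u p.2) = 0) ∧
      (∀ y, (u 0).1 (0, y) = f₀ y) ∧ ∀ r y, (u (r + 1)).1 (0, y) = 0 := by
  let D : ℕ → SmoothMap (ℝ × E) V →ₗ[ℝ] SmoothMap (ℝ × E) V := fun r =>
    lieDeriv (TimeField.lift (TimeField.autonomous (X r) (hX r)))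
  choose sol hsol hsol0 using fun (S : SmoothMap (ℝ × E) V) (r : ℕ) =>
    exists_transport_source (hX 0) hψ S (f₀ := if r = 0 then f₀ else 0) (by
      split_ifs
      · exact hf₀
      · exact contDiff_const)
  -- At order `r` the unknown solves the transport equation of the leading field, with the
  -- contributions of lower orders as source.
  obtain ⟨u, hu⟩ := exists_seq_eq (V := SmoothMap (ℝ × E) V) fun r z =>
    sol (-∑ q ∈ Finset.range r, D (r - q) (z q)) r
  have hu' : ∀ r, u r = sol (-∑ q ∈ Finset.range r, D (r - q) (u q)) r := fun r => by
    have h1 := hu r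
    have h2 : ∀ q ∈ Finset.range r, D (r - q) (if q < r then u q else 0) = D (r - q) (u q) :=
      fun q hq => by rw [if_pos (Finset.mem_range.1 hq)]
    exact h1.trans (by rw [Finset.sum_congr rfl h2])
  refine ⟨u, fun r => ?_, fun y => ?_, fun r y => ?_⟩
  · have h1 := hsol (-∑ q ∈ Finset.range r, D (r - q) (u q)) r
    rw [← hu', eq_neg_iff_add_eq_zero, add_assoc] at h1
    rw [← h1, ← Finset.Nat.sum_antidiagonal_swap, Finset.Nat.sum_antidiagonal_eq_sum_range_succ_mk,
      Finset.sum_range_succ, add_comm (∑ q ∈ Finset.range r, _)]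
    simp [D]
  · rw [hu', hsol0, if_pos rfl]
  · rw [hu', hsol0, if_neg (by omega)]; rfl

end Transport

/-! ### The two-scale solution -/

section TwoScale

open SmoothMap Finset.HasAntidiagonal Ser TwoTimeMap

variable {n : ℕ} {G K : Phase n → Phase n} {Φ : ℝ → Phase n → Phase n}
  {V : Type*} [NormedAddCommGroup V] [NormedSpace ℝ V] [FiniteDimensional ℝ V]
  {hΦ : IsPeriodicFlow G Φ} {hG : ContDiff ℝ ∞ G} {hK : ContDiff ℝ ∞ K}
  {L B : Ser (TimeField (Phase n))}

/-- A smooth solution `f` of the system `∂_τ f + G^ε · ∇f = 0`, `∂_t f + K^ε · ∇f = 0` with values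
in `V`, periodic in `τ`. -/
structure IsSmoothTwoScale (Gs Ks : ℕ → Phase n → Phase n) (f₀ : Phase n → V)
    (f : ℕ → TwoTimeMap (Phase n) V) : Prop where
  eq_tau : ∀ r t τ y, fderiv ℝ (f r).1 (t, τ, y) (0, 1, 0) +
    ∑ p ∈ antidiagonal r, fderiv ℝ (f p.2).1 (t, τ, y) (0, 0, Gs p.1 y) = 0
  eq_t : ∀ r t τ y, fderiv ℝ (f r).1 (t, τ, y) (1, 0, 0) +
    ∑ p ∈ antidiagonal r, fderiv ℝ (f p.2).1 (t, τ, y) (0, 0, Ks p.1 y) = 0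
  init_zero : ∀ y, (f 0).1 (0, 0, y) = f₀ y
  init_succ : ∀ r y, (f (r + 1)).1 (0, 0, y) = 0
  periodic : ∀ r t τ y, (f r).1 (t, τ + 2 * Real.pi, y) = (f r).1 (t, τ, y)

omit [FiniteDimensional ℝ V] in
theorem TwoTimeMap.hasDerivAt_slow {E : Type*} [NormedAddCommGroup E] [NormedSpace ℝ E]
    (f : TwoTimeMap E V) (t τ : ℝ) (y : E) :
    HasDerivAt (fun s => f.1 (s, τ, y)) (fderiv ℝ f.1 (t, τ, y) (1, 0, 0)) t :=
  hasDerivAt_dt f t τ y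

omit [FiniteDimensional ℝ V] in
theorem TwoTimeMap.hasDerivAt_fast {E : Type*} [NormedAddCommGroup E] [NormedSpace ℝ E]
    (f : TwoTimeMap E V) (t τ : ℝ) (y : E) :
    HasDerivAt (fun s => f.1 (t, s, y)) (fderiv ℝ f.1 (t, τ, y) (0, 1, 0)) τ :=
  HasFDerivAt.comp_hasDerivAt (f := fun s => (t, s, y)) τ (f.differentiableAt _).hasFDerivAt
    ((hasDerivAt_const τ t).prodMk ((hasDerivAt_id τ).prodMk (hasDerivAt_const τ y)))

omit [FiniteDimensional ℝ V] in
theorem TwoTimeMap.fderiv_space {E : Type*} [NormedAddCommGroup E] [NormedSpace ℝ E]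
    (f : TwoTimeMap E V) (t τ : ℝ) (y v : E) :
    fderiv ℝ (fun z => f.1 (t, τ, z)) y v = fderiv ℝ f.1 (t, τ, y) (0, 0, v) := by
  have h1 : HasFDerivAt (fun z => f.1 (t, τ, z)) _ y :=
    (f.differentiableAt (t, τ, y)).hasFDerivAt.comp y
      ((hasFDerivAt_const t y).prodMk ((hasFDerivAt_const τ y).prodMk (hasFDerivAt_id y)))
  rw [h1.fderiv]
  rfl

/-- Division by `ε` commutes with transport. It is needed because the averaged series represents `ε
K^ε`. -/
theorem conjSer_succ {𝔏 M : Type*} [LieRing 𝔏] [AddCommGroup M] [LieRingModule 𝔏 M]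
    [Module ℝ M] {L : Ser 𝔏} (hL : L 0 = 0) {Y : Ser M} (hY : Y 0 = 0) (r : ℕ) :
    conjSer L Y (r + 1) = conjSer L (Ser.mk fun r => Y (r + 1)) r := by
  rw [conjSer_apply, Finset.Nat.sum_antidiagonal_succ', hY, conj_apply_zero hL, conjSer_apply]
  simp

/-- The slow equation is first solved formally without any dependence on `τ`, then transported. The
transport commutes with `∂_t` and respects brackets, so the slow equation survives; the fast one is
the `τ`-derivative of a transport. -/
theorem exists_isSmoothTwoScale
    (h : (TimeField.averaging (Phase n)).IsAveraged (hΦ.isGlobalFlow.flowField hG hK) L B)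
    {ψ : ℝ → Phase n → Phase n} (hψ : IsGlobalFlow (averagedField B 0) ψ) {f₀ : Phase n → V}
    (hf₀ : ContDiff ℝ ∞ f₀) : ∃ f : ℕ → TwoTimeMap (Phase n) V,
      IsSmoothTwoScale (companionField hG hK B) (averagedField B) f₀ f := by
  obtain ⟨u, hu, hu0, hu1⟩ := exists_formal_transport contDiff_averagedField hψ hf₀
  let ι : SmoothMap (ℝ × Phase n) V →ₗ[ℝ] TwoTimeMap (Phase n) V :=
    precomp (.mk (fun p => (p.1, p.2.2)) (contDiff_fst.prodMk contDiff_snd.snd))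
  have hι : ∀ (w : SmoothMap (ℝ × Phase n) V) (q v : ℝ × ℝ × Phase n),
      fderiv ℝ (ι w).1 q v = fderiv ℝ w.1 (q.1, q.2.2) (v.1, v.2.2) := by
    intro w q v
    have h1 : HasFDerivAt (fun p : ℝ × ℝ × Phase n => (p.1, p.2.2))
        ((ContinuousLinearMap.fst ℝ ℝ (ℝ × Phase n)).prod
        ((ContinuousLinearMap.snd ℝ ℝ (Phase n)).comp
          (ContinuousLinearMap.snd ℝ ℝ (ℝ × Phase n)))) q :=
      hasFDerivAt_fst.prodMk ((ContinuousLinearMap.snd ℝ ℝ (Phase n)).comp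
        (ContinuousLinearMap.snd ℝ ℝ (ℝ × Phase n))).hasFDerivAt
    rw [fderiv_precomp]
    change fderiv ℝ w.1 (q.1, q.2.2) (fderiv ℝ (fun p : ℝ × ℝ × Phase n => (p.1, p.2.2)) q v) = _
    rw [h1.fderiv]
    rfl
  let m : Ser (TwoTimeMap (Phase n) V) := Ser.mk fun r => ι (u r)
  have hdm : ∀ r, dτ (m r) = 0 := fun r => ext_apply fun q => by
    change fderiv ℝ (ι (u r)).1 q (0, 1, 0) = 0
    rw [hι]
    exact map_zero _
  have hm0 : ⁅B, m⁆ 0 = 0 := by simp [lie_apply, h.B_zero]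
  -- The slow equation in bracket form, with the order shifted by one on account of `B = ε K^ε`.
  have hmt : ∀ r, dt (m r) = -⁅B, m⁆ (r + 1) := fun r => by
    refine ext_apply fun q => ?_
    obtain ⟨t, τ, y⟩ := q
    rw [neg_val, lie_apply, Finset.Nat.sum_antidiagonal_succ, h.B_zero, zero_lie, zero_add, sum_val]
    change fderiv ℝ (ι (u r)).1 (t, τ, y) (1, 0, 0) = -∑ p ∈ antidiagonal r,
      fderiv ℝ (ι (u p.2)).1 (t, τ, y) (0, 0, (B (p.1 + 1)).1 (τ, y))
    simp only [hι]
    have h1 := congrArg (fun Z : SmoothMap (ℝ × Phase n) V => Z.1 (t, y)) (hu r)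
    rw [add_val, sum_val, zero_val] at h1
    rw [eq_neg_iff_add_eq_zero, ← h1]
    congr 1
    refine Finset.sum_congr rfl fun p _ => ?_
    rw [val_of_ddt_eq_zero (h.d_B _) τ]
    rfl
  let f : ℕ → TwoTimeMap (Phase n) V := fun r =>
    .mk (fun p => twoScale Φ L m r p.1 p.2.1 p.2.2)
      (contDiff_twoScale (hΦ := hΦ.isGlobalFlow) (hG := hG) m r)
  have hfy : ∀ r t τ y v, fderiv ℝ (f r).1 (t, τ, y) (0, 0, v) =
      fderiv ℝ (fun z => twoScale Φ L m r t τ z) y v := fun r t τ y v =>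
    ((f r).fderiv_space t τ y v).symm
  refine ⟨f, fun r t τ y => ?_, fun r t τ y => ?_, fun y => ?_, fun r y => ?_, fun r t τ y => ?_⟩
  · rw [((f r).hasDerivAt_fast t τ y).unique (hasDerivAt_twoScale_fast h hdm r t τ y)]
    simp only [hfy]
    rw [← sum_fderiv_twoScale hΦ.isGlobalFlow h.L_zero (ddt_conjSer_companionSer h)
      (conjSer_val_zero h _), neg_add_eq_zero]
    rfl
  · rw [((f r).hasDerivAt_slow t τ y).unique (hasDerivAt_twoScale_slow h.L_zero m r t τ y)]
    simp only [hfy]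
    have h1 := sum_fderiv_twoScale hΦ.isGlobalFlow h.L_zero (ddt_conjSer h)
      (conjSer_val_zero h B) m (r + 1) t τ y
    rw [Finset.Nat.sum_antidiagonal_succ, h.B_zero] at h1
    have h2 : fderiv ℝ (fun z => twoScale Φ L m (0, r + 1).2 t τ z) y
      ((0 : TimeField (Phase n)).1 (0, y)) = 0 := map_zero _
    rw [h2, zero_add] at h1
    refine (congrArg (twoScale Φ L (Ser.map dt m) r t τ y + ·) h1).trans ?_
    rw [twoScale, twoScale, conjSer_succ h.L_zero hm0]
    have h3 : Ser.map dt m = -Ser.mk fun r => ⁅B, m⁆ (r + 1) := Ser.ext hmt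
    rw [h3, conjSer_neg h.L_zero, coeff_neg, neg_val, neg_add_cancel]
  · change twoScale Φ L m 0 0 0 y = _
    rw [twoScale_zero_fast hΦ.isGlobalFlow h]
    exact hu0 y
  · change twoScale Φ L m (r + 1) 0 0 y = _
    rw [twoScale_zero_fast hΦ.isGlobalFlow h]
    exact hu1 r y
  · exact twoScale_periodic hΦ.periodic h hdm r t τ y

namespace IsSmoothTwoScale

variable {Gs Ks : ℕ → Phase n → Phase n}

theorem isTwoScaleSolution {f₀ : Phase n → ℝ} {f : ℕ → TwoTimeMap (Phase n) ℝ}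
    (h : IsSmoothTwoScale Gs Ks f₀ f) :
    IsTwoScaleSolution Gs Ks f₀ fun r t τ y => (f r).1 (t, τ, y) where
  contDiff r := (f r).contDiff.of_le (by simp)
  eq_tau r t τ y := by
    rw [((f r).hasDerivAt_fast t τ y).deriv]
    refine Eq.trans (congrArg _ ?_) (h.eq_tau r t τ y)
    exact Finset.sum_congr rfl fun (p : ℕ × ℕ) _ => (f p.2).fderiv_space t τ y _
  eq_t r t τ y := by
    rw [((f r).hasDerivAt_slow t τ y).deriv]
    refine Eq.trans (congrArg _ ?_) (h.eq_t r t τ y)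
    exact Finset.sum_congr rfl fun (p : ℕ × ℕ) _ => (f p.2).fderiv_space t τ y _
  init_zero := h.init_zero
  init_succ := h.init_succ

omit [FiniteDimensional ℝ V] in
theorem diagonal_zero {f₀ : Phase n → V} {f : ℕ → TwoTimeMap (Phase n) V}
    (h : IsSmoothTwoScale Gs Ks f₀ f) (hs : IsNormalFormSplitting G K Gs Ks) (t τ : ℝ)
    (y : Phase n) : fderiv ℝ (f 0).1 (t, τ, y) (0, 1, 0) +
      fderiv ℝ (f 0).1 (t, τ, y) (0, 0, G y) = 0 := by
  simpa [hs.split_neg] using h.eq_tau 0 t τ y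

omit [FiniteDimensional ℝ V] in
-- This is the sum of the fast equation at order `r + 1` and the slow one at order `r`: beyond `G`
-- and `K` the coefficients of `G^ε / ε + K^ε` cancel.
theorem diagonal_succ {f₀ : Phase n → V} {f : ℕ → TwoTimeMap (Phase n) V}
    (h : IsSmoothTwoScale Gs Ks f₀ f) (hs : IsNormalFormSplitting G K Gs Ks) (r : ℕ) (t τ : ℝ)
    (y : Phase n) : fderiv ℝ (f r).1 (t, τ, y) (1, 0, 0) +
      fderiv ℝ (f (r + 1)).1 (t, τ, y) (0, 1, 0) +
      fderiv ℝ (f (r + 1)).1 (t, τ, y) (0, 0, G y) + fderiv ℝ (f r).1 (t, τ, y) (0, 0, K y) = 0 := by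
  have h1 := h.eq_tau (r + 1) t τ y
  have h2 := h.eq_t r t τ y
  rw [Finset.Nat.sum_antidiagonal_succ] at h1
  have h3 : ∑ p ∈ antidiagonal r, fderiv ℝ (f p.2).1 (t, τ, y) (0, 0, Gs (p.1 + 1) y) +
      ∑ p ∈ antidiagonal r, fderiv ℝ (f p.2).1 (t, τ, y) (0, 0, Ks p.1 y) =
        fderiv ℝ (f r).1 (t, τ, y) (0, 0, K y) := by
    rw [← Finset.sum_add_distrib, Finset.sum_eq_single_of_mem (0, r) (by simp)]
    · rw [← map_add, ← hs.split_zero]; simp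
    · rintro ⟨a, b⟩ hp hne
      obtain ⟨k, rfl⟩ : ∃ k, a = k + 1 := ⟨a - 1, by
        have : a ≠ 0 := fun h => hne (by simp only [mem_antidiagonal] at hp; ext <;> simp <;> omega)
        omega⟩
      have h4 := congrFun (hs.split_pos k) y
      rw [← map_add]
      simp only [Prod.mk_add_mk, add_zero]
      rw [show Gs (k + 1 + 1) y + Ks (k + 1) y = 0 from h4]
      exact map_zero _
  rw [← h3]
  rw [hs.split_neg] at h1
  have h5 := congrArg₂ (· + ·) h1 h2
  simp only [add_zero] at h5
  rw [← h5]
  abel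

theorem isFormalDiagonalSolution {f₀ : Phase n → ℝ} {f : ℕ → TwoTimeMap (Phase n) ℝ}
    (h : IsSmoothTwoScale Gs Ks f₀ f) (hs : IsNormalFormSplitting G K Gs Ks) :
    IsFormalDiagonalSolution G K f₀ fun r t τ y => (f r).1 (t, τ, y) where
  eq_neg t τ y := by
    rw [((f 0).hasDerivAt_fast t τ y).deriv, (f 0).fderiv_space, h.diagonal_zero hs]
  eq r t τ y := by
    rw [((f r).hasDerivAt_slow t τ y).deriv, ((f (r + 1)).hasDerivAt_fast t τ y).deriv,
      (f r).fderiv_space, (f (r + 1)).fderiv_space, h.diagonal_succ hs]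
  init_zero := h.init_zero
  init_succ := h.init_succ

end IsSmoothTwoScale

omit [FiniteDimensional ℝ V] in
-- The function is constant along the characteristics of the slow equation and, at `t = 0`, along
-- those of the fast one.
theorem eq_of_transport_two {g : ℝ → ℝ → Phase n → V}
    (hg : ContDiff ℝ 1 fun p : ℝ × ℝ × Phase n => g p.1 p.2.1 p.2.2) {X : Phase n → Phase n}
    {ψ : ℝ → Phase n → Phase n} (hψ : IsGlobalFlow X ψ) (hΦ : IsGlobalFlow G Φ)
    (h1 : ∀ t τ y, deriv (fun s => g t s y) τ + fderiv ℝ (g t τ) y (G y) = 0)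
    (h2 : ∀ t τ y, deriv (fun s => g s τ y) t + fderiv ℝ (g t τ) y (X y) = 0) (t τ : ℝ)
    (y : Phase n) : g t τ (ψ t (Φ τ y)) = g 0 0 y := by
  rw [eq_of_transport (f := fun t y => g t τ y)
    (hg.comp (contDiff_fst.prodMk (contDiff_const.prodMk contDiff_snd))) hψ (fun t y => h2 t τ y),
    eq_of_transport (f := fun τ y => g 0 τ y)
    (hg.comp (contDiff_const.prodMk (contDiff_fst.prodMk contDiff_snd))) hΦ (fun τ y => h1 0 τ y)]

/-- The two-scale system has at most one solution. -/
theorem IsTwoScaleSolution.eq {Gs Ks : ℕ → Phase n → Phase n} {f₀ : Phase n → ℝ}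
    {f f' : ℕ → ℝ → ℝ → Phase n → ℝ} {ψ : ℝ → Phase n → Phase n} (hψ : IsGlobalFlow (Ks 0) ψ)
    (hK0 : ContDiff ℝ ∞ (Ks 0)) (hG0 : ContDiff ℝ ∞ (Gs 0)) (hΦ : IsGlobalFlow (Gs 0) Φ)
    (h : IsTwoScaleSolution Gs Ks f₀ f) (h' : IsTwoScaleSolution Gs Ks f₀ f') : f = f' := by
  funext r
  induction r using Nat.strong_induction_on with
  | _ r ih =>
  have hda : ∀ {f : ℕ → ℝ → ℝ → Phase n → ℝ}, IsTwoScaleSolution Gs Ks f₀ f → ∀ t τ y,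
      DifferentiableAt ℝ (f r t τ) y ∧ DifferentiableAt ℝ (fun s => f r s τ y) t ∧
        DifferentiableAt ℝ (fun s => f r t s y) τ := fun {f} hf t τ y => by
    have hd := (hf.contDiff r).differentiable (by simp)
    exact ⟨(hd.comp (g := fun p : ℝ × ℝ × Phase n => f r p.1 p.2.1 p.2.2)
        (f := fun z => (t, τ, z)) (by fun_prop)) y,
      (hd.comp (g := fun p : ℝ × ℝ × Phase n => f r p.1 p.2.1 p.2.2)
        (f := fun s => (s, τ, y)) (by fun_prop)) t,
      (hd.comp (g := fun p : ℝ × ℝ × Phase n => f r p.1 p.2.1 p.2.2)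
        (f := fun s => (t, s, y)) (by fun_prop)) τ⟩
  -- Lower orders agree by induction, so the difference at order `r` is transported by the leading
  -- fields alone.
  have hsum : ∀ (X : ℕ → Phase n → Phase n) t τ y,
      ∑ p ∈ antidiagonal r, fderiv ℝ (f p.2 t τ) y (X p.1 y) -
        ∑ p ∈ antidiagonal r, fderiv ℝ (f' p.2 t τ) y (X p.1 y) =
      fderiv ℝ (f r t τ) y (X 0 y) - fderiv ℝ (f' r t τ) y (X 0 y) := fun X t τ y => by
    rw [← Finset.sum_sub_distrib, Finset.sum_eq_single_of_mem (0, r) (by simp)]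
    rintro ⟨a, b⟩ hp hne
    have : b < r := by
      simp only [mem_antidiagonal] at hp
      have : a ≠ 0 := fun h => hne (by ext <;> simp <;> omega)
      omega
    simp [ih b this]
  have key := eq_of_transport_two (g := fun t τ y => f r t τ y - f' r t τ y)
    ((h.contDiff r).sub (h'.contDiff r)) hψ hΦ
    (fun t τ y => by
      rw [deriv_fun_sub (hda h t τ y).2.2 (hda h' t τ y).2.2,
        fderiv_fun_sub (hda h t τ y).1 (hda h' t τ y).1]
      have h1 := congrArg₂ (· - ·) (h.eq_tau r t τ y) (h'.eq_tau r t τ y)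
      simp only [sub_zero] at h1
      rw [add_sub_add_comm, hsum] at h1
      exact h1)
    (fun t τ y => by
      rw [deriv_fun_sub (hda h t τ y).2.1 (hda h' t τ y).2.1,
        fderiv_fun_sub (hda h t τ y).1 (hda h' t τ y).1]
      have h1 := congrArg₂ (· - ·) (h.eq_t r t τ y) (h'.eq_t r t τ y)
      simp only [sub_zero] at h1
      rw [add_sub_add_comm, hsum] at h1
      exact h1)
  funext t τ y
  have h1 := key t τ (Φ (-τ) (ψ (-t) y))
  rw [hΦ.apply_neg hG0, hψ.apply_neg hK0] at h1
  rw [← sub_eq_zero, h1]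
  rcases r with _ | r
  · rw [h.init_zero, h'.init_zero, sub_self]
  · rw [h.init_succ, h'.init_succ, sub_self]

end TwoScale

/-! ### The error of the truncated two-scale solution -/

section ErrorEstimate

open SmoothMap Finset.HasAntidiagonal TwoTimeMap

theorem contDiff_field {n : ℕ} {G K : Phase n → Phase n} (hG : ContDiff ℝ ∞ G)
    (hK : ContDiff ℝ ∞ K) (ε : ℝ) : ContDiff ℝ ∞ fun y => (1 / ε) • G y + K y := by
  have h1 : ContDiff ℝ ∞ fun y => (1 / ε) • G y := hG.const_smul (1 / ε)
  exact h1.add hK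

/-- Continuity method: at the first time where the value `R` is attained, the hypothesis gives a
strict inequality. Negative times follow by reflection. -/
theorem lt_of_continuous_bootstrap {φ : ℝ → ℝ} (hφ : Continuous φ) {R T : ℝ} (h0 : φ 0 < R)
    (h : ∀ t, |t| ≤ T → (∀ s ∈ Set.uIcc 0 t, φ s ≤ R) → φ t < R) (t : ℝ) (ht : |t| ≤ T) :
    φ t < R := by
  have pos : ∀ {φ : ℝ → ℝ}, Continuous φ → φ 0 < R →
      (∀ t, |t| ≤ T → (∀ s ∈ Set.uIcc 0 t, φ s ≤ R) → φ t < R) → ∀ t, 0 ≤ t → t ≤ T → φ t < R := by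
    intro φ hφ h0 h t ht0 htT
    by_contra hlt
    have hne : (Set.Icc 0 t ∩ φ ⁻¹' {R}).Nonempty := by
      obtain ⟨s, hs, hsR⟩ := intermediate_value_Icc ht0 hφ.continuousOn ⟨h0.le, not_lt.1 hlt⟩
      exact ⟨s, hs, hsR⟩
    obtain ⟨s, ⟨hs, hsR⟩, hmin⟩ := (isCompact_Icc.inter_right
      ((isClosed_singleton (x := R)).preimage hφ)).exists_isLeast hne
    have hsR' : φ s = R := hsR
    refine (h s (by rw [abs_of_nonneg hs.1]; exact hs.2.trans htT) fun u hu => ?_).ne hsR'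
    rw [Set.uIcc_of_le hs.1] at hu
    by_contra hlt'
    obtain ⟨v, hv, hvR⟩ := intermediate_value_Icc hu.1 hφ.continuousOn ⟨h0.le, (not_le.1 hlt').le⟩
    have h1 : s ≤ v := hmin ⟨⟨hv.1, hv.2.trans (hu.2.trans hs.2)⟩, hvR⟩
    have h2 : u = s := le_antisymm hu.2 (h1.trans hv.2)
    rw [h2, hsR'] at hlt'
    exact hlt' le_rfl
  rcases le_total 0 t with h1 | h1
  · exact pos hφ h0 h t h1 (by rwa [abs_of_nonneg h1] at ht)
  · have h2 := pos (φ := fun s => φ (-s)) (hφ.comp continuous_neg) (by simpa using h0)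
      (fun s hs hs' => h (-s) (by rwa [abs_neg]) fun u hu => by
        have h3 : -u ∈ Set.uIcc 0 s := by
          rw [Set.mem_uIcc] at hu ⊢
          rcases hu with hu | hu
          · right; constructor <;> linarith [hu.1, hu.2]
          · left; constructor <;> linarith [hu.1, hu.2]
        simpa using hs' (-u) h3) (-t) (by linarith) (by rwa [abs_of_nonpos h1] at ht)
    simpa using h2

variable {E V : Type*} [NormedAddCommGroup E] [NormedSpace ℝ E] [NormedAddCommGroup V]
  [NormedSpace ℝ V]

omit [NormedSpace ℝ E] [NormedSpace ℝ V] in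
-- On the diagonal `τ = t/ε` is unbounded as `ε → 0`; periodicity reduces `τ` to a compact interval
-- and gives bounds uniform in `ε`.
theorem exists_bound_of_periodic [ProperSpace E] {q : ℝ × ℝ × E → V} (hq : Continuous q)
    (hper : ∀ t τ y, q (t, τ + 2 * Real.pi, y) = q (t, τ, y)) (T R : ℝ) :
    ∃ M, 0 ≤ M ∧ ∀ t τ y, |t| ≤ T → ‖y‖ ≤ R → ‖q (t, τ, y)‖ ≤ M := by
  obtain ⟨M, hM⟩ := ((isCompact_Icc (a := -T) (b := T)).prod ((isCompact_Icc (a := (0 : ℝ))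
    (b := 2 * Real.pi)).prod (isCompact_closedBall (0 : E) R))).exists_bound_of_continuousOn
      hq.continuousOn
  refine ⟨max M 0, le_max_right _ _, fun t τ y ht hy => ?_⟩
  have hp : Function.Periodic (fun τ => q (t, τ, y)) (2 * Real.pi) := fun τ => hper t τ y
  obtain ⟨s, hs, hsτ⟩ := hp.exists_mem_Ico₀ Real.two_pi_pos τ
  have h1 : q (t, τ, y) = q (t, s, y) := hsτ
  rw [h1]
  exact (hM _ ⟨abs_le.1 ht, ⟨hs.1, hs.2.le⟩, by simpa using hy⟩).trans (le_max_left _ _)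

variable {n : ℕ} {G K : Phase n → Phase n} {Gs Ks : ℕ → Phase n → Phase n}

/-- The residual `∂_t f + K · ∇f`. -/
noncomputable def slowResidual (K : Phase n → Phase n) (f : TwoTimeMap (Phase n) V)
    (p : ℝ × ℝ × Phase n) : V :=
  fderiv ℝ f.1 p (1, 0, K p.2.2)

namespace IsSmoothTwoScale

variable {f₀ : Phase n → V} {f : ℕ → TwoTimeMap (Phase n) V}

theorem exists_bound (h : IsSmoothTwoScale Gs Ks f₀ f) (r : ℕ) (T R : ℝ) :
    ∃ M, 0 ≤ M ∧ ∀ t τ y, |t| ≤ T → ‖y‖ ≤ R → ‖(f r).1 (t, τ, y)‖ ≤ M :=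
  exists_bound_of_periodic (f r).contDiff.continuous (h.periodic r) T R

theorem exists_bound_slowResidual (h : IsSmoothTwoScale Gs Ks f₀ f) (hK : ContDiff ℝ ∞ K) (r : ℕ)
    (T R : ℝ) :
    ∃ M, 0 ≤ M ∧ ∀ t τ y, |t| ≤ T → ‖y‖ ≤ R → ‖slowResidual K (f r) (t, τ, y)‖ ≤ M := by
  refine exists_bound_of_periodic ?_ (fun t τ y => ?_) T R
  · exact ((f r).contDiff.continuous_fderiv (by simp)).clm_apply (continuous_const.prodMk
      (continuous_const.prodMk (hK.continuous.comp (by fun_prop))))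
  · have h1 : (fun p : ℝ × ℝ × Phase n => (f r).1 (p + (0, 2 * Real.pi, 0))) = (f r).1 := by
      funext p
      obtain ⟨t, τ, y⟩ := p
      simpa using h.periodic r t τ y
    have h2 := fderiv_comp_add_right (𝕜 := ℝ) (f := (f r).1) (x := (t, τ, y))
      ((0 : ℝ), 2 * Real.pi, (0 : Phase n))
    rw [h1] at h2
    rw [slowResidual, slowResidual, h2]
    simp

/-- The derivative of a truncation along a trajectory of `F^ε`. -/
theorem hasDerivAt_truncation (h : IsSmoothTwoScale Gs Ks f₀ f)
    (hs : IsNormalFormSplitting G K Gs Ks) {ε : ℝ} (hε : ε ≠ 0) {x : ℝ → Phase n} {s : ℝ}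
    (hx : HasDerivAt x ((1 / ε) • G (x s) + K (x s)) s) (N : ℕ) :
    HasDerivAt (fun s => ∑ r ∈ Finset.range (N + 1), ε ^ r • (f r).1 (s, s / ε, x s))
      (ε ^ N • slowResidual K (f N) (s, s / ε, x s)) s := by
  have hterm : ∀ r, HasDerivAt (fun s => (f r).1 (s, s / ε, x s))
      (slowResidual K (f r) (s, s / ε, x s) + ε⁻¹ •
        (fderiv ℝ (f r).1 (s, s / ε, x s) (0, 1, 0) +
          fderiv ℝ (f r).1 (s, s / ε, x s) (0, 0, G (x s)))) s := fun r => by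
    have h1 : HasDerivAt (fun s => (s, s / ε, x s)) (1, 1 / ε, (1 / ε) • G (x s) + K (x s)) s :=
      (hasDerivAt_id s).prodMk (((hasDerivAt_id s).div_const ε).prodMk hx)
    have h2 : HasDerivAt (fun s => (f r).1 (s, s / ε, x s)) _ s :=
      HasFDerivAt.comp_hasDerivAt s ((f r).differentiableAt (s, s / ε, x s)).hasFDerivAt h1
    refine h2.congr_deriv ?_
    rw [slowResidual, ← map_add, ← map_smul, ← map_add]
    congr 1
    simp [add_comm]
  induction N with
  | zero =>
    simp only [zero_add, Finset.sum_range_one, pow_zero, one_smul]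
    refine (hterm 0).congr_deriv ?_
    rw [h.diagonal_zero hs, smul_zero, add_zero]
  | succ N ih =>
    simp only [Finset.sum_range_succ _ (N + 1)]
    refine (ih.fun_add ((hterm (N + 1)).const_smul (ε ^ (N + 1)))).congr_deriv ?_
    have h1 := h.diagonal_succ hs N s (s / ε) (x s)
    have h2 : slowResidual K (f N) (s, s / ε, x s) = fderiv ℝ (f N).1 (s, s / ε, x s) (1, 0, 0) +
        fderiv ℝ (f N).1 (s, s / ε, x s) (0, 0, K (x s)) := by
      rw [slowResidual, ← map_add]; simp
    -- The `ε⁻¹` part of the new term cancels the residual left by the previous truncation, so only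
    -- the residual of the new order remains.
    have h3 : slowResidual K (f N) (s, s / ε, x s) +
        (fderiv ℝ (f (N + 1)).1 (s, s / ε, x s) (0, 1, 0) +
          fderiv ℝ (f (N + 1)).1 (s, s / ε, x s) (0, 0, G (x s))) = 0 := by
      rw [h2, ← h1]; abel
    rw [smul_add, smul_smul, pow_succ, mul_assoc, mul_inv_cancel₀ hε, mul_one,
      eq_neg_of_add_eq_zero_right h3, smul_neg]
    abel

end IsSmoothTwoScale

/-- Trajectories of `F^ε` stay in a compact set that does not depend on `ε`. -/
theorem exists_confined_trajectory {Φ ψ : ℝ → Phase n → Phase n}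
    (hs : IsNormalFormSplitting G K Gs Ks) (hΦ : IsPeriodicFlow G Φ) (hG : ContDiff ℝ ∞ G)
    (hK : ContDiff ℝ ∞ K) (hψ : IsGlobalFlow (Ks 0) ψ) {f : ℕ → TwoTimeMap (Phase n) (Phase n)}
    (h : IsSmoothTwoScale Gs Ks id f) {C : Set (Phase n)} (hC : IsCompact C) {T : ℝ}
    (hT : 0 ≤ T) : ∃ R : ℝ, ∀ᶠ ε in 𝓝[>] (0 : ℝ), ∀ y ∈ C, ∃ x : ℝ → Phase n, x 0 = y ∧
      ∀ s, |s| ≤ T → ‖x s‖ ≤ R ∧ HasDerivAt x ((1 / ε) • G (x s) + K (x s)) s := by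
  have hΦc := hΦ.isGlobalFlow.contDiff hG
  have hψc := hψ.contDiff (hs.smooth_K 0)
  obtain ⟨RC, hRC⟩ := hC.isBounded.exists_norm_le
  -- `ψ_t ∘ Φ_τ` is the leading approximation of the motion. Its bound on the ball of radius `RC +
  -- 1` leaves room for an `O(ε)` error.
  obtain ⟨R₁, hR₁, hQ⟩ := exists_bound_of_periodic
    (q := fun p : ℝ × ℝ × Phase n => ψ p.1 (Φ p.2.1 p.2.2))
    (hψc.continuous.comp (continuous_fst.prodMk (hΦc.continuous.comp continuous_snd)))
    (fun t τ y => by simp only [hΦ.periodic]) T (RC + 1)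
  obtain ⟨M₁, hM₁, hq⟩ := h.exists_bound_slowResidual hK 1 T (R₁ + 1)
  obtain ⟨M₂, hM₂, hf1⟩ := h.exists_bound 1 T (R₁ + 1)
  -- The leading coefficient of the two-scale solution with initial value the identity inverts `ψ_t
  -- ∘ Φ_τ`.
  have hlead : ∀ t τ y, ψ t (Φ τ ((f 0).1 (t, τ, y))) = y := fun t τ y => by
    have h1 := eq_of_transport_two (g := fun t τ y => (f 0).1 (t, τ, y))
      ((f 0).contDiff.of_le (by simp)) hψ hΦ.isGlobalFlow
      (fun t τ y => by
        rw [((f 0).hasDerivAt_fast t τ y).deriv, (f 0).fderiv_space, h.diagonal_zero hs])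
      (fun t τ y => by
        rw [((f 0).hasDerivAt_slow t τ y).deriv, (f 0).fderiv_space]
        simpa using h.eq_t 0 t τ y) t τ (Φ (-τ) (ψ (-t) y))
    rw [hΦ.isGlobalFlow.apply_neg hG, hψ.apply_neg (hs.smooth_K 0), h.init_zero] at h1
    rw [h1, id, hΦ.isGlobalFlow.apply_neg hG, hψ.apply_neg (hs.smooth_K 0)]
  refine ⟨R₁ + 1, ?_⟩
  have hsmall : ∀ᶠ ε in 𝓝[>] (0 : ℝ), 0 < ε ∧ ε * (M₁ * T + M₂) ≤ 1 := by
    refine (eventually_mem_nhdsWithin).and (Eventually.filter_mono nhdsWithin_le_nhds ?_)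
    have h1 : Tendsto (fun ε : ℝ => ε * (M₁ * T + M₂)) (𝓝 0) (𝓝 (0 * (M₁ * T + M₂))) :=
      tendsto_id.mul_const _
    rw [zero_mul] at h1
    exact h1.eventually_le_const one_pos
  filter_upwards [hsmall] with ε hε y hy
  -- No completeness of `F^ε` is assumed: a cutoff field has a global flow, whose trajectories are
  -- those of `F^ε` while they stay in the ball.
  obtain ⟨F', hF', hF'c, hF'eq⟩ := exists_contDiff_hasCompactSupport_eqOn
    (F := fun y => (1 / ε) • G y + K y)
    (contDiff_field hG hK ε)
    (R := R₁ + 1) (by linarith)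
  obtain ⟨ψ', hψ'⟩ := exists_isGlobalFlow_of_hasCompactSupport hF' hF'c
  have hode : ∀ s, ‖ψ' s y‖ ≤ R₁ + 1 →
      HasDerivAt (fun s => ψ' s y) ((1 / ε) • G (ψ' s y) + K (ψ' s y)) s := fun s hs' => by
    have h1 := hψ'.ode s y
    rwa [hF'eq (by simpa using hs')] at h1
  have hcont : Continuous fun s => ψ' s y :=
    continuous_iff_continuousAt.2 fun t => (hψ'.ode t y).continuousAt
  -- While the trajectory stays in the ball, `f_0 + ε f_1` moves along it by at most `ε M₁ T` from
  -- its initial value `y`. So `f_0` has norm at most `RC + 1`, and applying `ψ_t ∘ Φ_τ` bounds the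
  -- position by `R₁`.
  have hmain : ∀ s, |s| ≤ T → ‖ψ' s y‖ < R₁ + 1 := by
    refine lt_of_continuous_bootstrap hcont.norm ?_ fun t ht hle => ?_
    · have h1 := hQ 0 0 y (by simpa using hT) ((hRC y hy).trans (by linarith))
      simp only [hΦ.init, hψ.init] at h1
      rw [hψ'.init]
      linarith
    · have h1 : ∀ s ∈ Set.uIcc 0 t, |s| ≤ T := fun s hs' =>
        (by simpa using Set.abs_sub_left_of_mem_uIcc hs' : |s| ≤ |t|).trans ht
      have h2 := (convex_uIcc (0 : ℝ) t).norm_image_sub_le_of_norm_hasDerivWithin_le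
        (f := fun s => ∑ r ∈ Finset.range (1 + 1), ε ^ r • (f r).1 (s, s / ε, ψ' s y))
        (C := ε * M₁)
        (fun s hs' => (h.hasDerivAt_truncation hs hε.1.ne' (hode s (hle s hs')) 1).hasDerivWithinAt)
        (fun s hs' => by
          rw [norm_smul, pow_one, Real.norm_of_nonneg hε.1.le]
          exact mul_le_mul_of_nonneg_left (hq _ _ _ (h1 s hs') (hle s hs')) hε.1.le)
        Set.left_mem_uIcc Set.right_mem_uIcc
      simp only [Finset.sum_range_succ, Finset.range_zero, Finset.sum_empty, zero_add, pow_zero,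
        one_smul, pow_one, zero_div, hψ'.init, h.init_zero, h.init_succ, smul_zero, add_zero, id,
        sub_zero] at h2
      have h3 : ‖ε • (f 1).1 (t, t / ε, ψ' t y)‖ ≤ ε * M₂ := by
        rw [norm_smul, Real.norm_of_nonneg hε.1.le]
        exact mul_le_mul_of_nonneg_left (hf1 _ _ _ ht (hle t Set.right_mem_uIcc)) hε.1.le
      have h4 : ‖(f 0).1 (t, t / ε, ψ' t y)‖ ≤ RC + 1 := by
        have h5 : (f 0).1 (t, t / ε, ψ' t y) = y +
            (((f 0).1 (t, t / ε, ψ' t y) + ε • (f 1).1 (t, t / ε, ψ' t y)) - y) -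
              ε • (f 1).1 (t, t / ε, ψ' t y) := by abel
        rw [h5]
        refine (norm_sub_le _ _).trans ((add_le_add (norm_add_le _ _) le_rfl).trans ?_)
        have h6 : ε * M₁ * ‖t‖ ≤ ε * (M₁ * T) := by
          rw [mul_assoc]
          exact mul_le_mul_of_nonneg_left (mul_le_mul_of_nonneg_left ht hM₁) hε.1.le
        have h7 := hε.2
        rw [mul_add] at h7
        linarith [hRC y hy]
      have h8 := hQ t (t / ε) _ ht h4
      simp only [hlead] at h8
      linarith
  exact ⟨fun s => ψ' s y, hψ'.init y, fun s hs' => ⟨(hmain s hs').le, hode s (hmain s hs').le⟩⟩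

/-- The truncated two-scale solution approximates the solutions of the transport equation. -/
theorem exists_error_bound {Φ ψ : ℝ → Phase n → Phase n} (hs : IsNormalFormSplitting G K Gs Ks)
    (hΦ : IsPeriodicFlow G Φ) (hG : ContDiff ℝ ∞ G) (hK : ContDiff ℝ ∞ K)
    (hψ : IsGlobalFlow (Ks 0) ψ) {g : ℕ → TwoTimeMap (Phase n) (Phase n)}
    (hg : IsSmoothTwoScale Gs Ks id g) {f₀ : Phase n → ℝ} {f : ℕ → TwoTimeMap (Phase n) ℝ}
    (hf : IsSmoothTwoScale Gs Ks f₀ f) {u : ℝ → ℝ → Phase n → ℝ}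
    (hu : ∀ᶠ ε in 𝓝[>] (0 : ℝ), IsTransportSolution (fun y => (1 / ε) • G y + K y) f₀ (u ε))
    (N : ℕ) (T : ℝ) {C : Set (Phase n)} (hC : IsCompact C) :
    ∃ M : ℝ, ∀ᶠ ε in 𝓝[>] (0 : ℝ), ∀ t ∈ Set.Icc (-T) T, ∀ y ∈ C,
      |u ε t y - ∑ r ∈ Finset.range (N + 1), ε ^ r * (f r).1 (t, t / ε, y)| ≤ M * ε ^ (N + 1) := by
  rcases lt_or_ge T 0 with hT | hT
  · exact ⟨0, Eventually.of_forall fun ε t ht => by linarith [ht.1, ht.2]⟩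
  obtain ⟨R, hR⟩ := exists_confined_trajectory hs hΦ hG hK hψ hg hC hT
  obtain ⟨M₁, hM₁, hq⟩ := hf.exists_bound_slowResidual hK (N + 1) T R
  obtain ⟨M₂, hM₂, hf1⟩ := hf.exists_bound (N + 1) T R
  -- One more term than required is kept: `M₁ T` bounds the drift of that longer truncation, `M₂`
  -- the extra term, both at order `ε^(N+1)`.
  refine ⟨M₁ * T + M₂, ?_⟩
  filter_upwards [hR, hu, eventually_mem_nhdsWithin] with ε hε huε hε0 t ht y hy
  have hε0' : 0 < ε := hε0
  have htT : |t| ≤ T := abs_le.2 ht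
  obtain ⟨x, hx0, hx⟩ := hε y hy
  have h1 : ∀ s ∈ Set.uIcc 0 t, |s| ≤ T := fun s hs' =>
    (by simpa using Set.abs_sub_left_of_mem_uIcc hs' : |s| ≤ |t|).trans htT
  have h2 : ∀ s ∈ Set.uIcc 0 t, |s - t| ≤ T := fun s hs' => by
    have h3 := Set.abs_sub_right_of_mem_uIcc hs'
    rw [sub_zero, abs_sub_comm] at h3
    exact h3.trans htT
  -- The trajectory is shifted in time so that it passes through `y` at time `t`. Along it the exact
  -- solution is constant, and at time zero both functions equal `f₀`.
  have hX : ∀ s ∈ Set.uIcc 0 t, HasDerivAt (fun s => x (s - t))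
      ((1 / ε) • G (x (s - t)) + K (x (s - t))) s := fun s hs' => by
    simpa using HasDerivAt.comp_sub_const s t ((hx (s - t) (h2 s hs')).2)
  have h3 := (convex_uIcc (0 : ℝ) t).norm_image_sub_le_of_norm_hasDerivWithin_le
    (f := fun s => u ε s (x (s - t)) - ∑ r ∈ Finset.range (N + 1 + 1),
      ε ^ r • (f r).1 (s, s / ε, x (s - t)))
    (C := ε ^ (N + 1) * M₁)
    (fun s hs' => ((hasDerivAt_along huε.contDiff (hX s hs')).fun_sub
      (hf.hasDerivAt_truncation hs hε0'.ne' (hX s hs') (N + 1))).hasDerivWithinAt)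
    (fun s hs' => by
      rw [huε.eq, zero_sub, norm_neg, norm_smul, Real.norm_of_nonneg (by positivity)]
      exact mul_le_mul_of_nonneg_left (hq _ _ _ (h1 s hs') (hx _ (h2 s hs')).1) (by positivity))
    Set.left_mem_uIcc Set.right_mem_uIcc
  have h4 : ∑ r ∈ Finset.range (N + 1 + 1), ε ^ r • (f r).1 (0, 0 / ε, x (0 - t)) =
      f₀ (x (0 - t)) := by
    rw [Finset.sum_range_succ']
    simp [hf.init_zero, hf.init_succ]
  rw [h4, huε.init] at h3
  simp only [sub_self, sub_zero, hx0] at h3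
  rw [Finset.sum_range_succ _ (N + 1)] at h3
  have h5 : ‖ε ^ (N + 1) • (f (N + 1)).1 (t, t / ε, y)‖ ≤ ε ^ (N + 1) * M₂ := by
    rw [norm_smul, Real.norm_of_nonneg (by positivity)]
    refine mul_le_mul_of_nonneg_left (hf1 _ _ _ htT ?_) (by positivity)
    have := (hx 0 (by simpa using hT)).1
    rwa [hx0] at this
  have h6 : u ε t y - ∑ r ∈ Finset.range (N + 1), ε ^ r * (f r).1 (t, t / ε, y) =
      (u ε t y - (∑ r ∈ Finset.range (N + 1), ε ^ r • (f r).1 (t, t / ε, y) +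
        ε ^ (N + 1) • (f (N + 1)).1 (t, t / ε, y))) +
          ε ^ (N + 1) • (f (N + 1)).1 (t, t / ε, y) := by
    simp only [smul_eq_mul]; ring
  rw [h6, ← Real.norm_eq_abs]
  refine (norm_add_le _ _).trans ((add_le_add h3 h5).trans ?_)
  rw [Real.norm_eq_abs]
  have h7 : ε ^ (N + 1) * M₁ * |t| ≤ ε ^ (N + 1) * M₁ * T :=
    mul_le_mul_of_nonneg_left htT (by positivity)
  linarith

end ErrorEstimate

/-! ### The linear coefficient of a polynomial in time -/

/-- Interpolation weights for the linear coefficient of polynomials of degree at most `R`. -/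
noncomputable def linearWeight (R m : ℕ) : ℝ :=
  (Lagrange.basis (Finset.range (R + 1)) (fun i : ℕ => (i : ℝ)) m).coeff 1

/-- Interpolation at `R + 1` nodes reproduces polynomials of degree at most `R`, in particular their
linear coefficients. -/
theorem sum_linearWeight_mul_pow {R k : ℕ} (hk : k ≤ R) :
    ∑ m ∈ Finset.range (R + 1), linearWeight R m * (m : ℝ) ^ k = if k = 1 then 1 else 0 := by
  have h1 : (Polynomial.X ^ k : Polynomial ℝ) = _ :=
    Lagrange.eq_interpolate (s := Finset.range (R + 1)) (v := fun i : ℕ => (i : ℝ))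
      (fun a _ b _ h => by simpa using h) (by
        rw [Polynomial.degree_X_pow, Finset.card_range]
        exact_mod_cast Nat.lt_succ_of_le hk)
  have h2 := congrArg (fun p : Polynomial ℝ => p.coeff 1) h1
  simp only [Lagrange.interpolate_apply, Polynomial.finsetSum_coeff, Polynomial.coeff_C_mul,
    Polynomial.eval_pow, Polynomial.eval_X, Polynomial.coeff_X_pow] at h2
  rw [← show (if 1 = k then (1 : ℝ) else 0) = if k = 1 then 1 else 0 by simp [eq_comm], h2]
  exact Finset.sum_congr rfl fun m _ => mul_comm _ _

section Secular

open SmoothMap TimeField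

variable {E V : Type*} [NormedAddCommGroup E] [NormedSpace ℝ E] [NormedAddCommGroup V]
  [NormedSpace ℝ V] [FiniteDimensional ℝ E] [FiniteDimensional ℝ V]

/-- The iterated primitives of left-nested brackets with `A`. -/
noncomputable def iteratedPrimitive
    (br : SmoothMap (ℝ × E) V → SmoothMap (ℝ × E) V → SmoothMap (ℝ × E) V)
    (A : SmoothMap (ℝ × E) V) : ℕ → SmoothMap (ℝ × E) V
  | 0 => primitive A
  | s + 1 => primitive (br (iteratedPrimitive br A s) A)

/-- The linear coefficient, divided by `r`, of the values at the periods. -/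
noncomputable def secularCoef (r : ℕ) : SmoothMap (ℝ × E) V →ₗ[ℝ] SmoothMap (ℝ × E) V :=
  (2 * Real.pi * r)⁻¹ •
    ∑ m ∈ Finset.range (r + 1), linearWeight r m • affine 0 (2 * Real.pi * m)

omit [FiniteDimensional ℝ E] [FiniteDimensional ℝ V] in
theorem secularCoef_val (r : ℕ) (X : SmoothMap (ℝ × E) V) (p : ℝ × E) :
    (secularCoef r X).1 p = (2 * Real.pi * r)⁻¹ •
      ∑ m ∈ Finset.range (r + 1), linearWeight r m • X.1 (2 * Real.pi * m, p.2) := by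
  simp [secularCoef]

omit [FiniteDimensional ℝ E] [FiniteDimensional ℝ V] in
theorem val_two_pi_mul {X : SmoothMap (ℝ × E) V} (hX : affine 1 (2 * Real.pi) X = X) (m : ℕ)
    (y : E) : X.1 (2 * Real.pi * m, y) = X.1 (0, y) := by
  induction m with
  | zero => simp
  | succ m ih =>
    have h1 := congrArg (fun X : SmoothMap (ℝ × E) V => X.1 (2 * Real.pi * m, y)) hX
    rw [← ih, ← h1, affine_val]
    have h2 : 1 * (2 * Real.pi * m) + 2 * Real.pi = 2 * Real.pi * ((m + 1 : ℕ) : ℝ) := by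
      push_cast; ring
    rw [h2]

omit [FiniteDimensional ℝ E] [FiniteDimensional ℝ V] in
theorem timeMul_pow_val (k : ℕ) (X : SmoothMap (ℝ × E) V) (p : ℝ × E) :
    ((timeMul ^ k) X).1 p = p.1 ^ k • X.1 p := by
  induction k with
  | zero => simp
  | succ k ih => rw [pow_succ', Module.End.mul_apply, timeMul_val, ih, smul_smul, pow_succ']

/-- The averaged series is the linear coefficient of the iterated primitives. -/
theorem averaged_eq_secularCoef {A : TimeField E} {L B : Ser (TimeField E)}
    (h : (averaging E).IsAveraged A L B) (r : ℕ) :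
    B (r + 1) = secularCoef (r + 1) (iteratedPrimitive (fun X Y => ⁅X, Y⁆) A r) := by
  obtain ⟨Λ, Z, hΛ, hS, hZ, hev, h1, hs⟩ := h.exists_secular isTimeMul (r + 1)
  have hev0 : ∀ {X : TimeField E}, (averaging E).ev X = 0 → ∀ y, X.1 (0, y) = 0 := fun h y => by
    have h2 := congrArg (fun X : TimeField E => X.1 (0, y)) h
    have h3 : (affine 0 0 _ : TimeField E).1 (0, y) = 0 := h2
    simpa using h3
  -- The iterated primitives are the coefficients of the secular solution, index `s` corresponding
  -- to order `s + 1`.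
  have hΛ' : ∀ s ≤ r, iteratedPrimitive (fun X Y => ⁅X, Y⁆) A s = Λ (s + 1) := by
    intro s hsr
    induction s with
    | zero =>
      refine eq_of_ddt_eq ?_ fun y => ?_
      · rw [iteratedPrimitive, ddt_primitive]; exact (h1 (by omega)).symm
      · rw [iteratedPrimitive, primitive_zero_val, hev0 (hev 1)]
    | succ s ih =>
      refine eq_of_ddt_eq ?_ fun y => ?_
      · rw [iteratedPrimitive, ddt_primitive, ih (by omega)]
        exact (hs (s + 1) (by omega) (by omega)).symm
      · rw [iteratedPrimitive, primitive_zero_val, hev0 (hev _)]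
  refine ext_apply fun p => ?_
  obtain ⟨τ, y⟩ := p
  -- At multiples of the period the periodic coefficients take their values at time zero, where `L`
  -- vanishes. What remains is a polynomial in `2πm` with linear coefficient `(r + 1) B_{r+1}`.
  have hval : ∀ m : ℕ, (Λ (r + 1)).1 (2 * Real.pi * m, y) = ∑ k ∈ Finset.range (r + 1),
      (2 * Real.pi * m) ^ (k + 1) • (Z k (r + 1)).1 (0, y) := by
    intro m
    rw [hΛ, add_val, val_two_pi_mul (h.S_L (r + 1)), hev0 (h.ev_L _), zero_add, sum_val]
    refine Finset.sum_congr rfl fun k _ => ?_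
    rw [timeMul_pow_val, val_two_pi_mul (hS k (r + 1))]
  have hZ0 : (Z 0 (r + 1)).1 (0, y) = ((r + 1 : ℕ) : ℝ) • (B (r + 1)).1 (τ, y) := by
    have h2 := congrArg (fun X : TimeField E => X.1 (τ, y)) (hZ (r + 1))
    have h3 : (affine 0 0 (Z 0 (r + 1))).1 (τ, y) = _ := h2
    simpa using h3
  rw [secularCoef_val, hΛ' r le_rfl]
  simp only [hval, Finset.smul_sum (s := Finset.range (r + 1)), smul_smul]
  rw [Finset.sum_comm]
  have h4 : ∀ k ∈ Finset.range (r + 1), ∑ m ∈ Finset.range (r + 1 + 1),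
      (linearWeight (r + 1) m * (2 * Real.pi * m) ^ (k + 1)) • (Z k (r + 1)).1 (0, y) =
      if k = 0 then (2 * Real.pi) • (Z 0 (r + 1)).1 (0, y) else 0 := by
    intro k hk
    rw [← Finset.sum_smul]
    have h5 : ∑ m ∈ Finset.range (r + 1 + 1),
        linearWeight (r + 1) m * (2 * Real.pi * m) ^ (k + 1) =
        (2 * Real.pi) ^ (k + 1) * if k + 1 = 1 then 1 else 0 := by
      rw [← sum_linearWeight_mul_pow (R := r + 1) (by simp at hk; omega), Finset.mul_sum]
      exact Finset.sum_congr rfl fun m _ => by ring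
    rw [h5]
    by_cases hk0 : k = 0
    · subst hk0; simp
    · simp [hk0]
  rw [Finset.sum_congr rfl h4]
  simp only [Finset.sum_ite_eq', Finset.mem_range, Nat.succ_pos, if_true]
  rw [hZ0, smul_smul, smul_smul]
  have : (2 * Real.pi * ((r + 1 : ℕ) : ℝ))⁻¹ * (2 * Real.pi * ((r + 1 : ℕ) : ℝ)) = 1 :=
    inv_mul_cancel₀ (by positivity)
  rw [mul_assoc, this, one_smul]

end Secular

/-! ### Spatial derivatives, divergence and Hamiltonian fields -/

section Geometry

open SmoothMap TimeField

variable {E V W : Type*} [NormedAddCommGroup E] [NormedSpace ℝ E] [NormedAddCommGroup V]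
  [NormedSpace ℝ V] [NormedAddCommGroup W] [NormedSpace ℝ W]

/-- The derivative in a direction of space. -/
noncomputable def spaceDeriv (v : E) : SmoothMap (ℝ × E) V →ₗ[ℝ] SmoothMap (ℝ × E) V :=
  lieDeriv (const (0, v))

theorem spaceDeriv_val (v : E) (X : SmoothMap (ℝ × E) V) (p : ℝ × E) :
    (spaceDeriv v X).1 p = fderiv ℝ X.1 p (0, v) := rfl

theorem spaceDeriv_val_eq_fderiv (v : E) (X : SmoothMap (ℝ × E) V) (τ : ℝ) (y : E) :
    (spaceDeriv v X).1 (τ, y) = fderiv ℝ (fun z => X.1 (τ, z)) y v := by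
  rw [(hasFDerivAt_slice X.contDiff τ y).fderiv]; rfl

theorem ddt_spaceDeriv (v : E) (X : SmoothMap (ℝ × E) V) :
    ddt (spaceDeriv v X) = spaceDeriv v (ddt X) := by
  rw [ddt, spaceDeriv, lieDeriv_comm, lieDeriv_const, lieDeriv_const, sub_zero,
    lieDeriv_zero_left, add_zero]

theorem spaceDeriv_postcomp (v : E) (ℓ : V →L[ℝ] W) (X : SmoothMap (ℝ × E) V) :
    spaceDeriv v (postcomp ℓ X) = postcomp ℓ (spaceDeriv v X) := lieDeriv_postcomp _ _ _

theorem ddt_postcomp (ℓ : V →L[ℝ] W) (X : SmoothMap (ℝ × E) V) :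
    ddt (postcomp ℓ X) = postcomp ℓ (ddt X) := lieDeriv_postcomp _ _ _

theorem spaceDeriv_lieDeriv (v : E) (X : TimeField E) (f : SmoothMap (ℝ × E) V) :
    spaceDeriv v (lieDeriv (lift X) f) =
      lieDeriv (lift X) (spaceDeriv v f) + lieDeriv (lift (spaceDeriv v X)) f := by
  rw [spaceDeriv, lieDeriv_comm, lieDeriv_const, sub_zero, lift, lieDeriv_postcomp]
  rfl

theorem map_primitive_of_ddt_comm [FiniteDimensional ℝ E] [FiniteDimensional ℝ V]
    [FiniteDimensional ℝ W] {T : SmoothMap (ℝ × E) V →ₗ[ℝ] SmoothMap (ℝ × E) W}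
    (hT : ∀ X, ddt (T X) = T (ddt X))
    (hT0 : ∀ X, (∀ y, X.1 (0, y) = 0) → ∀ y, (T X).1 (0, y) = 0) (X : SmoothMap (ℝ × E) V) :
    T (primitive X) = primitive (T X) := by
  refine eq_of_ddt_eq ?_ fun y => ?_
  · rw [hT, ddt_primitive, ddt_primitive]
  · rw [primitive_zero_val, hT0 _ (primitive_zero_val X)]

variable {n : ℕ}

/-- The divergence. -/
noncomputable def divergence : TimeField (Phase n) →ₗ[ℝ] SmoothMap (ℝ × Phase n) ℝ :=
  ∑ i, (postcomp (EuclideanSpace.proj i : Phase n →L[ℝ] ℝ)).comp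
    (spaceDeriv (EuclideanSpace.single i (1 : ℝ)))

theorem divergence_apply (X : TimeField (Phase n)) : divergence X =
    ∑ i, postcomp (EuclideanSpace.proj i : Phase n →L[ℝ] ℝ)
      (spaceDeriv (EuclideanSpace.single i (1 : ℝ)) X) := by
  simp [divergence]

theorem divergence_val (X : TimeField (Phase n)) (τ : ℝ) (y : Phase n) :
    (divergence X).1 (τ, y) =
      ∑ i, fderiv ℝ (fun z => X.1 (τ, z)) y (EuclideanSpace.single i 1) i := by
  rw [divergence_apply, sum_val]
  exact Finset.sum_congr rfl fun i _ => by
    rw [postcomp_apply, spaceDeriv_val_eq_fderiv]; rfl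

theorem divergence_eq_zero_iff (X : TimeField (Phase n)) :
    divergence X = 0 ↔ ∀ τ, IsDivergenceFree fun y => X.1 (τ, y) := by
  refine ⟨fun h τ y => ?_, fun h => ext_apply fun p => ?_⟩
  · rw [← divergence_val, h]; rfl
  · exact (divergence_val X p.1 p.2).trans (h p.1 p.2)

theorem ddt_divergence (X : TimeField (Phase n)) : ddt (divergence X) = divergence (ddt X) := by
  simp only [divergence_apply, map_sum, ddt_postcomp, ddt_spaceDeriv]

theorem lieDeriv_eq_sum (Z : TimeField (Phase n)) (f : SmoothMap (ℝ × Phase n) V)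
    (p : ℝ × Phase n) : (lieDeriv (lift Z) f).1 p =
      ∑ j, (Z.1 p) j • (spaceDeriv (EuclideanSpace.single j (1 : ℝ)) f).1 p := by
  have h1 : ((0 : ℝ), Z.1 p) =
      ∑ j, (Z.1 p) j • ((0 : ℝ), (EuclideanSpace.single j (1 : ℝ) : Phase n)) := by
    refine Prod.ext ?_ ?_
    · simp [Prod.fst_sum]
    · simp only [Prod.snd_sum, Prod.smul_snd]
      have h2 := (EuclideanSpace.basisFun (Fin n) ℝ).sum_repr (Z.1 p)
      simpa using h2.symm
  rw [lieDeriv_apply, lift_val, h1, map_sum]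
  exact Finset.sum_congr rfl fun j _ => by rw [map_smul, spaceDeriv_val]

/-- The terms beyond the directional derivatives are the trace of `DX ∘ DY`, symmetric in `X` and
`Y`, and cancel in the commutator. -/
theorem divergence_lie (X Y : TimeField (Phase n)) :
    divergence ⁅X, Y⁆ = lieDeriv (lift X) (divergence Y) - lieDeriv (lift Y) (divergence X) := by
  have h1 : ∀ X Y : TimeField (Phase n), divergence (lieDeriv (lift X) Y) =
      lieDeriv (lift X) (divergence Y) + ∑ i, postcomp (EuclideanSpace.proj i : Phase n →L[ℝ] ℝ)
        (lieDeriv (lift (spaceDeriv (EuclideanSpace.single i (1 : ℝ)) X)) Y) := by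
    intro X Y
    simp only [divergence_apply, map_sum, spaceDeriv_lieDeriv, map_add, Finset.sum_add_distrib,
      lieDeriv_postcomp]
  have h2 : ∀ X Y : TimeField (Phase n), ∑ i, postcomp (EuclideanSpace.proj i : Phase n →L[ℝ] ℝ)
        (lieDeriv (lift (spaceDeriv (EuclideanSpace.single i (1 : ℝ)) X)) Y) =
      ∑ i, postcomp (EuclideanSpace.proj i : Phase n →L[ℝ] ℝ)
        (lieDeriv (lift (spaceDeriv (EuclideanSpace.single i (1 : ℝ)) Y)) X) := by
    intro X Y
    refine ext_apply fun p => ?_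
    simp only [sum_val, postcomp_apply, lieDeriv_eq_sum, map_sum, map_smul, smul_eq_mul]
    rw [Finset.sum_comm]
    exact Finset.sum_congr rfl fun i _ => Finset.sum_congr rfl fun j _ => mul_comm _ _
  rw [lie_def, map_sub, h1, h1, h2 X Y]
  abel

/-- Such a function is constant along the characteristics `s ↦ (s, Φ_{-s} z)`. -/
theorem IsGlobalFlow.eq_zero_of_ddt_eq [FiniteDimensional ℝ E] {G : E → E} {Φ : ℝ → E → E}
    (h : IsGlobalFlow G Φ) (hG : ContDiff ℝ ∞ G) {f : SmoothMap (ℝ × E) V}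
    (hf : ddt f = lieDeriv (lift (autonomous G hG)) f) (h0 : ∀ y, f.1 (0, y) = 0) : f = 0 := by
  have h1 : ∀ z t, HasDerivAt (fun s => f.1 (s, Φ (-s) z)) 0 t := fun z t => by
    refine (hasDerivAt_comp_curve f.contDiff (h.hasDerivAt_neg t z)).congr_deriv ?_
    have h2 := congrArg (fun f : SmoothMap (ℝ × E) V => f.1 (t, Φ (-t) z)) hf
    have h3 : fderiv ℝ f.1 (t, Φ (-t) z) (1, 0) = fderiv ℝ f.1 (t, Φ (-t) z)
      (0, G (Φ (-t) z)) := h2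
    have h4 : ((0 : ℝ), -G (Φ (-t) z)) = -(0, G (Φ (-t) z)) := by simp
    rw [h4, map_neg, h3, add_neg_cancel]
  refine ext_apply fun p => ?_
  have h2 := is_const_of_deriv_eq_zero (fun t => (h1 (Φ p.1 p.2) t).differentiableAt)
    (fun t => (h1 (Φ p.1 p.2) t).deriv) p.1 0
  rw [h.neg_apply hG, h0] at h2
  exact h2

variable {G K : Phase n → Phase n} {Φ : ℝ → Phase n → Phase n}

/-- The divergence of the pulled-back field is transported by `G`, because `∂_τ K_τ = [G, K_τ]` and
`G` is divergence-free, and it vanishes at `τ = 0`. -/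
theorem divergence_flowField (hΦ : IsGlobalFlow G Φ) (hG : ContDiff ℝ ∞ G) (hK : ContDiff ℝ ∞ K)
    (hdG : IsDivergenceFree G) (hdK : IsDivergenceFree K) :
    divergence (hΦ.flowField hG hK) = 0 := by
  have h1 : divergence (autonomous G hG) = 0 := (divergence_eq_zero_iff _).2 fun _ => hdG
  refine hΦ.eq_zero_of_ddt_eq hG ?_ fun y => ?_
  · rw [ddt_divergence, hΦ.ddt_flowField, divergence_lie, h1, map_zero, sub_zero]
  · rw [divergence_val]
    simp only [hΦ.flowField_zero]
    exact hdK y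

theorem divergence_primitive {X : TimeField (Phase n)} (hX : divergence X = 0) :
    divergence (primitive X) = 0 := by
  refine eq_of_ddt_eq ?_ fun y => ?_
  · rw [ddt_divergence, ddt_primitive, hX, map_zero]
  · rw [divergence_val]
    simp

theorem divergence_iteratedPrimitive {A : TimeField (Phase n)} (hA : divergence A = 0) (s : ℕ) :
    divergence (iteratedPrimitive (fun X Y => ⁅X, Y⁆) A s) = 0 := by
  induction s with
  | zero => exact divergence_primitive hA
  | succ s ih =>
    refine divergence_primitive ?_
    rw [divergence_lie, hA, ih, map_zero, map_zero, sub_zero]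

theorem divergence_secularCoef {X : TimeField (Phase n)} (hX : divergence X = 0) (r : ℕ) :
    divergence (secularCoef r X) = 0 := by
  have h1 : ∀ m : ℕ, divergence (affine 0 (2 * Real.pi * m) X) = 0 := fun m => by
    refine (divergence_eq_zero_iff _).2 fun τ => ?_
    simpa using (divergence_eq_zero_iff _).1 hX (2 * Real.pi * m)
  simp [secularCoef, h1]

theorem isDivergenceFree_of_divergence {X : TimeField (Phase n)} (hX : divergence X = 0) :
    IsDivergenceFree fun y => X.1 (0, y) := (divergence_eq_zero_iff _).1 hX 0

/-- The splitting of divergence-free fields is divergence-free. -/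
theorem isDivergenceFree_averagedField {hΦ : IsPeriodicFlow G Φ} {hG : ContDiff ℝ ∞ G}
    {hK : ContDiff ℝ ∞ K} {L B : Ser (TimeField (Phase n))}
    (h : (averaging (Phase n)).IsAveraged (hΦ.isGlobalFlow.flowField hG hK) L B)
    (hdG : IsDivergenceFree G) (hdK : IsDivergenceFree K) (r : ℕ) :
    IsDivergenceFree (companionField hG hK B r) ∧ IsDivergenceFree (averagedField B r) := by
  have hB : ∀ r, divergence (B r) = 0 := by
    rintro (_ | r)
    · rw [h.B_zero, map_zero]
    · rw [averaged_eq_secularCoef h]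
      exact divergence_secularCoef
        (divergence_iteratedPrimitive (divergence_flowField _ _ _ hdG hdK) r) _
  refine ⟨isDivergenceFree_of_divergence (X := companionSer hG hK B r) ?_,
    isDivergenceFree_of_divergence (hB (r + 1))⟩
  have h1 : divergence (autonomous G hG) = 0 := (divergence_eq_zero_iff _).2 fun _ => hdG
  have h2 : divergence (autonomous K hK) = 0 := (divergence_eq_zero_iff _).2 fun _ => hdK
  rcases r with _ | _ | r
  · simp [companionSer, hB, h1]
  · simp [companionSer, hB, h2]
  · simp [companionSer, hB, Ser.monomialOne]

/-- The Hamiltonian vector field of a time-dependent function. -/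
noncomputable def hamiltonian (J : Matrix (Fin n) (Fin n) ℝ) :
    SmoothMap (ℝ × Phase n) ℝ →ₗ[ℝ] TimeField (Phase n) :=
  ∑ j, (postcomp (ContinuousLinearMap.toSpanSingleton ℝ
    (Matrix.toEuclideanLin J⁻¹ (EuclideanSpace.single j (1 : ℝ))))).comp
      (spaceDeriv (EuclideanSpace.single j (1 : ℝ)))

variable (J : Matrix (Fin n) (Fin n) ℝ)

theorem hamiltonian_apply (f : SmoothMap (ℝ × Phase n) ℝ) : hamiltonian J f =
    ∑ j, postcomp (ContinuousLinearMap.toSpanSingleton ℝ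
      (Matrix.toEuclideanLin J⁻¹ (EuclideanSpace.single j (1 : ℝ))))
        (spaceDeriv (EuclideanSpace.single j (1 : ℝ)) f) := by
  simp [hamiltonian]

theorem gradient_eq_sum (f : Phase n → ℝ) (y : Phase n) : gradient f y =
    ∑ j, fderiv ℝ f y (EuclideanSpace.single j 1) • EuclideanSpace.single j (1 : ℝ) := by
  have h1 := (EuclideanSpace.basisFun (Fin n) ℝ).sum_repr (gradient f y)
  rw [← h1]
  refine Finset.sum_congr rfl fun j _ => ?_
  rw [EuclideanSpace.basisFun_apply, ← inner_gradient_left, EuclideanSpace.inner_single_right]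
  simp

theorem hamiltonian_val (f : SmoothMap (ℝ × Phase n) ℝ) (τ : ℝ) (y : Phase n) :
    (hamiltonian J f).1 (τ, y) = hamiltonianField J (fun z => f.1 (τ, z)) y := by
  rw [hamiltonian_apply, hamiltonianField, gradient_eq_sum, map_sum, sum_val]
  exact Finset.sum_congr rfl fun j _ => by
    rw [postcomp_apply, spaceDeriv_val_eq_fderiv, map_smul]; rfl

theorem ddt_hamiltonian (f : SmoothMap (ℝ × Phase n) ℝ) :
    ddt (hamiltonian J f) = hamiltonian J (ddt f) := by
  simp only [hamiltonian_apply, map_sum, ddt_postcomp, ddt_spaceDeriv]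

theorem spaceDeriv_comm (v w : E) (X : SmoothMap (ℝ × E) V) :
    spaceDeriv v (spaceDeriv w X) = spaceDeriv w (spaceDeriv v X) := by
  rw [spaceDeriv, spaceDeriv, lieDeriv_comm, lieDeriv_const, lieDeriv_const, sub_zero,
    lieDeriv_zero_left, add_zero]

theorem spaceDeriv_hamiltonian (v : Phase n) (f : SmoothMap (ℝ × Phase n) ℝ) :
    spaceDeriv v (hamiltonian J f) = hamiltonian J (spaceDeriv v f) := by
  simp only [hamiltonian_apply, map_sum, spaceDeriv_postcomp]
  exact Finset.sum_congr rfl fun j _ => by rw [spaceDeriv_comm]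

/-- The Poisson bracket of time-dependent functions. -/
noncomputable def poisson (f g : SmoothMap (ℝ × Phase n) ℝ) : SmoothMap (ℝ × Phase n) ℝ :=
  lieDeriv (lift (hamiltonian J f)) g

theorem toEuclideanLin_single (A : Matrix (Fin n) (Fin n) ℝ) (i j : Fin n) :
    Matrix.toEuclideanLin A (EuclideanSpace.single j (1 : ℝ)) i = A i j := by
  simp

theorem poisson_val (f g : SmoothMap (ℝ × Phase n) ℝ) (p : ℝ × Phase n) :
    (poisson J f g).1 p = ∑ i, ∑ j, J⁻¹ i j *
      (spaceDeriv (EuclideanSpace.single j (1 : ℝ)) f).1 p *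
      (spaceDeriv (EuclideanSpace.single i (1 : ℝ)) g).1 p := by
  rw [poisson, lieDeriv_eq_sum]
  refine Finset.sum_congr rfl fun i _ => ?_
  have h1 : ((hamiltonian J f).1 p) i = ∑ j, J⁻¹ i j *
      (spaceDeriv (EuclideanSpace.single j (1 : ℝ)) f).1 p := by
    rw [hamiltonian_apply, sum_val, WithLp.ofLp_sum, Finset.sum_apply]
    refine Finset.sum_congr rfl fun j _ => ?_
    rw [postcomp_apply, ContinuousLinearMap.toSpanSingleton_apply, PiLp.smul_apply,
      toEuclideanLin_single, smul_eq_mul, mul_comm]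
  rw [h1, smul_eq_mul, Finset.sum_mul]

variable {J}

theorem inv_apply_swap (hJ : J.transpose = -J) (hJu : IsUnit J.det) (i j : Fin n) :
    J⁻¹ i j = -J⁻¹ j i := by
  have h1 : (J⁻¹).transpose = -J⁻¹ := by
    rw [Matrix.transpose_nonsing_inv, hJ]
    exact Matrix.inv_eq_left_inv (by rw [neg_mul_neg, Matrix.nonsing_inv_mul _ hJu])
  have h2 := congrFun (congrFun h1 j) i
  simpa using h2

theorem poisson_swap (hJ : J.transpose = -J) (hJu : IsUnit J.det)
    (f g : SmoothMap (ℝ × Phase n) ℝ) :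
    poisson J f g = -poisson J g f := by
  refine ext_apply fun p => ?_
  rw [neg_val, poisson_val, poisson_val, Finset.sum_comm, ← Finset.sum_neg_distrib]
  refine Finset.sum_congr rfl fun i _ => ?_
  rw [← Finset.sum_neg_distrib]
  refine Finset.sum_congr rfl fun j _ => ?_
  rw [inv_apply_swap hJ hJu]; ring

/-- Differentiating `{f, g}` in a direction `v` gives `{f, ∂_v g} + {∂_v f, g}`. Skew-symmetry turns
the second term into `-{g, ∂_v f}`, and applying `J⁻¹` yields the commutator of the two fields. -/
theorem hamiltonian_poisson (hJ : J.transpose = -J) (hJu : IsUnit J.det)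
    (f g : SmoothMap (ℝ × Phase n) ℝ) :
    hamiltonian J (poisson J f g) = ⁅hamiltonian J f, hamiltonian J g⁆ := by
  have h1 : ∀ v, spaceDeriv v (poisson J f g) = lieDeriv (lift (hamiltonian J f))
      (spaceDeriv v g) - lieDeriv (lift (hamiltonian J g)) (spaceDeriv v f) := by
    intro v
    have h2 := poisson_swap hJ hJu (spaceDeriv v f) g
    rw [poisson, spaceDeriv_lieDeriv, spaceDeriv_hamiltonian]
    rw [poisson, poisson] at h2
    rw [h2, sub_eq_add_neg]
  rw [hamiltonian_apply, lie_def]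
  simp only [h1, map_sub, ← lieDeriv_postcomp, Finset.sum_sub_distrib]
  rw [← map_sum, ← map_sum, ← hamiltonian_apply, ← hamiltonian_apply]

theorem hamiltonian_primitive (f : SmoothMap (ℝ × Phase n) ℝ) :
    hamiltonian J (primitive f) = primitive (hamiltonian J f) := by
  refine map_primitive_of_ddt_comm (ddt_hamiltonian J) (fun X hX y => ?_) f
  rw [hamiltonian_val, hamiltonianField, gradient_eq_sum]
  simp [hX]

/-- `J⁻¹∇` commutes with primitives in time and takes Poisson brackets to Lie brackets, so the whole
construction lifts to Hamiltonians. -/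
theorem hamiltonian_iteratedPrimitive (hJ : J.transpose = -J) (hJu : IsUnit J.det)
    (f : SmoothMap (ℝ × Phase n) ℝ) (s : ℕ) : hamiltonian J (iteratedPrimitive (poisson J) f s) =
      iteratedPrimitive (fun X Y => ⁅X, Y⁆) (hamiltonian J f) s := by
  induction s with
  | zero => exact hamiltonian_primitive f
  | succ s ih =>
    rw [iteratedPrimitive, hamiltonian_primitive, hamiltonian_poisson hJ hJu, ih]; rfl

theorem hamiltonian_secularCoef (f : SmoothMap (ℝ × Phase n) ℝ) (r : ℕ) :
    hamiltonian J (secularCoef r f) = secularCoef r (hamiltonian J f) := by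
  have h1 : ∀ m : ℕ, hamiltonian J (affine 0 (2 * Real.pi * m) f) =
      affine 0 (2 * Real.pi * m) (hamiltonian J f) := fun m => by
    refine ext_apply fun p => ?_
    obtain ⟨τ, y⟩ := p
    rw [affine_val, hamiltonian_val, hamiltonian_val]
    simp only [affine_val]
  simp only [secularCoef, LinearMap.smul_apply, LinearMap.sum_apply, map_smul, map_sum, h1]

/-- A function along a flow. -/
noncomputable def IsGlobalFlow.flowFun (hΦ : IsGlobalFlow G Φ) (hG : ContDiff ℝ ∞ G)
    {H : Phase n → ℝ} (hH : ContDiff ℝ ∞ H) : SmoothMap (ℝ × Phase n) ℝ :=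
  .mk (fun p => H (Φ p.1 p.2)) (hH.comp (hΦ.contDiff hG))

theorem ddt_flowFun (hΦ : IsGlobalFlow G Φ) (hG : ContDiff ℝ ∞ G) {H : Phase n → ℝ}
    (hH : ContDiff ℝ ∞ H) : ddt (hΦ.flowFun hG hH) =
      lieDeriv (lift (autonomous G hG)) (hΦ.flowFun hG hH) := by
  refine eq_ddt fun τ y => ?_
  have hd := hH.differentiable (by simp) (Φ τ y)
  have h1 : HasDerivAt (fun s => H (Φ s y)) _ τ :=
    HasFDerivAt.comp_hasDerivAt (l := H) τ hd.hasFDerivAt (hΦ.ode τ y)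
  refine h1.congr_deriv ?_
  have h2 : HasFDerivAt (fun z => H (Φ τ z)) (fderiv ℝ H (Φ τ y) ∘L fderiv ℝ (Φ τ) y) y :=
    hd.hasFDerivAt.comp y (hΦ.differentiableAt hG τ y).hasFDerivAt
  have h3 : HasFDerivAt (fun z => H (Φ τ z)) _ y :=
    hasFDerivAt_slice (hΦ.flowFun hG hH).contDiff τ y
  have h4 := DFunLike.congr_fun (h2.unique h3) (G y)
  rw [ContinuousLinearMap.comp_apply, hΦ.fderiv_apply_self hG] at h4
  rw [h4]; rfl

/-- The pullback of a Hamiltonian field along a Hamiltonian flow. -/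
theorem hamiltonian_flowFun (hJ : J.transpose = -J) (hJu : IsUnit J.det)
    (hΦ : IsGlobalFlow G Φ) (hG : ContDiff ℝ ∞ G) (hK : ContDiff ℝ ∞ K) {HG HK : Phase n → ℝ}
    (hHG : ContDiff ℝ ∞ HG) (hHK : ContDiff ℝ ∞ HK) (hGJ : G = hamiltonianField J HG)
    (hKJ : K = hamiltonianField J HK) :
    hamiltonian J (hΦ.flowFun hG hHK) = hΦ.flowField hG hK := by
  set h : SmoothMap (ℝ × Phase n) ℝ := .mk (fun p => HG p.2) (hHG.comp contDiff_snd) with hh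
  have h1 : hamiltonian J h = autonomous G hG := ext_apply fun p => by
    rw [autonomous_val, hGJ]; exact hamiltonian_val J h p.1 p.2
  -- Both sides solve `∂X = [G, X]` and have the value `K` at time zero, and such solutions are
  -- determined by the flow.
  have h2 : ddt (hamiltonian J (hΦ.flowFun hG hHK)) =
      ⁅autonomous G hG, hamiltonian J (hΦ.flowFun hG hHK)⁆ := by
    rw [ddt_hamiltonian, ddt_flowFun, ← h1, ← hamiltonian_poisson hJ hJu]; rfl
  have h3 : ∀ y, (hamiltonian J (hΦ.flowFun hG hHK)).1 (0, y) = K y := fun y => by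
    rw [hamiltonian_val, hKJ]
    have : (fun z => (hΦ.flowFun hG hHK).1 (0, z)) = HK := funext fun z =>
      congrArg HK (hΦ.init z)
    rw [this]
  refine ext_apply fun p => ?_
  have h4 := hΦ.fderiv_neg_apply_of_ddt_eq hG h2 p.1 (Φ p.1 p.2)
  have h5 := hΦ.fderiv_neg_apply_of_ddt_eq hG (hΦ.ddt_flowField hG hK) p.1 (Φ p.1 p.2)
  rw [hΦ.neg_apply hG, h3] at h4
  rw [hΦ.neg_apply hG, hΦ.flowField_zero] at h5
  exact h4.symm.trans h5

/-- The Hamiltonian of the averaged field. -/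
noncomputable def averagedHamiltonian (J : Matrix (Fin n) (Fin n) ℝ)
    (f : SmoothMap (ℝ × Phase n) ℝ) (r : ℕ) (y : Phase n) : ℝ :=
  (secularCoef (r + 1) (iteratedPrimitive (poisson J) f r)).1 (0, y)

theorem averagedField_eq_hamiltonianField {hΦ : IsPeriodicFlow G Φ} {hG : ContDiff ℝ ∞ G}
    {hK : ContDiff ℝ ∞ K} {L B : Ser (TimeField (Phase n))}
    (h : (averaging (Phase n)).IsAveraged (hΦ.isGlobalFlow.flowField hG hK) L B)
    (hJ : J.transpose = -J) (hJu : IsUnit J.det) {HG HK : Phase n → ℝ}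
    (hHG : ContDiff ℝ ∞ HG) (hHK : ContDiff ℝ ∞ HK) (hGJ : G = hamiltonianField J HG)
    (hKJ : K = hamiltonianField J HK) (r : ℕ) : averagedField B r =
      hamiltonianField J (averagedHamiltonian J (hΦ.isGlobalFlow.flowFun hG hHK) r) := by
  funext y
  have h1 := hamiltonian_val J (secularCoef (r + 1) (iteratedPrimitive (poisson J)
    (hΦ.isGlobalFlow.flowFun hG hHK) r)) 0 y
  rw [hamiltonian_secularCoef, hamiltonian_iteratedPrimitive hJ hJu,
    hamiltonian_flowFun hJ hJu hΦ.isGlobalFlow hG hK hHG hHK hGJ hKJ,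
    ← averaged_eq_secularCoef h] at h1
  exact h1

theorem hamiltonianField_neg (f : Phase n → ℝ) :
    hamiltonianField J (-f) = -hamiltonianField J f := by
  funext y
  simp only [hamiltonianField, gradient_eq_sum, Pi.neg_apply, map_sum, fderiv_neg]
  simp

theorem hamiltonianField_sub {f g : Phase n → ℝ} (hf : ContDiff ℝ ∞ f) (hg : ContDiff ℝ ∞ g) :
    hamiltonianField J (f - g) = hamiltonianField J f - hamiltonianField J g := by
  funext y
  have h1 : gradient (f - g) y = gradient f y - gradient g y := by
    simp only [gradient_eq_sum]
    rw [fderiv_sub (hf.differentiable (by simp) y) (hg.differentiable (by simp) y)]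
    simp [sub_smul]
  simp [hamiltonianField, h1]

theorem companionSeries_hamiltonianField {HG HK : Phase n → ℝ} {Hs : ℕ → Phase n → ℝ}
    (hHK : ContDiff ℝ ∞ HK) (hHs : ∀ r, ContDiff ℝ ∞ (Hs r)) (r : ℕ) :
    companionSeries (hamiltonianField J HG) (hamiltonianField J HK)
      (fun r => hamiltonianField J (Hs r)) r = hamiltonianField J (companionSeries HG HK Hs r) := by
  rcases r with _ | _ | r
  · rfl
  · exact (hamiltonianField_sub hHK (hHs 0)).symm
  · exact (hamiltonianField_neg _).symm

end Geometry

/-! ### Iterated oscillatory integrals -/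

section Oscillatory

open Complex

/-- The primitive `∫₀ᵗ e^{ijs} f(s) ds`. -/
noncomputable def oscPrim (j : ℤ) (f : ℝ → ℂ) (t : ℝ) : ℂ :=
  ∫ s in (0 : ℝ)..t, exp (I * j * s) * f s

/-- Iterated oscillatory primitives, the first letter being the innermost one. -/
noncomputable def iterOsc (l : List ℤ) (f : ℝ → ℂ) : ℝ → ℂ := l.foldl (fun g j => oscPrim j g) f

/-- The divided powers of time. -/
noncomputable def timePow (r : ℕ) (t : ℝ) : ℂ := (t : ℂ) ^ r / r.factorial

theorem continuous_timePow (r : ℕ) : Continuous (timePow r) := by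
  unfold timePow; fun_prop

theorem timePow_zero : timePow 0 = fun _ => 1 := by funext t; simp [timePow]

theorem continuous_osc (j : ℤ) : Continuous fun s : ℝ => exp (I * j * s) := by fun_prop

theorem hasDerivAt_oscPrim (j : ℤ) {f : ℝ → ℂ} (hf : Continuous f) (t : ℝ) :
    HasDerivAt (oscPrim j f) (exp (I * j * t) * f t) t :=
  hasDerivAt_primitive (f := fun s : ℝ => exp (I * j * s) * f s) ((continuous_osc j).mul hf) t

theorem oscPrim_apply_zero (j : ℤ) (f : ℝ → ℂ) : oscPrim j f 0 = 0 := by simp [oscPrim]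

theorem continuous_oscPrim (j : ℤ) {f : ℝ → ℂ} (hf : Continuous f) : Continuous (oscPrim j f) :=
  continuous_iff_continuousAt.2 fun t => (hasDerivAt_oscPrim j hf t).continuousAt

theorem hasDerivAt_timePow (r : ℕ) (t : ℝ) : HasDerivAt (timePow (r + 1)) (timePow r t) t := by
  have h1 : HasDerivAt (fun s : ℝ => (s : ℂ)) 1 t := ofRealCLM.hasDerivAt
  have h2 : HasDerivAt (fun s : ℝ => (s : ℂ) ^ (r + 1) / ((r + 1).factorial : ℂ)) _ t :=
    (h1.pow (r + 1)).div_const _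
  refine h2.congr_deriv ?_
  have h3 : ((r + 1 : ℕ) : ℂ) ≠ 0 := Nat.cast_ne_zero.2 (Nat.succ_ne_zero r)
  have h4 : ((r.factorial : ℕ) : ℂ) ≠ 0 := Nat.cast_ne_zero.2 r.factorial_ne_zero
  rw [timePow, Nat.factorial_succ, Nat.cast_mul]
  simp only [Nat.add_sub_cancel]
  field_simp

theorem hasDerivAt_osc (j : ℤ) (t : ℝ) :
    HasDerivAt (fun s : ℝ => exp (I * j * s)) (I * j * exp (I * j * t)) t := by
  have h1 : HasDerivAt (fun s : ℝ => (s : ℂ)) 1 t := ofRealCLM.hasDerivAt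
  have h2 : HasDerivAt (fun s : ℝ => exp (I * j * s)) _ t := (h1.const_mul (I * j)).cexp
  exact h2.congr_deriv (by ring)

theorem oscPrim_zero_timePow (r : ℕ) : oscPrim 0 (timePow r) = timePow (r + 1) := by
  funext t
  refine eq_of_hasDerivAt_eq (hasDerivAt_oscPrim 0 (continuous_timePow r)) (fun t => ?_) ?_ t
  · simpa using hasDerivAt_timePow r t
  · simp [oscPrim_apply_zero, timePow]

theorem I_div_mul {j : ℂ} (hj : j ≠ 0) : I / j * (I * j) = -1 := by
  field_simp
  exact I_sq

theorem oscPrim_one {j : ℤ} (hj : j ≠ 0) (t : ℝ) :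
    oscPrim j (timePow 0) t = I / j * (1 - exp (I * j * t) * 1) := by
  have hj' : (j : ℂ) ≠ 0 := Int.cast_ne_zero.2 hj
  refine eq_of_hasDerivAt_eq (g := fun t : ℝ => I / j * (1 - exp (I * j * t) * 1))
    (hasDerivAt_oscPrim j (continuous_timePow 0)) (fun t => ?_) ?_ t
  · have h1 : HasDerivAt (fun t : ℝ => I / j * (1 - exp (I * j * t) * 1)) _ t :=
      (((hasDerivAt_osc j t).mul_const 1).const_sub 1).const_mul (I / j)
    refine h1.congr_deriv ?_
    rw [timePow_zero]
    linear_combination (-exp (I * j * t)) * I_div_mul hj'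
  · simp [oscPrim_apply_zero]

/-- Integration by parts against `e^{ijt}`. At multiples of `2π` the exponential is `1`, which
leaves the recursion for `β̄` of a word of zeros and one further letter. -/
theorem oscPrim_timePow_succ {j : ℤ} (hj : j ≠ 0) (r : ℕ) (t : ℝ) :
    oscPrim j (timePow (r + 1)) t =
      I / j * (oscPrim j (timePow r) t - exp (I * j * t) * timePow (r + 1) t) := by
  have hj' : (j : ℂ) ≠ 0 := Int.cast_ne_zero.2 hj
  refine eq_of_hasDerivAt_eq
    (g := fun t : ℝ => I / j * (oscPrim j (timePow r) t - exp (I * j * t) * timePow (r + 1) t))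
    (hasDerivAt_oscPrim j (continuous_timePow _)) (fun t => ?_) ?_ t
  · have h1 : HasDerivAt (fun t : ℝ => I / j * (oscPrim j (timePow r) t -
        exp (I * j * t) * timePow (r + 1) t)) _ t :=
      ((hasDerivAt_oscPrim j (continuous_timePow r) t).fun_sub
        ((hasDerivAt_osc j t).fun_mul (hasDerivAt_timePow r t))).const_mul (I / j)
    refine h1.congr_deriv ?_
    linear_combination (-exp (I * j * t) * timePow (r + 1) t) * I_div_mul hj'
  · simp [oscPrim_apply_zero, timePow]

/-- An exponential left over from one integration merges with the next letter. This is the origin of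
the letter `j + l₁` in the recursion. -/
theorem oscPrim_comb (l j : ℤ) (c : ℂ) {f g : ℝ → ℂ} (hf : Continuous f) (hg : Continuous g) :
    oscPrim l (fun t => c * (f t - exp (I * j * t) * g t)) =
      fun t => c * (oscPrim l f t - oscPrim (j + l) g t) := by
  funext t
  have hc : Continuous fun t : ℝ => c * (f t - exp (I * j * t) * g t) :=
    continuous_const.mul (hf.sub ((continuous_osc j).mul hg))
  refine eq_of_hasDerivAt_eq (g := fun t => c * (oscPrim l f t - oscPrim (j + l) g t))
    (hasDerivAt_oscPrim l hc) (fun t => ?_) ?_ t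
  · refine ((hasDerivAt_oscPrim l hf t).fun_sub
      (hasDerivAt_oscPrim (j + l) hg t)).const_mul c |>.congr_deriv ?_
    have : exp (I * ((j + l : ℤ) : ℂ) * t) = exp (I * l * t) * exp (I * j * t) := by
      rw [← exp_add]; push_cast; congr 1; ring
    rw [this]; ring
  · simp [oscPrim_apply_zero]

theorem iterOsc_nil (f : ℝ → ℂ) : iterOsc [] f = f := rfl

theorem iterOsc_cons (j : ℤ) (l : List ℤ) (f : ℝ → ℂ) :
    iterOsc (j :: l) f = iterOsc l (oscPrim j f) := rfl

theorem iterOsc_concat (l : List ℤ) (j : ℤ) (f : ℝ → ℂ) :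
    iterOsc (l ++ [j]) f = oscPrim j (iterOsc l f) := by
  simp [iterOsc]

theorem continuous_iterOsc (l : List ℤ) {f : ℝ → ℂ} (hf : Continuous f) :
    Continuous (iterOsc l f) := by
  induction l generalizing f with
  | nil => exact hf
  | cons j l ih => exact ih (continuous_oscPrim j hf)

theorem iterOsc_comb (l : List ℤ) (c : ℂ) {f g : ℝ → ℂ} (hf : Continuous f) (hg : Continuous g) :
    iterOsc l (fun t => c * (f t - g t)) = fun t => c * (iterOsc l f t - iterOsc l g t) := by
  induction l generalizing f g with
  | nil => rfl
  | cons j l ih =>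
    have h1 := oscPrim_comb j 0 c hf hg
    simp only [Int.cast_zero, mul_zero, zero_mul, exp_zero, one_mul, zero_add] at h1
    rw [iterOsc_cons, h1, ih (continuous_oscPrim j hf) (continuous_oscPrim j hg)]
    rfl

theorem norm_iterOsc_le (l : List ℤ) {f : ℝ → ℂ} (k : ℕ) (hf : ∀ t, ‖f t‖ ≤ |t| ^ k) (t : ℝ) :
    ‖iterOsc l f t‖ ≤ |t| ^ (k + l.length) := by
  induction l generalizing f k with
  | nil => exact hf t
  | cons j l ih =>
    have h1 : ∀ t, ‖oscPrim j f t‖ ≤ |t| ^ (k + 1) := fun t => by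
      have h2 : ∀ s ∈ Set.uIoc 0 t, ‖exp (I * j * s) * f s‖ ≤ |t| ^ k := fun s hs => by
        have h3 : I * j * s = ((j * s : ℝ) : ℂ) * I := by push_cast; ring
        rw [norm_mul, h3, norm_exp_ofReal_mul_I, one_mul]
        refine (hf s).trans (pow_le_pow_left₀ (abs_nonneg s) ?_ k)
        have h4 := Set.uIoc_subset_uIcc hs
        simpa using Set.abs_sub_left_of_mem_uIcc h4
      have h3 := intervalIntegral.norm_integral_le_of_norm_le_const h2
      rwa [sub_zero, ← pow_succ] at h3
    have h2 := ih (k + 1) h1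
    rw [iterOsc_cons, List.length_cons]
    rwa [add_assoc, add_comm 1] at h2

theorem exp_two_pi_period (j : ℤ) (m : ℕ) : exp (I * j * ((2 * Real.pi * m : ℝ) : ℂ)) = 1 := by
  have h1 : I * j * ((2 * Real.pi * m : ℝ) : ℂ) = ((j * m : ℤ) : ℂ) * (2 * Real.pi * I) := by
    push_cast; ring
  rw [h1, exp_int_mul_two_pi_mul_I]

/-- The coefficient of a word is the linear coefficient of its oscillatory integral. -/
theorem sum_linearWeight_iterOsc (R r : ℕ) (l : List ℤ) (hR : r + l.length ≤ R) :
    ∑ m ∈ Finset.range (R + 1), (linearWeight R m : ℂ) *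
      iterOsc l (timePow r) (2 * Real.pi * m) = 2 * Real.pi * betaBarAux r l := by
  -- Extraction of the linear coefficient is linear and uses values at the periods only, so an
  -- identity valid there is enough.
  have hcomb : ∀ {U V W : ℝ → ℂ} {c u v : ℂ},
      (∀ m : ℕ, W (2 * Real.pi * m) = c * (U (2 * Real.pi * m) - V (2 * Real.pi * m))) →
      ∑ m ∈ Finset.range (R + 1), (linearWeight R m : ℂ) * U (2 * Real.pi * m) =
        2 * Real.pi * u →
      ∑ m ∈ Finset.range (R + 1), (linearWeight R m : ℂ) * V (2 * Real.pi * m) =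
        2 * Real.pi * v →
      ∑ m ∈ Finset.range (R + 1), (linearWeight R m : ℂ) * W (2 * Real.pi * m) =
        2 * Real.pi * (c * (u - v)) := by
    intro U V W c u v hW hU hV
    have h1 : 2 * Real.pi * (c * (u - v)) = c * (2 * Real.pi * u - 2 * Real.pi * v) := by ring
    rw [h1, ← hU, ← hV, ← Finset.sum_sub_distrib, Finset.mul_sum]
    exact Finset.sum_congr rfl fun m _ => by rw [hW]; ring
  have hnil : ∀ r ≤ R, ∑ m ∈ Finset.range (R + 1), (linearWeight R m : ℂ) *
      timePow r (2 * Real.pi * m) = 2 * Real.pi * betaBarAux r [] := by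
    intro r hr
    have h1 : ∀ m ∈ Finset.range (R + 1), (linearWeight R m : ℂ) * timePow r (2 * Real.pi * m) =
        ((2 * Real.pi) ^ r / r.factorial : ℝ) * ((linearWeight R m * (m : ℝ) ^ r : ℝ) : ℂ) := by
      intro m _
      rw [timePow]; push_cast; ring
    rw [Finset.sum_congr rfl h1, ← Finset.mul_sum, ← ofReal_sum, sum_linearWeight_mul_pow hr,
      betaBarAux]
    by_cases h : r = 1
    · subst h; simp
    · simp [h]
  -- Leading zeros build up powers of time; each nonzero letter is removed by integration by parts,
  -- following the recursion of the coefficients.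
  induction r, l using betaBarAux.induct with
  | case1 => exact hnil 1 (by simpa using hR)
  | case2 r _ => exact hnil r (by simpa using hR)
  | case3 r l ih =>
    rw [betaBarAux.eq_def]
    simp only [if_true]
    rw [iterOsc_cons, oscPrim_zero_timePow]
    exact ih (by simp at hR; omega)
  | case4 j hj =>
    rw [betaBarAux.eq_def]
    simp only [hj, if_false, mul_zero]
    refine Finset.sum_eq_zero fun m _ => ?_
    rw [iterOsc_cons, iterOsc_nil, oscPrim_one hj, exp_two_pi_period]
    simp
  | case5 j hj r ih1 ih2 =>
    rw [betaBarAux.eq_def]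
    simp only [hj, if_false]
    refine hcomb (fun m => ?_) (ih1 (by simp at hR ⊢; omega)) (hnil (r + 1) (by simp at hR; omega))
    rw [iterOsc_cons, iterOsc_nil, oscPrim_timePow_succ hj, exp_two_pi_period, one_mul]
    rfl
  | case6 j hj l₁ l ih1 ih2 =>
    rw [betaBarAux.eq_def]
    simp only [hj, if_false]
    refine hcomb (fun m => ?_) (ih1 (by simp at hR ⊢; omega)) (ih2 (by simp at hR ⊢; omega))
    have h1 : oscPrim j (timePow 0) = fun t : ℝ => I / j * (timePow 0 t -
        exp (I * j * t) * timePow 0 t) := by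
      funext t; rw [oscPrim_one hj, timePow_zero]
    simp only [iterOsc_cons]
    rw [h1, oscPrim_comb _ _ _ (continuous_timePow 0) (continuous_timePow 0),
      iterOsc_comb _ _ (continuous_oscPrim _ (continuous_timePow 0))
        (continuous_oscPrim _ (continuous_timePow 0))]
  | case7 j hj r l₁ l ih1 ih2 =>
    rw [betaBarAux.eq_def]
    simp only [hj, if_false]
    refine hcomb (fun m => ?_) (ih1 (by simp at hR ⊢; omega)) (ih2 (by simp at hR ⊢; omega))
    have h1 : oscPrim j (timePow (r + 1)) = fun t : ℝ => I / j * (oscPrim j (timePow r) t -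
        exp (I * j * t) * timePow (r + 1) t) := funext fun t => oscPrim_timePow_succ hj r t
    simp only [iterOsc_cons]
    rw [h1, oscPrim_comb _ _ _ (continuous_oscPrim _ (continuous_timePow r))
      (continuous_timePow (r + 1)), iterOsc_comb _ _
        (continuous_oscPrim _ (continuous_oscPrim _ (continuous_timePow r)))
        (continuous_oscPrim _ (continuous_timePow (r + 1)))]

end Oscillatory

/-! ### Fourier coefficients of smooth periodic families -/

section Fourier

open SmoothMap TimeField

variable {E V : Type} [NormedAddCommGroup E] [NormedSpace ℝ E] [FiniteDimensional ℝ E]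
  [NormedAddCommGroup V] [NormedSpace ℝ V] [FiniteDimensional ℝ V] [NormedSpace ℂ V]
  [IsScalarTower ℝ ℂ V] [SMulCommClass ℝ ℂ V]

omit [FiniteDimensional ℝ E] [FiniteDimensional ℝ V] [SMulCommClass ℝ ℂ V] in
theorem contDiff_osc_smul (k : ℤ) (a : SmoothMap (ℝ × E) V) :
    ContDiff ℝ ∞ fun p : ℝ × E => Complex.exp (-(Complex.I * k * p.1)) • a.1 p := by
  have h1 : ContDiff ℝ ∞ fun p : ℝ × E => (p.1 : ℂ) :=
    Complex.ofRealCLM.contDiff.comp contDiff_fst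
  have h2 : ContDiff ℝ ∞ fun p : ℝ × E => Complex.exp (-(Complex.I * k * p.1)) :=
    (contDiff_const.mul h1).neg.cexp
  exact h2.smul a.contDiff

/-- Multiplication by `e^{-ikτ}`. -/
noncomputable def oscMul (k : ℤ) (a : SmoothMap (ℝ × E) V) : SmoothMap (ℝ × E) V :=
  .mk _ (contDiff_osc_smul k a)

omit [FiniteDimensional ℝ E] [FiniteDimensional ℝ V] [SMulCommClass ℝ ℂ V] in
theorem oscMul_val (k : ℤ) (a : SmoothMap (ℝ × E) V) (p : ℝ × E) :
    (oscMul k a).1 p = Complex.exp (-(Complex.I * k * p.1)) • a.1 p := rfl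

omit [FiniteDimensional ℝ E] [FiniteDimensional ℝ V] in
theorem ddt_oscMul (k : ℤ) (a : SmoothMap (ℝ × E) V) : ddt (oscMul k a) = oscMul k (ddt a) -
    postcomp ((Complex.I * k) • ContinuousLinearMap.id ℝ V) (oscMul k a) := by
  refine eq_ddt fun τ y => ?_
  have h1 : HasDerivAt (fun s : ℝ => Complex.exp (-(Complex.I * k * s))) _ τ :=
    ((Complex.ofRealCLM.hasDerivAt (x := τ)).const_mul (Complex.I * k)).fun_neg.cexp
  have h2 : HasDerivAt (fun s : ℝ => Complex.exp (-(Complex.I * k * s)) • a.1 (s, y)) _ τ :=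
    h1.fun_smul (TimeField.hasDerivAt a τ y)
  refine h2.congr_deriv ?_
  rw [sub_val, postcomp_apply, oscMul_val, oscMul_val, sub_eq_add_neg]
  simp only [Complex.ofRealCLM_apply, Complex.ofReal_one, mul_one, mul_neg, neg_smul,
    _root_.smul_apply, ContinuousLinearMap.id_apply, smul_smul]
  rw [mul_comm (Complex.exp _)]

omit [FiniteDimensional ℝ E] [FiniteDimensional ℝ V] in
theorem spaceDeriv_oscMul (k : ℤ) (v : E) (a : SmoothMap (ℝ × E) V) :
    spaceDeriv v (oscMul k a) = oscMul k (spaceDeriv v a) := by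
  refine ext_apply fun p => ?_
  obtain ⟨τ, y⟩ := p
  rw [oscMul_val, spaceDeriv_val_eq_fderiv, spaceDeriv_val_eq_fderiv]
  have h1 : HasFDerivAt (fun z => Complex.exp (-(Complex.I * k * τ)) • a.1 (τ, z)) _ y :=
    (hasFDerivAt_slice a.contDiff τ y).const_smul _
  have h2 : (fun z => (oscMul k a).1 (τ, z)) =
    fun z => Complex.exp (-(Complex.I * k * τ)) • a.1 (τ, z) := rfl
  rw [h2, h1.fderiv, (hasFDerivAt_slice a.contDiff τ y).fderiv]
  rfl

omit [NormedSpace ℂ V] [IsScalarTower ℝ ℂ V] [SMulCommClass ℝ ℂ V] in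
theorem primitive_ddt (X : SmoothMap (ℝ × E) V) : primitive (ddt X) = X - affine 0 0 X := by
  refine eq_of_ddt_eq ?_ fun y => by simp
  rw [ddt_primitive, map_sub, ddt_affine, zero_smul, sub_zero]

omit [NormedSpace ℂ V] [IsScalarTower ℝ ℂ V] [SMulCommClass ℝ ℂ V] in
theorem spaceDeriv_primitive (v : E) (X : SmoothMap (ℝ × E) V) :
    spaceDeriv v (primitive X) = primitive (spaceDeriv v X) :=
  map_primitive_of_ddt_comm (ddt_spaceDeriv v) (fun X hX y => by
    rw [spaceDeriv_val_eq_fderiv]; simp [hX]) X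

omit [NormedSpace ℂ V] [IsScalarTower ℝ ℂ V] [SMulCommClass ℝ ℂ V] in
theorem postcomp_primitive {W : Type*} [NormedAddCommGroup W] [NormedSpace ℝ W]
    [FiniteDimensional ℝ W] (ℓ : V →L[ℝ] W) (X : SmoothMap (ℝ × E) V) :
    postcomp ℓ (primitive X) = primitive (postcomp ℓ X) :=
  map_primitive_of_ddt_comm (ddt_postcomp ℓ) (fun X hX y => by
    rw [postcomp_apply, hX, map_zero]) X

/-- The Fourier coefficients of a family that is periodic in time. -/
noncomputable def vecCoef (a : SmoothMap (ℝ × E) V) (k : ℤ) (y : E) : V :=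
  (2 * Real.pi)⁻¹ • (primitive (oscMul k a)).1 (2 * Real.pi, y)

omit [SMulCommClass ℝ ℂ V] in
theorem contDiff_vecCoef (a : SmoothMap (ℝ × E) V) (k : ℤ) : ContDiff ℝ ∞ (vecCoef a k) := by
  have h1 := contDiff_slice (primitive (oscMul k a)) (2 * Real.pi)
  exact h1.const_smul _

/-- The derivative in the space variables. -/
noncomputable def spaceFDeriv (a : SmoothMap (ℝ × E) V) : SmoothMap (ℝ × E) (E →L[ℝ] V) :=
  .mk (fun p => fderiv ℝ a.1 p ∘L ContinuousLinearMap.inr ℝ ℝ E)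
    ((a.contDiff.fderiv_right (m := ∞) (by simp)).clm_comp contDiff_const)

theorem fderiv_vecCoef (a : SmoothMap (ℝ × E) V) (k : ℤ) :
    fderiv ℝ (vecCoef a k) = vecCoef (spaceFDeriv a) k := by
  funext y
  ext v
  have h1 := hasFDerivAt_slice (primitive (oscMul k a)).contDiff (2 * Real.pi) y
  have h2 : HasFDerivAt (vecCoef a k) _ y := h1.const_smul (2 * Real.pi)⁻¹
  rw [h2.fderiv, vecCoef]
  simp only [_root_.smul_apply]
  congr 1
  have h3 := postcomp_primitive (ContinuousLinearMap.apply ℝ V v) (oscMul k (spaceFDeriv a))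
  have h4 : postcomp (ContinuousLinearMap.apply ℝ V v) (oscMul k (spaceFDeriv a)) =
    oscMul k (spaceDeriv v a) := rfl
  rw [h4, ← spaceDeriv_oscMul, ← spaceDeriv_primitive] at h3
  exact (congrArg (fun X : SmoothMap (ℝ × E) V => X.1 (2 * Real.pi, y)) h3).symm

omit [FiniteDimensional ℝ E] [FiniteDimensional ℝ V] [NormedSpace ℂ V] [IsScalarTower ℝ ℂ V]
  [SMulCommClass ℝ ℂ V] in
theorem affine_spaceFDeriv {a : SmoothMap (ℝ × E) V} (ha : affine 1 (2 * Real.pi) a = a) :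
    affine 1 (2 * Real.pi) (spaceFDeriv a) = spaceFDeriv a := by
  refine ext_apply fun p => ?_
  ext v
  have h1 : fderiv ℝ (affine 1 (2 * Real.pi) a).1 p (0, v) = _ :=
    fderiv_precomp (affineTime E 1 (2 * Real.pi)) a p (0, v)
  rw [fderiv_affineTime, ha] at h1
  simp only [mul_zero] at h1
  exact h1.symm

/-- Integration by parts; the boundary terms cancel because `a` and the exponential are periodic. -/
theorem vecCoef_ddt {a : SmoothMap (ℝ × E) V} (ha : affine 1 (2 * Real.pi) a = a) (k : ℤ) (y : E) :
    vecCoef (ddt a) k y = (Complex.I * k) • vecCoef a k y := by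
  have h1 := congrArg (fun X : SmoothMap (ℝ × E) V => X.1 (2 * Real.pi, y))
    (congrArg primitive (ddt_oscMul k a))
  simp only [primitive_ddt, map_sub, ← postcomp_primitive, sub_val, affine_val, oscMul_val,
    postcomp_apply] at h1
  have h2 : a.1 (2 * Real.pi, y) = a.1 (0, y) := by
    simpa using val_two_pi_mul ha 1 y
  have h3 : Complex.exp (-(Complex.I * k * ((2 * Real.pi : ℝ) : ℂ))) = 1 := by
    have := exp_two_pi_period k 1
    rw [Complex.exp_neg, inv_eq_one]
    simpa using this
  simp only [zero_mul, add_zero, h3, h2, Complex.ofReal_zero, mul_zero, neg_zero, Complex.exp_zero,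
    sub_self] at h1
  rw [vecCoef, vecCoef, smul_comm]
  congr 1
  exact sub_eq_zero.1 h1.symm

omit [SMulCommClass ℝ ℂ V] in
theorem vecCoef_sub (a b : SmoothMap (ℝ × E) V) (k : ℤ) (y : E) :
    vecCoef (a - b) k y = vecCoef a k y - vecCoef b k y := by
  have h1 : oscMul k (a - b) = oscMul k a - oscMul k b :=
    ext_apply fun p => smul_sub _ _ _
  rw [vecCoef, h1, map_sub, sub_val, smul_sub]; rfl

omit [SMulCommClass ℝ ℂ V] in
theorem norm_vecCoef_le (a : SmoothMap (ℝ × E) V) {R M : ℝ}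
    (hM : ∀ τ ∈ Set.Icc 0 (2 * Real.pi), ∀ y, ‖y‖ ≤ R → ‖a.1 (τ, y)‖ ≤ M) (k : ℤ) {y : E}
    (hy : ‖y‖ ≤ R) : ‖vecCoef a k y‖ ≤ M := by
  have hπ : 0 < 2 * Real.pi := by positivity
  have h1 : ‖∫ τ in (0 : ℝ)..(2 * Real.pi), (oscMul k a).1 (τ, y)‖ ≤ M * |2 * Real.pi - 0| := by
    refine intervalIntegral.norm_integral_le_of_norm_le_const fun τ hτ => ?_
    rw [Set.uIoc_of_le hπ.le] at hτ
    have h3 : -(Complex.I * k * τ) = ((-(k * τ) : ℝ) : ℂ) * Complex.I := by push_cast; ring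
    rw [oscMul_val, norm_smul]
    simp only
    rw [h3, Complex.norm_exp_ofReal_mul_I, one_mul]
    exact hM τ ⟨hτ.1.le, hτ.2⟩ y hy
  rw [sub_zero, abs_of_pos hπ] at h1
  rw [vecCoef, norm_smul, primitive_val, norm_inv, Real.norm_of_nonneg hπ.le, inv_mul_le_iff₀ hπ]
  exact h1.trans_eq (mul_comm _ _)

omit [FiniteDimensional ℝ V] [NormedSpace ℂ V] [IsScalarTower ℝ ℂ V] [SMulCommClass ℝ ℂ V] in
theorem exists_norm_le_on_ball (a : SmoothMap (ℝ × E) V) (R : ℝ) :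
    ∃ M, ∀ τ ∈ Set.Icc 0 (2 * Real.pi), ∀ y, ‖y‖ ≤ R → ‖a.1 (τ, y)‖ ≤ M := by
  have hc : IsCompact (Set.Icc (0 : ℝ) (2 * Real.pi) ×ˢ Metric.closedBall (0 : E) R) :=
    isCompact_Icc.prod (isCompact_closedBall 0 R)
  obtain ⟨M, hM⟩ := hc.exists_bound_of_continuousOn a.contDiff.continuous.continuousOn
  exact ⟨M, fun τ hτ y hy => hM (τ, y) ⟨hτ, by simpa using hy⟩⟩

/-- The coefficients of `a - ∂²a` are `1 + j²` times those of `a`, and they are bounded. This gives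
the quadratic decay that makes the family summable. -/
theorem exists_norm_vecCoef_le {a : SmoothMap (ℝ × E) V} (ha : affine 1 (2 * Real.pi) a = a)
    (R : ℝ) : ∃ M, ∀ (j : ℤ) (y : E), ‖y‖ ≤ R → ‖vecCoef a j y‖ ≤ M * (1 / (1 + (j : ℝ) ^ 2)) := by
  obtain ⟨M, hM⟩ := exists_norm_le_on_ball (a - ddt (ddt a)) R
  refine ⟨M, fun j y hy => ?_⟩
  have ha' : affine 1 (2 * Real.pi) (ddt a) = ddt a := by
    have := ddt_affine (V := V) 1 (2 * Real.pi) a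
    rw [ha, one_smul] at this
    exact this.symm
  have h1 := norm_vecCoef_le _ hM j hy
  rw [vecCoef_sub, vecCoef_ddt ha', vecCoef_ddt ha, smul_smul] at h1
  have h2 : vecCoef a j y - (Complex.I * j * (Complex.I * j)) • vecCoef a j y =
      (1 + (j : ℝ) ^ 2) • vecCoef a j y := by
    have h3 : (1 + (j : ℝ) ^ 2) • vecCoef a j y = ((1 + (j : ℝ) ^ 2 : ℝ) : ℂ) • vecCoef a j y :=
      (RCLike.real_smul_eq_coe_smul (K := ℂ) _ _)
    rw [h3]
    nth_rewrite 1 [← one_smul ℂ (vecCoef a j y)]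
    rw [← sub_smul]
    congr 1
    push_cast
    linear_combination (-(j : ℂ) ^ 2) * Complex.I_sq
  have hj : 0 < 1 + (j : ℝ) ^ 2 := by positivity
  rw [h2, norm_smul, Real.norm_of_nonneg hj.le] at h1
  rw [mul_one_div, le_div_iff₀ hj, mul_comm]
  exact h1

end Fourier

/-! ### Summable families of smooth maps -/

section SummableSmooth

variable {ι κ : Type*} {E V W X : Type*} [NormedAddCommGroup E] [NormedSpace ℝ E]
  [NormedAddCommGroup V] [NormedSpace ℝ V] [NormedAddCommGroup W] [NormedSpace ℝ W]
  [NormedAddCommGroup X] [NormedSpace ℝ X]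

/-- A family of smooth maps whose derivatives are all summable, uniformly on balls. -/
structure SummableSmooth (f : ι → E → V) : Prop where
  contDiff : ∀ i, ContDiff ℝ ∞ (f i)
  bound : ∀ (k : ℕ) (R : ℝ), ∃ u : ι → ℝ, Summable u ∧
    ∀ i y, ‖y‖ ≤ R → ‖iteratedFDeriv ℝ k (f i) y‖ ≤ u i

namespace SummableSmooth

variable {f : ι → E → V} {g : κ → E → W}

theorem summable_norm (hf : SummableSmooth f) (y : E) : Summable fun i => ‖f i y‖ := by
  obtain ⟨u, hu, h⟩ := hf.bound 0 ‖y‖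
  refine hu.of_nonneg_of_le (fun i => norm_nonneg _) fun i => ?_
  have := h i y le_rfl
  rwa [norm_iteratedFDeriv_zero] at this

theorem comp_equiv (hf : SummableSmooth f) (e : κ ≃ ι) : SummableSmooth fun i => f (e i) := by
  refine ⟨fun i => hf.contDiff _, fun k R => ?_⟩
  obtain ⟨u, hu, h⟩ := hf.bound k R
  exact ⟨fun i => u (e i), hu.comp_injective e.injective, fun i => h (e i)⟩

theorem fderiv (hf : SummableSmooth f) : SummableSmooth fun i => fderiv ℝ (f i) := by
  refine ⟨fun i => (hf.contDiff i).fderiv_right (by simp), fun k R => ?_⟩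
  obtain ⟨u, hu, h⟩ := hf.bound (k + 1) R
  exact ⟨u, hu, fun i y hy => by rw [norm_iteratedFDeriv_fderiv]; exact h i y hy⟩

theorem add {g : ι → E → V} (hf : SummableSmooth f) (hg : SummableSmooth g) :
    SummableSmooth fun i y => f i y + g i y := by
  refine ⟨fun i => (hf.contDiff i).add (hg.contDiff i), fun k R => ?_⟩
  obtain ⟨u, hu, h⟩ := hf.bound k R
  obtain ⟨v, hv, h'⟩ := hg.bound k R
  refine ⟨fun i => u i + v i, hu.add hv, fun i y hy => ?_⟩
  have h1 := iteratedFDeriv_add_apply (𝕜 := ℝ) (i := k) (x := y)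
    ((hf.contDiff i).contDiffAt.of_le (by exact_mod_cast le_top))
    ((hg.contDiff i).contDiffAt.of_le (by exact_mod_cast le_top))
  change ‖iteratedFDeriv ℝ k (f i + g i) y‖ ≤ _
  rw [h1]
  exact (norm_add_le _ _).trans (add_le_add (h i y hy) (h' i y hy))

theorem postcomp (hf : SummableSmooth f) (ℓ : V →L[ℝ] W) :
    SummableSmooth fun i y => ℓ (f i y) := by
  refine ⟨fun i => ℓ.contDiff.comp (hf.contDiff i), fun k R => ?_⟩
  obtain ⟨u, hu, h⟩ := hf.bound k R
  refine ⟨fun i => ‖ℓ‖ * u i, hu.mul_left _, fun i y hy => ?_⟩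
  have h1 := ℓ.norm_iteratedFDeriv_comp_left (hf.contDiff i).contDiffAt (x := y)
    (show ((k : ℕ) : WithTop ℕ∞) ≤ ∞ by exact_mod_cast le_top)
  exact h1.trans (mul_le_mul_of_nonneg_left (h i y hy) (norm_nonneg _))

/-- The jets of a summable family. -/
theorem jet (hf : SummableSmooth f) :
    SummableSmooth fun i y => (f i y, _root_.fderiv ℝ (f i) y) := by
  have h1 := (hf.postcomp (ContinuousLinearMap.inl ℝ V (E →L[ℝ] V))).add
    (hf.fderiv.postcomp (ContinuousLinearMap.inr ℝ V (E →L[ℝ] V)))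
  simpa using h1

/-- The Leibniz rule bounds each derivative by a finite sum of products of summable families. For `R
< 0` the condition on `y` is void. -/
theorem bilinear (hf : SummableSmooth f) (hg : SummableSmooth g) (β : V →L[ℝ] W →L[ℝ] X) :
    SummableSmooth fun (p : ι × κ) y => β (f p.1 y) (g p.2 y) := by
  refine ⟨fun p => β.isBoundedBilinearMap.contDiff.comp
    ((hf.contDiff p.1).prodMk (hg.contDiff p.2)), fun k R => ?_⟩
  choose u hu h using fun k => hf.bound k R
  choose v hv h' using fun k => hg.bound k R
  by_cases hR : 0 ≤ R
  · have hu0 : ∀ k i, 0 ≤ u k i := fun k i => (norm_nonneg _).trans (h k i 0 (by simpa using hR))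
    have hv0 : ∀ k i, 0 ≤ v k i := fun k i => (norm_nonneg _).trans (h' k i 0 (by simpa using hR))
    refine ⟨fun p => ‖β‖ * ∑ i ∈ Finset.range (k + 1), (k.choose i : ℝ) *
      u i p.1 * v (k - i) p.2, ?_, fun p y hy => ?_⟩
    · refine Summable.mul_left _ (summable_sum fun i _ => ?_)
      simp only [mul_assoc]
      exact ((hu i).mul_of_nonneg (hv (k - i)) (hu0 i) (hv0 _)).mul_left _
    · refine (β.norm_iteratedFDeriv_le_of_bilinear (hf.contDiff p.1) (hg.contDiff p.2) y
        (by exact_mod_cast le_top)).trans ?_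
      refine mul_le_mul_of_nonneg_left (Finset.sum_le_sum fun i _ => ?_) β.opNorm_nonneg
      exact mul_le_mul (mul_le_mul_of_nonneg_left (h i p.1 y hy) (by positivity))
        (h' _ p.2 y hy) (norm_nonneg _) (mul_nonneg (by positivity) (hu0 i p.1))
  · exact ⟨0, summable_zero, fun p y hy => absurd ((norm_nonneg y).trans hy) hR⟩

theorem smul [NormedSpace ℂ V] [SMulCommClass ℝ ℂ V] (hf : SummableSmooth f) {c : ι → ℂ} {C : ℝ}
    (hc : ∀ i, ‖c i‖ ≤ C) : SummableSmooth fun i y => c i • f i y := by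
  refine ⟨fun i => (hf.contDiff i).const_smul (c i), fun k R => ?_⟩
  obtain ⟨u, hu, h⟩ := hf.bound k R
  refine ⟨fun i => C * u i, hu.mul_left _, fun i y hy => ?_⟩
  have h1 := iteratedFDeriv_const_smul_apply (𝕜 := ℝ) (i := k) (a := c i) (x := y)
    ((hf.contDiff i).contDiffAt.of_le (by exact_mod_cast le_top))
  change ‖iteratedFDeriv ℝ k (c i • f i) y‖ ≤ _
  rw [h1, norm_smul]
  exact mul_le_mul (hc i) (h i y hy) (norm_nonneg _) ((norm_nonneg _).trans (hc i))

theorem hasSum_fderiv [CompleteSpace V] (hf : SummableSmooth f) {F : E → V}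
    (hF : ∀ y, HasSum (fun i => f i y) (F y)) (y : E) :
    HasSum (fun i => _root_.fderiv ℝ (f i) y) (_root_.fderiv ℝ F y) := by
  have h0 : F = fun y => ∑' i, f i y := funext fun y => (hF y).tsum_eq.symm
  obtain ⟨u, hu, h⟩ := hf.fderiv.bound 0 (‖y‖ + 1)
  have h1 := hasFDerivAt_tsum_of_isPreconnected (𝕜 := ℝ) (s := Metric.ball (0 : E) (‖y‖ + 1)) hu
    Metric.isOpen_ball (convex_ball _ _).isPreconnected
    (fun i z _ => ((hf.contDiff i).differentiable (by simp) z).hasFDerivAt)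
    (fun i z hz => by
      have := h i z (by simpa using (mem_ball_zero_iff.1 hz).le)
      rwa [norm_iteratedFDeriv_zero] at this)
    (x₀ := y) (by simp) (hF y).summable (x := y) (by simp)
  rw [h0, h1.fderiv]
  exact (hf.fderiv.summable_norm y).of_norm.hasSum

/-- The jet of a sum. -/
theorem hasSum_jet [CompleteSpace V] (hf : SummableSmooth f) {F : E → V}
    (hF : ∀ y, HasSum (fun i => f i y) (F y)) (y : E) :
    HasSum (fun i => (f i y, _root_.fderiv ℝ (f i) y)) (F y, _root_.fderiv ℝ F y) :=
  (hF y).prodMk (hf.hasSum_fderiv hF y)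

end SummableSmooth

theorem HasSum.bilinear [CompleteSpace X] {f : ι → V} {g : κ → W} {a : V} {b : W}
    (hf : HasSum f a) (hg : HasSum g b) (hf' : Summable fun i => ‖f i‖)
    (hg' : Summable fun i => ‖g i‖) (β : V →L[ℝ] W →L[ℝ] X) :
    HasSum (fun p : ι × κ => β (f p.1) (g p.2)) (β a b) := by
  have h1 : Summable fun p : ι × κ => β (f p.1) (g p.2) := by
    refine Summable.of_norm_bounded (g := fun p : ι × κ => ‖β‖ * (‖f p.1‖ * ‖g p.2‖))
      ((hf'.mul_of_nonneg hg' (fun _ => norm_nonneg _) fun _ => norm_nonneg _).mul_left _)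
      fun p => ?_
    rw [← mul_assoc]
    exact β.le_opNorm₂ _ _
  have h2 := h1.hasSum.prod_fiberwise fun i => (β (f i)).hasSum hg
  have h3 : HasSum (fun i => β (f i) b) (β a b) := (β.flip b).hasSum hf
  rw [h3.unique h2]
  exact h1.hasSum

end SummableSmooth

/-! ### Fourier series and word expansions -/

section FourierSeries

open SmoothMap TimeField

theorem summable_one_div_one_add_sq : Summable fun j : ℤ => 1 / (1 + (j : ℝ) ^ 2) := by
  refine Summable.of_norm_bounded_eventually
    (Real.summable_one_div_int_pow.2 one_lt_two) ?_
  have h1 : ({0} : Set ℤ)ᶜ ∈ cofinite := (Set.finite_singleton 0).compl_mem_cofinite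
  filter_upwards [h1] with j hj
  have hj' : (0 : ℝ) < (j : ℝ) ^ 2 := by
    have : (j : ℝ) ≠ 0 := Int.cast_ne_zero.2 hj
    positivity
  rw [Real.norm_of_nonneg (by positivity)]
  exact one_div_le_one_div_of_le hj' (by linarith)

variable {E : Type} [NormedAddCommGroup E] [NormedSpace ℝ E] [FiniteDimensional ℝ E]

/-- The derivative of a coefficient is the coefficient of the derivative. The induction varies the
target space, since derivatives take values in `E →L[ℝ] V`. -/
theorem exists_norm_iteratedFDeriv_vecCoef_le (k : ℕ) : ∀ {V : Type} [NormedAddCommGroup V]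
    [NormedSpace ℝ V] [FiniteDimensional ℝ V] [NormedSpace ℂ V] [IsScalarTower ℝ ℂ V]
    [SMulCommClass ℝ ℂ V] {a : SmoothMap (ℝ × E) V} (_ : affine 1 (2 * Real.pi) a = a) (R : ℝ),
    ∃ M, ∀ (j : ℤ) (y : E), ‖y‖ ≤ R →
      ‖iteratedFDeriv ℝ k (vecCoef a j) y‖ ≤ M * (1 / (1 + (j : ℝ) ^ 2)) := by
  induction k with
  | zero =>
    intro V _ _ _ _ _ _ a ha R
    simp only [norm_iteratedFDeriv_zero]
    exact exists_norm_vecCoef_le ha R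
  | succ k ih =>
    intro V _ _ _ _ _ _ a ha R
    obtain ⟨M, hM⟩ := ih (affine_spaceFDeriv ha) R
    refine ⟨M, fun j y hy => ?_⟩
    rw [← norm_iteratedFDeriv_fderiv, fderiv_vecCoef]
    exact hM j y hy

variable {V : Type} [NormedAddCommGroup V] [NormedSpace ℝ V] [FiniteDimensional ℝ V]
  [NormedSpace ℂ V] [IsScalarTower ℝ ℂ V] [SMulCommClass ℝ ℂ V]

theorem summableSmooth_vecCoef {a : SmoothMap (ℝ × E) V} (ha : affine 1 (2 * Real.pi) a = a) :
    SummableSmooth fun j : ℤ => vecCoef a j := by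
  refine ⟨contDiff_vecCoef a, fun k R => ?_⟩
  obtain ⟨M, hM⟩ := exists_norm_iteratedFDeriv_vecCoef_le k ha R
  exact ⟨_, summable_one_div_one_add_sq.mul_left M, hM⟩

theorem norm_exp_I_mul (j : ℤ) (τ : ℝ) : ‖Complex.exp (Complex.I * j * τ)‖ = 1 := by
  have h3 : Complex.I * j * τ = ((j * τ : ℝ) : ℂ) * Complex.I := by push_cast; ring
  rw [h3, Complex.norm_exp_ofReal_mul_I]

theorem hasSum_scalar_fourier {F : ℝ → ℂ} (hF : Continuous F)
    (hper : Function.Periodic F (2 * Real.pi)) {c : ℤ → ℂ}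
    (hc : ∀ j : ℤ, c j = (2 * Real.pi : ℝ)⁻¹ •
      ∫ τ in (0 : ℝ)..(2 * Real.pi), Complex.exp (-(Complex.I * j * τ)) * F τ)
    (hs : Summable c) (τ : ℝ) : HasSum (fun j : ℤ => Complex.exp (Complex.I * j * τ) * c j) (F τ) := by
  have : Fact (0 < 2 * Real.pi) := ⟨Real.two_pi_pos⟩
  have hπ : (Real.pi : ℂ) ≠ 0 := Complex.ofReal_ne_zero.2 Real.pi_ne_zero
  let f : C(AddCircle (2 * Real.pi), ℂ) := ⟨hper.lift, continuous_coinduced_dom.2 hF⟩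
  have hf : ∀ τ : ℝ, f (τ : AddCircle (2 * Real.pi)) = F τ := fun τ => rfl
  have h1 : fourierCoeff f = c := by
    funext j
    rw [fourierCoeff_eq_intervalIntegral _ j 0, hc, zero_add, one_div]
    congr 1
    refine intervalIntegral.integral_congr fun s _ => ?_
    simp only [hf]
    rw [fourier_coe_apply, smul_eq_mul]
    congr 2
    push_cast
    field_simp
  have h2 := has_pointwise_sum_fourier_series_of_summable (f := f) (by rwa [h1]) (τ : AddCircle _)
  rw [h1, hf] at h2
  refine h2.congr_fun fun j => ?_
  rw [fourier_coe_apply, smul_eq_mul, mul_comm]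
  congr 2
  push_cast
  field_simp

/-- The Fourier series of a smooth periodic family. -/
theorem hasSum_vecCoef {a : SmoothMap (ℝ × E) V} (ha : affine 1 (2 * Real.pi) a = a) (τ : ℝ)
    (y : E) : HasSum (fun j : ℤ => Complex.exp (Complex.I * j * τ) • vecCoef a j y)
      (a.1 (τ, y)) := by
  have : CompleteSpace V := FiniteDimensional.complete ℝ V
  have hs := (summableSmooth_vecCoef ha).summable_norm y
  have h1 : Summable fun j : ℤ => Complex.exp (Complex.I * j * τ) • vecCoef a j y :=
    Summable.of_norm (hs.congr fun j => by rw [norm_smul, norm_exp_I_mul, one_mul])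
  have h2 : ∑' j : ℤ, Complex.exp (Complex.I * j * τ) • vecCoef a j y = a.1 (τ, y) := by
    -- Complex-linear functionals reduce the claim to the scalar Fourier series on the circle.
    refine (SeparatingDual.eq_iff_forall_dual_eq (R := ℂ)).2 fun ℓ => ?_
    have h3 := ℓ.hasSum h1.hasSum
    have hcont : Continuous fun s => a.1 (s, y) := a.contDiff.continuous.comp (by fun_prop)
    have h4 := hasSum_scalar_fourier (F := fun s => ℓ (a.1 (s, y))) (ℓ.continuous.comp hcont)
      (fun s => by
        have h5 := congrArg (fun X : SmoothMap (ℝ × E) V => X.1 (s, y)) ha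
        simp only [affine_val, one_mul] at h5
        simp only [h5]) (c := fun j => ℓ (vecCoef a j y)) (fun j => by
        have hosc : Continuous fun s => (oscMul j a).1 (s, y) :=
          (oscMul j a).contDiff.continuous.comp (by fun_prop)
        have h5 := (ℓ.restrictScalars ℝ).intervalIntegral_comp_comm (μ := MeasureTheory.volume)
          (a := 0) (b := 2 * Real.pi) (f := fun s => (oscMul j a).1 (s, y))
          (hosc.intervalIntegrable _ _)
        have h6 : ℓ (vecCoef a j y) = (2 * Real.pi)⁻¹ •
            (ℓ.restrictScalars ℝ) ((primitive (oscMul j a)).1 (2 * Real.pi, y)) :=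
          (ℓ.restrictScalars ℝ).map_smul _ _
        rw [h6, primitive_val, ← h5]
        congr 1
        refine intervalIntegral.integral_congr fun s _ => ?_
        exact ℓ.map_smul _ _)
      (Summable.of_norm_bounded (hs.mul_left ‖ℓ‖) fun j => ℓ.le_opNorm _) τ
    refine h3.unique (h4.congr_fun fun j => ?_)
    simp
  rw [← h2]
  exact h1.hasSum

omit [IsScalarTower ℝ ℂ V] [SMulCommClass ℝ ℂ V] in
theorem HasSum.intervalIntegral_smul {ι : Type*} [Countable ι] {φ : ι → ℝ → ℂ} {x : ι → V}
    {g : ℝ → V} {C t : ℝ} (hφ : ∀ i, Continuous (φ i))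
    (hC : ∀ i, ∀ s ∈ Set.uIoc 0 t, ‖φ i s‖ ≤ C) (hx : Summable fun i => ‖x i‖)
    (hg : ∀ s, HasSum (fun i => φ i s • x i) (g s)) :
    HasSum (fun i => (∫ s in (0 : ℝ)..t, φ i s) • x i) (∫ s in (0 : ℝ)..t, g s) := by
  have : CompleteSpace V := FiniteDimensional.complete ℝ V
  have h1 := intervalIntegral.hasSum_integral_of_dominated_convergence (μ := MeasureTheory.volume)
    (a := 0) (b := t) (F := fun i s => φ i s • x i) (f := g) (fun i _ => C * ‖x i‖)
    (fun i => ((hφ i).smul continuous_const).aestronglyMeasurable)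
    (fun i => MeasureTheory.ae_of_all _ fun s hs => by
      rw [norm_smul]
      exact mul_le_mul_of_nonneg_right (hC i s hs) (norm_nonneg _))
    (MeasureTheory.ae_of_all _ fun s _ => hx.mul_left C) (by simp) (MeasureTheory.ae_of_all _ fun s _ => hg s)
  refine h1.congr_fun fun i => ?_
  exact (intervalIntegral.integral_smul_const _ _).symm

/-! ### Expansion over words -/

/-- The first-order bidifferential operator with constant coefficients `β`. -/
noncomputable def jetBracket (β : (V × (E →L[ℝ] V)) →L[ℝ] (V × (E →L[ℝ] V)) →L[ℝ] V)
    (X Y : E → V) (y : E) : V := β (X y, fderiv ℝ X y) (Y y, fderiv ℝ Y y)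

theorem nestedBracket_concat {M : Type*} [Zero M] (br : M → M → M) (X : ℤ → M) (l : List ℤ)
    (hl : l ≠ []) (j : ℤ) :
    nestedBracket br X (l ++ [j]) = br (nestedBracket br X l) (X j) := by
  rcases l with _ | ⟨i, l⟩
  · exact absurd rfl hl
  · simp [nestedBracket]

theorem ofFn_snoc (s : ℕ) (p : ℤ × (Fin s → ℤ)) :
    List.ofFn (Fin.snocEquiv (fun _ => ℤ) p) = List.ofFn p.2 ++ [p.1] := by
  rw [List.ofFn_succ', List.concat_eq_append]
  simp [Fin.snocEquiv]

theorem ofFn_ne_nil {s : ℕ} (w : Fin (s + 1) → ℤ) : List.ofFn w ≠ [] := by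
  simp

variable {W : Type} [NormedAddCommGroup W] [NormedSpace ℝ W] [FiniteDimensional ℝ W]
  (β : (V × (E →L[ℝ] V)) →L[ℝ] (V × (E →L[ℝ] V)) →L[ℝ] V)

omit [FiniteDimensional ℝ E] [FiniteDimensional ℝ V] [NormedSpace ℂ V] [IsScalarTower ℝ ℂ V]
  [SMulCommClass ℝ ℂ V] in
-- A word is split into its initial part and its last letter. The bracket is bilinear in the jets,
-- so summability passes to the product family.
theorem summableSmooth_nestedBracket {X : ℤ → E → V} (hX : SummableSmooth X) (s : ℕ) :
    SummableSmooth fun w : Fin (s + 1) → ℤ => nestedBracket (jetBracket β) X (List.ofFn w) := by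
  induction s with
  | zero => exact hX.comp_equiv (Equiv.funUnique (Fin 1) ℤ)
  | succ s ih =>
    have h1 := (ih.jet.bilinear hX.jet β).comp_equiv
      ((Fin.snocEquiv fun _ : Fin (s + 2) => ℤ).symm.trans (Equiv.prodComm _ _))
    convert h1 using 2 with w
    obtain ⟨p, rfl⟩ := (Fin.snocEquiv fun _ : Fin (s + 2) => ℤ).surjective w
    rw [ofFn_snoc, nestedBracket_concat _ _ _ (ofFn_ne_nil p.2)]
    simp
    rfl

/-- The iterated primitives as sums over words. -/
theorem hasSum_iteratedPrimitive (hβ : ∀ (c d : ℂ) x y, β (c • x) (d • y) = (c * d) • β x y)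
    {br : SmoothMap (ℝ × E) W → SmoothMap (ℝ × E) W → SmoothMap (ℝ × E) W} {ι : W →L[ℝ] V}
    (hbr : ∀ X Y τ y, ι ((br X Y).1 (τ, y)) =
      jetBracket β (fun z => ι (X.1 (τ, z))) (fun z => ι (Y.1 (τ, z))) y)
    {A : SmoothMap (ℝ × E) W} (hA : affine 1 (2 * Real.pi) A = A) (s : ℕ) (t : ℝ) (y : E) :
    HasSum (fun w : Fin (s + 1) → ℤ => iterOsc (List.ofFn w) (timePow 0) t •
      nestedBracket (jetBracket β) (vecCoef (postcomp ι A)) (List.ofFn w) y)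
      (ι ((iteratedPrimitive br A s).1 (t, y))) := by
  have : CompleteSpace V := FiniteDimensional.complete ℝ V
  have hA' : affine 1 (2 * Real.pi) (postcomp ι A) = postcomp ι A := by
    refine ext_apply fun p => ?_
    have h1 := congrArg (fun X : SmoothMap (ℝ × E) W => ι (X.1 p)) hA
    exact h1
  have hX := summableSmooth_vecCoef hA'
  have hN := summableSmooth_nestedBracket β hX
  have hW : ∀ (l : List ℤ) (t : ℝ), ‖iterOsc l (timePow 0) t‖ ≤ |t| ^ l.length := fun l t => by
    have := norm_iterOsc_le l (f := timePow 0) 0 (fun t => by simp [timePow]) t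
    rwa [zero_add] at this
  have hprim : ∀ (Z : SmoothMap (ℝ × E) W) (t : ℝ) (y : E),
      ι ((primitive Z).1 (t, y)) = ∫ s in (0 : ℝ)..t, ι (Z.1 (s, y)) := fun Z t y =>
    congrArg (fun X : SmoothMap (ℝ × E) V => X.1 (t, y)) (postcomp_primitive ι Z)
  have hexp : ∀ (j : ℤ) (l : List ℤ), Continuous fun s : ℝ =>
      Complex.exp (Complex.I * j * s) * iterOsc l (timePow 0) s := fun j l =>
    (continuous_osc j).mul (continuous_iterOsc l (continuous_timePow 0))
  have hexpb : ∀ (j : ℤ) (l : List ℤ) (t : ℝ), ∀ s ∈ Set.uIoc 0 t,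
      ‖Complex.exp (Complex.I * j * s) * iterOsc l (timePow 0) s‖ ≤ |t| ^ l.length := by
    intro j l t s hs
    rw [norm_mul, norm_exp_I_mul, one_mul]
    refine (hW l s).trans (pow_le_pow_left₀ (abs_nonneg s) ?_ _)
    simpa using Set.abs_sub_left_of_mem_uIcc (Set.uIoc_subset_uIcc hs)
  induction s generalizing t y with
  | zero =>
    rw [iteratedPrimitive, hprim]
    have h1 := HasSum.intervalIntegral_smul (t := t) (g := fun s => ι (A.1 (s, y)))
      (fun j => hexp j []) (fun j => hexpb j [] t) (hX.summable_norm y) (fun s => by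
        refine (hasSum_vecCoef hA' s y).congr_fun fun j => ?_
        rw [iterOsc_nil, timePow_zero, mul_one])
    rw [← (Equiv.funUnique (Fin 1) ℤ).symm.hasSum_iff]
    refine h1.congr_fun fun j => ?_
    have h2 : List.ofFn ((Equiv.funUnique (Fin 1) ℤ).symm j) = [j] := rfl
    rw [Function.comp_apply, h2]
    rfl
  | succ s ih =>
    rw [iteratedPrimitive, hprim, ← (Fin.snocEquiv fun _ : Fin (s + 2) => ℤ).hasSum_iff,
      ← (Equiv.prodComm _ _).hasSum_iff]
    -- At a fixed time, the bracket of the expansion over shorter words with the Fourier series of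
    -- `A` is expanded bilinearly; jets are needed because the bracket differentiates its arguments.
    have hpt : ∀ τ : ℝ, HasSum (fun p : (Fin (s + 1) → ℤ) × ℤ =>
        (Complex.exp (Complex.I * p.2 * τ) * iterOsc (List.ofFn p.1) (timePow 0) τ) •
          β (nestedBracket (jetBracket β) (vecCoef (postcomp ι A)) (List.ofFn p.1) y,
            fderiv ℝ (nestedBracket (jetBracket β) (vecCoef (postcomp ι A)) (List.ofFn p.1)) y)
            (vecCoef (postcomp ι A) p.2 y, fderiv ℝ (vecCoef (postcomp ι A) p.2) y))
        (ι ((br (iteratedPrimitive br A s) A).1 (τ, y))) := by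
      intro τ
      rw [hbr]
      have h1 : SummableSmooth fun (w : Fin (s + 1) → ℤ) y => iterOsc (List.ofFn w) (timePow 0) τ •
          nestedBracket (jetBracket β) (vecCoef (postcomp ι A)) (List.ofFn w) y :=
        (hN s).smul (C := |τ| ^ (s + 1)) fun w => by simpa using hW (List.ofFn w) τ
      have h2 : SummableSmooth fun (j : ℤ) y => Complex.exp (Complex.I * j * τ) •
          vecCoef (postcomp ι A) j y := hX.smul (C := 1) fun j => (norm_exp_I_mul j τ).le
      have h3 := (h1.hasSum_jet (ih τ) y).bilinear (h2.hasSum_jet (hasSum_vecCoef hA' τ) y)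
        (h1.jet.summable_norm y) (h2.jet.summable_norm y) β
      refine h3.congr_fun fun p => ?_
      have h4 : ∀ (c : ℂ) {F : E → V} (_ : ContDiff ℝ ∞ F),
          (c • F y, fderiv ℝ (fun z => c • F z) y) = c • (F y, fderiv ℝ F y) := fun c F hF => by
        have h5 : fderiv ℝ (fun z => c • F z) y = c • fderiv ℝ F y :=
          ((hF.differentiable (by simp) y).hasFDerivAt.const_smul c).fderiv
        rw [h5]; rfl
      rw [h4 _ ((hN s).contDiff p.1), h4 _ (hX.contDiff p.2), hβ, mul_comm]
    -- The scalar factors are bounded by `|t|^(s+1)` uniformly over all words of this length, so the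
    -- sum may be integrated termwise.
    have hint := HasSum.intervalIntegral_smul (t := t) (C := |t| ^ (s + 1))
      (φ := fun (p : (Fin (s + 1) → ℤ) × ℤ) τ =>
        Complex.exp (Complex.I * p.2 * τ) * iterOsc (List.ofFn p.1) (timePow 0) τ)
      (fun p => hexp p.2 _) (fun p => by simpa using hexpb p.2 (List.ofFn p.1) t)
      (((hN s).jet.bilinear hX.jet β).summable_norm y) hpt
    refine hint.congr_fun fun p => ?_
    have h5 : List.ofFn (Fin.snocEquiv (fun _ : Fin (s + 2) => ℤ) (Equiv.prodComm _ _ p)) =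
      List.ofFn p.1 ++ [p.2] := ofFn_snoc (s + 1) (p.2, p.1)
    simp only [Function.comp_apply]
    rw [h5, iterOsc_concat, nestedBracket_concat _ _ _ (ofFn_ne_nil p.1)]
    rfl

/-- The linear coefficients of the iterated primitives as sums over words. -/
theorem hasSum_secularCoef (hβ : ∀ (c d : ℂ) x y, β (c • x) (d • y) = (c * d) • β x y)
    {br : SmoothMap (ℝ × E) W → SmoothMap (ℝ × E) W → SmoothMap (ℝ × E) W} {ι : W →L[ℝ] V}
    (hbr : ∀ X Y τ y, ι ((br X Y).1 (τ, y)) =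
      jetBracket β (fun z => ι (X.1 (τ, z))) (fun z => ι (Y.1 (τ, z))) y)
    {A : SmoothMap (ℝ × E) W} (hA : affine 1 (2 * Real.pi) A = A) (s : ℕ) (p : ℝ × E) :
    HasSum (fun w : Fin (s + 1) → ℤ => (betaBar (List.ofFn w) / ((s + 1 : ℕ) : ℂ)) •
      nestedBracket (jetBracket β) (vecCoef (postcomp ι A)) (List.ofFn w) p.2)
      (ι ((secularCoef (s + 1) (iteratedPrimitive br A s)).1 p)) := by
  have hreal : ∀ (c : ℝ) (v : V), c • v = (c : ℂ) • v := fun c v =>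
    RCLike.real_smul_eq_coe_smul (K := ℂ) c v
  rw [secularCoef_val, map_smul, map_sum]
  simp only [map_smul, hreal]
  have h1 := (hasSum_sum (s := Finset.range (s + 1 + 1)) fun m _ =>
    (hasSum_iteratedPrimitive β hβ hbr hA s (2 * Real.pi * m) p.2).const_smul
      ((linearWeight (s + 1) m : ℝ) : ℂ)).const_smul (((2 * Real.pi * ((s + 1 : ℕ) : ℝ))⁻¹ : ℝ) : ℂ)
  refine h1.congr_fun fun w => ?_
  simp only [smul_smul]
  rw [← Finset.sum_smul, smul_smul, sum_linearWeight_iterOsc (s + 1) 0 _ (by simp), betaBar]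
  congr 1
  have hπ : (Real.pi : ℂ) ≠ 0 := Complex.ofReal_ne_zero.2 Real.pi_ne_zero
  have hs : (s : ℂ) + 1 ≠ 0 := by exact_mod_cast Nat.succ_ne_zero s
  push_cast
  field_simp

end FourierSeries

/-! ### Lie and Poisson brackets as bilinear operators on jets -/

section Brackets

open SmoothMap TimeField

/-- The coordinate brackets agree with the jet operators on smooth arguments only, so smoothness is
carried along as the predicate `P`. -/
theorem nestedBracket_congr {M : Type*} [Zero M] {P : M → Prop} {br br' : M → M → M}
    (h : ∀ X Y, P X → P Y → br X Y = br' X Y) (h' : ∀ X Y, P X → P Y → P (br' X Y)) {X : ℤ → M}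
    (hX : ∀ j, P (X j)) (l : List ℤ) : nestedBracket br X l = nestedBracket br' X l := by
  have key : ∀ (l : List ℤ) (A : M), P A →
      l.foldl (fun A j => br A (X j)) A = l.foldl (fun A j => br' A (X j)) A := by
    intro l
    induction l with
    | nil => intros; rfl
    | cons j l ih =>
      intro A hA
      rw [List.foldl_cons, List.foldl_cons, h A (X j) hA (hX j)]
      exact ih _ (h' A (X j) hA (hX j))
  rcases l with _ | ⟨i, l⟩
  · rfl
  · exact key l _ (hX i)

variable {n : ℕ}

theorem contDiff_jetBracket {V : Type} [NormedAddCommGroup V] [NormedSpace ℝ V]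
    (β : (V × (Phase n →L[ℝ] V)) →L[ℝ] (V × (Phase n →L[ℝ] V)) →L[ℝ] V) {X Y : Phase n → V}
    (hX : ContDiff ℝ ∞ X) (hY : ContDiff ℝ ∞ Y) : ContDiff ℝ ∞ (jetBracket β X Y) :=
  β.isBoundedBilinearMap.contDiff.comp ((hX.prodMk (hX.fderiv_right (by simp))).prodMk
    (hY.prodMk (hY.fderiv_right (by simp))))

/-! ### The Lie bracket of complex fields -/

/-- Complexification of vectors. -/
noncomputable def complexify (n : ℕ) : Phase n →L[ℝ] (Fin n → ℂ) :=
  ContinuousLinearMap.pi fun i => Complex.ofRealCLM ∘L EuclideanSpace.proj i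

theorem complexify_apply (x : Phase n) (i : Fin n) : complexify n x i = ((x i : ℝ) : ℂ) := rfl

/-- The Lie bracket as an operator on jets. -/
noncomputable def lieJet (n : ℕ) : ((Fin n → ℂ) × (Phase n →L[ℝ] (Fin n → ℂ))) →L[ℝ]
    ((Fin n → ℂ) × (Phase n →L[ℝ] (Fin n → ℂ))) →L[ℝ] (Fin n → ℂ) :=
  (LinearMap.mk₂ ℝ (fun (x y : (Fin n → ℂ) × (Phase n →L[ℝ] (Fin n → ℂ))) (i : Fin n) =>
    ∑ j, (y.2 (EuclideanSpace.single j 1) i * x.1 j - x.2 (EuclideanSpace.single j 1) i * y.1 j))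
    (fun x x' y => by
      funext i
      simp only [Prod.fst_add, Prod.snd_add, _root_.add_apply, Pi.add_apply,
        ← Finset.sum_add_distrib]
      exact Finset.sum_congr rfl fun j _ => by ring)
    (fun c x y => by
      funext i
      simp only [Prod.smul_fst, Prod.smul_snd, _root_.smul_apply, Pi.smul_apply, Finset.smul_sum,
        Complex.real_smul]
      exact Finset.sum_congr rfl fun j _ => by ring)
    (fun x y y' => by
      funext i
      simp only [Prod.fst_add, Prod.snd_add, _root_.add_apply, Pi.add_apply,
        ← Finset.sum_add_distrib]
      exact Finset.sum_congr rfl fun j _ => by ring)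
    (fun c x y => by
      funext i
      simp only [Prod.smul_fst, Prod.smul_snd, _root_.smul_apply, Pi.smul_apply, Finset.smul_sum,
        Complex.real_smul]
      exact Finset.sum_congr rfl fun j _ => by ring)).toContinuousBilinearMap

theorem lieJet_apply (x y : (Fin n → ℂ) × (Phase n →L[ℝ] (Fin n → ℂ))) (i : Fin n) :
    lieJet n x y i = ∑ j, (y.2 (EuclideanSpace.single j 1) i * x.1 j -
      x.2 (EuclideanSpace.single j 1) i * y.1 j) := rfl

theorem lieJet_smul (c d : ℂ) (x y : (Fin n → ℂ) × (Phase n →L[ℝ] (Fin n → ℂ))) :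
    lieJet n (c • x) (d • y) = (c * d) • lieJet n x y := by
  funext i
  simp only [lieJet_apply, Prod.smul_fst, Prod.smul_snd, _root_.smul_apply, Pi.smul_apply,
    smul_eq_mul, Finset.mul_sum]
  exact Finset.sum_congr rfl fun j _ => by ring

theorem partialDeriv_proj {X : Phase n → Fin n → ℂ} (hX : ContDiff ℝ ∞ X) (i j : Fin n)
    (y : Phase n) : partialDeriv j (fun z => X z i) y =
      fderiv ℝ X y (EuclideanSpace.single j 1) i := by
  have h1 : HasFDerivAt (fun z => X z i) _ y :=
    hasFDerivAt_pi'.1 (hX.differentiable (by simp) y).hasFDerivAt i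
  rw [partialDeriv, h1.fderiv]; rfl

theorem complexBracket_eq {X Y : Phase n → Fin n → ℂ} (hX : ContDiff ℝ ∞ X)
    (hY : ContDiff ℝ ∞ Y) : complexBracket X Y = jetBracket (lieJet n) X Y := by
  funext y i
  rw [complexBracket, jetBracket, lieJet_apply]
  simp only [partialDeriv_proj hX, partialDeriv_proj hY]

theorem complexify_lie (X Y : TimeField (Phase n)) (τ : ℝ) (y : Phase n) :
    complexify n ((⁅X, Y⁆ : TimeField (Phase n)).1 (τ, y)) = jetBracket (lieJet n)
      (fun z => complexify n (X.1 (τ, z))) (fun z => complexify n (Y.1 (τ, z))) y := by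
  have h1 : ∀ (Z : TimeField (Phase n)) (v : Phase n),
      fderiv ℝ (fun z => complexify n (Z.1 (τ, z))) y v =
        complexify n ((spaceDeriv v Z).1 (τ, y)) := fun Z v => by
    have h2 : HasFDerivAt (fun z => complexify n (Z.1 (τ, z))) _ y :=
      (complexify n).hasFDerivAt.comp y (hasFDerivAt_slice Z.contDiff τ y)
    rw [h2.fderiv]; rfl
  funext i
  rw [jetBracket, lieJet_apply, lie_def, sub_val, lieDeriv_eq_sum, lieDeriv_eq_sum,
    ← Finset.sum_sub_distrib, map_sum, Finset.sum_apply]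
  refine Finset.sum_congr rfl fun j _ => ?_
  simp only [h1, complexify_apply, PiLp.sub_apply, PiLp.smul_apply, smul_eq_mul]
  push_cast
  ring

theorem vecCoef_proj {V : Type} [NormedAddCommGroup V] [NormedSpace ℝ V] [FiniteDimensional ℝ V]
    [NormedSpace ℂ V] [IsScalarTower ℝ ℂ V] (a : SmoothMap (ℝ × Phase n) V) (ℓ : V →L[ℂ] ℂ)
    (k : ℤ) (y : Phase n) : ℓ (vecCoef a k y) = (1 / (2 * Real.pi) : ℂ) *
      ∫ τ in (0 : ℝ)..(2 * Real.pi), Complex.exp (-(Complex.I * k * τ)) * ℓ (a.1 (τ, y)) := by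
  have : CompleteSpace V := FiniteDimensional.complete ℝ V
  have hosc : Continuous fun s => (oscMul k a).1 (s, y) :=
    (oscMul k a).contDiff.continuous.comp (by fun_prop)
  have h5 := (ℓ.restrictScalars ℝ).intervalIntegral_comp_comm (μ := MeasureTheory.volume)
    (a := 0) (b := 2 * Real.pi) (f := fun s => (oscMul k a).1 (s, y))
    (hosc.intervalIntegrable _ _)
  have h6 : ℓ (vecCoef a k y) = (2 * Real.pi)⁻¹ •
      (ℓ.restrictScalars ℝ) ((primitive (oscMul k a)).1 (2 * Real.pi, y)) :=
    (ℓ.restrictScalars ℝ).map_smul _ _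
  rw [h6, primitive_val, ← h5, Complex.real_smul]
  congr 1
  · push_cast; rw [one_div]
  · refine intervalIntegral.integral_congr fun s _ => ?_
    exact ℓ.map_smul _ _

variable {G K : Phase n → Phase n} {Φ : ℝ → Phase n → Phase n}

theorem fieldCoef_eq (hΦ : IsGlobalFlow G Φ) (hG : ContDiff ℝ ∞ G) (hK : ContDiff ℝ ∞ K) :
    fieldCoef Φ K = vecCoef (postcomp (complexify n) (hΦ.flowField hG hK)) := by
  funext k y i
  have h1 := vecCoef_proj (postcomp (complexify n) (hΦ.flowField hG hK))
    (ContinuousLinearMap.proj i : (Fin n → ℂ) →L[ℂ] ℂ) k y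
  have h2 : ∀ τ : ℝ, (ContinuousLinearMap.proj i : (Fin n → ℂ) →L[ℂ] ℂ)
      ((postcomp (complexify n) (hΦ.flowField hG hK)).1 (τ, y)) =
        ((VectorField.pullback ℝ (Φ τ) K y i : ℝ) : ℂ) := fun τ => rfl
  simp only [h2] at h1
  exact h1.symm

/-- The expansion of the averaged field. -/
theorem hasSum_averagedField {hΦ : IsPeriodicFlow G Φ} {hG : ContDiff ℝ ∞ G}
    {hK : ContDiff ℝ ∞ K} {L B : Ser (TimeField (Phase n))}
    (h : (averaging (Phase n)).IsAveraged (hΦ.isGlobalFlow.flowField hG hK) L B) (m : ℕ)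
    (y : Phase n) : HasSum
      (fun w : Fin (m + 1) → ℤ => (betaBar (List.ofFn w) / ((m + 1 : ℕ) : ℂ)) •
        nestedBracket complexBracket (fieldCoef Φ K) (List.ofFn w) y)
      (fun i => ((averagedField B m y i : ℝ) : ℂ)) := by
  have h1 := hasSum_secularCoef (lieJet n) lieJet_smul complexify_lie
    (hΦ.isGlobalFlow.affine_flowField hG hK hΦ.periodic) m (0, y)
  rw [← averaged_eq_secularCoef h, ← fieldCoef_eq] at h1
  refine h1.congr_fun fun w => ?_
  rw [nestedBracket_congr (P := fun X : Phase n → Fin n → ℂ => ContDiff ℝ ∞ X)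
    (fun X Y => complexBracket_eq) (fun X Y => contDiff_jetBracket (lieJet n))
    (fun j => by rw [fieldCoef_eq hΦ.isGlobalFlow hG hK]; exact contDiff_vecCoef _ j)]

/-! ### The Poisson bracket -/

/-- The Poisson bracket as an operator on jets. -/
noncomputable def poissonJet (J : Matrix (Fin n) (Fin n) ℝ) : (ℂ × (Phase n →L[ℝ] ℂ)) →L[ℝ]
    (ℂ × (Phase n →L[ℝ] ℂ)) →L[ℝ] ℂ :=
  (LinearMap.mk₂ ℝ (fun (x y : ℂ × (Phase n →L[ℝ] ℂ)) =>
    -∑ i, ∑ j, x.2 (EuclideanSpace.single i 1) * ((J⁻¹ i j : ℝ) : ℂ) *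
      y.2 (EuclideanSpace.single j 1))
    (fun x x' y => by
      simp only [Prod.snd_add, _root_.add_apply, add_mul, Finset.sum_add_distrib]
      ring)
    (fun c x y => by
      simp only [Prod.smul_snd, _root_.smul_apply, Complex.real_smul, mul_assoc, ← Finset.mul_sum,
        mul_neg])
    (fun x y y' => by
      simp only [Prod.snd_add, _root_.add_apply, mul_add, Finset.sum_add_distrib]
      ring)
    (fun c x y => by
      simp only [Prod.smul_snd, _root_.smul_apply, Complex.real_smul, mul_left_comm _ (c : ℂ),
        ← Finset.mul_sum, mul_neg])).toContinuousBilinearMap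

variable (J : Matrix (Fin n) (Fin n) ℝ)

theorem poissonJet_apply (x y : ℂ × (Phase n →L[ℝ] ℂ)) : poissonJet J x y =
    -∑ i, ∑ j, x.2 (EuclideanSpace.single i 1) * ((J⁻¹ i j : ℝ) : ℂ) *
      y.2 (EuclideanSpace.single j 1) := rfl

theorem poissonJet_smul (c d : ℂ) (x y : ℂ × (Phase n →L[ℝ] ℂ)) :
    poissonJet J (c • x) (d • y) = (c * d) • poissonJet J x y := by
  simp only [poissonJet_apply, Prod.smul_snd, _root_.smul_apply, smul_eq_mul, mul_neg,
    Finset.mul_sum]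
  congr 1
  exact Finset.sum_congr rfl fun i _ => Finset.sum_congr rfl fun j _ => by ring

variable {J}

theorem ofReal_poisson (hJ : J.transpose = -J) (hJu : IsUnit J.det)
    (f g : SmoothMap (ℝ × Phase n) ℝ) (τ : ℝ) (y : Phase n) :
    Complex.ofRealCLM ((poisson J f g).1 (τ, y)) = jetBracket (poissonJet J)
      (fun z => Complex.ofRealCLM (f.1 (τ, z))) (fun z => Complex.ofRealCLM (g.1 (τ, z))) y := by
  have h1 : ∀ (f : SmoothMap (ℝ × Phase n) ℝ) (v : Phase n),
      fderiv ℝ (fun z => Complex.ofRealCLM (f.1 (τ, z))) y v =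
        (((spaceDeriv v f).1 (τ, y) : ℝ) : ℂ) := fun f v => by
    have h2 : HasFDerivAt (fun z => Complex.ofRealCLM (f.1 (τ, z))) _ y :=
      Complex.ofRealCLM.hasFDerivAt.comp y (hasFDerivAt_slice f.contDiff τ y)
    rw [h2.fderiv]; rfl
  rw [jetBracket, poissonJet_apply, poisson_val, Finset.sum_comm, ← Finset.sum_neg_distrib,
    map_sum]
  refine Finset.sum_congr rfl fun i _ => ?_
  rw [← Finset.sum_neg_distrib, map_sum]
  refine Finset.sum_congr rfl fun j _ => ?_
  simp only [h1]
  rw [inv_apply_swap hJ hJu j i, Complex.ofRealCLM_apply]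
  push_cast
  ring

theorem affine_flowFun {hΦ : IsPeriodicFlow G Φ} (hG : ContDiff ℝ ∞ G) {H : Phase n → ℝ}
    (hH : ContDiff ℝ ∞ H) : affine 1 (2 * Real.pi) (hΦ.isGlobalFlow.flowFun hG hH) =
      hΦ.isGlobalFlow.flowFun hG hH := by
  refine ext_apply fun p => ?_
  rw [affine_val, one_mul]
  exact congrArg H (hΦ.periodic p.1 p.2)

theorem hamiltonianCoef_eq (hΦ : IsGlobalFlow G Φ) (hG : ContDiff ℝ ∞ G) {H : Phase n → ℝ}
    (hH : ContDiff ℝ ∞ H) : hamiltonianCoef Φ H =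
      vecCoef (postcomp Complex.ofRealCLM (hΦ.flowFun hG hH)) := by
  funext k y
  have h1 := vecCoef_proj (postcomp Complex.ofRealCLM (hΦ.flowFun hG hH))
    (ContinuousLinearMap.id ℂ ℂ) k y
  exact h1.symm

/-- The expansion of the averaged Hamiltonian. -/
theorem hasSum_averagedHamiltonian {hΦ : IsPeriodicFlow G Φ} (hG : ContDiff ℝ ∞ G)
    (hJ : J.transpose = -J) (hJu : IsUnit J.det) {H : Phase n → ℝ} (hH : ContDiff ℝ ∞ H) (m : ℕ)
    (y : Phase n) : HasSum
      (fun w : Fin (m + 1) → ℤ => betaBar (List.ofFn w) / ((m + 1 : ℕ) : ℂ) *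
        nestedBracket (poissonBracket J) (hamiltonianCoef Φ H) (List.ofFn w) y)
      ((averagedHamiltonian J (hΦ.isGlobalFlow.flowFun hG hH) m y : ℝ) : ℂ) := by
  rw [hamiltonianCoef_eq hΦ.isGlobalFlow hG hH]
  exact hasSum_secularCoef (poissonJet J) (poissonJet_smul J) (ofReal_poisson hJ hJu)
    (affine_flowFun (hΦ := hΦ) hG hH) m (0, y)

end Brackets
-- The main theorem
theorem mainTheorem2 (n : ℕ) (G K : Phase n → Phase n) (hG : ContDiff ℝ ∞ G)
    (hK : ContDiff ℝ ∞ K) (Φ : ℝ → Phase n → Phase n) (hΦ : IsPeriodicFlow G Φ) :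
    -- the normal form splitting exists and is unique
    ∃ Gs Ks : ℕ → Phase n → Phase n, IsNormalFormSplitting G K Gs Ks ∧
      (∀ Gs' Ks' : ℕ → Phase n → Phase n, IsNormalFormSplitting G K Gs' Ks' →
        Gs' = Gs ∧ Ks' = Ks) ∧
      -- the two-scale system and the transport equation
      (HasGlobalFlow (Ks 0) → ∀ f₀ : Phase n → ℝ, ContDiff ℝ ∞ f₀ →
        (∀ ε : ℝ, 0 < ε → HasGlobalFlow (fun y => (1 / ε) • G y + K y) →
          ∃! f : ℝ → Phase n → ℝ, IsTransportSolution (fun y => (1 / ε) • G y + K y) f₀ f) ∧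
        ∃ ft : ℕ → ℝ → ℝ → Phase n → ℝ,
          IsTwoScaleSolution Gs Ks f₀ ft ∧
          (∀ ft', IsTwoScaleSolution Gs Ks f₀ ft' → ft' = ft) ∧
          (∀ r, ContDiff ℝ ∞ (fun p : ℝ × ℝ × Phase n => ft r p.1 p.2.1 p.2.2)) ∧
          (∀ r t τ y, ft r t (τ + 2 * Real.pi) y = ft r t τ y) ∧
          IsFormalDiagonalSolution G K f₀ ft ∧
          ∀ f : ℝ → ℝ → Phase n → ℝ,
            (∀ᶠ ε in 𝓝[>] (0 : ℝ),
              IsTransportSolution (fun y => (1 / ε) • G y + K y) f₀ (f ε)) →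
            ∀ (N : ℕ) (T : ℝ) (C : Set (Phase n)), IsCompact C →
              ∃ M : ℝ, ∀ᶠ ε in 𝓝[>] (0 : ℝ), ∀ t ∈ Set.Icc (-T) T, ∀ y ∈ C,
                |f ε t y - ∑ r ∈ Finset.range (N + 1), ε ^ r * ft r t (t / ε) y|
                  ≤ M * ε ^ (N + 1)) ∧
      -- the expansions
      (∀ m y, HasSum
        (fun w : Fin (m + 1) → ℤ => (betaBar (List.ofFn w) / ((m + 1 : ℕ) : ℂ)) •
          nestedBracket complexBracket (fieldCoef Φ K) (List.ofFn w) y)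
        (fun i => ((Ks m y i : ℝ) : ℂ))) ∧
      Gs = companionSeries G K Ks ∧
      -- the geometric properties
      (IsDivergenceFree G → IsDivergenceFree K →
        ∀ r, IsDivergenceFree (Gs r) ∧ IsDivergenceFree (Ks r)) ∧
      (∀ (J : Matrix (Fin n) (Fin n) ℝ), J.transpose = -J → IsUnit J.det →
        ∀ HG HK : Phase n → ℝ, ContDiff ℝ ∞ HG → ContDiff ℝ ∞ HK →
          G = hamiltonianField J HG → K = hamiltonianField J HK →
          ∃ Hs : ℕ → Phase n → ℝ, (∀ r, ContDiff ℝ ∞ (Hs r)) ∧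
            (∀ m y, HasSum
              (fun w : Fin (m + 1) → ℤ => betaBar (List.ofFn w) / ((m + 1 : ℕ) : ℂ) *
                nestedBracket (poissonBracket J) (hamiltonianCoef Φ HK) (List.ofFn w) y)
              ((Hs m y : ℝ) : ℂ)) ∧
            (∀ r, Ks r = hamiltonianField J (Hs r)) ∧
            ∀ r, Gs r = hamiltonianField J (companionSeries HG HK Hs r)) := by
  obtain ⟨L, B, h⟩ := (TimeField.averaging (Phase n)).exists_isAveraged
    (hΦ.isGlobalFlow.affine_flowField hG hK hΦ.periodic)
  have hs : IsNormalFormSplitting G K (companionField hG hK B) (averagedField B) :=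
    isNormalFormSplitting (hΦ := hΦ) h
  have hcomp := companionField_eq (hG := hG) (hK := hK) h.B_zero
  refine ⟨companionField hG hK B, averagedField B, hs, fun Gs' Ks' h' => hs.eq hΦ hG h',
    fun hflow f₀ hf₀ => ⟨fun ε _ hε => existsUnique_isTransportSolution
      (contDiff_field hG hK ε) hε hf₀, ?_⟩,
    fun m y => hasSum_averagedField (hΦ := hΦ) h m y, hcomp,
    fun hdG hdK r => isDivergenceFree_averagedField (hΦ := hΦ) h hdG hdK r,
    fun J hJ hJu HG HK hHG hHK hGJ hKJ => ?_⟩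
  · obtain ⟨ψ, hψ⟩ := exists_isGlobalFlow_of_hasGlobalFlow hflow
    obtain ⟨f, hf⟩ := exists_isSmoothTwoScale (hΦ := hΦ) h hψ hf₀
    -- The solution with initial value the identity serves only to confine the trajectories of `F^ε`
    -- in the error estimate.
    obtain ⟨g, hg⟩ := exists_isSmoothTwoScale (hΦ := hΦ) h hψ (contDiff_id (E := Phase n))
    have hG0 : IsGlobalFlow (companionField hG hK B 0) Φ := by
      rw [hs.split_neg]; exact hΦ.isGlobalFlow
    refine ⟨fun r t τ y => (f r).1 (t, τ, y), hf.isTwoScaleSolution, fun ft' h' =>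
      h'.eq hψ (hs.smooth_K 0) (hs.smooth_G 0) hG0 hf.isTwoScaleSolution,
      fun r => (f r).contDiff, hf.periodic, hf.isFormalDiagonalSolution hs,
      fun u hu N T C hC => exists_error_bound hs hΦ hG hK hψ hg hf hu N T hC⟩
  · set Hs := averagedHamiltonian J (hΦ.isGlobalFlow.flowFun hG hHK) with hHs
    have hsm : ∀ r, ContDiff ℝ ∞ (Hs r) := fun r => TimeField.contDiff_slice _ 0
    have hKs : ∀ r, averagedField B r = hamiltonianField J (Hs r) :=
      averagedField_eq_hamiltonianField (hΦ := hΦ) h hJ hJu hHG hHK hGJ hKJ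
    refine ⟨Hs, hsm, hasSum_averagedHamiltonian (hΦ := hΦ) hG hJ hJu hHK, hKs, fun r => ?_⟩
    rw [hcomp, funext hKs, ← companionSeries_hamiltonianField hHK hsm, ← hGJ, ← hKJ]
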